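/- **Types and objects.** Types are $T ::= \mathcal U \mid \mathsf{Unit} \mid T\times T \mid \mathsf{Set}(T)$. Over a set $\mathcal U$ of Ur-elements (arbitrary, possibly empty or infinite), $\mathsf{Unit}$ has one object and the objects of $\mathsf{Set}(T)$ are all (finite or infinite) sets of objects of type $T$. **$\Delta_0$ formulas.** Terms are $t ::= x \mid () \mid \langle t,t\rangle \mid \pi_1(t)\mid\pi_2(t)$, and $\Delta_0$ formulas are $\varphi ::= t=_{\mathcal U}t' \mid t\neq_{\mathcal U}t' \mid \top\mid\bot\mid\varphi\vee\varphi\mid\varphi\wedge\varphi\mid\forall x\in_T t\ \varphi\mid\exists x\in_T t\ \varphi$, all well typed, with the standard semantics. **NRC.** Expressions of the nested relational calculus NRC are built from typed variables, $()$, $\langle e_1,e_2\rangle$, $\pi_i(e)$, $\{e\}$, $\bigcup\{e_2\mid x\in e_1\}$, $\emptyset_T$, $e_1\cup e_2$ and $e_1\setminus e_2$. NRC[Get] has in addition $\mathsf{Get}_T(e)$, which returns the element of $e$ if $e$ is a singleton and otherwise a default object of type $T$ built from a fixed constant $c_0\in\mathcal U$ (with default $\emptyset$ at set types). **Calculus.**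 Sequents are $\Theta;\Gamma\vdash\psi$, with $\Theta$ a multiset of membership formulas $t\in_T u$, $\Gamma$ a multiset of $\Delta_0$ formulas, and $\psi$ of one of the forms $t\in_T u$, $t\subseteq_T u$, $t=_T u$. Below, $z,x_1,x_2$ and the $x$ of the rule for $\exists$ are variables that are not free in the conclusion, $\chi$ is any right-hand side of the form $t\in_T u$, and substitution avoids capture. The rules (premises $\Longrightarrow$ conclusion) are: - $\Theta;\Gamma,\varphi,\varphi\vdash\chi \Longrightarrow \Theta;\Gamma,\varphi\vdash\chi$; - $\Longrightarrow\Theta,t\in_{\mathcal U}u;\Gamma\vdash t\in_{\mathcal U}u$; - $\Theta;\Gamma\vdash t\subseteq_T u$ and $\Theta;\Gamma\vdash u\subseteq_T t \Longrightarrow \Theta;\Gamma\vdash t=_{\mathsf{Set}(T)}u$; - $\Theta;\Gamma\vdash\pi_i(t)=_{T_i}\pi_i(u)$ for $i=1,2$ $\Longrightarrow \Theta;\Gamma\vdash t=_{T_1\times T_2}u$; - $\Longrightarrow\Theta;\Gamma\vdash t=_{\mathsf{Unit}}u$; - $\Theta,t\in_{\mathcal U}z;\Gamma\vdash u\in_{\mathcal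 U}z \Longrightarrow \Theta;\Gamma\vdash t=_{\mathcal U}u$; - $\Theta,z\in_T t;\Gamma\vdash z\in_T u \Longrightarrow \Theta;\Gamma\vdash t\subseteq_T u$; - $\Theta,t\in_T v;\Gamma\vdash t=_T u \Longrightarrow \Theta,t\in_T v;\Gamma\vdash u\in_T v$; - $\Longrightarrow\Theta;\Gamma,\bot\vdash\chi$; $\quad\Longrightarrow\Theta;\Gamma,t\neq_{\mathcal U}t\vdash\chi$; - $\Theta;\Gamma,\varphi,\psi\vdash\chi \Longrightarrow \Theta;\Gamma,\varphi\wedge\psi\vdash\chi$; - $\Theta;\Gamma,\varphi\vdash\chi$ and $\Theta;\Gamma,\psi\vdash\chi \Longrightarrow \Theta;\Gamma,\varphi\vee\psi\vdash\chi$; - $\Theta,t\in_T u;\Gamma,\varphi[t/y]\vdash\chi \Longrightarrow \Theta,t\in_T u;\Gamma,\forall y\in_T u\,\varphi\vdash\chi$; - $\Theta,x\in_T u;\Gamma,\varphi\vdash\chi \Longrightarrow \Theta;\Gamma,\exists x\in_T u\,\varphi\vdash\chi$; - $\Theta[y/x];\Gamma[y/x]\vdash\chi[y/x] \Longrightarrow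 \Theta;\Gamma,x=_{\mathcal U}y\vdash\chi$ for variables $x,y$; - $\Theta[t_i/y];\Gamma[t_i/y]\vdash\chi[t_i/y] \Longrightarrow \Theta[s/y];\Gamma[s/y]\vdash\chi[s/y]$ with $s=\pi_i(\langle t_1,t_2\rangle)$, $i\in\{1,2\}$; - $\Theta[p/x];\Gamma[p/x]\vdash\chi[p/x] \Longrightarrow \Theta;\Gamma\vdash\chi$ with $p=\langle x_1,x_2\rangle$, for a variable $x$ of product type. An *intuitionistic proof that the $\Delta_0$ formula $\Sigma(o_{in},o_{out},\vec a)$ implicitly defines $o_{out}$ as a function of $o_{in}$* is a derivation of $\;\cdot\,;\ \Sigma(o_{in},o_{out},\vec a),\ \Sigma(o_{in},o_{out}',\vec a')\vdash o_{out}=_B o_{out}'$, where $B$ is the type of $o_{out}$ and $o_{out}',\vec a'$ are new variables. **Theorem.** There is a polynomial-time procedure which takes as input a $\Delta_0$ formula $\Sigma(o_{in},o_{out},\vec a)$, with $o_{in},o_{out},\vec a$ of arbitrary types, together with an intuitionistic proof that $\Sigma$ implicitly defines $o_{out}$ as a function of $o_{in}$ (written as the tree of its sequents), and returns an expression $E$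 with $o_{in}$ as its only free variable, whose output type is the type $B$ of $o_{out}$, such that over every set $\mathcal U$ of Ur-elements and for all objects $o_{in},o_{out},\vec a$ of the given types, $$\Sigma(o_{in},o_{out},\vec a)\ \text{ holds}\quad\Longrightarrow\quad E(o_{in})=o_{out}.$$ Here $E$ is an NRC expression if every occurrence of $\mathcal U$ in $B$ is inside a $\mathsf{Set}(\cdot)$. For the other types $B$, $E$ is an NRC[Get] expression and the conclusion holds for every choice of $c_0\in\mathcal U$. -/

import Mathlib

namespace NestedRel

universe u

/-! ### Types, objects -/

/-- Types of nested relations: Ur-elements, the unit type, products and set types. -/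
inductive Ty : Type
  | ur : Ty
  | unit : Ty
  | prod : Ty → Ty → Ty
  | set : Ty → Ty

/-- The objects of a type in the universe over the set `U` of Ur-elements
(sets may be infinite). -/
@[reducible]
def Ty.den (U : Type u) : Ty → Type u
  | .ur => U
  | .unit => PUnit
  | .prod S T => S.den U × T.den U
  | .set T => Set (T.den U)

/-- An object of type `Set(T)`, as a set. -/
abbrev Ty.asSet {U : Type u} {T : Ty} (s : (Ty.set T).den U) : Set (T.den U) := s

/-- The default object of each type, built from a constant `c₀ : U`. -/
def Ty.default {U : Type u} (c₀ : U) : (T : Ty) → T.den U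
  | .ur => c₀
  | .unit => PUnit.unit
  | .prod S T => (S.default c₀, T.default c₀)
  | .set T => (∅ : Set (T.den U))

/-- Does an Ur-element component of an object of this type occur outside every set former? -/
def Ty.bareUr : Ty → Bool
  | .ur => true
  | .unit => false
  | .prod S T => S.bareUr || T.bareUr
  | .set _ => false

/-! ### Typed variables. A context lists the types of the free variables. -/

/-- A context: the list of the types of the variables in scope. -/
abbrev Ctx := List Ty

/-- The variables of type `T` in a context (positions in the list that hold `T`). -/
inductive Var : Ctx → Ty → Type
  | zero {Γ : Ctx} {T : Ty} : Var (T :: Γ) T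
  | succ {Γ : Ctx} {S T : Ty} : Var Γ T → Var (S :: Γ) T

/-- The position of a variable. -/
def Var.idx {Γ : Ctx} {T : Ty} : Var Γ T → ℕ
  | .zero => 0
  | .succ x => x.idx + 1

/-- The inclusion of the variables of `Γ` in those of `Γ ++ Δ`. -/
def Var.inl {Γ Δ : Ctx} {T : Ty} : Var Γ T → Var (Γ ++ Δ) T
  | .zero => .zero
  | .succ x => .succ x.inl

/-- The inclusion of the variables of `Δ` in those of `Γ ++ Δ`. -/
def Var.inr {Δ : Ctx} {T : Ty} : (Γ : Ctx) → Var Δ T → Var (Γ ++ Δ) T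
  | [], x => x
  | _ :: Γ, x => .succ (Var.inr Γ x)

/-- A binding that assigns to every variable of the context an object of its type. -/
def Env (U : Type u) (Γ : Ctx) : Type u := ∀ T : Ty, Var Γ T → T.den U

/-- The binding of the empty context. -/
def Env.empty (U : Type u) : Env U [] := fun _ x => nomatch x

/-- Extend a binding by a value for the new first variable. -/
def Env.cons {U : Type u} {Γ : Ctx} {S : Ty} (a : S.den U) (ρ : Env U Γ) : Env U (S :: Γ)
  | _, .zero => a
  | _, .succ x => ρ _ x

/-! ### Terms and `Δ₀` formulas -/

/-- Terms: variables, the empty tuple, pairs and projections. -/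
inductive Tm (Γ : Ctx) : Ty → Type
  | var {T : Ty} : Var Γ T → Tm Γ T
  | unit : Tm Γ .unit
  | pair {S T : Ty} : Tm Γ S → Tm Γ T → Tm Γ (.prod S T)
  | fst {S T : Ty} : Tm Γ (.prod S T) → Tm Γ S
  | snd {S T : Ty} : Tm Γ (.prod S T) → Tm Γ T

/-- `Δ₀` formulas. The body of a bounded quantifier lives in the context with one more variable,
the bound one, in front. -/
inductive Fm : Ctx → Type
  | eq {Γ : Ctx} : Tm Γ .ur → Tm Γ .ur → Fm Γ
  | ne {Γ : Ctx} : Tm Γ .ur → Tm Γ .ur → Fm Γ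
  | top {Γ : Ctx} : Fm Γ
  | bot {Γ : Ctx} : Fm Γ
  | or {Γ : Ctx} : Fm Γ → Fm Γ → Fm Γ
  | and {Γ : Ctx} : Fm Γ → Fm Γ → Fm Γ
  | all {Γ : Ctx} {T : Ty} : Tm Γ (.set T) → Fm (T :: Γ) → Fm Γ
  | ex {Γ : Ctx} {T : Ty} : Tm Γ (.set T) → Fm (T :: Γ) → Fm Γ

/-- The value of a term. -/
def Tm.eval {U : Type u} {Γ : Ctx} (ρ : Env U Γ) : {T : Ty} → Tm Γ T → T.den U
  | _, .var x => ρ _ x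
  | _, .unit => PUnit.unit
  | _, .pair t s => (t.eval ρ, s.eval ρ)
  | _, .fst t => Prod.fst (t.eval ρ)
  | _, .snd t => Prod.snd (t.eval ρ)

/-- Truth of a `Δ₀` formula under a binding. -/
def Fm.holds {U : Type u} : {Γ : Ctx} → Env U Γ → Fm Γ → Prop
  | _, ρ, .eq t s => t.eval ρ = s.eval ρ
  | _, ρ, .ne t s => t.eval ρ ≠ s.eval ρ
  | _, _, .top => True
  | _, _, .bot => False
  | _, ρ, .or φ ψ => φ.holds ρ ∨ ψ.holds ρ
  | _, ρ, .and φ ψ => φ.holds ρ ∧ ψ.holds ρ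
  | _, ρ, .all (T := T) t φ => ∀ a : T.den U, a ∈ Ty.asSet (t.eval ρ) → φ.holds (ρ.cons a)
  | _, ρ, .ex (T := T) t φ => ∃ a : T.den U, a ∈ Ty.asSet (t.eval ρ) ∧ φ.holds (ρ.cons a)

/-! ### Renaming and substitution -/

/-- Renamings of variables. -/
abbrev Ren (Γ Δ : Ctx) := ∀ T : Ty, Var Γ T → Var Δ T

/-- Simultaneous substitutions of terms for variables. -/
abbrev Subs (Γ Δ : Ctx) := ∀ T : Ty, Var Γ T → Tm Δ T

/-- Push a renaming under a binder. -/
def Ren.lift {Γ Δ : Ctx} (r : Ren Γ Δ) (S : Ty) : Ren (S :: Γ) (S :: Δ)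
  | _, .zero => .zero
  | _, .succ x => .succ (r _ x)

/-- The renaming that adds an unused first variable. -/
def Ren.wk {Γ : Ctx} (S : Ty) : Ren Γ (S :: Γ) := fun _ x => .succ x

def Tm.ren {Γ Δ : Ctx} (r : Ren Γ Δ) : {T : Ty} → Tm Γ T → Tm Δ T
  | _, .var x => .var (r _ x)
  | _, .unit => .unit
  | _, .pair t s => .pair (t.ren r) (s.ren r)
  | _, .fst t => .fst (t.ren r)
  | _, .snd t => .snd (t.ren r)

def Fm.ren : {Γ Δ : Ctx} → Ren Γ Δ → Fm Γ → Fm Δ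
  | _, _, r, .eq t s => .eq (t.ren r) (s.ren r)
  | _, _, r, .ne t s => .ne (t.ren r) (s.ren r)
  | _, _, _, .top => .top
  | _, _, _, .bot => .bot
  | _, _, r, .or φ ψ => .or (φ.ren r) (ψ.ren r)
  | _, _, r, .and φ ψ => .and (φ.ren r) (ψ.ren r)
  | _, _, r, .all t φ => .all (t.ren r) (φ.ren (r.lift _))
  | _, _, r, .ex t φ => .ex (t.ren r) (φ.ren (r.lift _))

/-- Weakening of a term, a formula by an unused first variable. -/
abbrev Tm.wk {Γ : Ctx} {T : Ty} (S : Ty) (t : Tm Γ T) : Tm (S :: Γ) T := t.ren (Ren.wk S)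

abbrev Fm.wk {Γ : Ctx} (S : Ty) (φ : Fm Γ) : Fm (S :: Γ) := φ.ren (Ren.wk S)

/-- Push a substitution under a binder. -/
def Subs.lift {Γ Δ : Ctx} (σ : Subs Γ Δ) (S : Ty) : Subs (S :: Γ) (S :: Δ)
  | _, .zero => .var .zero
  | _, .succ x => (σ _ x).wk S

def Tm.sub {Γ Δ : Ctx} (σ : Subs Γ Δ) : {T : Ty} → Tm Γ T → Tm Δ T
  | _, .var x => σ _ x
  | _, .unit => .unit
  | _, .pair t s => .pair (t.sub σ) (s.sub σ)
  | _, .fst t => .fst (t.sub σ)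
  | _, .snd t => .snd (t.sub σ)

/-- Capture-avoiding substitution in formulas. -/
def Fm.sub : {Γ Δ : Ctx} → Subs Γ Δ → Fm Γ → Fm Δ
  | _, _, σ, .eq t s => .eq (t.sub σ) (s.sub σ)
  | _, _, σ, .ne t s => .ne (t.sub σ) (s.sub σ)
  | _, _, _, .top => .top
  | _, _, _, .bot => .bot
  | _, _, σ, .or φ ψ => .or (φ.sub σ) (ψ.sub σ)
  | _, _, σ, .and φ ψ => .and (φ.sub σ) (ψ.sub σ)
  | _, _, σ, .all t φ => .all (t.sub σ) (φ.sub (σ.lift _))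
  | _, _, σ, .ex t φ => .ex (t.sub σ) (φ.sub (σ.lift _))

/-- Replace the first variable by `t` and keep the others. -/
def Subs.inst {Γ : Ctx} {S : Ty} (t : Tm Γ S) : Subs (S :: Γ) Γ
  | _, .zero => t
  | _, .succ x => .var x

/-- Change the substitution `σ` at the variable `x` to the value `t`. -/
def Subs.upd {Γ Δ : Ctx} {S : Ty} : Var Γ S → Tm Δ S → Subs Γ Δ → Subs Γ Δ
  | .zero, t, _, _, .zero => t
  | .zero, _, σ, _, .succ y => σ _ (.succ y)
  | .succ _, _, σ, _, .zero => σ _ .zero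
  | .succ x, t, σ, _, .succ y => Subs.upd x t (fun _ z => σ _ (.succ z)) _ y

/-- The substitution `[y/x]` of the variable `y` for the variable `x`. -/
def Subs.replace {Γ : Ctx} {S : Ty} (x y : Var Γ S) : Subs Γ Γ :=
  Subs.upd x (.var y) (fun _ z => .var z)

/-- The substitution `[⟨x₁, x₂⟩/x]` with two new variables `x₁`, `x₂` (positions `0` and `1`). -/
def Subs.eta {Γ : Ctx} {S T : Ty} (x : Var Γ (.prod S T)) : Subs Γ (S :: T :: Γ) :=
  Subs.upd x (.pair (.var .zero) (.var (.succ .zero))) (fun _ z => .var (.succ (.succ z)))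

/-! ### The intuitionistic sequent calculus -/

/-- A membership formula `elt ∈_T set`. -/
structure Mem (Γ : Ctx) : Type where
  T : Ty
  elt : Tm Γ T
  set : Tm Γ (.set T)

def Mem.sub {Γ Δ : Ctx} (σ : Subs Γ Δ) (m : Mem Γ) : Mem Δ := ⟨m.T, m.elt.sub σ, m.set.sub σ⟩

def Mem.wk {Γ : Ctx} (S : Ty) (m : Mem Γ) : Mem (S :: Γ) := ⟨m.T, m.elt.wk S, m.set.wk S⟩

/-- Right-hand sides of sequents: `t ∈_T v`, `t ⊆_T v`, `t =_T v`. -/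
inductive Goal (Γ : Ctx) : Type
  | mem {T : Ty} : Tm Γ T → Tm Γ (.set T) → Goal Γ
  | sub {T : Ty} : Tm Γ (.set T) → Tm Γ (.set T) → Goal Γ
  | eq {T : Ty} : Tm Γ T → Tm Γ T → Goal Γ

/-- Derivations of sequents `Θ; Δ ⊢ G` whose free variables are among those of the context `Γ`.
The multisets `Θ` and `Δ` are written as lists, and each rule acts at an arbitrary position
of the lists. A variable that has to be fresh is a new variable of the context of the premise. -/
inductive Deriv : (Γ : Ctx) → List (Mem Γ) → List (Fm Γ) → Goal Γ → Type
  /-- Contraction. -/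
  | contr {Γ : Ctx} {Θ : List (Mem Γ)} (Δ₁ Δ₂ : List (Fm Γ)) (φ : Fm Γ)
      {T : Ty} {t : Tm Γ T} {v : Tm Γ (.set T)} :
      Deriv Γ Θ (Δ₁ ++ φ :: φ :: Δ₂) (.mem t v) →
      Deriv Γ Θ (Δ₁ ++ φ :: Δ₂) (.mem t v)
  /-- Axiom for membership of Ur-elements. -/
  | memUr {Γ : Ctx} (Θ₁ Θ₂ : List (Mem Γ)) {Δ : List (Fm Γ)}
      {t : Tm Γ .ur} {v : Tm Γ (.set .ur)} :
      Deriv Γ (Θ₁ ++ ⟨.ur, t, v⟩ :: Θ₂) Δ (.mem t v)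
  /-- Equality of sets on the right. -/
  | eqSet {Γ : Ctx} {Θ : List (Mem Γ)} {Δ : List (Fm Γ)} {T : Ty} {t v : Tm Γ (.set T)} :
      Deriv Γ Θ Δ (.sub t v) → Deriv Γ Θ Δ (.sub v t) → Deriv Γ Θ Δ (.eq t v)
  /-- Equality of pairs on the right. -/
  | eqProd {Γ : Ctx} {Θ : List (Mem Γ)} {Δ : List (Fm Γ)} {S T : Ty} {t v : Tm Γ (.prod S T)} :
      Deriv Γ Θ Δ (.eq (.fst t) (.fst v)) → Deriv Γ Θ Δ (.eq (.snd t) (.snd v)) →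
      Deriv Γ Θ Δ (.eq t v)
  /-- Equality at the unit type on the right. -/
  | eqUnit {Γ : Ctx} {Θ : List (Mem Γ)} {Δ : List (Fm Γ)} {t v : Tm Γ .unit} :
      Deriv Γ Θ Δ (.eq t v)
  /-- Equality of Ur-elements on the right, with a fresh set variable. -/
  | eqUr {Γ : Ctx} {Θ : List (Mem Γ)} {Δ : List (Fm Γ)} {t v : Tm Γ .ur} :
      Deriv (.set .ur :: Γ) (⟨.ur, t.wk _, .var .zero⟩ :: Θ.map (Mem.wk _)) (Δ.map (Fm.wk _))
        (.mem (v.wk _) (.var .zero)) →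
      Deriv Γ Θ Δ (.eq t v)
  /-- Inclusion on the right. -/
  | subR {Γ : Ctx} {Θ : List (Mem Γ)} {Δ : List (Fm Γ)} {T : Ty} {t v : Tm Γ (.set T)} :
      Deriv (T :: Γ) (⟨T, .var .zero, t.wk T⟩ :: Θ.map (Mem.wk T)) (Δ.map (Fm.wk T))
        (.mem (.var .zero) (v.wk T)) →
      Deriv Γ Θ Δ (.sub t v)
  /-- Membership on the right. -/
  | memR {Γ : Ctx} (Θ₁ Θ₂ : List (Mem Γ)) {Δ : List (Fm Γ)} {T : Ty}
      {t s : Tm Γ T} {v : Tm Γ (.set T)} :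
      Deriv Γ (Θ₁ ++ ⟨T, t, v⟩ :: Θ₂) Δ (.eq t s) →
      Deriv Γ (Θ₁ ++ ⟨T, t, v⟩ :: Θ₂) Δ (.mem s v)
  /-- Falsity on the left. -/
  | botL {Γ : Ctx} {Θ : List (Mem Γ)} (Δ₁ Δ₂ : List (Fm Γ))
      {T : Ty} {t : Tm Γ T} {v : Tm Γ (.set T)} :
      Deriv Γ Θ (Δ₁ ++ .bot :: Δ₂) (.mem t v)
  /-- Conjunction on the left. -/
  | andL {Γ : Ctx} {Θ : List (Mem Γ)} (Δ₁ Δ₂ : List (Fm Γ)) (φ ψ : Fm Γ)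
      {T : Ty} {t : Tm Γ T} {v : Tm Γ (.set T)} :
      Deriv Γ Θ (Δ₁ ++ φ :: ψ :: Δ₂) (.mem t v) →
      Deriv Γ Θ (Δ₁ ++ .and φ ψ :: Δ₂) (.mem t v)
  /-- Disjunction on the left. -/
  | orL {Γ : Ctx} {Θ : List (Mem Γ)} (Δ₁ Δ₂ : List (Fm Γ)) (φ ψ : Fm Γ)
      {T : Ty} {t : Tm Γ T} {v : Tm Γ (.set T)} :
      Deriv Γ Θ (Δ₁ ++ φ :: Δ₂) (.mem t v) →
      Deriv Γ Θ (Δ₁ ++ ψ :: Δ₂) (.mem t v) →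
      Deriv Γ Θ (Δ₁ ++ .or φ ψ :: Δ₂) (.mem t v)
  /-- Bounded universal quantification on the left. -/
  | allL {Γ : Ctx} (Θ₁ Θ₂ : List (Mem Γ)) (Δ₁ Δ₂ : List (Fm Γ)) {S : Ty} (s : Tm Γ S)
      (z : Tm Γ (.set S)) (φ : Fm (S :: Γ)) {T : Ty} {t : Tm Γ T} {v : Tm Γ (.set T)} :
      Deriv Γ (Θ₁ ++ ⟨S, s, z⟩ :: Θ₂) (Δ₁ ++ φ.sub (Subs.inst s) :: Δ₂) (.mem t v) →
      Deriv Γ (Θ₁ ++ ⟨S, s, z⟩ :: Θ₂) (Δ₁ ++ .all z φ :: Δ₂) (.mem t v)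
  /-- Bounded existential quantification on the left. -/
  | exL {Γ : Ctx} {Θ : List (Mem Γ)} (Δ₁ Δ₂ : List (Fm Γ)) {S : Ty}
      (z : Tm Γ (.set S)) (φ : Fm (S :: Γ)) {T : Ty} {t : Tm Γ T} {v : Tm Γ (.set T)} :
      Deriv (S :: Γ) (⟨S, .var .zero, z.wk S⟩ :: Θ.map (Mem.wk S))
        (Δ₁.map (Fm.wk S) ++ φ :: Δ₂.map (Fm.wk S)) (.mem (t.wk S) (v.wk S)) →
      Deriv Γ Θ (Δ₁ ++ .ex z φ :: Δ₂) (.mem t v)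
  /-- Substitution along an equality of variables. -/
  | eqSubst {Γ : Ctx} {Θ : List (Mem Γ)} (Δ₁ Δ₂ : List (Fm Γ)) (x y : Var Γ .ur)
      {T : Ty} {t : Tm Γ T} {v : Tm Γ (.set T)} :
      Deriv Γ (Θ.map (Mem.sub (Subs.replace x y)))
        (Δ₁.map (Fm.sub (Subs.replace x y)) ++ Δ₂.map (Fm.sub (Subs.replace x y)))
        (.mem (t.sub (Subs.replace x y)) (v.sub (Subs.replace x y))) →
      Deriv Γ Θ (Δ₁ ++ .eq (.var x) (.var y) :: Δ₂) (.mem t v)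
  /-- Inequality on the left. -/
  | neL {Γ : Ctx} {Θ : List (Mem Γ)} (Δ₁ Δ₂ : List (Fm Γ)) (s : Tm Γ .ur)
      {T : Ty} {t : Tm Γ T} {v : Tm Γ (.set T)} :
      Deriv Γ Θ (Δ₁ ++ .ne s s :: Δ₂) (.mem t v)
  /-- Conversion for the first projection of a pair. -/
  | betaFst {Γ : Ctx} {S₁ S₂ : Ty} (t₁ : Tm Γ S₁) (t₂ : Tm Γ S₂)
      (Θ : List (Mem (S₁ :: Γ))) (Δ : List (Fm (S₁ :: Γ)))
      {T : Ty} (t : Tm (S₁ :: Γ) T) (v : Tm (S₁ :: Γ) (.set T)) :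
      Deriv Γ (Θ.map (Mem.sub (Subs.inst t₁))) (Δ.map (Fm.sub (Subs.inst t₁)))
        (.mem (t.sub (Subs.inst t₁)) (v.sub (Subs.inst t₁))) →
      Deriv Γ (Θ.map (Mem.sub (Subs.inst (.fst (.pair t₁ t₂)))))
        (Δ.map (Fm.sub (Subs.inst (.fst (.pair t₁ t₂)))))
        (.mem (t.sub (Subs.inst (.fst (.pair t₁ t₂)))) (v.sub (Subs.inst (.fst (.pair t₁ t₂)))))
  /-- Conversion for the second projection of a pair. -/
  | betaSnd {Γ : Ctx} {S₁ S₂ : Ty} (t₁ : Tm Γ S₁) (t₂ : Tm Γ S₂)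
      (Θ : List (Mem (S₂ :: Γ))) (Δ : List (Fm (S₂ :: Γ)))
      {T : Ty} (t : Tm (S₂ :: Γ) T) (v : Tm (S₂ :: Γ) (.set T)) :
      Deriv Γ (Θ.map (Mem.sub (Subs.inst t₂))) (Δ.map (Fm.sub (Subs.inst t₂)))
        (.mem (t.sub (Subs.inst t₂)) (v.sub (Subs.inst t₂))) →
      Deriv Γ (Θ.map (Mem.sub (Subs.inst (.snd (.pair t₁ t₂)))))
        (Δ.map (Fm.sub (Subs.inst (.snd (.pair t₁ t₂)))))
        (.mem (t.sub (Subs.inst (.snd (.pair t₁ t₂)))) (v.sub (Subs.inst (.snd (.pair t₁ t₂)))))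
  /-- Expansion of a variable of product type into a pair of fresh variables. -/
  | eta {Γ : Ctx} {Θ : List (Mem Γ)} {Δ : List (Fm Γ)} {S₁ S₂ : Ty} (x : Var Γ (.prod S₁ S₂))
      {T : Ty} {t : Tm Γ T} {v : Tm Γ (.set T)} :
      Deriv (S₁ :: S₂ :: Γ) (Θ.map (Mem.sub (Subs.eta x))) (Δ.map (Fm.sub (Subs.eta x)))
        (.mem (t.sub (Subs.eta x)) (v.sub (Subs.eta x))) →
      Deriv Γ Θ Δ (.mem t v)

/-! ### Provably implicit definitions

`Sig` is a formula with free variables `o_in : A`, `o_out : B` and auxiliary parameters of the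
types `As`, in this order. The sequent that expresses functionality lives in the context
`o_in, o_out, a, o_out', a'`. -/

/-- `o_in, o_out, a` as variables of the doubled context. -/
def Ren.left (A : Ty) (Δ : Ctx) : Ren (A :: Δ) (A :: (Δ ++ Δ))
  | _, .zero => .zero
  | _, .succ x => .succ x.inl

/-- `o_in, o_out', a'` as variables of the doubled context. -/
def Ren.right (A : Ty) (Δ : Ctx) : Ren (A :: Δ) (A :: (Δ ++ Δ))
  | _, .zero => .zero
  | _, .succ x => .succ (Var.inr Δ x)

/-- Intuitionistic proofs that `Sig` implicitly defines `o_out` as a function of `o_in`: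
derivations of `Sig(o_in, o_out, a), Sig(o_in, o_out', a') ⊢ o_out =_B o_out'`. -/
def ImplicitDefProof {A B : Ty} {As : Ctx} (Sig : Fm (A :: B :: As)) : Type :=
  Deriv (A :: ((B :: As) ++ (B :: As))) []
    [Sig.ren (Ren.left A (B :: As)), Sig.ren (Ren.right A (B :: As))]
    (.eq (T := B) (.var (Ren.left A (B :: As) B (.succ .zero)))
      (.var (Ren.right A (B :: As) B (.succ .zero))))

/-! ### Nested relational calculus -/

/-- Expressions of the nested relational calculus. `Nrc false` is NRC; `Nrc true` is NRC
extended by the operations `Get_T : Set(T) → T`. -/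
inductive Nrc (g : Bool) : Ctx → Ty → Type
  | var {Γ : Ctx} {T : Ty} : Var Γ T → Nrc g Γ T
  | unit {Γ : Ctx} : Nrc g Γ .unit
  | pair {Γ : Ctx} {S T : Ty} : Nrc g Γ S → Nrc g Γ T → Nrc g Γ (.prod S T)
  | fst {Γ : Ctx} {S T : Ty} : Nrc g Γ (.prod S T) → Nrc g Γ S
  | snd {Γ : Ctx} {S T : Ty} : Nrc g Γ (.prod S T) → Nrc g Γ T
  | sing {Γ : Ctx} {T : Ty} : Nrc g Γ T → Nrc g Γ (.set T)
  /-- `bigUnion e₁ e₂` is `⋃ {e₂ | x ∈ e₁}`, with `x` the first variable of `e₂`. -/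
  | bigUnion {Γ : Ctx} {S T : Ty} : Nrc g Γ (.set S) → Nrc g (S :: Γ) (.set T) → Nrc g Γ (.set T)
  | emp {Γ : Ctx} (T : Ty) : Nrc g Γ (.set T)
  | union {Γ : Ctx} {T : Ty} : Nrc g Γ (.set T) → Nrc g Γ (.set T) → Nrc g Γ (.set T)
  | diff {Γ : Ctx} {T : Ty} : Nrc g Γ (.set T) → Nrc g Γ (.set T) → Nrc g Γ (.set T)
  | get {Γ : Ctx} {T : Ty} (h : g = true) : Nrc g Γ (.set T) → Nrc g Γ T

open Classical in
/-- The element of a singleton, and `d` for every other set. -/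
noncomputable def getOr {X : Type u} (s : Set X) (d : X) : X :=
  if h : ∃ x, s = {x} then h.choose else d

/-- The value of an expression. The constant `c₀` is only needed where `Get` is available. -/
noncomputable def Nrc.eval {U : Type u} {g : Bool} (c₀ : g = true → U) :
    {Γ : Ctx} → {T : Ty} → Env U Γ → Nrc g Γ T → T.den U
  | _, _, ρ, .var x => ρ _ x
  | _, _, _, .unit => PUnit.unit
  | _, _, ρ, .pair e₁ e₂ => (e₁.eval c₀ ρ, e₂.eval c₀ ρ)
  | _, _, ρ, .fst e => Prod.fst (e.eval c₀ ρ)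
  | _, _, ρ, .snd e => Prod.snd (e.eval c₀ ρ)
  | _, _, ρ, .sing (T := T) e => ({e.eval c₀ ρ} : Set (T.den U))
  | _, _, ρ, .bigUnion (S := S) (T := T) e₁ e₂ =>
      {b : T.den U | ∃ a : S.den U, a ∈ Ty.asSet (e₁.eval c₀ ρ) ∧
        b ∈ Ty.asSet (e₂.eval c₀ (ρ.cons a))}
  | _, _, _, .emp T => (∅ : Set (T.den U))
  | _, _, ρ, .union (T := T) e₁ e₂ =>
      {b : T.den U | b ∈ Ty.asSet (e₁.eval c₀ ρ) ∨ b ∈ Ty.asSet (e₂.eval c₀ ρ)}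
  | _, _, ρ, .diff (T := T) e₁ e₂ =>
      {b : T.den U | b ∈ Ty.asSet (e₁.eval c₀ ρ) ∧ b ∉ Ty.asSet (e₂.eval c₀ ρ)}
  | _, _, ρ, .get (T := T) h e => getOr (Ty.asSet (e.eval c₀ ρ)) (T.default (c₀ h))

/-! ### Data, programs and running time

Programs are finite systems of first-order recursive definitions over binary trees. Every step
costs one unit, and reading a variable costs in addition the size of the value, which is copied.
The total size of the data that a computation creates is therefore at most its cost, so that
polynomial cost here is polynomial time on Turing machines, and conversely. -/

/-- Data: binary trees. -/
inductive Data : Type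
  | nil : Data
  | cons : Data → Data → Data

/-- The number of nodes. -/
def Data.size : Data → ℕ
  | .nil => 1
  | .cons a b => a.size + b.size + 1

/-- Bodies of recursive definitions. Variables are positions in the list of current values. -/
inductive Code : Type
  | var (i : ℕ) : Code
  | nil : Code
  | cons (e₁ e₂ : Code) : Code
  /-- If `e` is `nil` then `e₁`, if it is `cons a b` then `e₂` with `a`, `b` as the new
  variables `0`, `1`. -/
  | case (e e₁ e₂ : Code) : Code
  /-- `e₂` with the value of `e₁` as the new variable `0`. -/
  | bind (e₁ e₂ : Code) : Code
  /-- Call of the function number `f`, whose body sees its argument as the variable `0`. -/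
  | call (f : ℕ) (e : Code) : Code

/-- A program: the bodies of its functions. -/
abbrev Program := List Code

/-- `Run P vs e a n`: in the program `P`, with the values `vs` of the variables,
the evaluation of `e` ends with the result `a` at the cost `n`. -/
inductive Run (P : Program) : List Data → Code → Data → ℕ → Prop
  | var {vs : List Data} {i : ℕ} {a : Data} (h : vs[i]? = some a) :
      Run P vs (.var i) a (a.size + 1)
  | nil {vs : List Data} : Run P vs .nil .nil 1
  | cons {vs : List Data} {e₁ e₂ : Code} {a b : Data} {m n : ℕ} :
      Run P vs e₁ a m → Run P vs e₂ b n → Run P vs (.cons e₁ e₂) (.cons a b) (m + n + 1)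
  | caseNil {vs : List Data} {e e₁ e₂ : Code} {c : Data} {m n : ℕ} :
      Run P vs e .nil m → Run P vs e₁ c n → Run P vs (.case e e₁ e₂) c (m + n + 1)
  | caseCons {vs : List Data} {e e₁ e₂ : Code} {a b c : Data} {m n : ℕ} :
      Run P vs e (.cons a b) m → Run P (a :: b :: vs) e₂ c n →
      Run P vs (.case e e₁ e₂) c (m + n + 1)
  | bind {vs : List Data} {e₁ e₂ : Code} {a c : Data} {m n : ℕ} :
      Run P vs e₁ a m → Run P (a :: vs) e₂ c n → Run P vs (.bind e₁ e₂) c (m + n + 1)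
  | call {vs : List Data} {f : ℕ} {e body : Code} {a c : Data} {m n : ℕ}
      (h : P[f]? = some body) :
      Run P vs e a m → Run P [a] body c n → Run P vs (.call f e) c (m + n + 1)

/-- On the input `a` the program (its function number `0`) returns `b` in at most `n` steps. -/
def Program.ReturnsWithin (P : Program) (a b : Data) (n : ℕ) : Prop :=
  ∃ m ≤ n, Run P [a] (.call 0 (.var 0)) b m

/-! ### Encodings as data -/

/-- Natural numbers in unary notation (used for tags and for positions in lists). -/
def Data.ofNat : ℕ → Data
  | 0 => .nil
  | n + 1 => .cons .nil (Data.ofNat n)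

def Data.ofList : List Data → Data
  | [] => .nil
  | a :: l => .cons a (Data.ofList l)

/-- A node of a syntax tree: a tag and the list of the arguments. -/
def Data.node (tag : ℕ) (args : List Data) : Data := .cons (Data.ofNat tag) (Data.ofList args)

def Ty.enc : Ty → Data
  | .ur => .node 0 []
  | .unit => .node 1 []
  | .prod S T => .node 2 [S.enc, T.enc]
  | .set T => .node 3 [T.enc]

def Ctx.enc (Γ : Ctx) : Data := .ofList (List.map Ty.enc Γ)

def Var.enc {Γ : Ctx} {T : Ty} (x : Var Γ T) : Data := .ofNat x.idx

def Tm.enc {Γ : Ctx} : {T : Ty} → Tm Γ T → Data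
  | _, .var x => .node 0 [x.enc]
  | _, .unit => .node 1 []
  | _, .pair t s => .node 2 [t.enc, s.enc]
  | _, .fst t => .node 3 [t.enc]
  | _, .snd t => .node 4 [t.enc]

def Fm.enc : {Γ : Ctx} → Fm Γ → Data
  | _, .eq t s => .node 0 [t.enc, s.enc]
  | _, .ne t s => .node 1 [t.enc, s.enc]
  | _, .top => .node 2 []
  | _, .bot => .node 3 []
  | _, .or φ ψ => .node 4 [φ.enc, ψ.enc]
  | _, .and φ ψ => .node 5 [φ.enc, ψ.enc]
  | _, .all (T := T) t φ => .node 6 [T.enc, t.enc, φ.enc]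
  | _, .ex (T := T) t φ => .node 7 [T.enc, t.enc, φ.enc]

def Mem.enc {Γ : Ctx} (m : Mem Γ) : Data := .ofList [m.T.enc, m.elt.enc, m.set.enc]

def Goal.enc {Γ : Ctx} : Goal Γ → Data
  | .mem (T := T) t v => .node 0 [T.enc, t.enc, v.enc]
  | .sub (T := T) t v => .node 1 [T.enc, t.enc, v.enc]
  | .eq (T := T) t v => .node 2 [T.enc, t.enc, v.enc]

/-- A sequent, together with the types of its variables. -/
def encSequent (Γ : Ctx) (Θ : List (Mem Γ)) (Δ : List (Fm Γ)) (G : Goal Γ) : Data :=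
  .ofList [Ctx.enc Γ, .ofList (Θ.map Mem.enc), .ofList (Δ.map Fm.enc), G.enc]

/-- The sequent that a derivation derives. -/
def Deriv.encConclusion {Γ : Ctx} {Θ : List (Mem Γ)} {Δ : List (Fm Γ)} {G : Goal Γ}
    (_ : Deriv Γ Θ Δ G) : Data :=
  encSequent Γ Θ Δ G

/-- The last rule of a derivation, with the positions of the principal formulas, and its
subderivations, each preceded by the sequent that it derives. -/
def Deriv.encRule : {Γ : Ctx} → {Θ : List (Mem Γ)} → {Δ : List (Fm Γ)} → {G : Goal Γ} →
    Deriv Γ Θ Δ G → Data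
  | _, _, _, _, .contr Δ₁ _ _ d =>
      .node 0 [.ofNat Δ₁.length, .cons d.encConclusion d.encRule]
  | _, _, _, _, .memUr Θ₁ _ => .node 1 [.ofNat Θ₁.length]
  | _, _, _, _, .eqSet d₁ d₂ =>
      .node 2 [.cons d₁.encConclusion d₁.encRule, .cons d₂.encConclusion d₂.encRule]
  | _, _, _, _, .eqProd d₁ d₂ =>
      .node 3 [.cons d₁.encConclusion d₁.encRule, .cons d₂.encConclusion d₂.encRule]
  | _, _, _, _, .eqUnit => .node 4 []
  | _, _, _, _, .eqUr d => .node 5 [.cons d.encConclusion d.encRule]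
  | _, _, _, _, .subR d => .node 6 [.cons d.encConclusion d.encRule]
  | _, _, _, _, .memR Θ₁ _ d => .node 7 [.ofNat Θ₁.length, .cons d.encConclusion d.encRule]
  | _, _, _, _, .botL Δ₁ _ => .node 8 [.ofNat Δ₁.length]
  | _, _, _, _, .andL Δ₁ _ _ _ d =>
      .node 9 [.ofNat Δ₁.length, .cons d.encConclusion d.encRule]
  | _, _, _, _, .orL Δ₁ _ _ _ d₁ d₂ =>
      .node 10 [.ofNat Δ₁.length, .cons d₁.encConclusion d₁.encRule,
        .cons d₂.encConclusion d₂.encRule]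
  | _, _, _, _, .allL Θ₁ _ Δ₁ _ _ _ _ d =>
      .node 11 [.ofNat Θ₁.length, .ofNat Δ₁.length, .cons d.encConclusion d.encRule]
  | _, _, _, _, .exL Δ₁ _ _ _ d =>
      .node 12 [.ofNat Δ₁.length, .cons d.encConclusion d.encRule]
  | _, _, _, _, .eqSubst Δ₁ _ _ _ d =>
      .node 13 [.ofNat Δ₁.length, .cons d.encConclusion d.encRule]
  | _, _, _, _, .neL Δ₁ _ _ => .node 14 [.ofNat Δ₁.length]
  | _, _, _, _, .betaFst _ _ _ _ _ _ d => .node 15 [.cons d.encConclusion d.encRule]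
  | _, _, _, _, .betaSnd _ _ _ _ _ _ d => .node 16 [.cons d.encConclusion d.encRule]
  | _, _, _, _, .eta x d => .node 17 [x.enc, .cons d.encConclusion d.encRule]

/-- A derivation is encoded as the tree of its sequents, labelled by the rules. -/
def Deriv.enc {Γ : Ctx} {Θ : List (Mem Γ)} {Δ : List (Fm Γ)} {G : Goal Γ}
    (d : Deriv Γ Θ Δ G) : Data :=
  .cons d.encConclusion d.encRule

/-- A problem instance: the types of `o_in`, `o_out`, `a`, the formula, the proof. -/
def ImplicitDefProof.enc {A B : Ty} {As : Ctx} {Sig : Fm (A :: B :: As)}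
    (d : ImplicitDefProof Sig) : Data :=
  .ofList [A.enc, B.enc, Ctx.enc As, Sig.enc, Deriv.enc d]

def Nrc.enc {g : Bool} : {Γ : Ctx} → {T : Ty} → Nrc g Γ T → Data
  | _, _, .var x => .node 0 [x.enc]
  | _, _, .unit => .node 1 []
  | _, _, .pair e₁ e₂ => .node 2 [e₁.enc, e₂.enc]
  | _, _, .fst e => .node 3 [e.enc]
  | _, _, .snd e => .node 4 [e.enc]
  | _, _, .sing e => .node 5 [e.enc]
  | _, _, .bigUnion e₁ e₂ => .node 6 [e₁.enc, e₂.enc]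
  | _, _, .emp T => .node 7 [T.enc]
  | _, _, .union e₁ e₂ => .node 8 [e₁.enc, e₂.enc]
  | _, _, .diff e₁ e₂ => .node 9 [e₁.enc, e₂.enc]
  | _, _, .get (T := T) _ e => .node 10 [T.enc, e.enc]

end NestedRel

open NestedRel

/-! The proof is a Craig interpolation argument. In the end sequent the first copy of `Sig` forms
the side `false` and the primed copy the side `true`; the only variable common to both is `o_in`.
Going up the derivation, every formula on the left keeps a side. A partial map records which
variables are common, each as a path of projections over the context `K` of the expression under
construction, which consists of `o_in` and the variables bound so far.

By induction on the derivation, four kinds of expressions are extracted together (`Spec`). If all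
terms on the right belong to the side `true`, an interpolant: a Boolean expression that follows from
the side `false` and, with the side `true`, yields the right-hand side. If the two terms of an
inclusion or of an equation of Ur-elements lie on different sides, a mixed interpolant, which
separates `z ∈ t` from `z ∈ v` (respectively `t ∈ z` from `v ∈ z`) for a common `z`. Further, a
superset: a set expression that contains the object the right-hand side is about. Finally, for an
equation `t = v` across the sides, an exact definition of `v`.

For sets, a derivation of `t = v` consists of derivations of `t ⊆ v` and `v ⊆ t`. The second yields
a superset of `v`, the first a mixed interpolant that accepts the elements of `t` and accepts only
elements of `v`. Filtering the superset by it gives exactly `v` (`defines_set`). Products are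
treated componentwise; at Ur type the filtered set is a singleton, and `Get` extracts its element
(`defines_ur`).

The delicate rules let the sides meet: a universal formula instantiated by a membership of the other
side, or a membership `s ∈ v` of the side `false` used to prove `t ∈ v` on the side `true`. The
bounding set then occurs on both sides, hence is expressible over common variables
(`Tm.isSome_of_ok`). The element is captured: a new bound variable ranges over that set, and its
components become the values of the variables of `s`. Interpolants quantify over the new variable
(`Interp.all_true`, `Interp.all_false`, `Interp.memR_false`), supersets take a union (`Covers.all`).
Capturing requires `s` to be a tuple of variables. The exceptions are the memberships `t ∈ z` that
the rule for equations of Ur-elements creates, and their fresh set variables `z` are marked: they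
never occur in a formula on the left. For right-hand memberships at Ur type, a mixed interpolant
with `z` replaced by the actual set avoids the capture (`Interp.memR_ur`).

The procedure is a concrete program, and each rule is shown to be semantically correct together with
a bound for its cost. Extraction visits each premise at most once; only a definition at Ur type
visits its premise twice. Every visit works on data of polynomial size, because the bound for the
paths grows by a constant per rule. The construction assumes that an Ur-element exists; the empty
case is reduced to it by an embedding that commutes with NRC. -/

namespace NestedRel

universe u

/-! ### Semantics of renaming and substitution -/

/-- Extend a function on variables by a value at the new first variable. -/
def vcons {C : Sort*} {Γ : Ctx} {S : Ty} (a : C) (f : ∀ T, Var Γ T → C) :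
    ∀ T, Var (S :: Γ) T → C
  | _, .zero => a
  | _, .succ x => f _ x

@[simp] theorem vcons_zero {C : Sort*} {Γ : Ctx} {S : Ty} (a : C) (f : ∀ T, Var Γ T → C) :
    vcons (S := S) a f S .zero = a := rfl

@[simp] theorem vcons_succ {C : Sort*} {Γ : Ctx} {S T : Ty} (a : C) (f : ∀ T, Var Γ T → C)
    (x : Var Γ T) : vcons (S := S) a f T (.succ x) = f T x := rfl

@[simp] theorem Env.cons_zero {U : Type u} {Γ : Ctx} {S : Ty} (a : S.den U) (ρ : Env U Γ) :
    ρ.cons a S .zero = a := rfl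

@[simp] theorem Env.cons_succ {U : Type u} {Γ : Ctx} {S T : Ty} (a : S.den U) (ρ : Env U Γ)
    (x : Var Γ T) : ρ.cons a T (.succ x) = ρ T x := rfl

/-- The binding that a substitution induces. -/
def Subs.env {U : Type u} {Γ Δ : Ctx} (σ : Subs Γ Δ) (ρ : Env U Δ) : Env U Γ :=
  fun T x => (σ T x).eval ρ

theorem Tm.eval_ren {U : Type u} {Γ Δ : Ctx} (r : Ren Γ Δ) (ρ : Env U Δ) {T : Ty} (t : Tm Γ T) :
    (t.ren r).eval ρ = t.eval (fun T x => ρ T (r T x)) := by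
  induction t <;> simp_all [Tm.ren, Tm.eval]

@[simp] theorem Tm.eval_wk {U : Type u} {Γ : Ctx} {S T : Ty} (a : S.den U) (ρ : Env U Γ)
    (t : Tm Γ T) : (t.ren (Ren.wk S)).eval (ρ.cons a) = t.eval ρ := by
  rw [Tm.eval_ren]; rfl

theorem Fm.holds_ren {U : Type u} {Γ Δ : Ctx} (r : Ren Γ Δ) (ρ : Env U Δ) (φ : Fm Γ) :
    (φ.ren r).holds ρ ↔ φ.holds (fun T x => ρ T (r T x)) := by
  have key : ∀ {Γ Δ : Ctx} (r : Ren Γ Δ) (ρ : Env U Δ) (S : Ty) (a : S.den U),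
      (fun T x => ρ.cons a T (r.lift S T x)) =
        Env.cons a (fun T x => ρ T (r T x) : Env U Γ) := by
    intro Γ Δ r ρ S a
    funext T x
    cases x <;> rfl
  induction φ generalizing Δ with
  | eq t s => simp [Fm.ren, Fm.holds, Tm.eval_ren]
  | ne t s => simp [Fm.ren, Fm.holds, Tm.eval_ren]
  | top => simp [Fm.ren, Fm.holds]
  | bot => simp [Fm.ren, Fm.holds]
  | or φ ψ h₁ h₂ => simp [Fm.ren, Fm.holds, h₁, h₂]
  | and φ ψ h₁ h₂ => simp [Fm.ren, Fm.holds, h₁, h₂]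
  | all t φ ih => simp [Fm.ren, Fm.holds, Tm.eval_ren, ih, key]
  | ex t φ ih => simp [Fm.ren, Fm.holds, Tm.eval_ren, ih, key]

@[simp] theorem Fm.holds_wk {U : Type u} {Γ : Ctx} {S : Ty} (a : S.den U) (ρ : Env U Γ)
    (φ : Fm Γ) : (φ.ren (Ren.wk S)).holds (ρ.cons a) ↔ φ.holds ρ := by
  rw [Fm.holds_ren]; rfl

theorem Tm.eval_sub {U : Type u} {Γ Δ : Ctx} (σ : Subs Γ Δ) (ρ : Env U Δ) {T : Ty} (t : Tm Γ T) :
    (t.sub σ).eval ρ = t.eval (σ.env ρ) := by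
  induction t <;> simp_all [Tm.sub, Tm.eval, Subs.env]

theorem Subs.env_lift {U : Type u} {Γ Δ : Ctx} (σ : Subs Γ Δ) (ρ : Env U Δ) {S : Ty}
    (a : S.den U) : (σ.lift S).env (ρ.cons a) = (σ.env ρ).cons a := by
  funext T x
  cases x with
  | zero => rfl
  | succ x => simp [Subs.env, Subs.lift]

theorem Fm.holds_sub {U : Type u} {Γ Δ : Ctx} (σ : Subs Γ Δ) (ρ : Env U Δ) (φ : Fm Γ) :
    (φ.sub σ).holds ρ ↔ φ.holds (σ.env ρ) := by
  induction φ generalizing Δ with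
  | eq t s => simp [Fm.sub, Fm.holds, Tm.eval_sub]
  | ne t s => simp [Fm.sub, Fm.holds, Tm.eval_sub]
  | top => simp [Fm.sub, Fm.holds]
  | bot => simp [Fm.sub, Fm.holds]
  | or φ ψ h₁ h₂ => simp [Fm.sub, Fm.holds, h₁, h₂]
  | and φ ψ h₁ h₂ => simp [Fm.sub, Fm.holds, h₁, h₂]
  | all t φ ih => simp [Fm.sub, Fm.holds, Tm.eval_sub, ih, Subs.env_lift]
  | ex t φ ih => simp [Fm.sub, Fm.holds, Tm.eval_sub, ih, Subs.env_lift]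

@[simp] theorem Subs.env_inst {U : Type u} {Γ : Ctx} {S : Ty} (t : Tm Γ S) (ρ : Env U Γ) :
    (Subs.inst t).env ρ = ρ.cons (t.eval ρ) := by
  funext T x
  cases x <;> rfl

/-- Case analysis on whether a variable is the updated one. -/
theorem Subs.upd_elim {Γ Δ : Ctx} {S : Ty} (x : Var Γ S) (t : Tm Δ S) (σ : Subs Γ Δ)
    (motive : ∀ T, Var Γ T → Tm Δ T → Prop) (hx : motive S x t)
    (hne : ∀ T (z : Var Γ T), (⟨T, z⟩ : Σ T, Var Γ T) ≠ ⟨S, x⟩ → motive T z (σ T z)) :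
    ∀ T (z : Var Γ T), motive T z (Subs.upd x t σ T z) := by
  induction x with
  | zero =>
    intro T z
    cases z with
    | zero => exact hx
    | succ z => exact hne _ _ (by rintro h; cases h)
  | succ x ih =>
    intro T z
    cases z with
    | zero => exact hne _ _ (by rintro h; cases h)
    | succ z =>
      refine ih t (fun _ z => σ _ (.succ z)) (fun T z s => motive T (.succ z) s) hx ?_ T z
      intro T z hz
      refine hne _ _ ?_
      intro h
      cases h
      exact hz rfl

/-- Only the value at `x` could change, and it equals the value of `y`. So substitution along a true
equation is invisible to every evaluation. -/
theorem Subs.env_replace {U : Type u} {Γ : Ctx} {S : Ty} (x y : Var Γ S) (ρ : Env U Γ)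
    (h : ρ S x = ρ S y) : (Subs.replace x y).env ρ = ρ := by
  funext T z
  exact Subs.upd_elim x (.var y) (fun _ z => .var z) (fun T z t => t.eval ρ = ρ T z) h.symm
    (fun _ _ _ => rfl) T z

theorem Subs.env_eta {U : Type u} {Γ : Ctx} {S T : Ty} (x : Var Γ (.prod S T)) (ρ : Env U Γ) :
    (Subs.eta x).env ((ρ.cons (ρ _ x).2).cons (ρ _ x).1) = ρ := by
  funext T z
  exact Subs.upd_elim x _ (fun _ z => .var (.succ (.succ z)))
    (fun T z t => t.eval ((ρ.cons (ρ _ x).2).cons (ρ _ x).1) = ρ T z) rfl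
    (fun _ _ _ => rfl) T z

/-! ### Free variables -/

/-- All variables of a term satisfy `P`. -/
def Tm.All {Γ : Ctx} (P : ∀ T, Var Γ T → Prop) : {T : Ty} → Tm Γ T → Prop
  | _, .var x => P _ x
  | _, .unit => True
  | _, .pair t s => t.All P ∧ s.All P
  | _, .fst t => t.All P
  | _, .snd t => t.All P

/-- All free variables of a formula satisfy `P`. -/
def Fm.All : {Γ : Ctx} → (∀ T, Var Γ T → Prop) → Fm Γ → Prop
  | _, P, .eq t s => t.All P ∧ s.All P
  | _, P, .ne t s => t.All P ∧ s.All P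
  | _, _, .top => True
  | _, _, .bot => True
  | _, P, .or φ ψ => φ.All P ∧ ψ.All P
  | _, P, .and φ ψ => φ.All P ∧ ψ.All P
  | _, P, .all t φ => t.All P ∧ φ.All (vcons True P)
  | _, P, .ex t φ => t.All P ∧ φ.All (vcons True P)

theorem Tm.All.mono {Γ : Ctx} {P Q : ∀ T, Var Γ T → Prop} (h : ∀ T x, P T x → Q T x) {T : Ty}
    {t : Tm Γ T} (ht : t.All P) : t.All Q := by
  induction t with
  | var x => exact h _ _ ht
  | unit => trivial
  | pair t s h₁ h₂ => exact ⟨h₁ ht.1, h₂ ht.2⟩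
  | fst t ih => exact ih ht
  | snd t ih => exact ih ht

theorem vcons_true_mono {Γ : Ctx} {S : Ty} {P Q : ∀ T, Var Γ T → Prop}
    (h : ∀ T x, P T x → Q T x) (T : Ty) (x : Var (S :: Γ) T) :
    vcons True P T x → vcons True Q T x := by
  cases x with
  | zero => simp
  | succ x => exact h _ x

theorem Fm.All.mono {Γ : Ctx} {P Q : ∀ T, Var Γ T → Prop} (h : ∀ T x, P T x → Q T x)
    {φ : Fm Γ} (hφ : φ.All P) : φ.All Q := by
  induction φ with
  | eq t s => exact ⟨hφ.1.mono h, hφ.2.mono h⟩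
  | ne t s => exact ⟨hφ.1.mono h, hφ.2.mono h⟩
  | top => trivial
  | bot => trivial
  | or φ ψ h₁ h₂ => exact ⟨h₁ h hφ.1, h₂ h hφ.2⟩
  | and φ ψ h₁ h₂ => exact ⟨h₁ h hφ.1, h₂ h hφ.2⟩
  | all t φ ih => exact ⟨hφ.1.mono h, ih (vcons_true_mono h) hφ.2⟩
  | ex t φ ih => exact ⟨hφ.1.mono h, ih (vcons_true_mono h) hφ.2⟩

theorem Tm.All.and {Γ : Ctx} {P Q : ∀ T, Var Γ T → Prop} {T : Ty} {t : Tm Γ T}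
    (hP : t.All P) (hQ : t.All Q) : t.All (fun T x => P T x ∧ Q T x) := by
  induction t with
  | var x => exact ⟨hP, hQ⟩
  | unit => trivial
  | pair t s h₁ h₂ => exact ⟨h₁ hP.1 hQ.1, h₂ hP.2 hQ.2⟩
  | fst t ih => exact ih hP hQ
  | snd t ih => exact ih hP hQ

theorem Tm.all_ren {Γ Δ : Ctx} (r : Ren Γ Δ) (P : ∀ T, Var Δ T → Prop) {T : Ty} (t : Tm Γ T) :
    (t.ren r).All P ↔ t.All (fun T x => P T (r T x)) := by
  induction t <;> simp_all [Tm.ren, Tm.All]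

theorem Tm.all_sub {Γ Δ : Ctx} (σ : Subs Γ Δ) (P : ∀ T, Var Δ T → Prop) {T : Ty} (t : Tm Γ T) :
    (t.sub σ).All P ↔ t.All (fun T x => (σ T x).All P) := by
  induction t <;> simp_all [Tm.sub, Tm.All]

theorem Fm.all_ren {Γ Δ : Ctx} (r : Ren Γ Δ) (P : ∀ T, Var Δ T → Prop) (φ : Fm Γ) :
    (φ.ren r).All P ↔ φ.All (fun T x => P T (r T x)) := by
  have key : ∀ {Γ Δ : Ctx} (r : Ren Γ Δ) (P : ∀ T, Var Δ T → Prop) (S : Ty),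
      (fun T x => vcons True P T (r.lift S T x)) = vcons True (fun T x => P T (r T x)) := by
    intro Γ Δ r P S
    funext T x
    cases x <;> rfl
  induction φ generalizing Δ with
  | eq t s => simp [Fm.ren, Fm.All, Tm.all_ren]
  | ne t s => simp [Fm.ren, Fm.All, Tm.all_ren]
  | top => simp [Fm.ren, Fm.All]
  | bot => simp [Fm.ren, Fm.All]
  | or φ ψ h₁ h₂ => simp [Fm.ren, Fm.All, h₁, h₂]
  | and φ ψ h₁ h₂ => simp [Fm.ren, Fm.All, h₁, h₂]
  | all t φ ih => simp [Fm.ren, Fm.All, Tm.all_ren, ih, key]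
  | ex t φ ih => simp [Fm.ren, Fm.All, Tm.all_ren, ih, key]

theorem Fm.all_sub {Γ Δ : Ctx} (σ : Subs Γ Δ) (P : ∀ T, Var Δ T → Prop) (φ : Fm Γ) :
    (φ.sub σ).All P ↔ φ.All (fun T x => (σ T x).All P) := by
  have key : ∀ {Γ Δ : Ctx} (σ : Subs Γ Δ) (P : ∀ T, Var Δ T → Prop) (S : Ty),
      (fun T x => (σ.lift S T x).All (vcons True P)) =
        vcons True (fun T x => (σ T x).All P) := by
    intro Γ Δ σ P S
    funext T x
    cases x with
    | zero => rfl
    | succ x => simp only [Subs.lift, Tm.wk, Tm.all_ren]; rfl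
  induction φ generalizing Δ with
  | eq t s => simp [Fm.sub, Fm.All, Tm.all_sub]
  | ne t s => simp [Fm.sub, Fm.All, Tm.all_sub]
  | top => simp [Fm.sub, Fm.All]
  | bot => simp [Fm.sub, Fm.All]
  | or φ ψ h₁ h₂ => simp [Fm.sub, Fm.All, h₁, h₂]
  | and φ ψ h₁ h₂ => simp [Fm.sub, Fm.All, h₁, h₂]
  | all t φ ih => simp [Fm.sub, Fm.All, Tm.all_sub, ih, key]
  | ex t φ ih => simp [Fm.sub, Fm.All, Tm.all_sub, ih, key]

theorem Tm.All.trivial {Γ : Ctx} {P : ∀ T, Var Γ T → Prop} (h : ∀ T x, P T x) {T : Ty}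
    (t : Tm Γ T) : t.All P := by
  induction t <;> simp_all [Tm.All]

theorem Fm.All.trivial {Γ : Ctx} {P : ∀ T, Var Γ T → Prop} (h : ∀ T x, P T x) (φ : Fm Γ) :
    φ.All P := by
  have h' : ∀ (S : Ty) T (x : Var (S :: Γ) T), vcons True P T x := by
    intro S T x
    cases x <;> simp [h]
  induction φ with
  | eq t s => exact ⟨.trivial h _, .trivial h _⟩
  | ne t s => exact ⟨.trivial h _, .trivial h _⟩
  | top => exact True.intro
  | bot => exact True.intro
  | or φ ψ h₁ h₂ => exact ⟨h₁ h h', h₂ h h'⟩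
  | and φ ψ h₁ h₂ => exact ⟨h₁ h h', h₂ h h'⟩
  | @all _ T t φ ih =>
    refine ⟨.trivial h _, ih (h' T) fun S T x => ?_⟩
    rcases x with _ | x
    · exact True.intro
    · exact h' _ _ x
  | @ex _ T t φ ih =>
    refine ⟨.trivial h _, ih (h' T) fun S T x => ?_⟩
    rcases x with _ | x
    · exact True.intro
    · exact h' _ _ x

theorem Tm.eval_congr {U : Type u} {Γ : Ctx} {ρ ρ' : Env U Γ} {T : Ty} {t : Tm Γ T}
    (h : t.All (fun T x => ρ T x = ρ' T x)) : t.eval ρ = t.eval ρ' := by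
  induction t with
  | var x => exact h
  | unit => rfl
  | pair t s h₁ h₂ => simp [Tm.eval, h₁ h.1, h₂ h.2]
  | fst t ih => simp [Tm.eval, ih h]
  | snd t ih => simp [Tm.eval, ih h]

/-- Interpolation rests on this coincidence property: a formula of one side does not notice when
variables that belong only to the other side receive new values. -/
theorem Fm.holds_congr {U : Type u} {Γ : Ctx} {ρ ρ' : Env U Γ} {φ : Fm Γ}
    (h : φ.All (fun T x => ρ T x = ρ' T x)) : φ.holds ρ ↔ φ.holds ρ' := by
  have key : ∀ {Γ : Ctx} (ρ ρ' : Env U Γ) (S : Ty) (a : S.den U) T (x : Var (S :: Γ) T),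
      vcons True (fun T x => ρ T x = ρ' T x) T x → ρ.cons a T x = ρ'.cons a T x := by
    intro Γ ρ ρ' S a T x hx
    cases x with
    | zero => rfl
    | succ x => exact hx
  induction φ with
  | eq t s => simp [Fm.holds, Tm.eval_congr h.1, Tm.eval_congr h.2]
  | ne t s => simp [Fm.holds, Tm.eval_congr h.1, Tm.eval_congr h.2]
  | top => simp [Fm.holds]
  | bot => simp [Fm.holds]
  | or φ ψ h₁ h₂ => simp [Fm.holds, h₁ h.1, h₂ h.2]
  | and φ ψ h₁ h₂ => simp [Fm.holds, h₁ h.1, h₂ h.2]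
  | all t φ ih =>
    simp only [Fm.holds, Tm.eval_congr h.1]
    exact forall_congr' fun a => imp_congr_right fun _ => ih (h.2.mono (key ρ ρ' _ a))
  | ex t φ ih =>
    simp only [Fm.holds, Tm.eval_congr h.1]
    exact exists_congr fun a => and_congr_right fun _ => ih (h.2.mono (key ρ ρ' _ a))

/-! ### Soundness of the calculus -/

/-- Truth of a membership formula. -/
def Mem.holds {U : Type u} {Γ : Ctx} (ρ : Env U Γ) (A : Mem Γ) : Prop :=
  A.elt.eval ρ ∈ Ty.asSet (A.set.eval ρ)

/-- Truth of a right-hand side. -/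
def Goal.holds {U : Type u} {Γ : Ctx} (ρ : Env U Γ) : Goal Γ → Prop
  | .mem t v => t.eval ρ ∈ Ty.asSet (v.eval ρ)
  | .sub t v => Ty.asSet (t.eval ρ) ⊆ Ty.asSet (v.eval ρ)
  | .eq t v => t.eval ρ = v.eval ρ

@[simp] theorem Mem.holds_wk {U : Type u} {Γ : Ctx} {S : Ty} (a : S.den U) (ρ : Env U Γ)
    (A : Mem Γ) : (A.wk S).holds (ρ.cons a) ↔ A.holds ρ := by
  simp only [Mem.holds, Mem.wk, Tm.eval_wk]
  rfl

theorem Mem.holds_sub {U : Type u} {Γ Δ : Ctx} (σ : Subs Γ Δ) (ρ : Env U Δ) (A : Mem Γ) :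
    (A.sub σ).holds ρ ↔ A.holds (σ.env ρ) := by
  simp only [Mem.holds, Mem.sub, Tm.eval_sub]
  rfl

/-- Truth of the sequent is needed besides the interpolants. It lets the set of a right-hand
membership serve as a superset (`covers_of_right`), and it makes the two terms of an equation
interchangeable when one of them is defined (`defines_set`, `defines_ur`). -/
theorem Deriv.sound {U : Type u} {Γ : Ctx} {Θ : List (Mem Γ)} {Δ : List (Fm Γ)} {G : Goal Γ}
    (d : Deriv Γ Θ Δ G) (ρ : Env U Γ) (hΘ : ∀ A ∈ Θ, A.holds ρ) (hΔ : ∀ φ ∈ Δ, φ.holds ρ) :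
    G.holds ρ := by
  induction d with
  | contr Δ₁ Δ₂ φ d ih => exact ih ρ hΘ (by simpa using hΔ)
  | memUr Θ₁ Θ₂ => exact hΘ ⟨.ur, _, _⟩ (by simp)
  | eqSet d₁ d₂ h₁ h₂ => exact Set.Subset.antisymm (h₁ ρ hΘ hΔ) (h₂ ρ hΘ hΔ)
  | eqProd d₁ d₂ h₁ h₂ => exact Prod.ext (h₁ ρ hΘ hΔ) (h₂ ρ hΘ hΔ)
  | eqUnit => rfl
  | @eqUr Γ Θ Δ t v d ih =>
    -- The fresh set variable is interpreted by the singleton of the value of `t`; membership of `v`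
    -- in it is the equation.
    have := ih (ρ.cons (S := .set .ur) ({t.eval ρ} : Set U))
      (by
        simp only [List.mem_cons, List.mem_map, forall_eq_or_imp, forall_exists_index, and_imp,
          forall_apply_eq_imp_iff₂, Mem.holds_wk]
        exact ⟨by simp [Mem.holds, Tm.eval], hΘ⟩) (by simpa using hΔ)
    simp only [Goal.holds, Tm.eval, Tm.eval_wk, Env.cons_zero] at this
    exact (Set.mem_singleton_iff.1 this).symm
  | subR d ih =>
    intro a ha
    have := ih (ρ.cons a) (by
      simp only [List.mem_cons, List.mem_map, forall_eq_or_imp, forall_exists_index, and_imp,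
        forall_apply_eq_imp_iff₂, Mem.holds_wk]
      exact ⟨by simpa [Mem.holds, Tm.eval] using ha, hΘ⟩) (by simpa using hΔ)
    simpa [Goal.holds, Tm.eval] using this
  | @memR Γ Θ₁ Θ₂ Δ T t s v d ih =>
    have h := hΘ ⟨T, t, v⟩ (by simp)
    have h' : t.eval ρ = s.eval ρ := ih ρ hΘ hΔ
    simpa [Goal.holds, Mem.holds, h'] using h
  | botL Δ₁ Δ₂ => exact (hΔ .bot (by simp)).elim
  | andL Δ₁ Δ₂ φ ψ d ih =>
    refine ih ρ hΘ ?_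
    have h := hΔ (.and φ ψ) (by simp)
    simp only [List.mem_append, List.mem_cons] at hΔ ⊢
    rintro χ (h' | rfl | rfl | h')
    · exact hΔ _ (.inl h')
    · exact h.1
    · exact h.2
    · exact hΔ _ (.inr (.inr h'))
  | orL Δ₁ Δ₂ φ ψ d₁ d₂ h₁ h₂ =>
    have h := hΔ (.or φ ψ) (by simp)
    simp only [List.mem_append, List.mem_cons] at hΔ h₁ h₂
    rcases h with h | h
    · refine h₁ ρ hΘ ?_
      rintro χ (h' | rfl | h')
      · exact hΔ _ (.inl h')
      · exact h
      · exact hΔ _ (.inr (.inr h'))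
    · refine h₂ ρ hΘ ?_
      rintro χ (h' | rfl | h')
      · exact hΔ _ (.inl h')
      · exact h
      · exact hΔ _ (.inr (.inr h'))
  | @allL Γ Θ₁ Θ₂ Δ₁ Δ₂ S s z φ T t v d ih =>
    have h := hΔ (.all z φ) (by simp)
    have h' := hΘ ⟨S, s, z⟩ (by simp)
    refine ih ρ hΘ ?_
    simp only [List.mem_append, List.mem_cons] at hΔ ⊢
    rintro χ (h'' | rfl | h'')
    · exact hΔ _ (.inl h'')
    · rw [Fm.holds_sub, Subs.env_inst]
      exact h _ h'
    · exact hΔ _ (.inr (.inr h''))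
  | exL Δ₁ Δ₂ z φ d ih =>
    obtain ⟨a, ha, h⟩ := hΔ (.ex z φ) (by simp)
    have := ih (ρ.cons a) (by
      simp only [List.mem_cons, List.mem_map, forall_eq_or_imp, forall_exists_index, and_imp,
        forall_apply_eq_imp_iff₂, Mem.holds_wk]
      exact ⟨by simpa [Mem.holds, Tm.eval] using ha, hΘ⟩) (by
      simp only [List.mem_append, List.mem_cons, List.mem_map] at hΔ ⊢
      rintro χ (⟨χ', h', rfl⟩ | rfl | ⟨χ', h', rfl⟩)
      · exact (Fm.holds_wk _ _ _).2 (hΔ _ (.inl h'))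
      · exact h
      · exact (Fm.holds_wk _ _ _).2 (hΔ _ (.inr (.inr h'))))
    simpa [Goal.holds] using this
  | eqSubst Δ₁ Δ₂ x y d ih =>
    have h : ρ _ x = ρ _ y := hΔ (.eq (.var x) (.var y)) (by simp)
    have := ih ρ (by simpa [Mem.holds_sub, Subs.env_replace _ _ _ h] using hΘ) (by
      simp only [List.mem_append, List.mem_cons, List.mem_map] at hΔ ⊢
      rintro χ (⟨χ', h', rfl⟩ | ⟨χ', h', rfl⟩) <;>
        rw [Fm.holds_sub, Subs.env_replace _ _ _ h]
      · exact hΔ _ (.inl h')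
      · exact hΔ _ (.inr (.inr h')))
    simpa [Goal.holds, Tm.eval_sub, Subs.env_replace _ _ _ h] using this
  | neL Δ₁ Δ₂ s => exact (hΔ (.ne s s) (by simp) rfl).elim
  | betaFst t₁ t₂ Θ Δ t v d ih =>
    have := ih ρ (by simpa [Mem.holds_sub, Tm.eval] using hΘ)
      (by simpa [Fm.holds_sub, Tm.eval] using hΔ)
    simpa [Goal.holds, Tm.eval_sub, Tm.eval] using this
  | betaSnd t₁ t₂ Θ Δ t v d ih =>
    have := ih ρ (by simpa [Mem.holds_sub, Tm.eval] using hΘ)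
      (by simpa [Fm.holds_sub, Tm.eval] using hΔ)
    simpa [Goal.holds, Tm.eval_sub, Tm.eval] using this
  | eta x d ih =>
    have := ih ((ρ.cons (ρ _ x).2).cons (ρ _ x).1)
      (by simpa [Mem.holds_sub, Subs.env_eta] using hΘ)
      (by simpa [Fm.holds_sub, Subs.env_eta] using hΔ)
    simpa [Goal.holds, Tm.eval_sub, Subs.env_eta] using this

/-! ### Partial maps from variables to paths -/

/-- Iterated projections of a variable. -/
inductive Path (K : Ctx) : Ty → Type
  | var {T : Ty} : Var K T → Path K T
  | fst {S T : Ty} : Path K (.prod S T) → Path K S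
  | snd {S T : Ty} : Path K (.prod S T) → Path K T

/-- A path, as a term. -/
def Path.tm {K : Ctx} : {T : Ty} → Path K T → Tm K T
  | _, .var x => .var x
  | _, .fst e => .fst e.tm
  | _, .snd e => .snd e.tm

/-- Weakening of a path. -/
def Path.wk {K : Ctx} (S : Ty) : {T : Ty} → Path K T → Path (S :: K) T
  | _, .var x => .var (.succ x)
  | _, .fst e => .fst (e.wk S)
  | _, .snd e => .snd (e.wk S)

@[simp] theorem Path.eval_wk {U : Type u} {K : Ctx} {S T : Ty} (e : Path K T) (κ : Env U K)
    (a : S.den U) : (e.wk S).tm.eval (κ.cons a) = e.tm.eval κ := by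
  induction e <;> simp_all [Path.wk, Path.tm, Tm.eval]

/-- A partial map from the variables of a context to paths over `K`. -/
inductive PMap (K : Ctx) : Ctx → Type
  | nil : PMap K []
  | cons {Γ : Ctx} {T : Ty} : Option (Path K T) → PMap K Γ → PMap K (T :: Γ)

def PMap.get {K : Ctx} : {Γ : Ctx} → PMap K Γ → {T : Ty} → Var Γ T → Option (Path K T)
  | _, .cons o _, _, .zero => o
  | _, .cons _ m, _, .succ x => m.get x

def PMap.set {K : Ctx} : {Γ : Ctx} → PMap K Γ → {T : Ty} → Var Γ T → Path K T → PMap K Γ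
  | _, .cons _ m, _, .zero, e => .cons (some e) m
  | _, .cons o m, _, .succ x, e => .cons o (m.set x e)

/-- Weakening of all paths. -/
def PMap.wk {K : Ctx} (S : Ty) : {Γ : Ctx} → PMap K Γ → PMap (S :: K) Γ
  | _, .nil => .nil
  | _, .cons o m => .cons (o.map (Path.wk S)) (m.wk S)

@[simp] theorem PMap.get_cons_zero {K Γ : Ctx} {T : Ty} (o : Option (Path K T)) (m : PMap K Γ) :
    (m.cons o).get .zero = o := rfl

@[simp] theorem PMap.get_cons_succ {K Γ : Ctx} {S T : Ty} (o : Option (Path K S)) (m : PMap K Γ)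
    (x : Var Γ T) : (m.cons o).get (.succ x) = m.get x := rfl

@[simp] theorem PMap.get_wk {K : Ctx} (S : Ty) {Γ : Ctx} (m : PMap K Γ) {T : Ty} (x : Var Γ T) :
    (m.wk S).get x = (m.get x).map (Path.wk S) := by
  induction x with
  | zero => cases m; rfl
  | succ x ih => cases m; exact ih _

theorem PMap.get_set_self {K Γ : Ctx} (m : PMap K Γ) {T : Ty} (x : Var Γ T) (e : Path K T) :
    (m.set x e).get x = some e := by
  induction x with
  | zero => cases m; rfl
  | succ x ih => cases m; exact ih _ _

theorem PMap.get_set_ne {K Γ : Ctx} (m : PMap K Γ) {T S : Ty} (x : Var Γ T) (y : Var Γ S)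
    (e : Path K T) (h : (⟨S, y⟩ : Σ T, Var Γ T) ≠ ⟨T, x⟩) : (m.set x e).get y = m.get y := by
  induction x with
  | zero =>
    cases m
    cases y with
    | zero => exact absurd rfl h
    | succ y => rfl
  | succ x ih =>
    cases m
    cases y with
    | zero => rfl
    | succ y =>
      refine ih _ y e fun h' => h ?_
      cases h'
      rfl

/-- Case analysis on whether a variable is the one that was set. -/
theorem PMap.set_elim {K Γ : Ctx} (m : PMap K Γ) {T : Ty} (x : Var Γ T) (e : Path K T)
    (motive : ∀ S, Var Γ S → Option (Path K S) → Prop) (hx : motive T x (some e))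
    (hne : ∀ S (y : Var Γ S), (⟨S, y⟩ : Σ T, Var Γ T) ≠ ⟨T, x⟩ → motive S y (m.get y))
    {S : Ty} (y : Var Γ S) : motive S y ((m.set x e).get y) := by
  by_cases h : (⟨S, y⟩ : Σ T, Var Γ T) = ⟨T, x⟩
  · cases h
    rw [PMap.get_set_self]
    exact hx
  · rw [PMap.get_set_ne _ _ _ _ h]
    exact hne _ _ h

/-- A binding of `Γ` and a binding of `K` agree along a partial map. -/
def Agree {U : Type u} {K Γ : Ctx} (m : PMap K Γ) (κ : Env U K) (ρ : Env U Γ) : Prop :=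
  ∀ T (x : Var Γ T) e, m.get x = some e → e.tm.eval κ = ρ T x

theorem Agree.wk {U : Type u} {K Γ : Ctx} {m : PMap K Γ} {κ : Env U K} {ρ : Env U Γ}
    (h : Agree m κ ρ) {S : Ty} (a : S.den U) : Agree (m.wk S) (κ.cons a) ρ := by
  intro T x e he
  simp only [PMap.get_wk, Option.map_eq_some_iff] at he
  obtain ⟨e', he', rfl⟩ := he
  simpa using h T x e' he'

theorem Agree.cons_none {U : Type u} {K Γ : Ctx} {m : PMap K Γ} {κ : Env U K} {ρ : Env U Γ}
    (h : Agree m κ ρ) {S : Ty} (a : S.den U) : Agree (m.cons none) κ (ρ.cons a) := by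
  intro T x e he
  cases x with
  | zero => simp at he
  | succ x => exact h _ x e he

/-- Override a binding by the values that a partial map prescribes. -/
def Env.override {U : Type u} {K Γ : Ctx} (ρ : Env U Γ) (m : PMap K Γ) (κ : Env U K) : Env U Γ :=
  fun T x => ((m.get x).map fun e => e.tm.eval κ).getD (ρ T x)

/-- Variables without a prescribed value keep their old one. This is how a model of one side is
adapted to new values of common variables. -/
theorem agree_override {U : Type u} {K Γ : Ctx} (m : PMap K Γ) (κ : Env U K) (ρ : Env U Γ) :
    Agree m κ (ρ.override m κ) := by
  intro T x e he
  simp [Env.override, he]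

/-- Translate a term along a partial map. -/
def Tm.tr {K Γ : Ctx} (m : PMap K Γ) : {T : Ty} → Tm Γ T → Option (Tm K T)
  | _, .var x => (m.get x).map Path.tm
  | _, .unit => some .unit
  | _, .pair t s => (t.tr m).bind fun t' => (s.tr m).map fun s' => .pair t' s'
  | _, .fst t => (t.tr m).map .fst
  | _, .snd t => (t.tr m).map .snd

theorem Tm.exists_tr {K Γ : Ctx} {m : PMap K Γ} {T : Ty} {t : Tm Γ T}
    (h : t.All fun _ x => (m.get x).isSome) : ∃ e, t.tr m = some e := by
  induction t with
  | var x =>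
    obtain ⟨e, he⟩ := Option.isSome_iff_exists.1 h
    exact ⟨e.tm, by simp [Tm.tr, he]⟩
  | unit => exact ⟨.unit, rfl⟩
  | pair t s h₁ h₂ =>
    obtain ⟨e₁, he₁⟩ := h₁ h.1
    obtain ⟨e₂, he₂⟩ := h₂ h.2
    exact ⟨.pair e₁ e₂, by simp [Tm.tr, he₁, he₂]⟩
  | fst t ih =>
    obtain ⟨e, he⟩ := ih h
    exact ⟨.fst e, by simp [Tm.tr, he]⟩
  | snd t ih =>
    obtain ⟨e, he⟩ := ih h
    exact ⟨.snd e, by simp [Tm.tr, he]⟩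

theorem Tm.eval_tr {U : Type u} {K Γ : Ctx} {m : PMap K Γ} {κ : Env U K} {ρ : Env U Γ}
    (hm : Agree m κ ρ) {T : Ty} {t : Tm Γ T} {e : Tm K T} (h : t.tr m = some e) :
    e.eval κ = t.eval ρ := by
  induction t with
  | var x =>
    simp only [Tm.tr, Option.map_eq_some_iff] at h
    obtain ⟨e', he', rfl⟩ := h
    exact hm _ x e' he'
  | unit => cases h; rfl
  | pair t s h₁ h₂ =>
    simp only [Tm.tr, Option.bind_eq_some_iff, Option.map_eq_some_iff] at h
    obtain ⟨t', ht, s', hs, rfl⟩ := h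
    simp [Tm.eval, h₁ ht, h₂ hs]
  | fst t ih =>
    simp only [Tm.tr, Option.map_eq_some_iff] at h
    obtain ⟨t', ht, rfl⟩ := h
    simp [Tm.eval, ih ht]
  | snd t ih =>
    simp only [Tm.tr, Option.map_eq_some_iff] at h
    obtain ⟨t', ht, rfl⟩ := h
    simp [Tm.eval, ih ht]

/-! ### Tuples of variables -/

/-- The term is built from variables by pairing. -/
def Tm.IsTree {Γ : Ctx} : {T : Ty} → Tm Γ T → Prop
  | _, .var _ => True
  | _, .unit => False
  | _, .pair t s => t.IsTree ∧ s.IsTree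
  | _, .fst _ => False
  | _, .snd _ => False

/-- Map the variables of the tuple `t` that have no value yet to the components of `e`. -/
def PMap.bindTree {K Γ : Ctx} (m : PMap K Γ) : {T : Ty} → Tm Γ T → Path K T → PMap K Γ
  | _, .var x, e => if (m.get x).isSome then m else m.set x e
  | _, .pair t s, e => (m.bindTree t e.fst).bindTree s e.snd
  | _, .unit, _ => m
  | _, .fst _, _ => m
  | _, .snd _, _ => m

/-- Values are never overwritten, not even for a variable that occurs twice in the tuple. The price
is that the tuple need not evaluate to the captured object, so interpolants have to test this
equation. -/
theorem PMap.get_bindTree_of_isSome {K Γ : Ctx} (m : PMap K Γ) {S T : Ty} (t : Tm Γ S)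
    (e : Path K S) (x : Var Γ T) (h : (m.get x).isSome) : (m.bindTree t e).get x = m.get x := by
  induction t generalizing m with
  | var y =>
    simp only [PMap.bindTree]
    split
    · rfl
    · rename_i hy
      refine PMap.get_set_ne _ _ _ _ ?_
      intro h'
      cases h'
      exact hy h
  | pair t s h₁ h₂ =>
    have := h₁ m e.fst h
    rw [PMap.bindTree, h₂ _ _ (by rw [this]; exact h), this]
  | unit => rfl
  | fst _ => rfl
  | snd _ => rfl

theorem PMap.isSome_bindTree {K Γ : Ctx} (m : PMap K Γ) {S T : Ty} (t : Tm Γ S)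
    (e : Path K S) (x : Var Γ T) (h : (m.get x).isSome) : ((m.bindTree t e).get x).isSome := by
  rwa [PMap.get_bindTree_of_isSome _ _ _ _ h]

theorem PMap.all_bindTree {K Γ : Ctx} (m : PMap K Γ) {S : Ty} (t : Tm Γ S) (e : Path K S)
    (h : t.IsTree) : t.All fun _ x => ((m.bindTree t e).get x).isSome := by
  induction t generalizing m with
  | var y =>
    simp only [PMap.bindTree, Tm.All]
    split
    · assumption
    · simp [PMap.get_set_self]
  | pair t s h₁ h₂ =>
    exact ⟨(h₁ m e.fst h.1).mono fun T x hx => PMap.isSome_bindTree _ _ _ _ hx, h₂ _ _ h.2⟩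
  | unit => trivial
  | fst _ => exact h.elim
  | snd _ => exact h.elim

/-- Only variables of the tuple become common. With `Q` saying that these are allowed on one side,
the variables exclusive to the other side stay without a value. -/
theorem PMap.of_isSome_bindTree {K Γ : Ctx} (m : PMap K Γ) {S : Ty} (t : Tm Γ S)
    (e : Path K S) {Q : ∀ T, Var Γ T → Prop} (h : t.All Q) {T : Ty} (x : Var Γ T)
    (hx : ((m.bindTree t e).get x).isSome) : (m.get x).isSome ∨ Q T x := by
  induction t generalizing m with
  | var y =>
    simp only [PMap.bindTree] at hx
    split at hx
    · exact .inl hx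
    · revert hx
      exact PMap.set_elim m y e (fun S z o => o.isSome → (m.get z).isSome ∨ Q S z)
        (fun _ => .inr h) (fun _ _ _ h => .inl h) x
  | pair t s h₁ h₂ =>
    rcases h₂ (m.bindTree t e.fst) e.snd h.2 hx with hx | hx
    · exact h₁ m e.fst h.1 hx
    · exact .inr hx
  | unit => exact .inl hx
  | fst _ => exact .inl hx
  | snd _ => exact .inl hx

theorem Agree.bindTree {U : Type u} {K Γ : Ctx} {m : PMap K Γ} {κ : Env U K} {ρ : Env U Γ}
    (hm : Agree m κ ρ) {S : Ty} (t : Tm Γ S) (e : Path K S) (h : e.tm.eval κ = t.eval ρ) :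
    Agree (m.bindTree t e) κ ρ := by
  induction t generalizing m with
  | var y =>
    simp only [PMap.bindTree]
    split
    · exact hm
    · intro T x
      refine PMap.set_elim m y e (fun S z o => ∀ e, o = some e → e.tm.eval κ = ρ S z) ?_ ?_ x
      · rintro _ ⟨⟩
        exact h
      · exact fun _ _ _ => hm _ _
  | pair t s h₁ h₂ =>
    refine h₂ (h₁ hm e.fst ?_) e.snd ?_ <;> simp [Path.tm, Tm.eval, h]
  | unit => exact hm
  | fst _ => exact hm
  | snd _ => exact hm

/-! ### Sequents with sides

Every formula on the left of a sequent belongs to one of two sides. A variable that has a value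
under the partial map is common to both sides; the other variables belong to one side. -/

/-- A sequent with sides, without its right-hand side. -/
structure TSeq (K Γ : Ctx) where
  m : PMap K Γ
  τ : List Bool
  δ : List Bool
  Θ : List (Mem Γ)
  Δ : List (Fm Γ)

/-- The formulas of the sides that satisfy `P` hold, and the bindings agree. -/
structure TSeq.Models {U : Type u} {K Γ : Ctx} (s : TSeq K Γ) (P : Bool → Prop) (κ : Env U K)
    (ρ : Env U Γ) : Prop where
  agree : Agree s.m κ ρ
  mem : List.Forall₂ (fun q A => P q → Mem.holds ρ A) s.τ s.Θ
  fm : List.Forall₂ (fun q φ => P q → Fm.holds ρ φ) s.δ s.Δ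

/-- The variables that may occur on the side `p`. -/
def Ok {K Γ : Ctx} (m : PMap K Γ) (S : ∀ T, Var Γ T → Bool) (p : Bool) (T : Ty) (x : Var Γ T) :
    Prop :=
  (m.get x).isSome ∨ S T x = p

/-- The term is a variable with the property `Z`. -/
def Tm.IsMark {Γ : Ctx} (Z : ∀ T, Var Γ T → Prop) : {T : Ty} → Tm Γ T → Prop
  | _, .var x => Z _ x
  | _, _ => False

/-- A membership formula that may occur on the side `p`: its element is a tuple of variables,
or its set is one of the variables in `Z`. -/
structure MemOk {K Γ : Ctx} (m : PMap K Γ) (S : ∀ T, Var Γ T → Bool) (Z : ∀ T, Var Γ T → Prop)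
    (p : Bool) (A : Mem Γ) : Prop where
  elt : A.elt.All (Ok m S p)
  elt_not : A.elt.All (fun T x => ¬ Z T x)
  set : A.set.All (Ok m S p)
  shape : A.elt.IsTree ∨ A.set.IsMark Z

/-- A formula that may occur on the side `p`. -/
structure FmOk {K Γ : Ctx} (m : PMap K Γ) (S : ∀ T, Var Γ T → Bool) (Z : ∀ T, Var Γ T → Prop)
    (p : Bool) (φ : Fm Γ) : Prop where
  ok : φ.All (Ok m S p)
  not : φ.All (fun T x => ¬ Z T x)

/-- The formulas respect the sides; the variables in `Z` are sets of Ur-elements. -/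
structure TSeq.Inv {K Γ : Ctx} (s : TSeq K Γ) (S : ∀ T, Var Γ T → Bool)
    (Z : ∀ T, Var Γ T → Prop) : Prop where
  mem : List.Forall₂ (MemOk s.m S Z) s.τ s.Θ
  fm : List.Forall₂ (FmOk s.m S Z) s.δ s.Δ
  ty : ∀ T x, Z T x → T = .set .ur

theorem forall₂_middle {α β : Type*} {R : α → β → Prop} {l₁ l₂ : List α} {m₁ m₂ : List β}
    {a : α} {b : β} (h : l₁.length = m₁.length) :
    List.Forall₂ R (l₁ ++ a :: l₂) (m₁ ++ b :: m₂) ↔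
      List.Forall₂ R l₁ m₁ ∧ R a b ∧ List.Forall₂ R l₂ m₂ := by
  induction l₁ generalizing m₁ with
  | nil =>
    cases m₁ with
    | nil => simp
    | cons => simp at h
  | cons c l₁ ih =>
    cases m₁ with
    | nil => simp at h
    | cons d m₁ => simp [ih (by simpa using h), and_assoc]

theorem forall₂_append {α β : Type*} {R : α → β → Prop} {l₁ l₂ : List α} {m₁ m₂ : List β}
    (h : l₁.length = m₁.length) :
    List.Forall₂ R (l₁ ++ l₂) (m₁ ++ m₂) ↔ List.Forall₂ R l₁ m₁ ∧ List.Forall₂ R l₂ m₂ := by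
  induction l₁ generalizing m₁ with
  | nil =>
    cases m₁ with
    | nil => simp
    | cons => simp at h
  | cons c l₁ ih =>
    cases m₁ with
    | nil => simp at h
    | cons d m₁ => simp [ih (by simpa using h), and_assoc]

/-- Splits the list of sides at the place where a rule splits the list of formulas, so that the side
of the principal formula can be inspected. -/
theorem exists_middle {α β : Type*} {R : α → β → Prop} {l : List α} {m₁ m₂ : List β} {b : β}
    (h : List.Forall₂ R l (m₁ ++ b :: m₂)) :
    ∃ l₁ a l₂, l = l₁ ++ a :: l₂ ∧ l₁.length = m₁.length := by
  induction m₁ generalizing l with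
  | nil =>
    cases h with
    | cons _ _ => exact ⟨[], _, _, rfl, rfl⟩
  | cons c m₁ ih =>
    cases h with
    | cons _ h =>
      obtain ⟨l₁, a, l₂, rfl, hl⟩ := ih h
      exact ⟨_ :: l₁, a, l₂, rfl, by simp [hl]⟩

theorem Tm.isTree_sub {Γ Δ : Ctx} {σ : Subs Γ Δ} (hσ : ∀ T x, (σ T x).IsTree) {T : Ty}
    {t : Tm Γ T} (h : t.IsTree) : (t.sub σ).IsTree := by
  induction t with
  | var x => exact hσ _ x
  | unit => exact h
  | pair t s h₁ h₂ => exact ⟨h₁ h.1, h₂ h.2⟩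
  | fst _ => exact h
  | snd _ => exact h

theorem Tm.isTree_ren {Γ Δ : Ctx} {r : Ren Γ Δ} {T : Ty}
    {t : Tm Γ T} (h : t.IsTree) : (t.ren r).IsTree := by
  induction t with
  | var x => trivial
  | unit => exact h
  | pair t s h₁ h₂ => exact ⟨h₁ h.1, h₂ h.2⟩
  | fst _ => exact h
  | snd _ => exact h

/-- Meant for the conversion rules, where premise and conclusion are two instances of one schematic
sequent. -/
theorem Tm.isTree_sub_of_sub {Γ Δ : Ctx} {σ σ' : Subs Γ Δ}
    (hσ : ∀ T x, (σ T x).IsTree → (σ' T x).IsTree) {T : Ty}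
    {t : Tm Γ T} (h : (t.sub σ).IsTree) : (t.sub σ').IsTree := by
  induction t with
  | var x => exact hσ _ x h
  | unit => exact h
  | pair t s h₁ h₂ => exact ⟨h₁ h.1, h₂ h.2⟩
  | fst _ => exact h
  | snd _ => exact h

theorem Tm.isMark_sub {Γ Δ : Ctx} {σ : Subs Γ Δ} {Z : ∀ T, Var Γ T → Prop}
    {Z' : ∀ T, Var Δ T → Prop} (hσ : ∀ T x, Z T x → (σ T x).IsMark Z') {T : Ty} {t : Tm Γ T}
    (h : t.IsMark Z) : (t.sub σ).IsMark Z' := by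
  cases t with
  | var x => exact hσ _ x h
  | _ => exact h.elim

theorem Tm.isMark_sub_of_sub {Γ Δ : Ctx} {σ σ' : Subs Γ Δ} {Z : ∀ T, Var Δ T → Prop}
    (hσ : ∀ T x, (σ T x).IsMark Z → (σ' T x).IsMark Z) {T : Ty} {t : Tm Γ T}
    (h : (t.sub σ).IsMark Z) : (t.sub σ').IsMark Z := by
  cases t with
  | var x => exact hσ _ x h
  | _ => exact h.elim

theorem MemOk.mono {K K' Γ : Ctx} {m : PMap K Γ} {m' : PMap K' Γ} {S : ∀ T, Var Γ T → Bool}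
    {Z : ∀ T, Var Γ T → Prop} {p : Bool} {A : Mem Γ} (h : MemOk m S Z p A)
    (hm : ∀ T (x : Var Γ T), (m.get x).isSome → (m'.get x).isSome) : MemOk m' S Z p A :=
  ⟨h.elt.mono fun _ _ h => h.imp_left (hm _ _), h.elt_not,
    h.set.mono fun _ _ h => h.imp_left (hm _ _), h.shape⟩

theorem FmOk.mono {K K' Γ : Ctx} {m : PMap K Γ} {m' : PMap K' Γ} {S : ∀ T, Var Γ T → Bool}
    {Z : ∀ T, Var Γ T → Prop} {p : Bool} {φ : Fm Γ} (h : FmOk m S Z p φ)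
    (hm : ∀ T (x : Var Γ T), (m.get x).isSome → (m'.get x).isSome) : FmOk m' S Z p φ :=
  ⟨h.ok.mono fun _ _ h => h.imp_left (hm _ _), h.not⟩

theorem Tm.ok_wk {K Γ : Ctx} {m : PMap K Γ} {S : ∀ T, Var Γ T → Bool} {p : Bool} {T : Ty}
    {t : Tm Γ T} (h : t.All (Ok m S p)) (R : Ty) (o : Option (Path K R)) (b : Bool) :
    (t.ren (Ren.wk R)).All (Ok (m.cons o) (vcons b S) p) :=
  (Tm.all_ren _ _ _).2 h

theorem MemOk.wk {K Γ : Ctx} {m : PMap K Γ} {S : ∀ T, Var Γ T → Bool}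
    {Z : ∀ T, Var Γ T → Prop} {p : Bool} {A : Mem Γ} (h : MemOk m S Z p A) (R : Ty)
    (o : Option (Path K R)) (b : Bool) (c : Prop) :
    MemOk (m.cons o) (vcons b S) (vcons c Z) p (A.wk R) := by
  refine ⟨Tm.ok_wk h.elt _ _ _, (Tm.all_ren _ _ _).2 h.elt_not, Tm.ok_wk h.set _ _ _, ?_⟩
  refine h.shape.imp Tm.isTree_ren ?_
  obtain ⟨_, _, t⟩ := A
  cases t with
  | var x => exact id
  | _ => exact False.elim

theorem FmOk.wk {K Γ : Ctx} {m : PMap K Γ} {S : ∀ T, Var Γ T → Bool}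
    {Z : ∀ T, Var Γ T → Prop} {p : Bool} {φ : Fm Γ} (h : FmOk m S Z p φ) (R : Ty)
    (o : Option (Path K R)) (b : Bool) (c : Prop) :
    FmOk (m.cons o) (vcons b S) (vcons c Z) p (φ.wk R) :=
  ⟨(Fm.all_ren _ _ _).2 h.ok, (Fm.all_ren _ _ _).2 h.not⟩

theorem MemOk.sub {K Γ Γ' : Ctx} {m : PMap K Γ} {m' : PMap K Γ'} {S : ∀ T, Var Γ T → Bool}
    {S' : ∀ T, Var Γ' T → Bool} {Z : ∀ T, Var Γ T → Prop} {Z' : ∀ T, Var Γ' T → Prop}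
    {p : Bool} {A : Mem Γ} (h : MemOk m S Z p A) {σ : Subs Γ Γ'}
    (h₁ : ∀ T x, Ok m S p T x → (σ T x).All (Ok m' S' p))
    (h₂ : ∀ T x, ¬ Z T x → (σ T x).All (fun T x => ¬ Z' T x))
    (h₃ : ∀ T x, (σ T x).IsTree) (h₄ : ∀ T x, Z T x → (σ T x).IsMark Z') :
    MemOk m' S' Z' p (A.sub σ) :=
  ⟨(Tm.all_sub _ _ _).2 (h.elt.mono h₁), (Tm.all_sub _ _ _).2 (h.elt_not.mono h₂),
    (Tm.all_sub _ _ _).2 (h.set.mono h₁), h.shape.imp (Tm.isTree_sub h₃) (Tm.isMark_sub h₄)⟩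

theorem FmOk.sub {K Γ Γ' : Ctx} {m : PMap K Γ} {m' : PMap K Γ'} {S : ∀ T, Var Γ T → Bool}
    {S' : ∀ T, Var Γ' T → Bool} {Z : ∀ T, Var Γ T → Prop} {Z' : ∀ T, Var Γ' T → Prop}
    {p : Bool} {φ : Fm Γ} (h : FmOk m S Z p φ) {σ : Subs Γ Γ'}
    (h₁ : ∀ T x, Ok m S p T x → (σ T x).All (Ok m' S' p))
    (h₂ : ∀ T x, ¬ Z T x → (σ T x).All (fun T x => ¬ Z' T x)) :
    FmOk m' S' Z' p (φ.sub σ) :=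
  ⟨(Fm.all_sub _ _ _).2 (h.ok.mono h₁), (Fm.all_sub _ _ _).2 (h.not.mono h₂)⟩

theorem Tm.all_sub_of_sub {Γ Γ' : Ctx} {σ σ' : Subs Γ Γ'}
    (hσ : ∀ T x (P : ∀ T, Var Γ' T → Prop), (σ T x).All P → (σ' T x).All P)
    {P : ∀ T, Var Γ' T → Prop} {T : Ty} {t : Tm Γ T} (h : (t.sub σ).All P) :
    (t.sub σ').All P :=
  (Tm.all_sub _ _ _).2 (((Tm.all_sub _ _ _).1 h).mono fun _ _ => hσ _ _ _)

theorem MemOk.sub_of_sub {K Γ Γ' : Ctx} {m : PMap K Γ'} {S : ∀ T, Var Γ' T → Bool}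
    {Z : ∀ T, Var Γ' T → Prop} {p : Bool} {A : Mem Γ} {σ σ' : Subs Γ Γ'}
    (h₁ : ∀ T x (P : ∀ T, Var Γ' T → Prop), (σ T x).All P → (σ' T x).All P)
    (h₂ : ∀ T x, (σ T x).IsTree → (σ' T x).IsTree)
    (h₃ : ∀ T x, (σ T x).IsMark Z → (σ' T x).IsMark Z)
    (h : MemOk m S Z p (A.sub σ)) : MemOk m S Z p (A.sub σ') :=
  ⟨Tm.all_sub_of_sub h₁ h.elt, Tm.all_sub_of_sub h₁ h.elt_not, Tm.all_sub_of_sub h₁ h.set,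
    h.shape.imp (Tm.isTree_sub_of_sub h₂) (Tm.isMark_sub_of_sub h₃)⟩

theorem FmOk.sub_of_sub {K Γ Γ' : Ctx} {m : PMap K Γ'} {S : ∀ T, Var Γ' T → Bool}
    {Z : ∀ T, Var Γ' T → Prop} {p : Bool} {φ : Fm Γ} {σ σ' : Subs Γ Γ'}
    (h₁ : ∀ T x (P : ∀ T, Var Γ' T → Prop), (σ T x).All P → (σ' T x).All P)
    (h : FmOk m S Z p (φ.sub σ)) : FmOk m S Z p (φ.sub σ') :=
  ⟨(Fm.all_sub _ _ _).2 (((Fm.all_sub _ _ _).1 h.ok).mono fun _ _ => h₁ _ _ _),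
    (Fm.all_sub _ _ _).2 (((Fm.all_sub _ _ _).1 h.not).mono fun _ _ => h₁ _ _ _)⟩

/-- A variable without a value belongs to a single side, so it cannot be allowed on both. This is
where terms shared by the sides become expressible over the common variables. -/
theorem Tm.isSome_of_ok {K Γ : Ctx} {m : PMap K Γ} {S : ∀ T, Var Γ T → Bool} {p q : Bool}
    (hpq : p ≠ q) {T : Ty} {t : Tm Γ T} (hp : t.All (Ok m S p)) (hq : t.All (Ok m S q)) :
    t.All fun _ x => (m.get x).isSome := by
  refine (hp.and hq).mono ?_
  rintro T x ⟨h | h, h' | h'⟩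
  · exact h
  · exact h
  · exact h'
  · exact absurd (h.symm.trans h') hpq

/-! ### Derived operations of the calculus -/

/-- A term, as an expression. -/
def Tm.nrc (g : Bool) {K : Ctx} : {T : Ty} → Tm K T → Nrc g K T
  | _, .var x => .var x
  | _, .unit => .unit
  | _, .pair t s => .pair (t.nrc g) (s.nrc g)
  | _, .fst t => .fst (t.nrc g)
  | _, .snd t => .snd (t.nrc g)

@[simp] theorem Tm.eval_nrc {U : Type u} {g : Bool} (c₀ : g = true → U) {K : Ctx} {T : Ty}
    (t : Tm K T) (κ : Env U K) : (t.nrc g).eval c₀ κ = t.eval κ := by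
  induction t <;> simp_all [Tm.nrc, Tm.eval, Nrc.eval]

/-- Truth of an expression of type `Set(Unit)`. -/
def Nrc.Tr {U : Type u} {g : Bool} (c₀ : g = true → U) {K : Ctx} (κ : Env U K)
    (E : Nrc g K (.set .unit)) : Prop :=
  PUnit.unit ∈ Ty.asSet (E.eval c₀ κ)

namespace Nrc

variable {g : Bool} {K : Ctx}

def tt : Nrc g K (.set .unit) := .sing .unit

def neg (E : Nrc g K (.set .unit)) : Nrc g K (.set .unit) := .diff tt E

def conj (E F : Nrc g K (.set .unit)) : Nrc g K (.set .unit) := neg (.union (neg E) (neg F))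

/-- The set is nonempty. -/
def inhab {T : Ty} (E : Nrc g K (.set T)) : Nrc g K (.set .unit) := .bigUnion E tt

def neq {T : Ty} (e f : Nrc g K T) : Nrc g K (.set .unit) := inhab (.diff (.sing e) (.sing f))

def isMem {T : Ty} (e : Nrc g K T) (f : Nrc g K (.set T)) : Nrc g K (.set .unit) :=
  neg (inhab (.diff (.sing e) f))

def filter {T : Ty} (E : Nrc g K (.set T)) (F : Nrc g (T :: K) (.set .unit)) :
    Nrc g K (.set T) :=
  .bigUnion E (.bigUnion F (.sing (.var (.succ .zero))))

def letIn {S T : Ty} (e : Nrc g K S) (F : Nrc g (S :: K) (.set T)) : Nrc g K (.set T) :=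
  .bigUnion (.sing e) F

/-- `e = f` and `E`, where `n` says that `e ≠ f`. -/
def guardAnd (n E : Nrc g K (.set .unit)) : Nrc g K (.set .unit) := neg (.union n (neg E))

/-- The product of two sets; the second one may not depend on the first variable. -/
def product {S T : Ty} (E : Nrc g K (.set S)) (F : Nrc g (S :: K) (.set T)) :
    Nrc g K (.set (.prod S T)) :=
  .bigUnion E (.bigUnion F (.sing (.pair (.var (.succ .zero)) (.var .zero))))

variable {U : Type u} (c₀ : g = true → U) (κ : Env U K)

@[simp] theorem tr_tt : (tt : Nrc g K _).Tr c₀ κ := Set.mem_singleton _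

@[simp] theorem tr_neg (E : Nrc g K (.set .unit)) : (neg E).Tr c₀ κ ↔ ¬ E.Tr c₀ κ :=
  ⟨fun h => h.2, fun h => ⟨tr_tt c₀ κ, h⟩⟩

@[simp] theorem tr_union (E F : Nrc g K (.set .unit)) :
    (union E F).Tr c₀ κ ↔ E.Tr c₀ κ ∨ F.Tr c₀ κ := Iff.rfl

@[simp] theorem tr_conj (E F : Nrc g K (.set .unit)) :
    (conj E F).Tr c₀ κ ↔ E.Tr c₀ κ ∧ F.Tr c₀ κ := by simp [conj]

@[simp] theorem tr_bigUnion {T : Ty} (E : Nrc g K (.set T)) (F : Nrc g (T :: K) (.set .unit)) :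
    (bigUnion E F).Tr c₀ κ ↔ ∃ a : T.den U, a ∈ Ty.asSet (E.eval c₀ κ) ∧ F.Tr c₀ (κ.cons a) :=
  Iff.rfl

theorem tr_inhab {T : Ty} (E : Nrc g K (.set T)) :
    (inhab E).Tr c₀ κ ↔ ∃ a : T.den U, a ∈ Ty.asSet (E.eval c₀ κ) := by simp [inhab]

@[simp] theorem tr_neq {T : Ty} (e f : Nrc g K T) :
    (neq e f).Tr c₀ κ ↔ e.eval c₀ κ ≠ f.eval c₀ κ := by
  rw [neq, tr_inhab]
  constructor
  · rintro ⟨a, rfl, h⟩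
    exact h
  · intro h
    exact ⟨_, rfl, h⟩

@[simp] theorem tr_isMem {T : Ty} (e : Nrc g K T) (f : Nrc g K (.set T)) :
    (isMem e f).Tr c₀ κ ↔ e.eval c₀ κ ∈ Ty.asSet (f.eval c₀ κ) := by
  rw [isMem, tr_neg, tr_inhab]
  constructor
  · intro h
    by_contra h'
    exact h ⟨_, rfl, h'⟩
  · rintro h ⟨a, rfl, h'⟩
    exact h' h

theorem mem_filter {T : Ty} (E : Nrc g K (.set T)) (F : Nrc g (T :: K) (.set .unit))
    (a : T.den U) : a ∈ Ty.asSet ((filter E F).eval c₀ κ) ↔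
      a ∈ Ty.asSet (E.eval c₀ κ) ∧ F.Tr c₀ (κ.cons a) := by
  constructor
  · rintro ⟨b, hb, c, hc, h⟩
    cases (h : a = b)
    exact ⟨hb, hc⟩
  · rintro ⟨h, h'⟩
    exact ⟨a, h, .unit, h', rfl⟩

@[simp] theorem tr_letIn {S : Ty} (e : Nrc g K S) (F : Nrc g (S :: K) (.set .unit)) :
    (letIn e F).Tr c₀ κ ↔ F.Tr c₀ (κ.cons (e.eval c₀ κ)) := by
  rw [letIn, tr_bigUnion]
  constructor
  · rintro ⟨a, rfl, h⟩
    exact h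
  · intro h
    exact ⟨_, rfl, h⟩

@[simp] theorem tr_guardAnd (n E : Nrc g K (.set .unit)) :
    (guardAnd n E).Tr c₀ κ ↔ ¬ n.Tr c₀ κ ∧ E.Tr c₀ κ := by simp [guardAnd]

theorem mem_product {S T : Ty} (E : Nrc g K (.set S)) (F : Nrc g (S :: K) (.set T))
    (a : S.den U) (b : T.den U) (ha : a ∈ Ty.asSet (E.eval c₀ κ))
    (hb : b ∈ Ty.asSet (F.eval c₀ (κ.cons a))) :
    ((a, b) : S.den U × T.den U) ∈ Ty.asSet ((product E F).eval c₀ κ) :=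
  ⟨a, ha, b, hb, rfl⟩

end Nrc

/-! ### Interpolants and supersets -/

/-- The type of the objects that a right-hand side is about. -/
def Goal.ty {Γ : Ctx} : Goal Γ → Ty
  | .mem (T := T) _ _ => T
  | .sub (T := T) _ _ => T
  | .eq (T := T) _ _ => T

/-- The set `s` contains the objects that a right-hand side is about. -/
def Goal.Covered {U : Type u} {Γ : Ctx} (ρ : Env U Γ) :
    (G : Goal Γ) → ((Ty.set G.ty).den U) → Prop
  | .mem t _, s => t.eval ρ ∈ Ty.asSet s
  | .sub t _, s => Ty.asSet (t.eval ρ) ⊆ Ty.asSet s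
  | .eq _ v, s => v.eval ρ ∈ Ty.asSet s

/-- The expression is implied by the formulas on the side `false`, and together with the
formulas on the side `true` it implies the right-hand side. -/
structure Interp {g : Bool} {K Γ : Ctx} (s : TSeq K Γ) (G : Goal Γ) (E : Nrc g K (.set .unit)) :
    Prop where
  fwd : ∀ (U : Type u) [Nonempty U] (c₀ : g = true → U) (κ : Env U K) (ρ : Env U Γ),
    s.Models (· = false) κ ρ → E.Tr c₀ κ
  bwd : ∀ (U : Type u) [Nonempty U] (c₀ : g = true → U) (κ : Env U K) (ρ : Env U Γ),
    s.Models (· = true) κ ρ → E.Tr c₀ κ → G.holds ρ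

/-- The value of the expression contains the objects that the right-hand side is about. -/
def Covers {g : Bool} {K Γ : Ctx} (s : TSeq K Γ) (G : Goal Γ) (E : Nrc g K (.set G.ty)) : Prop :=
  ∀ (U : Type u) [Nonempty U] (c₀ : g = true → U) (κ : Env U K) (ρ : Env U Γ),
    s.Models (fun _ => True) κ ρ → G.Covered ρ (E.eval c₀ κ)

/-- The expression interpolates between `z ∈ t` and `z ∈ v`, with `z` the first variable. -/
structure InterpSub {g : Bool} {K Γ : Ctx} {T : Ty} (s : TSeq (T :: K) Γ) (t v : Tm Γ (.set T))
    (E : Nrc g (T :: K) (.set .unit)) : Prop where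
  fwd : ∀ (U : Type u) [Nonempty U] (c₀ : g = true → U) (κ : Env U (T :: K)) (ρ : Env U Γ),
    s.Models (· = false) κ ρ → κ _ .zero ∈ Ty.asSet (t.eval ρ) → E.Tr c₀ κ
  bwd : ∀ (U : Type u) [Nonempty U] (c₀ : g = true → U) (κ : Env U (T :: K)) (ρ : Env U Γ),
    s.Models (· = true) κ ρ → E.Tr c₀ κ → κ _ .zero ∈ Ty.asSet (v.eval ρ)

/-- The expression interpolates between `t ∈ z` and `v ∈ z`, with `z` the first variable. -/
structure InterpUr {g : Bool} {K Γ : Ctx} (s : TSeq (.set .ur :: K) Γ) (t v : Tm Γ .ur)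
    (E : Nrc g (.set .ur :: K) (.set .unit)) : Prop where
  fwd : ∀ (U : Type u) [Nonempty U] (c₀ : g = true → U) (κ : Env U (.set .ur :: K))
    (ρ : Env U Γ), s.Models (· = false) κ ρ →
      t.eval ρ ∈ Ty.asSet (T := .ur) (κ (.set .ur) .zero) → E.Tr c₀ κ
  bwd : ∀ (U : Type u) [Nonempty U] (c₀ : g = true → U) (κ : Env U (.set .ur :: K))
    (ρ : Env U Γ), s.Models (· = true) κ ρ → E.Tr c₀ κ →
      v.eval ρ ∈ Ty.asSet (T := .ur) (κ (.set .ur) .zero)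

/-- A model of the formulas of the first sequent yields one of the second, with the same values
of the terms on the right. -/
def Step (P : Bool → Prop) {K Γ Γ' : Ctx} (s : TSeq K Γ) {T : Ty} (t : Tm Γ T)
    (v : Tm Γ (.set T)) (s' : TSeq K Γ') (t' : Tm Γ' T) (v' : Tm Γ' (.set T)) : Prop :=
  ∀ (U : Type u) [Nonempty U] (κ : Env U K) (ρ : Env U Γ), s.Models P κ ρ →
    ∃ ρ' : Env U Γ', s'.Models P κ ρ' ∧ (P true → t'.eval ρ' = t.eval ρ ∧ v'.eval ρ' = v.eval ρ)

/-- A rule that merely transforms the models of each side does not change the interpolant. The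
values of the terms on the right matter only for the side `true`, to which they belong. -/
theorem Interp.of_step {g : Bool} {K Γ Γ' : Ctx} {s : TSeq K Γ} {T : Ty} {t : Tm Γ T}
    {v : Tm Γ (.set T)} {s' : TSeq K Γ'} {t' : Tm Γ' T} {v' : Tm Γ' (.set T)}
    {E : Nrc g K (.set .unit)} (h : ∀ b, Step.{u} (· = b) s t v s' t' v')
    (hE : Interp.{u} s' (.mem t' v') E) : Interp.{u} s (.mem t v) E := by
  refine ⟨fun U _ c₀ κ ρ hρ => ?_, fun U _ c₀ κ ρ hρ hT => ?_⟩
  · obtain ⟨ρ', h', -⟩ := h _ U κ ρ hρ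
    exact hE.fwd U c₀ κ ρ' h'
  · obtain ⟨ρ', h', h''⟩ := h _ U κ ρ hρ
    obtain ⟨h₁, h₂⟩ := h'' rfl
    have := hE.bwd U c₀ κ ρ' h' hT
    rwa [Goal.holds, h₁, h₂] at this

theorem Covers.of_step {g : Bool} {K Γ Γ' : Ctx} {s : TSeq K Γ} {T : Ty} {t : Tm Γ T}
    {v : Tm Γ (.set T)} {s' : TSeq K Γ'} {t' : Tm Γ' T} {v' : Tm Γ' (.set T)}
    {E : Nrc g K (.set T)} (h : Step.{u} (fun _ => True) s t v s' t' v')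
    (hE : Covers.{u} s' (.mem t' v') E) : Covers.{u} s (.mem t v) E := by
  intro U _ c₀ κ ρ hρ
  obtain ⟨ρ', h', h''⟩ := h U κ ρ hρ
  have := hE U c₀ κ ρ' h'
  obtain ⟨h₁, h₂⟩ := h'' trivial
  change t'.eval ρ' ∈ _ at this
  rwa [h₁] at this

theorem TSeq.Models.all_mem {U : Type u} {K Γ : Ctx} {s : TSeq K Γ} {κ : Env U K} {ρ : Env U Γ}
    (h : s.Models (fun _ => True) κ ρ) : ∀ A ∈ s.Θ, A.holds ρ := by
  intro A hA
  obtain ⟨n, hn, rfl⟩ := List.mem_iff_get.1 hA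
  have := (List.forall₂_iff_get.1 h.mem).2 n (by rw [h.mem.length_eq]; exact n.2) n.2
  simpa using this

theorem TSeq.Models.all_fm {U : Type u} {K Γ : Ctx} {s : TSeq K Γ} {κ : Env U K} {ρ : Env U Γ}
    (h : s.Models (fun _ => True) κ ρ) : ∀ A ∈ s.Δ, A.holds ρ := by
  intro A hA
  obtain ⟨n, hn, rfl⟩ := List.mem_iff_get.1 hA
  have := (List.forall₂_iff_get.1 h.fm).2 n (by rw [h.fm.length_eq]; exact n.2) n.2
  simpa using this

theorem TSeq.Models.sound {U : Type u} {K Γ : Ctx} {s : TSeq K Γ} {κ : Env U K} {ρ : Env U Γ}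
    (h : s.Models (fun _ => True) κ ρ) {G : Goal Γ} (d : Deriv Γ s.Θ s.Δ G) : G.holds ρ :=
  d.sound ρ h.all_mem h.all_fm

theorem forall₂_mp {α β : Type*} {R S Q : α → β → Prop} {l : List α} {m : List β}
    (h₁ : List.Forall₂ R l m) (h₂ : List.Forall₂ S l m) (h : ∀ a b, R a b → S a b → Q a b) :
    List.Forall₂ Q l m := by
  induction h₁ with
  | nil => exact .nil
  | cons ha _ ih =>
    cases h₂ with
    | cons hb h₂ => exact .cons (h _ _ ha hb) (ih h₂)

theorem TSeq.Models.mono {U : Type u} {K Γ : Ctx} {s : TSeq K Γ} {κ : Env U K} {ρ : Env U Γ}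
    {P Q : Bool → Prop} (h : s.Models P κ ρ) (hPQ : ∀ b, Q b → P b) : s.Models Q κ ρ :=
  ⟨h.agree, h.mem.imp fun _ _ h hq => h (hPQ _ hq), h.fm.imp fun _ _ h hq => h (hPQ _ hq)⟩

theorem TSeq.Models.side {U : Type u} {K Γ : Ctx} {s : TSeq K Γ} {κ : Env U K} {ρ : Env U Γ}
    (h : s.Models (fun _ => True) κ ρ) (b : Bool) : s.Models (· = b) κ ρ :=
  h.mono fun _ _ => trivial

/-- A fresh variable must be interpreted even when its side is not under consideration. Any object
will do, but one has to exist; this is why sets of Ur-elements are taken to be nonempty here. -/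
theorem exists_den (U : Type u) [h : Nonempty U] (T : Ty) : Nonempty (T.den U) :=
  h.map fun c => Ty.default c T

/-! ### Propositional and existential left rules, fresh variables, conversions -/

section Rules

variable {K Γ : Ctx} {m : PMap K Γ} {τ δ δ₁ δ₂ : List Bool} {Θ : List (Mem Γ)}
  {Δ Δ₁ Δ₂ : List (Fm Γ)} {S : ∀ T, Var Γ T → Bool} {Z : ∀ T, Var Γ T → Prop} {p : Bool}
  {T : Ty} {t : Tm Γ T} {v : Tm Γ (.set T)}

/-! #### Contraction, conjunction -/

theorem TSeq.Inv.contr (hl : δ₁.length = Δ₁.length) {φ : Fm Γ}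
    (h : TSeq.Inv ⟨m, τ, δ₁ ++ p :: δ₂, Θ, Δ₁ ++ φ :: Δ₂⟩ S Z) :
    TSeq.Inv ⟨m, τ, δ₁ ++ p :: p :: δ₂, Θ, Δ₁ ++ φ :: φ :: Δ₂⟩ S Z := by
  refine ⟨h.mem, ?_, h.ty⟩
  have := h.fm
  simp_all [forall₂_middle hl]

theorem step_contr (P : Bool → Prop) (hl : δ₁.length = Δ₁.length) {φ : Fm Γ} :
    Step.{u} P ⟨m, τ, δ₁ ++ p :: δ₂, Θ, Δ₁ ++ φ :: Δ₂⟩ t v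
      ⟨m, τ, δ₁ ++ p :: p :: δ₂, Θ, Δ₁ ++ φ :: φ :: Δ₂⟩ t v := by
  intro U _ κ ρ h
  refine ⟨ρ, ⟨h.agree, h.mem, ?_⟩, fun _ => ⟨rfl, rfl⟩⟩
  have := h.fm
  simp only [forall₂_middle hl, List.forall₂_cons] at this ⊢
  tauto

theorem TSeq.Inv.and (hl : δ₁.length = Δ₁.length) {φ ψ : Fm Γ}
    (h : TSeq.Inv ⟨m, τ, δ₁ ++ p :: δ₂, Θ, Δ₁ ++ .and φ ψ :: Δ₂⟩ S Z) :
    TSeq.Inv ⟨m, τ, δ₁ ++ p :: p :: δ₂, Θ, Δ₁ ++ φ :: ψ :: Δ₂⟩ S Z := by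
  refine ⟨h.mem, ?_, h.ty⟩
  have := h.fm
  simp only [forall₂_middle hl, List.forall₂_cons] at this ⊢
  obtain ⟨h₁, h₂, h₃⟩ := this
  exact ⟨h₁, ⟨h₂.ok.1, h₂.not.1⟩, ⟨h₂.ok.2, h₂.not.2⟩, h₃⟩

theorem step_and (P : Bool → Prop) (hl : δ₁.length = Δ₁.length) {φ ψ : Fm Γ} :
    Step.{u} P ⟨m, τ, δ₁ ++ p :: δ₂, Θ, Δ₁ ++ .and φ ψ :: Δ₂⟩ t v
      ⟨m, τ, δ₁ ++ p :: p :: δ₂, Θ, Δ₁ ++ φ :: ψ :: Δ₂⟩ t v := by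
  intro U _ κ ρ h
  refine ⟨ρ, ⟨h.agree, h.mem, ?_⟩, fun _ => ⟨rfl, rfl⟩⟩
  have := h.fm
  simp only [forall₂_middle hl, List.forall₂_cons] at this ⊢
  obtain ⟨h₁, h₂, h₃⟩ := this
  exact ⟨h₁, fun h => (h₂ h).1, fun h => (h₂ h).2, h₃⟩

/-! #### Disjunction -/

theorem TSeq.Inv.or (hl : δ₁.length = Δ₁.length) {φ ψ : Fm Γ}
    (h : TSeq.Inv ⟨m, τ, δ₁ ++ p :: δ₂, Θ, Δ₁ ++ .or φ ψ :: Δ₂⟩ S Z) :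
    TSeq.Inv ⟨m, τ, δ₁ ++ p :: δ₂, Θ, Δ₁ ++ φ :: Δ₂⟩ S Z ∧
      TSeq.Inv ⟨m, τ, δ₁ ++ p :: δ₂, Θ, Δ₁ ++ ψ :: Δ₂⟩ S Z := by
  have := h.fm
  simp only [forall₂_middle hl] at this
  obtain ⟨h₁, h₂, h₃⟩ := this
  exact ⟨⟨h.mem, (forall₂_middle hl).2 ⟨h₁, ⟨h₂.ok.1, h₂.not.1⟩, h₃⟩, h.ty⟩,
    ⟨h.mem, (forall₂_middle hl).2 ⟨h₁, ⟨h₂.ok.2, h₂.not.2⟩, h₃⟩, h.ty⟩⟩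

theorem TSeq.Models.or {U : Type u} {κ : Env U K} {ρ : Env U Γ} {P : Bool → Prop}
    (hl : δ₁.length = Δ₁.length) {φ ψ : Fm Γ} (hp : P p)
    (h : TSeq.Models ⟨m, τ, δ₁ ++ p :: δ₂, Θ, Δ₁ ++ .or φ ψ :: Δ₂⟩ P κ ρ) :
    TSeq.Models ⟨m, τ, δ₁ ++ p :: δ₂, Θ, Δ₁ ++ φ :: Δ₂⟩ P κ ρ ∨
      TSeq.Models ⟨m, τ, δ₁ ++ p :: δ₂, Θ, Δ₁ ++ ψ :: Δ₂⟩ P κ ρ := by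
  have := h.fm
  simp only [forall₂_middle hl] at this
  obtain ⟨h₁, h₂, h₃⟩ := this
  rcases h₂ hp with h₂ | h₂
  · exact .inl ⟨h.agree, h.mem, (forall₂_middle hl).2 ⟨h₁, fun _ => h₂, h₃⟩⟩
  · exact .inr ⟨h.agree, h.mem, (forall₂_middle hl).2 ⟨h₁, fun _ => h₂, h₃⟩⟩

/-- A formula on a side that is not considered may be replaced. -/
theorem TSeq.Models.replace {U : Type u} {κ : Env U K} {ρ : Env U Γ} {P : Bool → Prop}
    (hl : δ₁.length = Δ₁.length) {φ ψ : Fm Γ} (hp : ¬ P p)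
    (h : TSeq.Models ⟨m, τ, δ₁ ++ p :: δ₂, Θ, Δ₁ ++ φ :: Δ₂⟩ P κ ρ) :
    TSeq.Models ⟨m, τ, δ₁ ++ p :: δ₂, Θ, Δ₁ ++ ψ :: Δ₂⟩ P κ ρ := by
  have := h.fm
  simp only [forall₂_middle hl] at this
  exact ⟨h.agree, h.mem, (forall₂_middle hl).2 ⟨this.1, fun h => (hp h).elim, this.2.2⟩⟩

theorem Covers.or {g : Bool} (hl : δ₁.length = Δ₁.length) {φ ψ : Fm Γ} {E F : Nrc g K (.set T)}
    (hE : Covers.{u} ⟨m, τ, δ₁ ++ p :: δ₂, Θ, Δ₁ ++ φ :: Δ₂⟩ (.mem t v) E)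
    (hF : Covers.{u} ⟨m, τ, δ₁ ++ p :: δ₂, Θ, Δ₁ ++ ψ :: Δ₂⟩ (.mem t v) F) :
    Covers.{u} ⟨m, τ, δ₁ ++ p :: δ₂, Θ, Δ₁ ++ .or φ ψ :: Δ₂⟩ (.mem t v) (.union E F) := by
  intro U _ c₀ κ ρ h
  rcases h.or hl trivial with h | h
  · exact .inl (hE U c₀ κ ρ h)
  · exact .inr (hF U c₀ κ ρ h)

/-- The forward implication may argue by cases, so it yields one of the two interpolants. The
backward implication ignores the side `false`, where the disjunction may be replaced by whichever
disjunct fits. -/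
theorem Interp.or_false {g : Bool} (hl : δ₁.length = Δ₁.length) {φ ψ : Fm Γ}
    {E F : Nrc g K (.set .unit)} {G : Goal Γ}
    (hE : Interp.{u} ⟨m, τ, δ₁ ++ false :: δ₂, Θ, Δ₁ ++ φ :: Δ₂⟩ G E)
    (hF : Interp.{u} ⟨m, τ, δ₁ ++ false :: δ₂, Θ, Δ₁ ++ ψ :: Δ₂⟩ G F) :
    Interp.{u} ⟨m, τ, δ₁ ++ false :: δ₂, Θ, Δ₁ ++ .or φ ψ :: Δ₂⟩ G (.union E F) := by
  refine ⟨fun U _ c₀ κ ρ h => ?_, fun U _ c₀ κ ρ h hT => ?_⟩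
  · rcases h.or hl (by rfl) with h | h
    · exact .inl (hE.fwd U c₀ κ ρ h)
    · exact .inr (hF.fwd U c₀ κ ρ h)
  · rcases hT with hT | hT
    · exact hE.bwd U c₀ κ ρ (h.replace hl (by simp)) hT
    · exact hF.bwd U c₀ κ ρ (h.replace hl (by simp)) hT

/-- Dual to the side `false`: both interpolants follow from that side, and the case distinction
happens in the backward implication, which may need either of them. -/
theorem Interp.or_true {g : Bool} (hl : δ₁.length = Δ₁.length) {φ ψ : Fm Γ}
    {E F : Nrc g K (.set .unit)} {G : Goal Γ}
    (hE : Interp.{u} ⟨m, τ, δ₁ ++ true :: δ₂, Θ, Δ₁ ++ φ :: Δ₂⟩ G E)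
    (hF : Interp.{u} ⟨m, τ, δ₁ ++ true :: δ₂, Θ, Δ₁ ++ ψ :: Δ₂⟩ G F) :
    Interp.{u} ⟨m, τ, δ₁ ++ true :: δ₂, Θ, Δ₁ ++ .or φ ψ :: Δ₂⟩ G (.conj E F) := by
  refine ⟨fun U _ c₀ κ ρ h => ?_, fun U _ c₀ κ ρ h hT => ?_⟩
  · rw [Nrc.tr_conj]
    exact ⟨hE.fwd U c₀ κ ρ (h.replace hl (by simp)), hF.fwd U c₀ κ ρ (h.replace hl (by simp))⟩
  · rw [Nrc.tr_conj] at hT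
    rcases h.or hl (by rfl) with h | h
    · exact hE.bwd U c₀ κ ρ h hT.1
    · exact hF.bwd U c₀ κ ρ h hT.2

/-! #### Contradictions -/

theorem covers_of_false {g : Bool} (hl : δ₁.length = Δ₁.length) {φ : Fm Γ}
    (hφ : ∀ (U : Type u) (ρ : Env U Γ), ¬ φ.holds ρ) :
    Covers.{u} ⟨m, τ, δ₁ ++ p :: δ₂, Θ, Δ₁ ++ φ :: Δ₂⟩ (.mem t v) (.emp (g := g) T) := by
  intro U _ c₀ κ ρ h
  have := h.fm
  simp only [forall₂_middle hl] at this
  exact (hφ U ρ (this.2.1 trivial)).elim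

/-- A contradiction on the side `false` makes it unsatisfiable, so falsity interpolates; on the side
`true`, truth does. -/
theorem interp_of_false_left {g : Bool} (hl : δ₁.length = Δ₁.length) {φ : Fm Γ} {G : Goal Γ}
    (hφ : ∀ (U : Type u) (ρ : Env U Γ), ¬ φ.holds ρ) :
    Interp.{u} ⟨m, τ, δ₁ ++ false :: δ₂, Θ, Δ₁ ++ φ :: Δ₂⟩ G (.emp (g := g) .unit) := by
  refine ⟨fun U _ c₀ κ ρ h => ?_, fun U _ c₀ κ ρ h hT => hT.elim⟩
  have := h.fm
  simp only [forall₂_middle hl] at this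
  exact (hφ U ρ (this.2.1 (by trivial))).elim

theorem interp_of_false_right {g : Bool} (hl : δ₁.length = Δ₁.length) {φ : Fm Γ} {G : Goal Γ}
    (hφ : ∀ (U : Type u) (ρ : Env U Γ), ¬ φ.holds ρ) :
    Interp.{u} ⟨m, τ, δ₁ ++ true :: δ₂, Θ, Δ₁ ++ φ :: Δ₂⟩ G (.tt (g := g)) := by
  refine ⟨fun U _ c₀ κ ρ h => Nrc.tr_tt _ _, fun U _ c₀ κ ρ h hT => ?_⟩
  have := h.fm
  simp only [forall₂_middle hl] at this
  exact (hφ U ρ (this.2.1 (by trivial))).elim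

/-! #### Existential quantification and fresh variables -/

theorem TSeq.Inv.ex (hl : δ₁.length = Δ₁.length) {R : Ty} {z : Tm Γ (.set R)} {φ : Fm (R :: Γ)}
    (h : TSeq.Inv ⟨m, τ, δ₁ ++ p :: δ₂, Θ, Δ₁ ++ .ex z φ :: Δ₂⟩ S Z) :
    TSeq.Inv ⟨m.cons none, p :: τ, δ₁ ++ p :: δ₂, ⟨R, .var .zero, z.wk R⟩ :: Θ.map (Mem.wk R),
      Δ₁.map (Fm.wk R) ++ φ :: Δ₂.map (Fm.wk R)⟩ (vcons p S) (vcons False Z) := by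
  have := h.fm
  simp only [forall₂_middle hl] at this
  obtain ⟨h₁, h₂, h₃⟩ := this
  refine ⟨.cons ?_ ?_, (forall₂_middle (by simpa using hl)).2 ⟨?_, ?_, ?_⟩, ?_⟩
  · exact ⟨.inr rfl, id, Tm.ok_wk h₂.ok.1 _ _ _, .inl trivial⟩
  · exact List.forall₂_map_right_iff.2 (h.mem.imp fun _ _ h => h.wk _ _ _ _)
  · exact List.forall₂_map_right_iff.2 (h₁.imp fun _ _ h => h.wk _ _ _ _)
  · refine ⟨h₂.ok.2.mono fun T x hx => ?_, h₂.not.2.mono fun T x hx => ?_⟩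
    · cases x with
      | zero => exact .inr rfl
      | succ x => exact hx
    · cases x with
      | zero => exact id
      | succ x => exact hx
  · exact List.forall₂_map_right_iff.2 (h₃.imp fun _ _ h => h.wk _ _ _ _)
  · intro T x hx
    cases x with
    | zero => exact hx.elim
    | succ x => exact h.ty _ _ hx

theorem step_ex (P : Bool → Prop) (hl : δ₁.length = Δ₁.length) {R : Ty} {z : Tm Γ (.set R)}
    {φ : Fm (R :: Γ)} :
    Step.{u} P ⟨m, τ, δ₁ ++ p :: δ₂, Θ, Δ₁ ++ .ex z φ :: Δ₂⟩ t v
      ⟨m.cons none, p :: τ, δ₁ ++ p :: δ₂, ⟨R, .var .zero, z.wk R⟩ :: Θ.map (Mem.wk R),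
        Δ₁.map (Fm.wk R) ++ φ :: Δ₂.map (Fm.wk R)⟩ (t.wk R) (v.wk R) := by
  intro U _ κ ρ h
  have := h.fm
  simp only [forall₂_middle hl] at this
  obtain ⟨h₁, h₂, h₃⟩ := this
  -- If the side of the formula is not considered, there is no witness to take, and an arbitrary
  -- object is used.
  have : ∃ a : R.den U, P p → a ∈ Ty.asSet (z.eval ρ) ∧ φ.holds (ρ.cons a) := by
    by_cases hp : P p
    · obtain ⟨a, ha⟩ := h₂ hp
      exact ⟨a, fun _ => ha⟩
    · obtain ⟨a⟩ := exists_den U R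
      exact ⟨a, fun h => (hp h).elim⟩
  obtain ⟨a, ha⟩ := this
  refine ⟨ρ.cons a, ⟨h.agree.cons_none a, .cons ?_ ?_,
    (forall₂_middle (by simpa using hl)).2 ⟨?_, fun hp => (ha hp).2, ?_⟩⟩, fun _ => by simp⟩
  · intro hp
    simpa [Mem.holds, Tm.eval] using (ha hp).1
  · exact List.forall₂_map_right_iff.2 (h.mem.imp fun _ _ h hp => by simpa using h hp)
  · exact List.forall₂_map_right_iff.2 (h₁.imp fun _ _ h hp => by simpa using h hp)
  · exact List.forall₂_map_right_iff.2 (h₃.imp fun _ _ h hp => by simpa using h hp)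

/-- Add a fresh variable and a membership formula. -/
theorem TSeq.Inv.fresh {R : Ty} (o : Option (Path K R)) (b : Bool) (c : Prop) {A : Mem (R :: Γ)}
    (h : TSeq.Inv ⟨m, τ, δ, Θ, Δ⟩ S Z) (hc : c → R = .set .ur)
    (hA : MemOk (m.cons o) (vcons b S) (vcons c Z) p A) :
    TSeq.Inv ⟨m.cons o, p :: τ, δ, A :: Θ.map (Mem.wk R), Δ.map (Fm.wk R)⟩
      (vcons b S) (vcons c Z) := by
  refine ⟨.cons hA ?_, ?_, ?_⟩
  · exact List.forall₂_map_right_iff.2 (h.mem.imp fun _ _ h => h.wk _ _ _ _)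
  · exact List.forall₂_map_right_iff.2 (h.fm.imp fun _ _ h => h.wk _ _ _ _)
  · intro T x hx
    cases x with
    | zero => exact hc hx
    | succ x => exact h.ty _ _ hx

theorem TSeq.Models.fresh {U : Type u} {κ : Env U K} {ρ : Env U Γ} {P : Bool → Prop} {R : Ty}
    {o : Option (Path K R)} {a : R.den U} {A : Mem (R :: Γ)}
    (h : TSeq.Models ⟨m, τ, δ, Θ, Δ⟩ P κ ρ) (ho : ∀ e, o = some e → e.tm.eval κ = a)
    (hA : P p → A.holds (ρ.cons a)) :
    TSeq.Models ⟨m.cons o, p :: τ, δ, A :: Θ.map (Mem.wk R), Δ.map (Fm.wk R)⟩ P κ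
      (ρ.cons a) := by
  refine ⟨?_, .cons hA ?_, ?_⟩
  · intro T x e he
    cases x with
    | zero => exact ho e he
    | succ x => exact h.agree _ _ _ he
  · exact List.forall₂_map_right_iff.2 (h.mem.imp fun _ _ h hp => by simpa using h hp)
  · exact List.forall₂_map_right_iff.2 (h.fm.imp fun _ _ h hp => by simpa using h hp)

/-! #### Conversions -/

theorem TSeq.Inv.sub_of_sub {Γ' : Ctx} {σ σ' : Subs Γ' Γ} {Θ : List (Mem Γ')}
    {Δ : List (Fm Γ')} (h : TSeq.Inv ⟨m, τ, δ, Θ.map (Mem.sub σ), Δ.map (Fm.sub σ)⟩ S Z)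
    (h₁ : ∀ T x (P : ∀ T, Var Γ T → Prop), (σ T x).All P → (σ' T x).All P)
    (h₂ : ∀ T x, (σ T x).IsTree → (σ' T x).IsTree)
    (h₃ : ∀ T x, (σ T x).IsMark Z → (σ' T x).IsMark Z) :
    TSeq.Inv ⟨m, τ, δ, Θ.map (Mem.sub σ'), Δ.map (Fm.sub σ')⟩ S Z :=
  ⟨List.forall₂_map_right_iff.2 ((List.forall₂_map_right_iff.1 h.mem).imp
      fun _ _ => MemOk.sub_of_sub h₁ h₂ h₃),
    List.forall₂_map_right_iff.2 ((List.forall₂_map_right_iff.1 h.fm).imp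
      fun _ _ => FmOk.sub_of_sub h₁), h.ty⟩

theorem TSeq.Models.sub_of_sub {Γ' : Ctx} {σ σ' : Subs Γ' Γ} {Θ : List (Mem Γ')}
    {Δ : List (Fm Γ')} {U : Type u} {κ : Env U K} {ρ : Env U Γ} {P : Bool → Prop}
    (h : TSeq.Models ⟨m, τ, δ, Θ.map (Mem.sub σ), Δ.map (Fm.sub σ)⟩ P κ ρ)
    (hσ : σ.env ρ = σ'.env ρ) :
    TSeq.Models ⟨m, τ, δ, Θ.map (Mem.sub σ'), Δ.map (Fm.sub σ')⟩ P κ ρ := by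
  refine ⟨h.agree, List.forall₂_map_right_iff.2 ((List.forall₂_map_right_iff.1 h.mem).imp ?_),
    List.forall₂_map_right_iff.2 ((List.forall₂_map_right_iff.1 h.fm).imp ?_)⟩
  · intro a A h hp
    simpa [Mem.holds_sub, hσ] using h hp
  · intro a A h hp
    simpa [Fm.holds_sub, hσ] using h hp

theorem inst_all_of_beta {R : Ty} {a b : Tm Γ R}
    (h : ∀ P : ∀ T, Var Γ T → Prop, a.All P → b.All P) (T : Ty) (x : Var (R :: Γ) T)
    (P : ∀ T, Var Γ T → Prop) : (Subs.inst a T x).All P → (Subs.inst b T x).All P := by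
  cases x with
  | zero => exact h P
  | succ x => exact id

theorem inst_isTree_of_beta {R : Ty} {a b : Tm Γ R} (h : ¬ a.IsTree) (T : Ty)
    (x : Var (R :: Γ) T) : (Subs.inst a T x).IsTree → (Subs.inst b T x).IsTree := by
  cases x with
  | zero => exact fun h' => (h h').elim
  | succ x => exact id

theorem inst_isMark_of_beta {R : Ty} {a b : Tm Γ R} (h : ¬ a.IsMark Z) (T : Ty)
    (x : Var (R :: Γ) T) : (Subs.inst a T x).IsMark Z → (Subs.inst b T x).IsMark Z := by
  cases x with
  | zero => exact fun h' => (h h').elim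
  | succ x => exact id

/-- A redex is neither a tuple of variables nor a marked variable, so the shape of a membership
formula never relies on it; and contracting it can only remove variables. -/
theorem TSeq.Inv.beta {R : Ty} {a b : Tm Γ R} {Θ : List (Mem (R :: Γ))} {Δ : List (Fm (R :: Γ))}
    (h : TSeq.Inv ⟨m, τ, δ, Θ.map (Mem.sub (.inst a)), Δ.map (Fm.sub (.inst a))⟩ S Z)
    (h₁ : ∀ P : ∀ T, Var Γ T → Prop, a.All P → b.All P) (h₂ : ¬ a.IsTree) (h₃ : ¬ a.IsMark Z) :
    TSeq.Inv ⟨m, τ, δ, Θ.map (Mem.sub (.inst b)), Δ.map (Fm.sub (.inst b))⟩ S Z :=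
  h.sub_of_sub (inst_all_of_beta h₁) (inst_isTree_of_beta h₂) (inst_isMark_of_beta h₃)

theorem step_beta (P : Bool → Prop) {R : Ty} {a b : Tm Γ R} {Θ : List (Mem (R :: Γ))}
    {Δ : List (Fm (R :: Γ))} {t : Tm (R :: Γ) T} {v : Tm (R :: Γ) (.set T)}
    (h : ∀ (U : Type u) (ρ : Env U Γ), a.eval ρ = b.eval ρ) :
    Step.{u} P ⟨m, τ, δ, Θ.map (Mem.sub (.inst a)), Δ.map (Fm.sub (.inst a))⟩
      (t.sub (.inst a)) (v.sub (.inst a))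
      ⟨m, τ, δ, Θ.map (Mem.sub (.inst b)), Δ.map (Fm.sub (.inst b))⟩
      (t.sub (.inst b)) (v.sub (.inst b)) := by
  intro U _ κ ρ hρ
  have : (Subs.inst a).env ρ = (Subs.inst b).env ρ := by simp [h]
  exact ⟨ρ, hρ.sub_of_sub this, fun _ => by simp [Tm.eval_sub, h]⟩

/-! #### Expansion of variables of product type -/

/-- The values of the components of a variable. -/
def PMap.eta (m : PMap K Γ) {R₁ R₂ : Ty} (x : Var Γ (.prod R₁ R₂)) :
    PMap K (R₁ :: R₂ :: Γ) :=
  (m.cons ((m.get x).map .snd)).cons ((m.get x).map .fst)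

/-- Both components inherit the side of `x`, and they have values exactly if `x` has one. -/
theorem ok_eta {R₁ R₂ : Ty} (x : Var Γ (.prod R₁ R₂)) (T : Ty) (y : Var Γ T)
    (h : Ok m S p T y) :
    (Subs.eta x T y).All (Ok (m.eta x) (vcons (S _ x) (vcons (S _ x) S)) p) := by
  revert h
  refine Subs.upd_elim x _ _ (fun T y t => Ok m S p T y → t.All (Ok (m.eta x)
    (vcons (S _ x) (vcons (S _ x) S)) p)) ?_ ?_ T y
  · intro h
    exact ⟨by simpa [Ok, Tm.All, PMap.eta] using h, by simpa [Ok, Tm.All, PMap.eta] using h⟩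
  · intro T z _ h
    simpa [Ok, Tm.All, PMap.eta] using h

theorem eta_all_not {R₁ R₂ : Ty} (x : Var Γ (.prod R₁ R₂)) :
    ∀ T y, ¬ Z T y → (Subs.eta x T y).All (fun T x => ¬ vcons False (vcons False Z) T x) := by
  refine Subs.upd_elim x _ _ (fun T y t => ¬ Z T y → t.All
    (fun T x => ¬ vcons False (vcons False Z) T x)) ?_ ?_
  · exact fun _ => ⟨id, id⟩
  · exact fun T z _ h => h

theorem TSeq.Inv.eta {R₁ R₂ : Ty} (x : Var Γ (.prod R₁ R₂))
    (h : TSeq.Inv ⟨m, τ, δ, Θ, Δ⟩ S Z) :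
    TSeq.Inv ⟨m.eta x, τ, δ, Θ.map (Mem.sub (.eta x)), Δ.map (Fm.sub (.eta x))⟩
      (vcons (S _ x) (vcons (S _ x) S)) (vcons False (vcons False Z)) := by
  have h₃ : ∀ T y, (Subs.eta x T y).IsTree :=
    Subs.upd_elim x _ _ (fun T y t => t.IsTree) ⟨trivial, trivial⟩ fun _ _ _ => trivial
  have h₄ : ∀ T y, Z T y → (Subs.eta x T y).IsMark (vcons False (vcons False Z)) := by
    refine Subs.upd_elim x _ _
      (fun T y t => Z T y → t.IsMark (vcons False (vcons False Z))) ?_ ?_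
    · intro hz
      -- Marked variables have type `Set(Ur)`, so a variable of product type is not marked.
      cases h.ty _ _ hz
    · exact fun T z _ h => h
  refine ⟨List.forall₂_map_right_iff.2 (h.mem.imp fun _ _ h => h.sub (ok_eta x) (eta_all_not x) h₃ h₄),
    List.forall₂_map_right_iff.2 (h.fm.imp fun _ _ h => h.sub (ok_eta x) (eta_all_not x)), ?_⟩
  intro T y hy
  rcases y with _ | _ | y
  · exact hy.elim
  · exact hy.elim
  · exact h.ty _ _ hy

theorem step_eta (P : Bool → Prop) {R₁ R₂ : Ty} (x : Var Γ (.prod R₁ R₂)) :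
    Step.{u} P ⟨m, τ, δ, Θ, Δ⟩ t v
      ⟨m.eta x, τ, δ, Θ.map (Mem.sub (.eta x)), Δ.map (Fm.sub (.eta x))⟩
      (t.sub (.eta x)) (v.sub (.eta x)) := by
  intro U _ κ ρ h
  refine ⟨(ρ.cons (ρ _ x).2).cons (ρ _ x).1, ⟨?_, ?_, ?_⟩, fun _ => ?_⟩
  · intro T y e he
    rcases y with _ | _ | y
    · simp only [PMap.eta, PMap.get_cons_zero, Option.map_eq_some_iff] at he
      obtain ⟨e', he', rfl⟩ := he
      simp [Path.tm, Tm.eval, h.agree _ _ _ he']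
    · simp only [PMap.eta, PMap.get_cons_zero, PMap.get_cons_succ,
        Option.map_eq_some_iff] at he
      obtain ⟨e', he', rfl⟩ := he
      simp [Path.tm, Tm.eval, h.agree _ _ _ he']
    · exact h.agree _ y _ he
  · exact List.forall₂_map_right_iff.2 (h.mem.imp fun _ _ h hp => by
      simpa [Mem.holds_sub, Subs.env_eta] using h hp)
  · exact List.forall₂_map_right_iff.2 (h.fm.imp fun _ _ h hp => by
      simpa [Fm.holds_sub, Subs.env_eta] using h hp)
  · simp [Tm.eval_sub, Subs.env_eta]

end Rules

/-! ### Rules in which the two sides interact, right rules, exact definitions -/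

section Rules

variable {K Γ : Ctx} {m : PMap K Γ} {τ τ₁ τ₂ δ δ₁ δ₂ : List Bool} {Θ Θ₁ Θ₂ : List (Mem Γ)}
  {Δ Δ₁ Δ₂ : List (Fm Γ)} {S : ∀ T, Var Γ T → Bool} {Z : ∀ T, Var Γ T → Prop} {p q : Bool}
  {T : Ty} {t : Tm Γ T} {v : Tm Γ (.set T)}

theorem Mem.holds_congr {U : Type u} {ρ ρ' : Env U Γ} {A : Mem Γ} (h : MemOk m S Z p A)
    (hρ : ∀ T x, Ok m S p T x → ρ T x = ρ' T x) : A.holds ρ ↔ A.holds ρ' := by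
  rw [Mem.holds, Mem.holds, Tm.eval_congr (h.elt.mono hρ), Tm.eval_congr (h.set.mono hρ)]

/-! #### Substitution along an equality -/

/-- If `x` has a value and `y` has none, give the value of `x` to `y`. -/
def PMap.merge (m : PMap K Γ) {R : Ty} (x y : Var Γ R) : PMap K Γ :=
  match m.get x, m.get y with
  | some e, none => m.set y e
  | _, _ => m

theorem PMap.get_merge_of_isSome {R : Ty} (x y : Var Γ R) {z : Var Γ T}
    (h : (m.get z).isSome) : (m.merge x y).get z = m.get z := by
  unfold PMap.merge
  split
  · rename_i hy
    refine PMap.get_set_ne _ _ _ _ fun h' => ?_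
    cases h'
    simp [hy] at h
  · rfl

theorem PMap.isSome_merge {R : Ty} (x y : Var Γ R) (h : (m.get x).isSome) :
    ((m.merge x y).get y).isSome := by
  unfold PMap.merge
  split
  · simp [PMap.get_set_self]
  · rename_i h'
    obtain ⟨e, he⟩ := Option.isSome_iff_exists.1 h
    cases hy : m.get y with
    | none => exact (h' e he hy).elim
    | some e' => rfl

theorem PMap.of_isSome_merge {R : Ty} (x y : Var Γ R) {z : Var Γ T}
    (h : ((m.merge x y).get z).isSome) :
    (m.get z).isSome ∨ (⟨T, z⟩ : Σ T, Var Γ T) = ⟨R, y⟩ := by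
  unfold PMap.merge at h
  split at h
  · by_cases hz : (⟨T, z⟩ : Σ T, Var Γ T) = ⟨R, y⟩
    · exact .inr hz
    · rw [PMap.get_set_ne _ _ _ _ hz] at h
      exact .inl h
  · exact .inl h

theorem Agree.merge {U : Type u} {κ : Env U K} {ρ : Env U Γ} (h : Agree m κ ρ) {R : Ty}
    (x y : Var Γ R) (hxy : ρ _ x = ρ _ y) : Agree (m.merge x y) κ ρ := by
  unfold PMap.merge
  split
  · rename_i e hx _
    intro T z
    refine PMap.set_elim m y e (fun S z o => ∀ e, o = some e → e.tm.eval κ = ρ S z) ?_ ?_ z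
    · rintro _ ⟨⟩
      rw [h _ _ _ hx, hxy]
    · exact fun _ _ _ => h _ _
  · exact h

/-- If `x` has a value, then `y` has one after the merge and is allowed everywhere. Otherwise `x` is
exclusive to the side `p` of the equation, so it is replaced only in formulas of that side, where
`y` is allowed as well. -/
theorem ok_replace {R : Ty} {x y : Var Γ R} (hx : Ok m S p R x) (hy : Ok m S p R y)
    (T : Ty) (z : Var Γ T) (hz : Ok m S q T z) :
    (Subs.replace x y T z).All (Ok (m.merge x y) S q) := by
  have hmono : ∀ T (z : Var Γ T), Ok m S q T z → Ok (m.merge x y) S q T z := fun T z h =>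
    h.imp_left fun h => by rwa [PMap.get_merge_of_isSome x y h]
  revert hz
  refine Subs.upd_elim x _ _ (fun T z t => Ok m S q T z → t.All (Ok (m.merge x y) S q)) ?_ ?_ T z
  · intro hq
    rcases hx with hx | hx
    · exact .inl (PMap.isSome_merge x y hx)
    · rcases hq with hq | hq
      · exact .inl (PMap.isSome_merge x y hq)
      · have : p = q := hx.symm.trans hq
        subst this
        exact hmono _ _ hy
  · exact fun T z _ h => hmono T z h

/-- The new variable `y` has type Ur, whereas marked variables are sets. -/
theorem replace_all_not (hZ : ∀ T x, Z T x → T = .set .ur) (x y : Var Γ .ur) :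
    ∀ T z, ¬ Z T z → (Subs.replace x y T z).All (fun T x => ¬ Z T x) := by
  refine Subs.upd_elim x _ _ (fun T z t => ¬ Z T z → t.All (fun T x => ¬ Z T x)) ?_ ?_
  · intro _ hy
    cases hZ _ _ hy
  · exact fun T z _ h => h

theorem TSeq.Inv.eqSubst (hl : δ₁.length = Δ₁.length) {x y : Var Γ .ur}
    (h : TSeq.Inv ⟨m, τ, δ₁ ++ p :: δ₂, Θ, Δ₁ ++ .eq (.var x) (.var y) :: Δ₂⟩ S Z) :
    TSeq.Inv ⟨m.merge x y, τ, δ₁ ++ δ₂, Θ.map (Mem.sub (.replace x y)),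
      Δ₁.map (Fm.sub (.replace x y)) ++ Δ₂.map (Fm.sub (.replace x y))⟩ S Z := by
  have := h.fm
  simp only [forall₂_middle hl] at this
  obtain ⟨h₁, h₂, h₃⟩ := this
  have h₂' := replace_all_not h.ty x y
  have h₃' : ∀ T z, (Subs.replace x y T z).IsTree :=
    Subs.upd_elim x _ _ (fun T y t => t.IsTree) trivial fun _ _ _ => trivial
  have h₄' : ∀ T z, Z T z → (Subs.replace x y T z).IsMark Z := by
    refine Subs.upd_elim x _ _ (fun T z t => Z T z → t.IsMark Z) ?_ ?_
    · intro hz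
      cases h.ty _ _ hz
    · exact fun T z _ h => h
  refine ⟨List.forall₂_map_right_iff.2 (h.mem.imp fun _ _ h =>
    h.sub (ok_replace h₂.ok.1 h₂.ok.2) h₂' h₃' h₄'),
    (forall₂_append (by simpa using hl)).2 ⟨?_, ?_⟩, h.ty⟩
  · exact List.forall₂_map_right_iff.2 (h₁.imp fun _ _ h =>
      h.sub (ok_replace h₂.ok.1 h₂.ok.2) h₂')
  · exact List.forall₂_map_right_iff.2 (h₃.imp fun _ _ h =>
      h.sub (ok_replace h₂.ok.1 h₂.ok.2) h₂')

theorem step_eqSubst_same (P : Bool → Prop) (hp : P p) (hl : δ₁.length = Δ₁.length)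
    {x y : Var Γ .ur} :
    Step.{u} P ⟨m, τ, δ₁ ++ p :: δ₂, Θ, Δ₁ ++ .eq (.var x) (.var y) :: Δ₂⟩ t v
      ⟨m.merge x y, τ, δ₁ ++ δ₂, Θ.map (Mem.sub (.replace x y)),
        Δ₁.map (Fm.sub (.replace x y)) ++ Δ₂.map (Fm.sub (.replace x y))⟩
      (t.sub (.replace x y)) (v.sub (.replace x y)) := by
  intro U _ κ ρ h
  have := h.fm
  simp only [forall₂_middle hl] at this
  obtain ⟨h₁, h₂, h₃⟩ := this
  have hxy : ρ _ x = ρ _ y := h₂ hp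
  refine ⟨ρ, ⟨h.agree.merge x y hxy, ?_, (forall₂_append (by simpa using hl)).2 ⟨?_, ?_⟩⟩,
    fun _ => ?_⟩
  · exact List.forall₂_map_right_iff.2 (h.mem.imp fun _ _ h hp => by
      simpa [Mem.holds_sub, Subs.env_replace _ _ _ hxy] using h hp)
  · exact List.forall₂_map_right_iff.2 (h₁.imp fun _ _ h hp => by
      simpa [Fm.holds_sub, Subs.env_replace _ _ _ hxy] using h hp)
  · exact List.forall₂_map_right_iff.2 (h₃.imp fun _ _ h hp => by
      simpa [Fm.holds_sub, Subs.env_replace _ _ _ hxy] using h hp)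
  · simp [Tm.eval_sub, Subs.env_replace _ _ _ hxy]

/-- On the side that does not contain the equality, substitution is sound if the values of the
two variables are equal whenever both are common. -/
theorem eqSubst_other (hl : δ₁.length = Δ₁.length) {x y : Var Γ .ur} (hpq : p ≠ q)
    (hI : TSeq.Inv ⟨m, τ, δ₁ ++ p :: δ₂, Θ, Δ₁ ++ .eq (.var x) (.var y) :: Δ₂⟩ S Z)
    (ht : true = q → t.All (Ok m S q) ∧ v.All (Ok m S q))
    {U : Type u} {κ : Env U K} {ρ : Env U Γ}
    (h : TSeq.Models ⟨m, τ, δ₁ ++ p :: δ₂, Θ, Δ₁ ++ .eq (.var x) (.var y) :: Δ₂⟩ (· = q) κ ρ)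
    (hxy : ∀ e e', m.get x = some e → m.get y = some e' → e.tm.eval κ = e'.tm.eval κ) :
    ∃ ρ', TSeq.Models ⟨m.merge x y, τ, δ₁ ++ δ₂, Θ.map (Mem.sub (.replace x y)),
        Δ₁.map (Fm.sub (.replace x y)) ++ Δ₂.map (Fm.sub (.replace x y))⟩ (· = q) κ ρ' ∧
      (true = q → (t.sub (.replace x y)).eval ρ' = t.eval ρ ∧
        (v.sub (.replace x y)).eval ρ' = v.eval ρ) := by
  have := h.fm
  simp only [forall₂_middle hl] at this
  obtain ⟨h₁, h₂, h₃⟩ := this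
  have := hI.fm
  simp only [forall₂_middle hl] at this
  obtain ⟨hI₁, hI₂, hI₃⟩ := this
  have hx : Ok m S p _ x := hI₂.ok.1
  have hy : Ok m S p _ y := hI₂.ok.2
  -- In effect the model changes at most at `y`, and only if `y` has just become common through `x`.
  set ρ' := ρ.override (m.merge x y) κ with hρ'
  have hsome : ∀ T (z : Var Γ T) e, m.get z = some e → ρ' T z = ρ T z := by
    intro T z e he
    have := PMap.get_merge_of_isSome (m := m) x y (z := z) (by simp [he])
    simp [hρ', Env.override, this, he, h.agree _ _ _ he]
  have key : ∀ T (z : Var Γ T), Ok m S q T z → (Subs.replace x y).env ρ' T z = ρ T z := by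
    refine Subs.upd_elim x (.var y) (fun _ z => .var z)
      (fun T z t => Ok m S q T z → t.eval ρ' = ρ T z) ?_ ?_
    · intro hq
      -- If `x` is allowed on the side `q`, it must be common, because the equation lives on the
      -- side `p`.
      have hmx : (m.get x).isSome := by
        rcases hx with hx | hx
        · exact hx
        · exact hq.resolve_right fun h => hpq (hx.symm.trans h)
      obtain ⟨e, he⟩ := Option.isSome_iff_exists.1 hmx
      change ρ' _ y = ρ _ x
      rw [← h.agree _ _ _ he]
      cases hmy : m.get y with
      | some e' =>
        rw [hsome _ _ _ hmy, ← h.agree _ _ _ hmy, hxy e e' he hmy]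
      | none =>
        have : (m.merge x y).get y = some e := by
          simp only [PMap.merge, he, hmy]
          exact PMap.get_set_self _ _ _
        simp [hρ', Env.override, this]
    · intro T z _ hz
      change ρ' _ z = ρ _ z
      cases hmz : m.get z with
      | some e => exact hsome _ _ _ hmz
      | none =>
        cases hmz' : (m.merge x y).get z with
        | none => simp [hρ', Env.override, hmz']
        -- Here `z` is the newly common `y`. Without an old value it was exclusive to the side `p`,
        -- so it is not allowed on the side `q`.
        | some e =>
          rcases PMap.of_isSome_merge x y (z := z) (by rw [hmz']; rfl) with h' | h'
          · simp [hmz] at h'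
          · cases h'
            simp only [Ok, hmz, Option.isSome_none, Bool.false_eq_true, false_or] at hy hz
            exact (hpq (hy.symm.trans hz)).elim
  refine ⟨ρ', ⟨agree_override _ _ _, ?_, (forall₂_append (by simpa using hl)).2 ⟨?_, ?_⟩⟩,
    fun hq => ?_⟩
  · refine List.forall₂_map_right_iff.2 (forall₂_mp hI.mem h.mem ?_)
    rintro a A hA h rfl
    rw [Mem.holds_sub, Mem.holds_congr hA key]
    exact h rfl
  · refine List.forall₂_map_right_iff.2 (forall₂_mp hI₁ h₁ ?_)
    rintro a A hA h rfl
    rw [Fm.holds_sub, Fm.holds_congr (hA.ok.mono key)]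
    exact h rfl
  · refine List.forall₂_map_right_iff.2 (forall₂_mp hI₃ h₃ ?_)
    rintro a A hA h rfl
    rw [Fm.holds_sub, Fm.holds_congr (hA.ok.mono key)]
    exact h rfl
  · obtain ⟨h₁, h₂⟩ := ht hq
    rw [Tm.eval_sub, Tm.eval_sub, Tm.eval_congr (h₁.mono key), Tm.eval_congr (h₂.mono key)]
    exact ⟨rfl, rfl⟩

/-- At least one of the two variables has no value, and the side without the equation does not
mention it. That side can therefore be adapted to the substitution, and the interpolant needs no
test. -/
theorem Interp.eqSubst {g : Bool} (hl : δ₁.length = Δ₁.length) {x y : Var Γ .ur}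
    (hI : TSeq.Inv ⟨m, τ, δ₁ ++ p :: δ₂, Θ, Δ₁ ++ .eq (.var x) (.var y) :: Δ₂⟩ S Z)
    (ht : t.All (Ok m S true)) (hv : v.All (Ok m S true)) {E : Nrc g K (.set .unit)}
    (hxy : ∀ e e', m.get x = some e → m.get y = some e' → False)
    (hE : Interp.{u} ⟨m.merge x y, τ, δ₁ ++ δ₂, Θ.map (Mem.sub (.replace x y)),
        Δ₁.map (Fm.sub (.replace x y)) ++ Δ₂.map (Fm.sub (.replace x y))⟩
      (.mem (t.sub (.replace x y)) (v.sub (.replace x y))) E) :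
    Interp.{u} ⟨m, τ, δ₁ ++ p :: δ₂, Θ, Δ₁ ++ .eq (.var x) (.var y) :: Δ₂⟩ (.mem t v) E := by
  refine hE.of_step fun q => ?_
  by_cases hpq : p = q
  · subst hpq
    exact step_eqSubst_same (· = p) rfl hl
  · intro U _ κ ρ h
    refine eqSubst_other hl hpq hI ?_ h fun e e' he he' => (hxy e e' he he').elim
    rintro rfl
    exact ⟨ht, hv⟩

/-- Both variables are common, so the equation speaks of values that both sides see. The side
`false` knows it and hands it over as a conjunct of the interpolant. -/
theorem Interp.eqSubst_false {g : Bool} (hl : δ₁.length = Δ₁.length) {x y : Var Γ .ur}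
    (hI : TSeq.Inv ⟨m, τ, δ₁ ++ false :: δ₂, Θ, Δ₁ ++ .eq (.var x) (.var y) :: Δ₂⟩ S Z)
    (ht : t.All (Ok m S true)) (hv : v.All (Ok m S true)) {E : Nrc g K (.set .unit)}
    {e e' : Path K .ur} (he : m.get x = some e) (he' : m.get y = some e')
    (hE : Interp.{u} ⟨m.merge x y, τ, δ₁ ++ δ₂, Θ.map (Mem.sub (.replace x y)),
        Δ₁.map (Fm.sub (.replace x y)) ++ Δ₂.map (Fm.sub (.replace x y))⟩
      (.mem (t.sub (.replace x y)) (v.sub (.replace x y))) E) :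
    Interp.{u} ⟨m, τ, δ₁ ++ false :: δ₂, Θ, Δ₁ ++ .eq (.var x) (.var y) :: Δ₂⟩ (.mem t v)
      (.guardAnd (.neq (e.tm.nrc g) (e'.tm.nrc g)) E) := by
  refine ⟨fun U _ c₀ κ ρ h => ?_, fun U _ c₀ κ ρ h hT => ?_⟩
  · obtain ⟨ρ', h', -⟩ := step_eqSubst_same (t := t) (v := v) (· = false) rfl hl U κ ρ h
    have hxy : ρ _ x = ρ _ y := by
      have := h.fm
      simp only [forall₂_middle hl] at this
      exact this.2.1 (by trivial)
    simp only [Nrc.tr_guardAnd, Nrc.tr_neq, Tm.eval_nrc, ne_eq, not_not]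
    exact ⟨by rw [h.agree _ _ _ he, h.agree _ _ _ he', hxy], hE.fwd U c₀ κ ρ' h'⟩
  · simp only [Nrc.tr_guardAnd, Nrc.tr_neq, Tm.eval_nrc, ne_eq, not_not] at hT
    obtain ⟨ρ', h', h''⟩ := eqSubst_other hl (by simp) hI (fun _ => ⟨ht, hv⟩) h
      (by rw [he, he']; rintro _ _ ⟨⟩ ⟨⟩; exact hT.1)
    have := hE.bwd U c₀ κ ρ' h' hT.2
    rwa [Goal.holds, (h'' rfl).1, (h'' rfl).2] at this

/-- Now the side `true` knows the equation and can supply it, so it becomes a hypothesis of the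
interpolant. -/
theorem Interp.eqSubst_true {g : Bool} (hl : δ₁.length = Δ₁.length) {x y : Var Γ .ur}
    (hI : TSeq.Inv ⟨m, τ, δ₁ ++ true :: δ₂, Θ, Δ₁ ++ .eq (.var x) (.var y) :: Δ₂⟩ S Z)
    {E : Nrc g K (.set .unit)}
    {e e' : Path K .ur} (he : m.get x = some e) (he' : m.get y = some e')
    (hE : Interp.{u} ⟨m.merge x y, τ, δ₁ ++ δ₂, Θ.map (Mem.sub (.replace x y)),
        Δ₁.map (Fm.sub (.replace x y)) ++ Δ₂.map (Fm.sub (.replace x y))⟩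
      (.mem (t.sub (.replace x y)) (v.sub (.replace x y))) E) :
    Interp.{u} ⟨m, τ, δ₁ ++ true :: δ₂, Θ, Δ₁ ++ .eq (.var x) (.var y) :: Δ₂⟩ (.mem t v)
      (.union (.neq (e.tm.nrc g) (e'.tm.nrc g)) E) := by
  refine ⟨fun U _ c₀ κ ρ h => ?_, fun U _ c₀ κ ρ h hT => ?_⟩
  · simp only [Nrc.tr_union, Nrc.tr_neq, Tm.eval_nrc]
    rw [or_iff_not_imp_left, ne_eq, not_not]
    intro hT
    obtain ⟨ρ', h', -⟩ := eqSubst_other (t := t) (v := v) hl (by simp) hI (by simp) h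
      (by rw [he, he']; rintro _ _ ⟨⟩ ⟨⟩; exact hT)
    exact hE.fwd U c₀ κ ρ' h'
  · simp only [Nrc.tr_union, Nrc.tr_neq, Tm.eval_nrc] at hT
    have hxy : ρ _ x = ρ _ y := by
      have := h.fm
      simp only [forall₂_middle hl] at this
      exact this.2.1 (by trivial)
    have hT := hT.resolve_left (by simp [h.agree _ _ _ he, h.agree _ _ _ he', hxy])
    obtain ⟨ρ', h', h''⟩ := step_eqSubst_same (t := t) (v := v) (· = true) rfl hl U κ ρ h
    have := hE.bwd U c₀ κ ρ' h' hT
    rwa [Goal.holds, (h'' rfl).1, (h'' rfl).2] at this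

/-! #### Universal quantification -/

theorem TSeq.Inv.wk {R : Ty} (h : TSeq.Inv ⟨m, τ, δ, Θ, Δ⟩ S Z) :
    TSeq.Inv ⟨m.wk R, τ, δ, Θ, Δ⟩ S Z :=
  ⟨h.mem.imp fun _ _ h => h.mono (by simp), h.fm.imp fun _ _ h => h.mono (by simp), h.ty⟩

theorem TSeq.Inv.mono {K' : Ctx} {m' : PMap K' Γ} (h : TSeq.Inv ⟨m, τ, δ, Θ, Δ⟩ S Z)
    (hm : ∀ T (x : Var Γ T), (m.get x).isSome → (m'.get x).isSome) :
    TSeq.Inv ⟨m', τ, δ, Θ, Δ⟩ S Z :=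
  ⟨h.mem.imp fun _ _ h => h.mono hm, h.fm.imp fun _ _ h => h.mono hm, h.ty⟩

theorem TSeq.Models.wk {U : Type u} {κ : Env U K} {ρ : Env U Γ} {P : Bool → Prop}
    (h : TSeq.Models ⟨m, τ, δ, Θ, Δ⟩ P κ ρ) {R : Ty} (a : R.den U) :
    TSeq.Models ⟨m.wk R, τ, δ, Θ, Δ⟩ P (κ.cons a) ρ :=
  ⟨h.agree.wk a, h.mem, h.fm⟩

/-- The hypothesis `hs` holds either because membership and formula share their side or because `s`
has been captured. Marked variables stay out of the instance since they never occur in the element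
of a membership formula. -/
theorem TSeq.Inv.all (hl : δ₁.length = Δ₁.length) (hl' : τ₁.length = Θ₁.length) {R : Ty}
    {s : Tm Γ R} {z : Tm Γ (.set R)} {φ : Fm (R :: Γ)}
    (h : TSeq.Inv ⟨m, τ₁ ++ q :: τ₂, δ₁ ++ p :: δ₂, Θ₁ ++ ⟨R, s, z⟩ :: Θ₂,
      Δ₁ ++ .all z φ :: Δ₂⟩ S Z) (hs : s.All (Ok m S p)) :
    TSeq.Inv ⟨m, τ₁ ++ q :: τ₂, δ₁ ++ p :: δ₂, Θ₁ ++ ⟨R, s, z⟩ :: Θ₂,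
      Δ₁ ++ φ.sub (.inst s) :: Δ₂⟩ S Z := by
  have := h.fm
  simp only [forall₂_middle hl] at this
  obtain ⟨h₁, h₂, h₃⟩ := this
  have := h.mem
  simp only [forall₂_middle hl'] at this
  refine ⟨h.mem, (forall₂_middle hl).2 ⟨h₁, ⟨?_, ?_⟩, h₃⟩, h.ty⟩
  · rw [Fm.all_sub]
    refine h₂.ok.2.mono fun T x hx => ?_
    cases x with
    | zero => exact hs
    | succ x => exact hx
  · rw [Fm.all_sub]
    refine h₂.not.2.mono fun T x hx => ?_
    cases x with
    | zero => exact this.2.1.elt_not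
    | succ x => exact hx

/-- The element of the membership formula used with a universal formula is a tuple of
variables. -/
theorem TSeq.Inv.isTree (hl : δ₁.length = Δ₁.length) (hl' : τ₁.length = Θ₁.length) {R : Ty}
    {s : Tm Γ R} {z : Tm Γ (.set R)} {φ : Fm (R :: Γ)}
    (h : TSeq.Inv ⟨m, τ₁ ++ q :: τ₂, δ₁ ++ p :: δ₂, Θ₁ ++ ⟨R, s, z⟩ :: Θ₂,
      Δ₁ ++ .all z φ :: Δ₂⟩ S Z) : s.IsTree := by
  have h₁ := h.fm
  simp only [forall₂_middle hl] at h₁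
  have h₂ := h.mem
  simp only [forall₂_middle hl'] at h₂
  -- The bound of a quantifier in a formula is not marked, which excludes the second shape of
  -- membership formulas.
  have hz := h₁.2.1.not.1
  rcases h₂.2.1.shape with h | h
  · exact h
  · cases z with
    | var z => exact (hz h).elim
    | _ => exact h.elim

theorem TSeq.Models.all {U : Type u} {κ : Env U K} {ρ : Env U Γ} {P : Bool → Prop}
    (hl : δ₁.length = Δ₁.length) (hl' : τ₁.length = Θ₁.length) {R : Ty}
    {s : Tm Γ R} {z : Tm Γ (.set R)} {φ : Fm (R :: Γ)}
    (h : TSeq.Models ⟨m, τ₁ ++ q :: τ₂, δ₁ ++ p :: δ₂, Θ₁ ++ ⟨R, s, z⟩ :: Θ₂,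
      Δ₁ ++ .all z φ :: Δ₂⟩ P κ ρ) (hpq : P p → P q) :
    TSeq.Models ⟨m, τ₁ ++ q :: τ₂, δ₁ ++ p :: δ₂, Θ₁ ++ ⟨R, s, z⟩ :: Θ₂,
      Δ₁ ++ φ.sub (.inst s) :: Δ₂⟩ P κ ρ := by
  have := h.fm
  simp only [forall₂_middle hl] at this
  obtain ⟨h₁, h₂, h₃⟩ := this
  have := h.mem
  simp only [forall₂_middle hl'] at this
  refine ⟨h.agree, h.mem, (forall₂_middle hl).2 ⟨h₁, fun hp => ?_, h₃⟩⟩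
  rw [Fm.holds_sub, Subs.env_inst]
  exact h₂ hp _ (this.2.1 (hpq hp))

theorem step_all (P : Bool → Prop) (hl : δ₁.length = Δ₁.length) (hl' : τ₁.length = Θ₁.length)
    {R : Ty} {s : Tm Γ R} {z : Tm Γ (.set R)} {φ : Fm (R :: Γ)} (hpq : P p → P q) :
    Step.{u} P ⟨m, τ₁ ++ q :: τ₂, δ₁ ++ p :: δ₂, Θ₁ ++ ⟨R, s, z⟩ :: Θ₂, Δ₁ ++ .all z φ :: Δ₂⟩ t v
      ⟨m, τ₁ ++ q :: τ₂, δ₁ ++ p :: δ₂, Θ₁ ++ ⟨R, s, z⟩ :: Θ₂, Δ₁ ++ φ.sub (.inst s) :: Δ₂⟩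
      t v :=
  fun _ _ _ ρ h => ⟨ρ, h.all hl hl' hpq, fun _ => ⟨rfl, rfl⟩⟩

/-- Make the variables of the tuple `s` common, with values from a new variable. -/
def PMap.capture (m : PMap K Γ) {R : Ty} (s : Tm Γ R) : PMap (R :: K) Γ :=
  (m.wk R).bindTree s (.var .zero)

theorem PMap.isSome_capture {R : Ty} (s : Tm Γ R) (T : Ty) (x : Var Γ T)
    (h : (m.get x).isSome) : ((m.capture s).get x).isSome :=
  PMap.isSome_bindTree _ _ _ _ (by simpa using h)

theorem Agree.capture {U : Type u} {κ : Env U K} {ρ : Env U Γ} (h : Agree m κ ρ) {R : Ty}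
    (s : Tm Γ R) : Agree (m.capture s) (κ.cons (s.eval ρ)) ρ :=
  (h.wk _).bindTree _ _ rfl

theorem TSeq.Models.capture {U : Type u} {κ : Env U K} {ρ : Env U Γ} {P : Bool → Prop}
    (h : TSeq.Models ⟨m, τ, δ, Θ, Δ⟩ P κ ρ) {R : Ty} (s : Tm Γ R) :
    TSeq.Models ⟨m.capture s, τ, δ, Θ, Δ⟩ P (κ.cons (s.eval ρ)) ρ :=
  ⟨h.agree.capture s, h.mem, h.fm⟩

/-- On the other side, the captured variables may take the values that the new variable
prescribes. -/
theorem capture_other {U : Type u} {κ : Env U K} {ρ : Env U Γ} (hpq : p ≠ q)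
    (hI : TSeq.Inv ⟨m, τ, δ, Θ, Δ⟩ S Z)
    (h : TSeq.Models ⟨m, τ, δ, Θ, Δ⟩ (· = p) κ ρ) {R : Ty} {s : Tm Γ R}
    (hs : s.All (Ok m S q)) {e : Tm (R :: K) R} (he : s.tr (m.capture s) = some e)
    {a : R.den U} (ha : e.eval (κ.cons a) = a) :
    ∃ ρ', TSeq.Models ⟨m.capture s, τ, δ, Θ, Δ⟩ (· = p) (κ.cons a) ρ' ∧ s.eval ρ' = a ∧
      ∀ T x, Ok m S p T x → ρ' T x = ρ T x := by
  -- Newly captured variables are exclusive to the side `q`, so giving them the values prescribed by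
  -- `a` does not disturb the side `p`.
  set ρ' := ρ.override (m.capture s) (κ.cons a) with hρ'
  have key : ∀ T (x : Var Γ T), Ok m S p T x → ρ' T x = ρ T x := by
    intro T x hx
    cases hmx : m.get x with
    | some e =>
      have := PMap.get_bindTree_of_isSome (m.wk R) s (.var .zero) x (by simp [hmx])
      simp [hρ', Env.override, PMap.capture, this, hmx, h.agree _ _ _ hmx]
    | none =>
      cases hmx' : (m.capture s).get x with
      | none => simp [hρ', Env.override, hmx']
      | some e =>
        have h₁ := PMap.of_isSome_bindTree (m.wk R) s (.var .zero) hs x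
          (by rw [PMap.capture] at hmx'; simp [hmx'])
        simp only [PMap.get_wk, hmx, Ok, Option.map_none, Option.isSome_none,
          Bool.false_eq_true, false_or] at h₁ hx
        exact (hpq (hx.symm.trans h₁)).elim
  refine ⟨ρ', ⟨agree_override _ _ _, forall₂_mp hI.mem h.mem ?_, forall₂_mp hI.fm h.fm ?_⟩,
    ?_, key⟩
  · rintro _ A hA h rfl
    rw [Mem.holds_congr hA key]
    exact h rfl
  · rintro _ A hA h rfl
    rw [Fm.holds_congr (hA.ok.mono key)]
    exact h rfl
  · rw [← Tm.eval_tr (agree_override _ _ _) he, ha]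

/-- In a given model the value of `s` is an element of `z`, and the member of the union at this
element covers the object. No guard is needed, since a superset may be too large. -/
theorem Covers.all {g : Bool} (hl : δ₁.length = Δ₁.length) (hl' : τ₁.length = Θ₁.length)
    {R : Ty} {s : Tm Γ R} {z : Tm Γ (.set R)} {φ : Fm (R :: Γ)} {z' : Tm K (.set R)}
    (hz : z.tr m = some z') {E : Nrc g (R :: K) (.set T)}
    (hE : Covers.{u} ⟨m.capture s, τ₁ ++ q :: τ₂, δ₁ ++ p :: δ₂, Θ₁ ++ ⟨R, s, z⟩ :: Θ₂,
      Δ₁ ++ φ.sub (.inst s) :: Δ₂⟩ (.mem t v) E) :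
    Covers.{u} ⟨m, τ₁ ++ q :: τ₂, δ₁ ++ p :: δ₂, Θ₁ ++ ⟨R, s, z⟩ :: Θ₂,
      Δ₁ ++ .all z φ :: Δ₂⟩ (.mem t v) (.bigUnion (z'.nrc g) E) := by
  intro U _ c₀ κ ρ h
  have := hE U c₀ _ ρ ((h.all hl hl' fun _ => trivial).capture s)
  refine ⟨s.eval ρ, ?_, this⟩
  have := h.mem
  simp only [forall₂_middle hl'] at this
  rw [Tm.eval_nrc, Tm.eval_tr h.agree hz]
  exact this.2.1 trivial

/-- The models of the premise on the side of the universal formula. -/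
theorem all_other {U : Type u} {κ : Env U K} {ρ : Env U Γ} (hpq : p ≠ q)
    (hl : δ₁.length = Δ₁.length) {R : Ty} {s : Tm Γ R} {z : Tm Γ (.set R)} {φ : Fm (R :: Γ)}
    (hI : TSeq.Inv ⟨m, τ, δ₁ ++ p :: δ₂, Θ, Δ₁ ++ .all z φ :: Δ₂⟩ S Z)
    (h : TSeq.Models ⟨m, τ, δ₁ ++ p :: δ₂, Θ, Δ₁ ++ .all z φ :: Δ₂⟩ (· = p) κ ρ)
    (hs : s.All (Ok m S q)) {e : Tm (R :: K) R} (he : s.tr (m.capture s) = some e)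
    {a : R.den U} (ha : e.eval (κ.cons a) = a) (haz : a ∈ Ty.asSet (z.eval ρ)) :
    ∃ ρ', TSeq.Models ⟨m.capture s, τ, δ₁ ++ p :: δ₂, Θ, Δ₁ ++ φ.sub (.inst s) :: Δ₂⟩ (· = p)
        (κ.cons a) ρ' ∧ ∀ T x, Ok m S p T x → ρ' T x = ρ T x := by
  obtain ⟨ρ', h', rfl, key⟩ := capture_other hpq hI h hs he ha
  have h₁ := h'.fm
  simp only [forall₂_middle hl] at h₁
  have h₂ := hI.fm
  simp only [forall₂_middle hl] at h₂
  refine ⟨ρ', ⟨h'.agree, h'.mem, (forall₂_middle hl).2 ⟨h₁.1, fun _ => ?_, h₁.2.2⟩⟩, key⟩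
  rw [Fm.holds_sub, Subs.env_inst]
  refine h₁.2.1 (by trivial) _ ?_
  rwa [Tm.eval_congr (h₂.2.1.ok.1.mono key)]

/-- The side `false` knows an element of `z` and passes it on by an existential quantifier. The
guard discards elements that do not fit the tuple, which happens when a variable of `s` occurs twice
or already had a value. -/
theorem Interp.all_true {g : Bool} (hl : δ₁.length = Δ₁.length) (hl' : τ₁.length = Θ₁.length)
    {R : Ty} {s : Tm Γ R} {z : Tm Γ (.set R)} {φ : Fm (R :: Γ)}
    (hI : TSeq.Inv ⟨m, τ₁ ++ false :: τ₂, δ₁ ++ true :: δ₂, Θ₁ ++ ⟨R, s, z⟩ :: Θ₂,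
      Δ₁ ++ .all z φ :: Δ₂⟩ S Z)
    (ht : t.All (Ok m S true)) (hv : v.All (Ok m S true))
    {z' : Tm K (.set R)} (hz : z.tr m = some z') {e : Tm (R :: K) R}
    (he : s.tr (m.capture s) = some e) {E : Nrc g (R :: K) (.set .unit)}
    (hE : Interp.{u} ⟨m.capture s, τ₁ ++ false :: τ₂, δ₁ ++ true :: δ₂, Θ₁ ++ ⟨R, s, z⟩ :: Θ₂,
      Δ₁ ++ φ.sub (.inst s) :: Δ₂⟩ (.mem t v) E) :
    Interp.{u} ⟨m, τ₁ ++ false :: τ₂, δ₁ ++ true :: δ₂, Θ₁ ++ ⟨R, s, z⟩ :: Θ₂,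
      Δ₁ ++ .all z φ :: Δ₂⟩ (.mem t v)
      (.bigUnion (z'.nrc g) (.guardAnd (.neq (e.nrc g) (.var .zero)) E)) := by
  have hs := hI.mem
  simp only [forall₂_middle hl'] at hs
  refine ⟨fun U _ c₀ κ ρ h => ?_, fun U _ c₀ κ ρ h hT => ?_⟩
  · have h₁ := h.mem
    simp only [forall₂_middle hl'] at h₁
    have h₂ := (h.all hl hl' (by simp)).capture s
    simp only [Nrc.tr_bigUnion, Nrc.tr_guardAnd, Nrc.tr_neq, Tm.eval_nrc, ne_eq, not_not]
    refine ⟨s.eval ρ, ?_, ?_, hE.fwd U c₀ _ ρ h₂⟩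
    · rw [Tm.eval_tr h.agree hz]
      exact h₁.2.1 (by trivial)
    · rw [Tm.eval_tr (h.agree.capture s) he]
      rfl
  · simp only [Nrc.tr_bigUnion, Nrc.tr_guardAnd, Nrc.tr_neq, Tm.eval_nrc, ne_eq, not_not] at hT
    obtain ⟨a, haz, hae, hT⟩ := hT
    rw [Tm.eval_tr h.agree hz] at haz
    obtain ⟨ρ', h', key⟩ := all_other (by simp) hl hI h hs.2.1.elt he hae haz
    have := hE.bwd U c₀ _ ρ' h' hT
    rwa [Goal.holds, Tm.eval_congr (ht.mono key), Tm.eval_congr (hv.mono key)] at this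

/-- Dual situation: the side `true` knows the element of `z` and instantiates, while the side
`false` can establish the interpolant for every element of `z` that fits the tuple. -/
theorem Interp.all_false {g : Bool} (hl : δ₁.length = Δ₁.length) (hl' : τ₁.length = Θ₁.length)
    {R : Ty} {s : Tm Γ R} {z : Tm Γ (.set R)} {φ : Fm (R :: Γ)}
    (hI : TSeq.Inv ⟨m, τ₁ ++ true :: τ₂, δ₁ ++ false :: δ₂, Θ₁ ++ ⟨R, s, z⟩ :: Θ₂,
      Δ₁ ++ .all z φ :: Δ₂⟩ S Z)
    {z' : Tm K (.set R)} (hz : z.tr m = some z') {e : Tm (R :: K) R}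
    (he : s.tr (m.capture s) = some e) {E : Nrc g (R :: K) (.set .unit)} {G : Goal Γ}
    (hE : Interp.{u} ⟨m.capture s, τ₁ ++ true :: τ₂, δ₁ ++ false :: δ₂, Θ₁ ++ ⟨R, s, z⟩ :: Θ₂,
      Δ₁ ++ φ.sub (.inst s) :: Δ₂⟩ G E) :
    Interp.{u} ⟨m, τ₁ ++ true :: τ₂, δ₁ ++ false :: δ₂, Θ₁ ++ ⟨R, s, z⟩ :: Θ₂,
      Δ₁ ++ .all z φ :: Δ₂⟩ G
      (.neg (.bigUnion (z'.nrc g) (.neg (.union (.neq (e.nrc g) (.var .zero)) E)))) := by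
  have hs := hI.mem
  simp only [forall₂_middle hl'] at hs
  refine ⟨fun U _ c₀ κ ρ h => ?_, fun U _ c₀ κ ρ h hT => ?_⟩
  · simp only [Nrc.tr_neg, Nrc.tr_bigUnion, Nrc.tr_union, Nrc.tr_neq, Tm.eval_nrc, ne_eq]
    rintro ⟨a, haz, hT⟩
    rw [not_or, not_not] at hT
    rw [Tm.eval_tr h.agree hz] at haz
    obtain ⟨ρ', h', key⟩ := all_other (by simp) hl hI h hs.2.1.elt he hT.1 haz
    exact hT.2 (hE.fwd U c₀ _ ρ' h')
  · have h₁ := h.mem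
    simp only [forall₂_middle hl'] at h₁
    have h₂ := (h.all hl hl' (by simp)).capture s
    simp only [Nrc.tr_neg, Nrc.tr_bigUnion, Nrc.tr_union, Nrc.tr_neq, Tm.eval_nrc, ne_eq,
      not_exists, not_and, not_not] at hT
    have := hT (s.eval ρ) (by rw [Tm.eval_tr h.agree hz]; exact h₁.2.1 (by trivial))
    refine hE.bwd U c₀ _ ρ h₂ (this.resolve_left (not_not.2 ?_))
    rw [Tm.eval_tr (h.agree.capture s) he]
    rfl

/-! #### Membership on the right -/

theorem covers_of_right {g : Bool} (d : Deriv Γ Θ Δ (.mem t v)) {v' : Tm K (.set T)}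
    (hv : v.tr m = some v') : Covers.{u} ⟨m, τ, δ, Θ, Δ⟩ (.mem t v) (v'.nrc g) := by
  intro U _ c₀ κ ρ h
  have := h.sound d
  rwa [Goal.holds, ← Tm.eval_tr h.agree hv, ← Tm.eval_nrc c₀] at this

theorem covers_of_elt {g : Bool} {t' : Tm K T}
    (ht : t.tr m = some t') : Covers.{u} ⟨m, τ, δ, Θ, Δ⟩ (.mem t v) (.sing (t'.nrc g)) := by
  intro U _ c₀ κ ρ h
  change t.eval ρ = (t'.nrc g).eval c₀ κ
  rw [Tm.eval_nrc, Tm.eval_tr h.agree ht]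

theorem interp_memUr_false {g : Bool} (hl' : τ₁.length = Θ₁.length) {t' : Tm K T}
    {v' : Tm K (.set T)} (ht : t.tr m = some t') (hv : v.tr m = some v') :
    Interp.{u} ⟨m, τ₁ ++ false :: τ₂, δ, Θ₁ ++ ⟨T, t, v⟩ :: Θ₂, Δ⟩ (.mem t v)
      (.isMem (t'.nrc g) (v'.nrc g)) := by
  refine ⟨fun U _ c₀ κ ρ h => ?_, fun U _ c₀ κ ρ h hT => ?_⟩
  · have h₁ := h.mem
    simp only [forall₂_middle hl'] at h₁
    rw [Nrc.tr_isMem, Tm.eval_nrc, Tm.eval_nrc, Tm.eval_tr h.agree ht, Tm.eval_tr h.agree hv]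
    exact h₁.2.1 (by trivial)
  · rwa [Nrc.tr_isMem, Tm.eval_nrc, Tm.eval_nrc, Tm.eval_tr h.agree ht,
      Tm.eval_tr h.agree hv] at hT

theorem interp_memUr_true {g : Bool} (hl' : τ₁.length = Θ₁.length) :
    Interp.{u} ⟨m, τ₁ ++ true :: τ₂, δ, Θ₁ ++ ⟨T, t, v⟩ :: Θ₂, Δ⟩ (.mem t v) (.tt (g := g)) := by
  refine ⟨fun U _ c₀ κ ρ h => Nrc.tr_tt _ _, fun U _ c₀ κ ρ h hT => ?_⟩
  have h₁ := h.mem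
  simp only [forall₂_middle hl'] at h₁
  exact h₁.2.1 (by trivial)

theorem Covers.memR {g : Bool} {s : Tm Γ T} {E : Nrc g K (.set T)}
    (hE : Covers.{u} ⟨m, τ, δ, Θ, Δ⟩ (.eq s t) E) :
    Covers.{u} ⟨m, τ, δ, Θ, Δ⟩ (.mem t v) E :=
  hE

theorem Interp.memR_true {g : Bool} (hl' : τ₁.length = Θ₁.length) {s : Tm Γ T}
    {E : Nrc g K (.set .unit)}
    (hE : Interp.{u} ⟨m, τ₁ ++ true :: τ₂, δ, Θ₁ ++ ⟨T, s, v⟩ :: Θ₂, Δ⟩ (.eq s t) E) :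
    Interp.{u} ⟨m, τ₁ ++ true :: τ₂, δ, Θ₁ ++ ⟨T, s, v⟩ :: Θ₂, Δ⟩ (.mem t v) E := by
  refine ⟨hE.fwd, fun U _ c₀ κ ρ h hT => ?_⟩
  have h₁ := h.mem
  simp only [forall₂_middle hl'] at h₁
  have h₂ : s.eval ρ = t.eval ρ := hE.bwd U c₀ κ ρ h hT
  rw [Goal.holds, ← h₂]
  exact h₁.2.1 (by trivial)

/-- The side `false` exports its element of `v` by an existential quantifier. On the side `true` the
captured `s` then denotes an element of `v`, and the premise identifies it with `t`. -/
theorem Interp.memR_false {g : Bool} (hl' : τ₁.length = Θ₁.length) {s : Tm Γ T}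
    (hI : TSeq.Inv ⟨m, τ₁ ++ false :: τ₂, δ, Θ₁ ++ ⟨T, s, v⟩ :: Θ₂, Δ⟩ S Z)
    (ht : t.All (Ok m S true))
    {v' : Tm K (.set T)} (hv : v.tr m = some v') {e : Tm (T :: K) T}
    (he : s.tr (m.capture s) = some e) {E : Nrc g (T :: K) (.set .unit)}
    (hE : Interp.{u} ⟨m.capture s, τ₁ ++ false :: τ₂, δ, Θ₁ ++ ⟨T, s, v⟩ :: Θ₂, Δ⟩ (.eq s t) E) :
    Interp.{u} ⟨m, τ₁ ++ false :: τ₂, δ, Θ₁ ++ ⟨T, s, v⟩ :: Θ₂, Δ⟩ (.mem t v)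
      (.bigUnion (v'.nrc g) (.guardAnd (.neq (e.nrc g) (.var .zero)) E)) := by
  have hs := hI.mem
  simp only [forall₂_middle hl'] at hs
  refine ⟨fun U _ c₀ κ ρ h => ?_, fun U _ c₀ κ ρ h hT => ?_⟩
  · have h₁ := h.mem
    simp only [forall₂_middle hl'] at h₁
    simp only [Nrc.tr_bigUnion, Nrc.tr_guardAnd, Nrc.tr_neq, Tm.eval_nrc, ne_eq, not_not]
    refine ⟨s.eval ρ, ?_, ?_, hE.fwd U c₀ _ ρ (h.capture s)⟩
    · rw [Tm.eval_tr h.agree hv]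
      exact h₁.2.1 (by trivial)
    · rw [Tm.eval_tr (h.agree.capture s) he]
      rfl
  · simp only [Nrc.tr_bigUnion, Nrc.tr_guardAnd, Nrc.tr_neq, Tm.eval_nrc, ne_eq, not_not] at hT
    obtain ⟨a, hav, hae, hT⟩ := hT
    rw [Tm.eval_tr h.agree hv] at hav
    obtain ⟨ρ', h', rfl, key⟩ := capture_other (by simp) hI h hs.2.1.elt he hae
    have h₂ : s.eval ρ' = t.eval ρ' := hE.bwd U c₀ _ ρ' h' hT
    rwa [h₂, Tm.eval_congr (ht.mono key)] at hav

/-- At Ur type `s` may be an arbitrary term, which cannot be captured. Separating `s ∈ z` from `t ∈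
z` for common `z` suffices: with `v` for `z`, the side `false` knows the former and the side `true`
concludes the latter. -/
theorem Interp.memR_ur {g : Bool} (hl' : τ₁.length = Θ₁.length) {s t : Tm Γ .ur}
    {v : Tm Γ (.set .ur)} {v' : Tm K (.set .ur)} (hv : v.tr m = some v')
    {E : Nrc g (.set .ur :: K) (.set .unit)}
    (hE : InterpUr.{u} ⟨m.wk _, τ₁ ++ false :: τ₂, δ, Θ₁ ++ ⟨.ur, s, v⟩ :: Θ₂, Δ⟩ s t E) :
    Interp.{u} ⟨m, τ₁ ++ false :: τ₂, δ, Θ₁ ++ ⟨.ur, s, v⟩ :: Θ₂, Δ⟩ (.mem t v)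
      (.letIn (v'.nrc g) E) := by
  refine ⟨fun U _ c₀ κ ρ h => ?_, fun U _ c₀ κ ρ h hT => ?_⟩
  · have h₁ := h.mem
    simp only [forall₂_middle hl'] at h₁
    rw [Nrc.tr_letIn]
    refine hE.fwd U c₀ _ ρ (h.wk _) ?_
    simp only [Env.cons_zero, Tm.eval_nrc, Tm.eval_tr h.agree hv]
    exact h₁.2.1 (by trivial)
  · rw [Nrc.tr_letIn] at hT
    have := hE.bwd U c₀ _ ρ (h.wk _) hT
    simp only [Env.cons_zero, Tm.eval_nrc, Tm.eval_tr h.agree hv] at this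
    exact this

/-! #### Equality and inclusion on the right -/

theorem Interp.conj_set {g : Bool} {t v : Tm Γ (.set T)} {s : TSeq K Γ}
    {E F : Nrc g K (.set .unit)} (hE : Interp.{u} s (.sub t v) E)
    (hF : Interp.{u} s (.sub v t) F) : Interp.{u} s (.eq t v) (.conj E F) := by
  refine ⟨fun U _ c₀ κ ρ h => ?_, fun U _ c₀ κ ρ h hT => ?_⟩
  · rw [Nrc.tr_conj]
    exact ⟨hE.fwd U c₀ κ ρ h, hF.fwd U c₀ κ ρ h⟩
  · rw [Nrc.tr_conj] at hT
    exact Set.Subset.antisymm (hE.bwd U c₀ κ ρ h hT.1) (hF.bwd U c₀ κ ρ h hT.2)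

theorem Interp.conj_prod {g : Bool} {T₁ T₂ : Ty} {t v : Tm Γ (.prod T₁ T₂)} {s : TSeq K Γ}
    {E F : Nrc g K (.set .unit)} (hE : Interp.{u} s (.eq t.fst v.fst) E)
    (hF : Interp.{u} s (.eq t.snd v.snd) F) : Interp.{u} s (.eq t v) (.conj E F) := by
  refine ⟨fun U _ c₀ κ ρ h => ?_, fun U _ c₀ κ ρ h hT => ?_⟩
  · rw [Nrc.tr_conj]
    exact ⟨hE.fwd U c₀ κ ρ h, hF.fwd U c₀ κ ρ h⟩
  · rw [Nrc.tr_conj] at hT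
    exact Prod.ext (hE.bwd U c₀ κ ρ h hT.1) (hF.bwd U c₀ κ ρ h hT.2)

theorem interp_unit {g : Bool} {t v : Tm Γ .unit} {s : TSeq K Γ} :
    Interp.{u} s (.eq t v) (.tt (g := g)) :=
  ⟨fun _ _ _ _ _ _ => Nrc.tr_tt _ _, fun _ _ _ _ _ _ _ => rfl⟩

theorem covers_unit {g : Bool} {t v : Tm Γ .unit} {s : TSeq K Γ} :
    Covers.{u} s (.eq t v) (.tt (g := g)) :=
  fun _ _ _ _ _ _ => rfl

/-- The second superset is computed in a context with one more variable because it is placed under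
the binder of the first. -/
theorem Covers.prod {g : Bool} {T₁ T₂ : Ty} {t v : Tm Γ (.prod T₁ T₂)}
    {E : Nrc g K (.set T₁)} {F : Nrc g (T₁ :: K) (.set T₂)}
    (hE : Covers.{u} ⟨m, τ, δ, Θ, Δ⟩ (.eq t.fst v.fst) E)
    (hF : Covers.{u} ⟨m.wk T₁, τ, δ, Θ, Δ⟩ (.eq t.snd v.snd) F) :
    Covers.{u} ⟨m, τ, δ, Θ, Δ⟩ (.eq t v) (.product E F) :=
  fun U _ c₀ κ ρ h => Nrc.mem_product c₀ κ E F _ _ (hE U c₀ κ ρ h) (hF U c₀ _ ρ (h.wk _))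

theorem Covers.ur {g : Bool} {t v : Tm Γ .ur} {E : Nrc g K (.set .ur)}
    (hE : Covers.{u} ⟨m.cons none, false :: τ, δ,
      ⟨.ur, t.wk _, .var .zero⟩ :: Θ.map (Mem.wk (.set .ur)), Δ.map (Fm.wk (.set .ur))⟩
      (.mem (v.wk _) (.var .zero)) E) :
    Covers.{u} ⟨m, τ, δ, Θ, Δ⟩ (.eq t v) E := by
  intro U _ c₀ κ ρ h
  have := hE U c₀ κ (ρ.cons (S := .set .ur) ({t.eval ρ} : Set U)) (h.fresh (by simp) (fun _ => by
    simp [Mem.holds, Tm.eval]))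
  simp only [Goal.Covered, Tm.eval_wk] at this
  exact this

theorem Covers.sub {g : Bool} {t v : Tm Γ (.set T)} {E : Nrc g K (.set T)}
    (hE : Covers.{u} ⟨m.cons none, true :: τ, δ,
      ⟨T, .var .zero, t.wk _⟩ :: Θ.map (Mem.wk T), Δ.map (Fm.wk T)⟩
      (.mem (.var .zero) (v.wk _)) E) :
    Covers.{u} ⟨m, τ, δ, Θ, Δ⟩ (.sub t v) E := by
  intro U _ c₀ κ ρ h a ha
  have := hE U c₀ κ (ρ.cons a) (h.fresh (by simp) (fun _ => by
    simpa [Mem.holds, Tm.eval] using ha))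
  simp only [Goal.Covered, Tm.eval, Env.cons_zero] at this
  exact this

theorem Interp.ur {g : Bool} {t v : Tm Γ .ur} {E : Nrc g K (.set .unit)}
    (hE : Interp.{u} ⟨m.cons none, true :: τ, δ,
      ⟨.ur, t.wk _, .var .zero⟩ :: Θ.map (Mem.wk (.set .ur)), Δ.map (Fm.wk (.set .ur))⟩
      (.mem (v.wk _) (.var .zero)) E) :
    Interp.{u} ⟨m, τ, δ, Θ, Δ⟩ (.eq t v) E := by
  refine ⟨fun U _ c₀ κ ρ h => ?_, fun U _ c₀ κ ρ h hT => ?_⟩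
  -- The new membership belongs to the side `true`; for the side `false` any set would do.
  · exact hE.fwd U c₀ κ (ρ.cons (S := .set .ur) (∅ : Set U)) (h.fresh (by simp) (by simp))
  · have := hE.bwd U c₀ κ (ρ.cons (S := .set .ur) ({t.eval ρ} : Set U))
      (h.fresh (by simp) (fun _ => by simp [Mem.holds, Tm.eval])) hT
    simp only [Goal.holds, Tm.eval, Tm.eval_wk, Env.cons_zero] at this
    exact (Set.mem_singleton_iff.1 this).symm

theorem Interp.sub {g : Bool} {t v : Tm Γ (.set T)} {E : Nrc g K (.set .unit)}
    (hE : Interp.{u} ⟨m.cons none, true :: τ, δ,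
      ⟨T, .var .zero, t.wk _⟩ :: Θ.map (Mem.wk T), Δ.map (Fm.wk T)⟩
      (.mem (.var .zero) (v.wk _)) E) :
    Interp.{u} ⟨m, τ, δ, Θ, Δ⟩ (.sub t v) E := by
  refine ⟨fun U _ c₀ κ ρ h => ?_, fun U _ c₀ κ ρ h hT a ha => ?_⟩
  · obtain ⟨a⟩ := exists_den U T
    exact hE.fwd U c₀ κ (ρ.cons a) (h.fresh (by simp) (by simp))
  · have := hE.bwd U c₀ κ (ρ.cons a) (h.fresh (by simp) (fun _ => by
      simpa [Mem.holds, Tm.eval] using ha)) hT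
    simpa [Goal.holds, Tm.eval] using this

/-- The fresh variable is made common, with the first variable of the expression as its value,
instead of being hidden on one side. -/
theorem InterpUr.of_interp {g : Bool} {m : PMap (.set .ur :: K) Γ} {t v : Tm Γ .ur}
    {E : Nrc g (.set .ur :: K) (.set .unit)}
    (hE : Interp.{u} ⟨m.cons (some (.var .zero)), false :: τ, δ,
      ⟨.ur, t.wk _, .var .zero⟩ :: Θ.map (Mem.wk (.set .ur)), Δ.map (Fm.wk (.set .ur))⟩
      (.mem (v.wk _) (.var .zero)) E) :
    InterpUr.{u} ⟨m, τ, δ, Θ, Δ⟩ t v E := by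
  refine ⟨fun U _ c₀ κ ρ h ht => ?_, fun U _ c₀ κ ρ h hT => ?_⟩
  · refine hE.fwd U c₀ κ (ρ.cons (κ _ .zero)) (h.fresh ?_ ?_)
    · rintro _ ⟨⟩
      rfl
    · intro _
      simpa [Mem.holds, Tm.eval] using ht
  · have := hE.bwd U c₀ κ (ρ.cons (κ _ .zero)) (h.fresh (by rintro _ ⟨⟩; rfl) (by simp)) hT
    simpa [Goal.holds, Tm.eval] using this

theorem InterpSub.of_interp {g : Bool} {m : PMap (T :: K) Γ} {t v : Tm Γ (.set T)}
    {E : Nrc g (T :: K) (.set .unit)}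
    (hE : Interp.{u} ⟨m.cons (some (.var .zero)), false :: τ, δ,
      ⟨T, .var .zero, t.wk _⟩ :: Θ.map (Mem.wk T), Δ.map (Fm.wk T)⟩
      (.mem (.var .zero) (v.wk _)) E) :
    InterpSub.{u} ⟨m, τ, δ, Θ, Δ⟩ t v E := by
  refine ⟨fun U _ c₀ κ ρ h ht => ?_, fun U _ c₀ κ ρ h hT => ?_⟩
  · refine hE.fwd U c₀ κ (ρ.cons (κ _ .zero)) (h.fresh ?_ ?_)
    · rintro _ ⟨⟩
      rfl
    · intro _
      simpa [Mem.holds, Tm.eval] using ht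
  · have := hE.bwd U c₀ κ (ρ.cons (κ _ .zero)) (h.fresh (by rintro _ ⟨⟩; rfl) (by simp)) hT
    simpa [Goal.holds, Tm.eval] using this

/-! #### Exact definitions -/

/-- The value of the expression is the value of the second term. -/
def Defines {g : Bool} (s : TSeq K Γ) (v : Tm Γ T) (E : Nrc g K T) : Prop :=
  ∀ (U : Type u) [Nonempty U] (c₀ : g = true → U) (κ : Env U K) (ρ : Env U Γ),
    s.Models (fun _ => True) κ ρ → E.eval c₀ κ = v.eval ρ

/-- The inclusion `v ⊆ t` bounds `v` from above; `t ⊆ v` provides a test that is passed by the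
elements of `t` and only by elements of `v`. Since `t = v` in every model of both sides, the filter
is exact. -/
theorem defines_set {g : Bool} {t v : Tm Γ (.set T)} (d : Deriv Γ Θ Δ (.eq t v))
    {E : Nrc g K (.set T)} {F : Nrc g (T :: K) (.set .unit)}
    (hE : Covers.{u} ⟨m, τ, δ, Θ, Δ⟩ (.sub v t) E)
    (hF : InterpSub.{u} ⟨m.wk T, τ, δ, Θ, Δ⟩ t v F) :
    Defines.{u} ⟨m, τ, δ, Θ, Δ⟩ v (.filter E F) := by
  intro U _ c₀ κ ρ h
  have htv : t.eval ρ = v.eval ρ := h.sound d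
  refine Set.ext fun a => ?_
  refine (Nrc.mem_filter c₀ κ E F a).trans ⟨fun ha => ?_, fun ha => ⟨hE U c₀ κ ρ h ha, ?_⟩⟩
  · exact hF.bwd U c₀ (κ.cons a) ρ ((h.wk a).side _) ha.2
  · refine hF.fwd U c₀ (κ.cons a) ρ ((h.wk a).side _) ?_
    rw [htv]
    exact ha

theorem Defines.covers {g : Bool} {t v : Tm Γ T} {s : TSeq K Γ} {E : Nrc g K T}
    (hE : Defines.{u} s v E) : Covers.{u} s (.eq t v) (.sing E) :=
  fun U _ c₀ κ ρ h => (hE U c₀ κ ρ h).symm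

theorem Defines.prod {g : Bool} {T₁ T₂ : Ty} {v : Tm Γ (.prod T₁ T₂)} {s : TSeq K Γ}
    {E : Nrc g K T₁} {F : Nrc g K T₂} (hE : Defines.{u} s v.fst E)
    (hF : Defines.{u} s v.snd F) : Defines.{u} s v (.pair E F) :=
  fun U _ c₀ κ ρ h => Prod.ext (hE U c₀ κ ρ h) (hF U c₀ κ ρ h)

theorem defines_unit {g : Bool} {v : Tm Γ .unit} {s : TSeq K Γ} :
    Defines.{u} s v (.unit (g := g)) :=
  fun _ _ _ _ _ _ => rfl

theorem getOr_singleton {X : Type u} (x d : X) : getOr {x} d = x := by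
  have h : ∃ y, ({x} : Set X) = {y} := ⟨x, rfl⟩
  rw [getOr, dif_pos h]
  exact (Set.singleton_injective h.choose_spec).symm

/-- With `z = {a}` the test separates `t = a` from `v = a`, and these are equivalent because `t =
v`. The filtered set is the singleton of the value of `v`, so `Get` does not fall back on its
default. -/
theorem defines_ur {g : Bool} (hg : g = true) {t v : Tm Γ .ur} (d : Deriv Γ Θ Δ (.eq t v))
    {E : Nrc g K (.set .ur)} {F : Nrc g (.set .ur :: .ur :: K) (.set .unit)}
    (hE : Covers.{u} ⟨m, τ, δ, Θ, Δ⟩ (.eq t v) E)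
    (hF : InterpUr.{u} ⟨(m.wk .ur).wk (.set .ur), τ, δ, Θ, Δ⟩ t v F) :
    Defines.{u} ⟨m, τ, δ, Θ, Δ⟩ v
      (.get hg (.filter E (.letIn (.sing (.var .zero)) F))) := by
  intro U _ c₀ κ ρ h
  have htv : t.eval ρ = v.eval ρ := h.sound d
  have key : (Nrc.filter E (.letIn (.sing (.var .zero)) F)).eval c₀ κ =
      ({v.eval ρ} : Set U) := by
    refine Set.ext fun a => ?_
    refine (Nrc.mem_filter c₀ κ E _ a).trans ?_
    rw [Nrc.tr_letIn, Set.mem_singleton_iff]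
    have h' := (h.wk (R := .ur) a).wk (R := .set .ur)
      ((Nrc.sing (.var .zero) : Nrc g (.ur :: K) _).eval c₀ (κ.cons (S := .ur) a))
    constructor
    · intro ha
      exact (hF.bwd U c₀ _ ρ (h'.side _) ha.2 : v.eval ρ = a).symm
    · rintro rfl
      exact ⟨hE U c₀ κ ρ h, hF.fwd U c₀ _ ρ (h'.side _) htv⟩
  rw [Nrc.eval, key]
  exact getOr_singleton _ _

end Rules

/-! ### Execution of programs -/

/-- Determinism makes the choice in `fn` harmless: any terminating run of a call gives its value and
its cost. -/
theorem Run.det {P : Program} {vs : List Data} {e : Code} {a b : Data} {m n : ℕ}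
    (h : Run P vs e a m) (h' : Run P vs e b n) : a = b ∧ m = n := by
  induction h generalizing b n with
  | var h =>
    cases h' with
    | var h' => simp_all
  | nil => cases h'; simp
  | cons _ _ ih₁ ih₂ =>
    cases h' with
    | cons h₁ h₂ =>
      obtain ⟨rfl, rfl⟩ := ih₁ h₁
      obtain ⟨rfl, rfl⟩ := ih₂ h₂
      simp
  | caseNil _ _ ih₁ ih₂ =>
    cases h' with
    | caseNil h₁ h₂ =>
      obtain ⟨-, rfl⟩ := ih₁ h₁
      obtain ⟨rfl, rfl⟩ := ih₂ h₂
      simp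
    | caseCons h₁ h₂ => cases (ih₁ h₁).1
  | caseCons _ _ ih₁ ih₂ =>
    cases h' with
    | caseNil h₁ h₂ => cases (ih₁ h₁).1
    | caseCons h₁ h₂ =>
      obtain ⟨h, rfl⟩ := ih₁ h₁
      cases h
      obtain ⟨rfl, rfl⟩ := ih₂ h₂
      simp
  | bind _ _ ih₁ ih₂ =>
    cases h' with
    | bind h₁ h₂ =>
      obtain ⟨rfl, rfl⟩ := ih₁ h₁
      obtain ⟨rfl, rfl⟩ := ih₂ h₂
      simp
  | call hb _ _ ih₁ ih₂ =>
    cases h' with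
    | call hb' h₁ h₂ =>
      obtain ⟨rfl, rfl⟩ := ih₁ h₁
      rw [hb] at hb'
      cases hb'
      obtain ⟨rfl, rfl⟩ := ih₂ h₂
      simp

open Classical in
/-- The result and the cost of a function call, if it ends. -/
noncomputable def fn (P : Program) (f : ℕ) (a : Data) : Option (Data × ℕ) :=
  if h : ∃ r : Data × ℕ, ∃ body, P[f]? = some body ∧ Run P [a] body r.1 r.2
    then some h.choose else none

/-- The result and the cost of the evaluation of a code. -/
noncomputable def ev (P : Program) : List Data → Code → Option (Data × ℕ)
  | vs, .var i =>
    match vs[i]? with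
    | some a => some (a, a.size + 1)
    | none => none
  | _, .nil => some (.nil, 1)
  | vs, .cons e₁ e₂ =>
    match ev P vs e₁ with
    | some (a, m) =>
      match ev P vs e₂ with
      | some (b, n) => some (.cons a b, m + n + 1)
      | none => none
    | none => none
  | vs, .case e e₁ e₂ =>
    match ev P vs e with
    | some (.nil, m) =>
      match ev P vs e₁ with
      | some (c, n) => some (c, m + n + 1)
      | none => none
    | some (.cons a b, m) =>
      match ev P (a :: b :: vs) e₂ with
      | some (c, n) => some (c, m + n + 1)
      | none => none
    | none => none
  | vs, .bind e₁ e₂ =>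
    match ev P vs e₁ with
    | some (a, m) =>
      match ev P (a :: vs) e₂ with
      | some (c, n) => some (c, m + n + 1)
      | none => none
    | none => none
  | vs, .call f e =>
    match ev P vs e with
    | some (a, m) =>
      match fn P f a with
      | some (c, n) => some (c, m + n + 1)
      | none => none
    | none => none

theorem fn_of_run {P : Program} {f : ℕ} {a b : Data} {n : ℕ} {body : Code}
    (hb : P[f]? = some body) (h : Run P [a] body b n) : fn P f a = some (b, n) := by
  have hex : ∃ r : Data × ℕ, ∃ body, P[f]? = some body ∧ Run P [a] body r.1 r.2 :=
    ⟨(b, n), body, hb, h⟩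
  rw [fn, dif_pos hex]
  obtain ⟨body', hb', h'⟩ := hex.choose_spec
  rw [hb] at hb'
  cases hb'
  obtain ⟨h₁, h₂⟩ := h'.det h
  exact congrArg some (Prod.ext h₁ h₂)

theorem run_of_fn {P : Program} {f : ℕ} {a b : Data} {n : ℕ} (h : fn P f a = some (b, n)) :
    ∃ body, P[f]? = some body ∧ Run P [a] body b n := by
  unfold fn at h
  split at h
  · rename_i hex
    have := hex.choose_spec
    rw [Option.some.inj h] at this
    exact this
  · cases h

/-- `ev` is recursive in the code, with calls looked up through `fn`, so it can be computed by
simplification. Runs of concrete bodies are obtained by computing `ev`. -/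
theorem run_of_ev {P : Program} {vs : List Data} {e : Code} {a : Data} {n : ℕ}
    (h : ev P vs e = some (a, n)) : Run P vs e a n := by
  induction e generalizing vs a n with
  | var i =>
    unfold ev at h
    split at h
    · cases h; exact .var ‹_›
    · cases h
  | nil => cases h; exact .nil
  | cons e₁ e₂ h₁ h₂ =>
    unfold ev at h
    split at h
    · split at h
      · cases h; exact .cons (h₁ ‹_›) (h₂ ‹_›)
      · cases h
    · cases h
  | case e e₁ e₂ h₀ h₁ h₂ =>
    unfold ev at h
    split at h
    · split at h
      · cases h; exact .caseNil (h₀ ‹_›) (h₁ ‹_›)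
      · cases h
    · split at h
      · cases h; exact .caseCons (h₀ ‹_›) (h₂ ‹_›)
      · cases h
    · cases h
  | bind e₁ e₂ h₁ h₂ =>
    unfold ev at h
    split at h
    · split at h
      · cases h; exact .bind (h₁ ‹_›) (h₂ ‹_›)
      · cases h
    · cases h
  | call f e h₁ =>
    unfold ev at h
    split at h
    · split at h
      · cases h
        obtain ⟨body, hb, hr⟩ := run_of_fn ‹_›
        exact .call hb (h₁ ‹_›) hr
      · cases h
    · cases h

/-- The call ends with the given result, at a bounded cost. -/
def Fn (P : Program) (f : ℕ) (a b : Data) (n : ℕ) : Prop := ∃ k ≤ n, fn P f a = some (b, k)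

theorem Fn.mono {P : Program} {f : ℕ} {a b : Data} {m n : ℕ} (h : Fn P f a b m) (hmn : m ≤ n) :
    Fn P f a b n := by
  obtain ⟨k, hk, h⟩ := h
  exact ⟨k, hk.trans hmn, h⟩

theorem Fn.intro {P : Program} {f : ℕ} {a b : Data} {n : ℕ} {body : Code}
    (hb : P[f]? = some body) (h : ∃ k ≤ n, ev P [a] body = some (b, k)) : Fn P f a b n := by
  obtain ⟨k, hk, h⟩ := h
  exact ⟨k, hk, fn_of_run hb (run_of_ev h)⟩

/-! ### The program -/

namespace Code

def hd (e : Code) : Code := .case e .nil (.var 0)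

def tl (e : Code) : Code := .case e .nil (.var 1)

def nat : ℕ → Code
  | 0 => .nil
  | n + 1 => .cons .nil (nat n)

def lst : List Code → Code
  | [] => .nil
  | a :: l => .cons a (lst l)

def node (tag : ℕ) (args : List Code) : Code := .cons (nat tag) (lst args)

def sing (e : Code) : Code := node 5 [e]

def tt : Code := sing (node 1 [])

def neg (e : Code) : Code := node 9 [tt, e]

def union (e f : Code) : Code := node 8 [e, f]

def big (e f : Code) : Code := node 6 [e, f]

def conj (e f : Code) : Code := neg (union (neg e) (neg f))

def inhab (e : Code) : Code := big e tt

def neq (e f : Code) : Code := inhab (node 9 [sing e, sing f])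

def isMem (e f : Code) : Code := neg (inhab (node 9 [sing e, f]))

def guardAnd (n e : Code) : Code := neg (union n (neg e))

/-- The expression for the variable number `n`. -/
def pos (n : ℕ) : Code := node 0 [nat n]

def filter (e f : Code) : Code := big e (big f (sing (pos 1)))

def letIn (e f : Code) : Code := big (sing e) f

/-- Branch on a tag that selects a handler, which is called with the variable `a`. -/
def dispatch : List ℕ → Code → ℕ → Code
  | [], _, _ => .nil
  | h :: hs, s, a => .case s (.call h (.var a)) (dispatch hs (.var 1) (a + 2))

/-- The argument of the main functions. -/
def arg (mode m τ δ d : Code) : Code := .cons mode (.cons m (.cons τ (.cons δ d)))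

/-- Calls of the functions of the program. -/
def extract (mode m τ δ d : Code) : Code := .call 1 (arg mode m τ δ d)

def define (m τ δ d : Code) : Code := .call 2 (arg .nil m τ δ d)

def nth (l i : Code) : Code := .call 3 (.cons l i)

def setNth (l i a : Code) : Code := .call 4 (.cons l (.cons i a))

def dupNth (l i : Code) : Code := .call 5 (.cons l i)

def removeNth (l i : Code) : Code := .call 6 (.cons l i)

def wkPath (e : Code) : Code := .call 7 e

def wkMap (m : Code) : Code := .call 8 m

def tr (m t : Code) : Code := .call 9 (.cons m t)

def bindTree (m s e : Code) : Code := .call 10 (.cons m (.cons s e))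

def nones (l : Code) : Code := .call 11 l

/-- Variables are de Bruijn positions: the second branch of a `case` puts head and tail in front and
shifts all other variables by two. The `nil` branch for an argument that is not a pair is never
reached. -/
def nthBody : Code :=
  .case (.var 0) .nil (.case (.var 1) (hd (.var 0)) (nth (tl (.var 2)) (.var 1)))

def setNthBody : Code :=
  .case (.var 0) .nil (.case (.var 1) .nil (.case (.var 0) (.cons (.var 1) (tl (.var 2)))
    (.cons (hd (.var 4)) (setNth (tl (.var 4)) (.var 1) (.var 3)))))

def dupNthBody : Code :=
  .case (.var 0) .nil (.case (.var 1) (.cons (hd (.var 0)) (.var 0))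
    (.cons (hd (.var 2)) (dupNth (tl (.var 2)) (.var 1))))

def removeNthBody : Code :=
  .case (.var 0) .nil (.case (.var 1) (tl (.var 0))
    (.cons (hd (.var 2)) (removeNth (tl (.var 2)) (.var 1))))

def wkPathBody : Code :=
  .case (.var 0) .nil (.case (.var 0) (node 0 [.cons .nil (hd (.var 1))])
    (.cons (.var 2) (lst [wkPath (hd (.var 3))])))

def wkMapBody : Code :=
  .case (.var 0) .nil (.case (.var 0) (.cons .nil (wkMap (.var 1)))
    (.cons (wkPath (.var 2)) (wkMap (.var 3))))

/-- The unary tag is peeled off one unit at a time: a variable is looked up, the empty tuple is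
copied, a pair is translated componentwise. Both projections share the last branch, which copies the
tag. -/
def trBody : Code :=
  .case (.var 0) .nil (.case (.var 1) .nil (.case (.var 0) (nth (.var 2) (hd (.var 1)))
    (.case (.var 1) (.var 5) (.case (.var 1)
      (.cons (.var 4) (lst [tr (.var 6) (hd (.var 5)), tr (.var 6) (hd (tl (.var 5)))]))
      (.cons (.var 6) (lst [tr (.var 8) (hd (.var 7))]))))))

/-- Every tag other than that of a variable is treated as a pair, which is right for tuples of
variables. A variable without a value is recognized by the entry `nil`, which is never the code of a
path. -/
def bindTreeBody : Code :=
  .case (.var 0) .nil (.case (.var 1) .nil (.case (.var 0) .nil (.case (.var 0)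
    (.case (nth (.var 4) (hd (.var 1))) (setNth (.var 4) (hd (.var 1)) (.var 3)) (.var 6))
    (bindTree (bindTree (.var 6) (hd (.var 3)) (node 3 [.var 5])) (hd (tl (.var 3)))
      (node 4 [.var 5])))))

def nonesBody : Code := .case (.var 0) .nil (.cons .nil (nones (.var 1)))

/-- The four tails of the argument give the derivation. -/
def dispatchBody (hs : List ℕ) : Code :=
  dispatch hs (hd (tl (tl (tl (tl (tl (.var 0))))))) 0

/-- Decompose the argument of a handler. -/
def unpack (body : Code) : Code :=
  .case (.var 0) .nil (.case (.var 1) .nil (.case (.var 1) .nil (.case (.var 1) .nil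
  (.case (.var 1) .nil (.case (.var 1) .nil (.case (.var 2) .nil (.case (.var 1) .nil
  (.case (.var 1) .nil (.case (.var 1) .nil (.case (.var 0) .nil (.case (.var 1) .nil
  (.case (.var 1) .nil (.case (.var 1) .nil body)))))))))))))

/-- The components of the argument after `unpack`, under `j` further variables. -/
def goalRight (j : ℕ) : Code := .var (0 + j)

def goalLeft (j : ℕ) : Code := .var (2 + j)

def goalTy (j : ℕ) : Code := .var (4 + j)

def fms (j : ℕ) : Code := .var (10 + j)

def mems (j : ℕ) : Code := .var (12 + j)

def arg₀ (j : ℕ) : Code := hd (.var (17 + j))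

def arg₁ (j : ℕ) : Code := hd (tl (.var (17 + j)))

def arg₂ (j : ℕ) : Code := hd (tl (tl (.var (17 + j))))

def fmTags (j : ℕ) : Code := .var (20 + j)

def memTags (j : ℕ) : Code := .var (22 + j)

def vmap (j : ℕ) : Code := .var (24 + j)

def mode (j : ℕ) : Code := .var (26 + j)

/-- Serves contraction and conjunction: both replace one formula by two of the same side. The new
formulas are recorded in the premise, so only the list of sides has to be updated. -/
def dupHandler : Code :=
  unpack (extract (mode 0) (vmap 0) (memTags 0) (dupNth (fmTags 0) (arg₀ 0)) (arg₁ 0))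

def memUrHandler : Code :=
  unpack (.case (mode 0)
    (.case (nth (memTags 0) (arg₀ 0)) (sing (tr (vmap 0) (goalLeft 0)))
      (tr (vmap 2) (goalRight 2)))
    (.case (nth (memTags 2) (arg₀ 2)) (isMem (tr (vmap 2) (goalLeft 2)) (tr (vmap 2) (goalRight 2)))
      tt))

/-- The conjunction of the interpolants of two premises. -/
def conjPremises (j : ℕ) : Code :=
  conj (extract (mode j) (vmap j) (memTags j) (fmTags j) (arg₀ j))
    (extract (mode j) (vmap j) (memTags j) (fmTags j) (arg₁ j))

/-- The exact definition of a set. -/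
def defineSet : Code :=
  filter (extract .nil (vmap 0) (memTags 0) (fmTags 0) (arg₁ 0))
    (extract (nat 2) (wkMap (vmap 0)) (memTags 0) (fmTags 0) (arg₀ 0))

def eqSetHandler : Code := unpack (.case (mode 0) (sing defineSet) (conjPremises 2))

def eqProdHandler : Code :=
  unpack (.case (mode 0)
    (big (extract (mode 0) (vmap 0) (memTags 0) (fmTags 0) (arg₀ 0))
      (big (extract (mode 0) (wkMap (vmap 0)) (memTags 0) (fmTags 0) (arg₁ 0))
        (sing (node 2 [pos 1, pos 0]))))
    (conjPremises 2))

/-- A rule with a fresh variable; `b` is the side of the new membership formula when a superset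
is computed. -/
def freshHandler (b : Code) : Code :=
  unpack (.case (mode 0)
    (extract .nil (.cons .nil (vmap 0)) (.cons b (memTags 0)) (fmTags 0) (arg₀ 0))
    -- Variable `1` is the mode minus one. If it is `nil`, an ordinary interpolant is wanted;
    -- otherwise the terms lie on different sides and the fresh variable becomes common.
    (.case (.var 1)
      (extract (nat 1) (.cons .nil (vmap 2)) (.cons (nat 1) (memTags 2)) (fmTags 2) (arg₀ 2))
      (extract (nat 1) (.cons (pos 0) (vmap 4)) (.cons .nil (memTags 4)) (fmTags 4) (arg₀ 4))))

/-- The element of the membership formula at the position `arg₀`. -/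
def entryElt (j : ℕ) : Code := hd (tl (nth (mems j) (arg₀ j)))

/-- The set of the membership formula at the position `arg₀`. -/
def entrySet (j : ℕ) : Code := hd (tl (tl (nth (mems j) (arg₀ j))))

/-- The partial map after the capture of the variables of `entryElt`. -/
def capture (j : ℕ) : Code := bindTree (wkMap (vmap j)) (entryElt j) (pos 0)

/-- Inequality of the captured tuple and the new variable. -/
def captureNeq (j : ℕ) : Code := neq (tr (capture j) (entryElt j)) (pos 0)

def memRHandler : Code :=
  unpack (.case (mode 0)
    (.case (nth (memTags 0) (arg₀ 0))
      (extract (mode 0) (vmap 0) (memTags 0) (fmTags 0) (arg₁ 0))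
      (tr (vmap 2) (goalRight 2)))
    (.case (nth (memTags 2) (arg₀ 2))
      -- The tag of the type is `nil` exactly at Ur type, where the element of the membership need
      -- not be a tuple of variables.
      (.case (hd (goalTy 2))
        (letIn (tr (vmap 2) (goalRight 2))
          (extract (nat 2) (wkMap (vmap 2)) (memTags 2) (fmTags 2) (arg₁ 2)))
        (big (tr (vmap 4) (goalRight 4)) (guardAnd (captureNeq 4)
          (extract (mode 4) (capture 4) (memTags 4) (fmTags 4) (arg₁ 4)))))
      (extract (mode 4) (vmap 4) (memTags 4) (fmTags 4) (arg₁ 4))))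

def falseHandler : Code :=
  unpack (.case (mode 0) (node 7 [goalTy 0])
    (.case (nth (fmTags 2) (arg₀ 2)) (node 7 [node 1 []]) tt))

def orHandler : Code :=
  let e (k j : ℕ) : Code :=
    extract (mode j) (vmap j) (memTags j) (fmTags j) (if k = 1 then arg₁ j else arg₂ j)
  unpack (.case (mode 0) (union (e 1 0) (e 2 0))
    (.case (nth (fmTags 2) (arg₀ 2)) (union (e 1 2) (e 2 2)) (conj (e 1 4) (e 2 4))))

/-- Membership and formula share their side in the first and in the last branch. Otherwise the
element is captured, and the mode and the sides select union, existential or universal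
quantification. -/
def allHandler : Code :=
  let same (j : ℕ) : Code := extract (mode j) (vmap j) (memTags j) (fmTags j) (arg₂ j)
  let captured (j : ℕ) : Code := extract (mode j) (capture j) (memTags j) (fmTags j) (arg₂ j)
  let bound (j : ℕ) : Code := tr (vmap j) (entrySet j)
  unpack (.case (nth (memTags 0) (arg₀ 0))
    (.case (nth (fmTags 0) (arg₁ 0)) (same 0)
      (.case (mode 2) (big (bound 2) (captured 2))
        (big (bound 4) (guardAnd (captureNeq 4) (captured 4)))))
    (.case (nth (fmTags 2) (arg₁ 2))
      (.case (mode 2) (big (bound 2) (captured 2))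
        (neg (big (bound 4) (neg (union (captureNeq 4) (captured 4))))))
      (same 4)))

def exHandler : Code :=
  unpack (extract (mode 0) (.cons .nil (vmap 0)) (.cons (nth (fmTags 0) (arg₀ 0)) (memTags 0))
    (fmTags 0) (arg₁ 0))

/-- The cases are those of `PMap.merge`. A test of the equation is built only if both variables are
common and an interpolant is wanted. -/
def eqSubstHandler : Code :=
  let x (j : ℕ) : Code := hd (tl (hd (tl (nth (fms j) (arg₀ j)))))
  let y (j : ℕ) : Code := hd (tl (hd (tl (tl (nth (fms j) (arg₀ j))))))
  let ext (j : ℕ) (m : Code) : Code :=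
    extract (mode j) m (memTags j) (removeNth (fmTags j) (arg₀ j)) (arg₁ j)
  let test (j : ℕ) : Code := neq (nth (vmap j) (x j)) (nth (vmap j) (y j))
  unpack (.case (nth (vmap 0) (x 0)) (ext 0 (vmap 0))
    (.case (nth (vmap 2) (y 2)) (ext 2 (setNth (vmap 2) (y 2) (nth (vmap 2) (x 2))))
      (.case (mode 4) (ext 4 (vmap 4))
        (.case (nth (fmTags 6) (arg₀ 6)) (guardAnd (test 6) (ext 6 (vmap 6)))
          (union (test 8) (ext 8 (vmap 8)))))))

def betaHandler : Code :=
  unpack (extract (mode 0) (vmap 0) (memTags 0) (fmTags 0) (arg₀ 0))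

def etaHandler : Code :=
  unpack (.case (nth (vmap 0) (arg₀ 0))
    (extract (mode 0) (.cons .nil (.cons .nil (vmap 0))) (memTags 0) (fmTags 0) (arg₁ 0))
    (extract (mode 2) (.cons (node 3 [nth (vmap 2) (arg₀ 2)])
      (.cons (node 4 [nth (vmap 2) (arg₀ 2)]) (vmap 2))) (memTags 2) (fmTags 2) (arg₁ 2)))

def defineProd : Code :=
  unpack (node 2 [define (vmap 0) (memTags 0) (fmTags 0) (arg₀ 0),
    define (vmap 0) (memTags 0) (fmTags 0) (arg₁ 0)])

def defineUr : Code :=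
  unpack (node 10 [node 0 [], filter
    (extract .nil (.cons .nil (vmap 0)) (.cons .nil (memTags 0)) (fmTags 0) (arg₀ 0))
    (letIn (sing (pos 0)) (extract (nat 1) (.cons (pos 0) (wkMap (wkMap (vmap 0))))
      (.cons .nil (memTags 0)) (fmTags 0) (arg₀ 0)))])

/-- The input is the list of the types of the variables, the formula, and the derivation. -/
def mainBody : Code :=
  let d : Code := hd (tl (tl (tl (tl (.var 0)))))
  define (.cons (pos 0) (nones (tl (hd (hd d))))) .nil (lst [nat 0, nat 1]) d

end Code

open Code in
/-- The program that extracts a definition from a derivation. -/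
def prog : Program :=
  [mainBody,
    dispatchBody [12, 13, 14, 15, 16, 17, 18, 19, 20, 12, 21, 22, 23, 24, 20, 25, 25, 26],
    -- The rules with tags `0` and `1` conclude memberships, which are never defined, so these two
    -- entries are arbitrary; at tag `4`, the unit rule, the entry is meant.
    dispatchBody [29, 29, 27, 28, 29, 30],
    nthBody, setNthBody, dupNthBody, removeNthBody, wkPathBody, wkMapBody, trBody, bindTreeBody,
    nonesBody,
    dupHandler, memUrHandler, eqSetHandler, eqProdHandler, tt, freshHandler .nil,
    freshHandler (nat 1), memRHandler, falseHandler, orHandler, allHandler, exHandler,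
    eqSubstHandler, betaHandler, etaHandler,
    unpack defineSet, defineProd, node 1 [], defineUr]

/-! ### Sizes of encodings -/

theorem Data.size_pos (a : Data) : 1 ≤ a.size := by cases a <;> simp [Data.size]

theorem Data.size_ofNat (n : ℕ) : (Data.ofNat n).size = 2 * n + 1 := by
  induction n with
  | zero => rfl
  | succ n ih => simp [Data.ofNat, Data.size, ih]; omega

theorem Data.length_lt_size_ofList (l : List Data) : l.length < (Data.ofList l).size := by
  induction l with
  | nil => simp [Data.ofList, Data.size]
  | cons a l ih => simp [Data.ofList, Data.size]; omega

theorem Data.size_lt_of_mem {a : Data} {l : List Data} (h : a ∈ l) :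
    a.size < (Data.ofList l).size := by
  induction l with
  | nil => simp at h
  | cons b l ih =>
    simp only [Data.ofList, Data.size]
    rcases List.mem_cons.1 h with rfl | h
    · have := Data.size_pos (.ofList l)
      omega
    · have := ih h
      omega

/-- The encoding of an optional path. -/
def encOpt {K : Ctx} {T : Ty} : Option (Path K T) → Data
  | none => .nil
  | some e => e.tm.enc

/-- The values of a partial map, as a list. -/
def PMap.encList {K : Ctx} : {Γ : Ctx} → PMap K Γ → List Data
  | _, .nil => []
  | _, .cons o m => encOpt o :: m.encList

def PMap.enc {K Γ : Ctx} (m : PMap K Γ) : Data := .ofList m.encList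

theorem PMap.getElem?_encList {K Γ : Ctx} (m : PMap K Γ) {T : Ty} (x : Var Γ T) :
    m.encList[x.idx]? = some (encOpt (m.get x)) := by
  induction x with
  | zero => cases m; rfl
  | succ x ih => cases m; simpa [Var.idx, PMap.encList] using ih _

theorem PMap.encList_set {K Γ : Ctx} (m : PMap K Γ) {T : Ty} (x : Var Γ T) (e : Path K T) :
    (m.set x e).encList = m.encList.set x.idx e.tm.enc := by
  induction x with
  | zero => cases m; rfl
  | succ x ih => cases m; simpa [Var.idx, PMap.encList, PMap.set] using ih _ _

/-- All values of the partial map have size at most `b`. -/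
def PMap.Bdd {K Γ : Ctx} (m : PMap K Γ) (b : ℕ) : Prop :=
  ∀ T (x : Var Γ T) e, m.get x = some e → e.tm.enc.size ≤ b

theorem PMap.Bdd.mono {K Γ : Ctx} {m : PMap K Γ} {b c : ℕ} (h : m.Bdd b) (hbc : b ≤ c) :
    m.Bdd c := fun T x e he => (h T x e he).trans hbc

theorem PMap.Bdd.size_le {K Γ : Ctx} {m : PMap K Γ} {b : ℕ} (h : m.Bdd b) :
    m.enc.size ≤ Γ.length * (b + 2) + 1 := by
  induction m with
  | nil => simp [PMap.enc, PMap.encList, Data.ofList, Data.size]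
  | @cons Γ T o m ih =>
    have h₁ : m.enc.size ≤ Γ.length * (b + 2) + 1 := ih fun T x e he => h T (.succ x) e he
    have h₂ : (encOpt o).size ≤ b + 1 := by
      cases o with
      | none => simp [encOpt, Data.size]
      | some e =>
        have := h _ .zero e rfl
        simp only [encOpt]
        omega
    have h₃ : (PMap.cons o m).enc.size = (encOpt o).size + m.enc.size + 1 := rfl
    rw [h₃, List.length_cons, Nat.succ_mul]
    omega

theorem PMap.Bdd.cons_none {K Γ : Ctx} {m : PMap K Γ} {b : ℕ} (h : m.Bdd b) {T : Ty} :
    (m.cons (none : Option (Path K T))).Bdd b := by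
  intro S x e he
  cases x with
  | zero => cases he
  | succ x => exact h _ _ _ he

theorem PMap.Bdd.cons_some {K Γ : Ctx} {m : PMap K Γ} {b : ℕ} (h : m.Bdd b) {T : Ty}
    {e : Path K T} (he : e.tm.enc.size ≤ b) : (m.cons (some e)).Bdd b := by
  intro S x e he
  cases x with
  | zero => cases he; assumption
  | succ x => exact h _ _ _ he

theorem Path.size_wk {K : Ctx} {S T : Ty} (e : Path K T) :
    (e.wk S).tm.enc.size = e.tm.enc.size + 2 := by
  induction e with
  | var x =>
    simp [Path.wk, Path.tm, Tm.enc, Var.enc, Var.idx, Data.node, Data.ofNat, Data.ofList,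
      Data.size]
    omega
  | fst e ih => simp [Path.wk, Path.tm, Tm.enc, Data.node, Data.ofList, Data.size, ih]; omega
  | snd e ih => simp [Path.wk, Path.tm, Tm.enc, Data.node, Data.ofList, Data.size, ih]; omega

theorem Path.size_fst {K : Ctx} {S T : Ty} (e : Path K (.prod S T)) :
    e.fst.tm.enc.size = e.tm.enc.size + 10 := by
  simp [Path.tm, Tm.enc, Data.node, Data.ofNat, Data.ofList, Data.size]; omega

theorem Path.size_snd {K : Ctx} {S T : Ty} (e : Path K (.prod S T)) :
    e.snd.tm.enc.size = e.tm.enc.size + 12 := by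
  simp [Path.tm, Tm.enc, Data.node, Data.ofNat, Data.ofList, Data.size]; omega

theorem PMap.Bdd.wk {K Γ : Ctx} {m : PMap K Γ} {b : ℕ} (h : m.Bdd b) {S : Ty} :
    (m.wk S).Bdd (b + 2) := by
  intro T x e he
  simp only [PMap.get_wk, Option.map_eq_some_iff] at he
  obtain ⟨e', he', rfl⟩ := he
  rw [Path.size_wk]
  exact Nat.add_le_add_right (h _ _ _ he') 2

theorem PMap.Bdd.set {K Γ : Ctx} {m : PMap K Γ} {b : ℕ} (h : m.Bdd b) {T : Ty} (x : Var Γ T)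
    {e : Path K T} (he : e.tm.enc.size ≤ b) : (m.set x e).Bdd b := by
  intro S y
  refine PMap.set_elim m x e (fun S y o => ∀ e, o = some e → e.tm.enc.size ≤ b) ?_ ?_ y
  · rintro _ ⟨⟩
    exact he
  · exact fun _ _ _ => h _ _

theorem PMap.Bdd.merge {K Γ : Ctx} {m : PMap K Γ} {b : ℕ} (h : m.Bdd b) {T : Ty}
    (x y : Var Γ T) : (m.merge x y).Bdd b := by
  unfold PMap.merge
  split
  · rename_i e hx _
    exact h.set y (h _ _ _ hx)
  · exact h

theorem PMap.Bdd.eta {K Γ : Ctx} {m : PMap K Γ} {b : ℕ} (h : m.Bdd b) {S T : Ty}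
    (x : Var Γ (.prod S T)) : (m.eta x).Bdd (b + 12) := by
  have h' : m.Bdd (b + 12) := h.mono (by omega)
  unfold PMap.eta
  cases hx : m.get x with
  | none => exact h'.cons_none.cons_none
  | some e =>
    have := h _ _ _ hx
    refine (h'.cons_some ?_).cons_some ?_
    · rw [Path.size_snd]; omega
    · rw [Path.size_fst]; omega

theorem Tm.size_enc_pair {Γ : Ctx} {S T : Ty} (t : Tm Γ S) (s : Tm Γ T) :
    (Tm.pair t s).enc.size = t.enc.size + s.enc.size + 9 := by
  simp [Tm.enc, Data.node, Data.ofNat, Data.ofList, Data.size]; omega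

theorem Tm.size_enc_var {Γ : Ctx} {T : Ty} (x : Var Γ T) :
    (Tm.var x).enc.size = 2 * x.idx + 5 := by
  simp [Tm.enc, Var.enc, Data.node, Data.ofNat, Data.ofList, Data.size, Data.size_ofNat]; omega

/-- Descending into a pair lengthens the path by at most 12, while the tuple loses at least 9 in
size. Hence the weight 2: the path plus twice the remaining tuple never grows. -/
theorem PMap.Bdd.bindTree {K Γ : Ctx} {m : PMap K Γ} {b : ℕ} (h : m.Bdd b) {T : Ty}
    (s : Tm Γ T) (e : Path K T) (he : e.tm.enc.size + 2 * s.enc.size ≤ b) :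
    (m.bindTree s e).Bdd b := by
  induction s generalizing m with
  | var x =>
    simp only [PMap.bindTree]
    split
    · exact h
    · exact h.set x (by omega)
  | pair t s h₁ h₂ =>
    rw [Tm.size_enc_pair] at he
    refine h₂ (h₁ h e.fst ?_) e.snd ?_
    · rw [Path.size_fst]; omega
    · rw [Path.size_snd]; omega
  | unit => exact h
  | fst _ => exact h
  | snd _ => exact h

theorem PMap.Bdd.capture {K Γ : Ctx} {m : PMap K Γ} {b : ℕ} (h : m.Bdd b) {T : Ty}
    (s : Tm Γ T) (hs : 2 * s.enc.size + 3 ≤ b) : (m.capture s).Bdd (b + 2) :=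
  h.wk.bindTree _ _ (by rw [Path.tm, Tm.size_enc_var, Var.idx]; omega)

/-! ### The auxiliary functions -/

/-- The bounds for the auxiliary functions share one form: `X` majorizes the data at hand, so one
level of the recursion costs a constant multiple of `X`; the remaining factor bounds the number of
levels. -/
theorem fn_nth {l : List Data} {i : ℕ} {a : Data} (h : l[i]? = some a) {X : ℕ}
    (hX : (Data.ofList l).size + (Data.ofNat i).size + 2 ≤ X) :
    Fn prog 3 (.cons (.ofList l) (.ofNat i)) a (20 * X * (i + 1)) := by
  induction i generalizing l with
  | zero =>
    cases l with
    | nil => simp at h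
    | cons b l =>
      simp only [List.getElem?_cons_zero, Option.some.injEq] at h
      subst h
      refine Fn.intro rfl ?_
      simp [Code.nthBody, ev, Code.hd, Data.ofNat, Data.ofList, Data.size] at hX ⊢
      omega
  | succ i ih =>
    cases l with
    | nil => simp at h
    | cons b l =>
      simp [Data.ofNat, Data.ofList, Data.size] at h hX
      obtain ⟨k, hk, e⟩ := ih h (by omega)
      refine Fn.intro rfl ?_
      simp [Code.nthBody, Code.nth, ev, Code.hd, Code.tl, Data.ofNat, Data.ofList, Data.size, e]
      rw [Nat.mul_add _ (i + 1)]
      omega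

theorem fn_setNth {l : List Data} {i : ℕ} {a : Data} (h : i < l.length) {X : ℕ}
    (hX : (Data.ofList l).size + (Data.ofNat i).size + a.size + 3 ≤ X) :
    Fn prog 4 (.cons (.ofList l) (.cons (.ofNat i) a)) (.ofList (l.set i a))
      (40 * X * (i + 1)) := by
  induction i generalizing l with
  | zero =>
    cases l with
    | nil => simp at h
    | cons b l =>
      refine Fn.intro rfl ?_
      simp [Code.setNthBody, ev, Code.tl, Data.ofNat, Data.ofList, Data.size] at hX ⊢
      omega
  | succ i ih =>
    cases l with
    | nil => simp at h
    | cons b l =>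
      simp [Data.ofNat, Data.ofList, Data.size] at h hX
      obtain ⟨k, hk, e⟩ := ih h (by omega)
      refine Fn.intro rfl ?_
      simp [Code.setNthBody, Code.setNth, ev, Code.hd, Code.tl, Data.ofNat, Data.ofList,
        Data.size, e]
      rw [Nat.mul_add _ (i + 1)]
      omega

theorem fn_dupNth (l₁ l₂ : List Data) (a : Data) {X : ℕ}
    (hX : (Data.ofList (l₁ ++ a :: l₂)).size + (Data.ofNat l₁.length).size + 2 ≤ X) :
    Fn prog 5 (.cons (.ofList (l₁ ++ a :: l₂)) (.ofNat l₁.length))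
      (.ofList (l₁ ++ a :: a :: l₂)) (40 * X * (l₁.length + 1)) := by
  induction l₁ with
  | nil =>
    refine Fn.intro rfl ?_
    simp [Code.dupNthBody, ev, Code.hd, Data.ofNat, Data.ofList, Data.size] at hX ⊢
    omega
  | cons b l ih =>
    simp [Data.ofNat, Data.ofList, Data.size] at hX
    obtain ⟨k, hk, e⟩ := ih (by omega)
    refine Fn.intro rfl ?_
    simp [Code.dupNthBody, Code.dupNth, ev, Code.hd, Code.tl, Data.ofNat, Data.ofList,
      Data.size, e]
    rw [Nat.mul_add _ (l.length + 1)]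
    omega

theorem fn_removeNth (l₁ l₂ : List Data) (a : Data) {X : ℕ}
    (hX : (Data.ofList (l₁ ++ a :: l₂)).size + (Data.ofNat l₁.length).size + 2 ≤ X) :
    Fn prog 6 (.cons (.ofList (l₁ ++ a :: l₂)) (.ofNat l₁.length))
      (.ofList (l₁ ++ l₂)) (40 * X * (l₁.length + 1)) := by
  induction l₁ with
  | nil =>
    refine Fn.intro rfl ?_
    simp [Code.removeNthBody, ev, Code.tl, Data.ofNat, Data.ofList, Data.size] at hX ⊢
    omega
  | cons b l ih =>
    simp [Data.ofNat, Data.ofList, Data.size] at hX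
    obtain ⟨k, hk, e⟩ := ih (by omega)
    refine Fn.intro rfl ?_
    simp [Code.removeNthBody, Code.removeNth, ev, Code.hd, Code.tl, Data.ofNat, Data.ofList,
      Data.size, e]
    rw [Nat.mul_add _ (l.length + 1)]
    omega

theorem fn_wkPath {K : Ctx} {S T : Ty} (e : Path K T) {X : ℕ} (hX : e.tm.enc.size + 1 ≤ X) :
    Fn prog 7 e.tm.enc (e.wk S).tm.enc (20 * X * e.tm.enc.size) := by
  induction e with
  | var x =>
    refine Fn.intro rfl ?_
    simp [Code.wkPathBody, Code.node, Code.nat, Code.lst, ev, Code.hd, Path.wk, Path.tm, Tm.enc,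
      Var.enc, Var.idx, Data.node, Data.ofNat, Data.ofList, Data.size] at hX ⊢
    nlinarith
  | fst e ih =>
    have hs := Path.size_fst e
    rw [hs] at hX ⊢
    obtain ⟨k, hk, e⟩ := ih (by omega)
    refine Fn.intro rfl ?_
    simp [Code.wkPathBody, Code.wkPath, Code.lst, ev, Code.hd, Path.wk, Path.tm, Tm.enc,
      Data.node, Data.ofNat, Data.ofList, Data.size, e]
    rw [Nat.mul_add]
    omega
  | snd e ih =>
    have hs := Path.size_snd e
    rw [hs] at hX ⊢
    obtain ⟨k, hk, e⟩ := ih (by omega)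
    refine Fn.intro rfl ?_
    simp [Code.wkPathBody, Code.wkPath, Code.lst, ev, Code.hd, Path.wk, Path.tm, Tm.enc,
      Data.node, Data.ofNat, Data.ofList, Data.size, e]
    rw [Nat.mul_add]
    omega

theorem Tm.enc_eq_cons {Γ : Ctx} {T : Ty} (t : Tm Γ T) : ∃ a b, t.enc = .cons a b := by
  cases t <;> exact ⟨_, _, rfl⟩

theorem fn_wkMap {K Γ : Ctx} {S : Ty} (m : PMap K Γ) {X : ℕ} (hX : m.enc.size + 1 ≤ X) :
    Fn prog 8 m.enc (m.wk S).enc (40 * X * m.enc.size) := by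
  induction m with
  | nil =>
    refine Fn.intro rfl ?_
    simp [Code.wkMapBody, ev, PMap.enc, PMap.encList, PMap.wk, Data.ofList, Data.size] at hX ⊢
    omega
  | @cons Γ T o m ih =>
    have hs : (PMap.cons o m).enc = .cons (encOpt o) m.enc := rfl
    have hs' : ((PMap.cons o m).wk S).enc = .cons (encOpt (o.map (Path.wk S))) (m.wk S).enc := rfl
    rw [hs, Data.size] at hX ⊢
    rw [hs']
    obtain ⟨k, hk, e⟩ := ih (by omega)
    cases o with
    | none =>
      refine Fn.intro rfl ?_
      simp [Code.wkMapBody, Code.wkMap, ev, encOpt, Data.size, e] at hX ⊢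
      rw [Nat.mul_add, Nat.mul_add]
      omega
    | some p =>
      obtain ⟨k', hk', e'⟩ := fn_wkPath (S := S) p (X := X) (by simp [encOpt] at hX; omega)
      obtain ⟨a, b, hab⟩ := Tm.enc_eq_cons p.tm
      refine Fn.intro rfl ?_
      simp only [encOpt, Option.map_some] at hX ⊢
      rw [hab] at e' hX hk' ⊢
      simp [Code.wkMapBody, Code.wkMap, Code.wkPath, ev, Data.size, e, e'] at hX hk' ⊢
      -- Of the budget `40 * X` per node of the first entry, one half pays for weakening its path;
      -- the rest and the last `40 * X` pay for this level.
      have : 40 * X * (a.size + b.size + 1 + m.enc.size + 1) =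
        20 * X * (a.size + b.size + 1) + 20 * X * (a.size + b.size + 1) +
          40 * X * m.enc.size + 40 * X := by ring
      rw [this]
      omega

theorem fn_tr {K Γ : Ctx} {m : PMap K Γ} {T : Ty} {t : Tm Γ T} {t' : Tm K T}
    (h : t.tr m = some t') {X : ℕ} (hX : m.enc.size + t.enc.size + 2 ≤ X) :
    Fn prog 9 (.cons m.enc t.enc) t'.enc (40 * X * t.enc.size) := by
  induction t with
  | var x =>
    simp only [Tm.tr, Option.map_eq_some_iff] at h
    obtain ⟨e, he, rfl⟩ := h
    rw [Tm.size_enc_var] at hX ⊢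
    obtain ⟨k, hk, e'⟩ := fn_nth (m.getElem?_encList x) (X := X)
      (by rw [← PMap.enc, Data.size_ofNat]; omega)
    refine Fn.intro rfl ?_
    rw [he, ← PMap.enc] at e'
    simp [Code.trBody, Code.nth, ev, Code.hd, Tm.enc, Var.enc, Data.node, Data.ofNat,
      Data.ofList, Data.size, Data.size_ofNat, e', encOpt]
    have : 40 * X * (2 * x.idx + 5) = 20 * X * (x.idx + 1) + 60 * (X * x.idx) + 180 * X := by ring
    rw [this]
    omega
  | unit =>
    cases h
    refine Fn.intro rfl ?_
    simp [Code.trBody, ev, Tm.enc, Data.node, Data.ofNat, Data.ofList, Data.size] at hX ⊢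
    omega
  | pair t s h₁ h₂ =>
    simp only [Tm.tr, Option.bind_eq_some_iff, Option.map_eq_some_iff] at h
    obtain ⟨t', ht, s', hs, rfl⟩ := h
    rw [Tm.size_enc_pair] at hX ⊢
    obtain ⟨k₁, hk₁, e₁⟩ := h₁ ht (by omega)
    obtain ⟨k₂, hk₂, e₂⟩ := h₂ hs (by omega)
    refine Fn.intro rfl ?_
    simp [Code.trBody, Code.tr, Code.lst, ev, Code.hd, Code.tl, Tm.enc, Data.node, Data.ofNat,
      Data.ofList, Data.size, e₁, e₂]
    rw [Nat.mul_add, Nat.mul_add]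
    omega
  | fst t ih =>
    simp only [Tm.tr, Option.map_eq_some_iff] at h
    obtain ⟨t', ht, rfl⟩ := h
    simp only [Tm.enc, Data.node, Data.ofNat, Data.ofList, Data.size] at hX ⊢
    obtain ⟨k, hk, e⟩ := ih ht (by omega)
    refine Fn.intro rfl ?_
    simp [Code.trBody, Code.tr, Code.lst, ev, Code.hd, Data.size, e]
    have : 40 * X * (1 + (1 + (1 + 1 + 1) + 1) + 1 + (t.enc.size + 1 + 1) + 1) =
      40 * X * t.enc.size + 400 * X := by ring
    rw [this]
    omega
  | snd t ih =>
    simp only [Tm.tr, Option.map_eq_some_iff] at h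
    obtain ⟨t', ht, rfl⟩ := h
    simp only [Tm.enc, Data.node, Data.ofNat, Data.ofList, Data.size] at hX ⊢
    obtain ⟨k, hk, e⟩ := ih ht (by omega)
    refine Fn.intro rfl ?_
    simp [Code.trBody, Code.tr, Code.lst, ev, Code.hd, Data.size, e]
    have : 40 * X * (1 + (1 + (1 + (1 + 1 + 1) + 1) + 1) + 1 + (t.enc.size + 1 + 1) + 1) =
      40 * X * t.enc.size + 480 * X := by ring
    rw [this]
    omega

theorem PMap.length_encList {K Γ : Ctx} (m : PMap K Γ) : m.encList.length = Γ.length := by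
  induction m with
  | nil => rfl
  | cons o m ih => simp [PMap.encList, ih]

theorem Var.idx_lt {Γ : Ctx} {T : Ty} (x : Var Γ T) : x.idx < Γ.length := by
  induction x with
  | zero => simp [Var.idx]
  | succ x ih => simp [Var.idx, ih]

/-- The bound `b` for the paths is preserved by the recursion, so it also covers the intermediate
map on which the second call works. -/
theorem fn_bindTree {K Γ : Ctx} {m : PMap K Γ} {T : Ty} {s : Tm Γ T} (hs : s.IsTree)
    (e : Path K T) {b X : ℕ} (hm : m.Bdd b) (he : e.tm.enc.size + 2 * s.enc.size ≤ b)
    (hX : Γ.length * (b + 2) + 2 * b + 10 ≤ X) :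
    Fn prog 10 (.cons m.enc (.cons s.enc e.tm.enc)) (m.bindTree s e).enc
      (100 * X * s.enc.size) := by
  induction s generalizing m with
  | var x =>
    have hm' := hm.size_le
    rw [Tm.size_enc_var] at he ⊢
    have hx := (Data.size_ofNat x.idx)
    obtain ⟨k, hk, h⟩ := fn_nth (m.getElem?_encList x) (X := X) (by rw [← PMap.enc]; omega)
    rw [← PMap.enc] at h
    have : 100 * X * (2 * x.idx + 5) =
      60 * X * (x.idx + 1) + 140 * (X * x.idx) + 440 * X := by ring
    rw [this]
    cases hmx : m.get x with
    | some e' =>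
      obtain ⟨c, d, hcd⟩ := Tm.enc_eq_cons e'.tm
      have hb : m.bindTree (.var x) e = m := by simp [PMap.bindTree, hmx]
      rw [hb]
      have hs := hm _ _ _ hmx
      rw [hmx, encOpt, hcd] at h
      refine Fn.intro rfl ?_
      simp [Code.bindTreeBody, Code.nth, ev, Code.hd, Tm.enc, Var.enc, Data.node, Data.ofNat,
        Data.ofList, Data.size, h]
      have h₁ : 20 * X * (x.idx + 1) + 40 * X * (x.idx + 1) = 60 * X * (x.idx + 1) := by ring
      omega
    | none =>
      have hb : m.bindTree (.var x) e = m.set x e := by simp [PMap.bindTree, hmx]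
      rw [hmx, encOpt] at h
      obtain ⟨k', hk', h'⟩ := fn_setNth (l := m.encList) (i := x.idx) (a := e.tm.enc) (X := X)
        (by rw [PMap.length_encList]; exact x.idx_lt) (by rw [← PMap.enc]; omega)
      rw [← PMap.encList_set, ← PMap.enc, ← PMap.enc] at h'
      rw [hb]
      refine Fn.intro rfl ?_
      simp [Code.bindTreeBody, Code.nth, Code.setNth, ev, Code.hd, Tm.enc, Var.enc, Data.node,
        Data.ofNat, Data.ofList, Data.size, h, h']
      have h₁ : 40 * X * (x.idx + 1) + 20 * X * (x.idx + 1) = 60 * X * (x.idx + 1) := by ring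
      omega
  | pair t s h₁ h₂ =>
    have hm' := hm.size_le
    have hsz := Tm.size_enc_pair t s
    rw [hsz] at he ⊢
    have he₁ := Path.size_fst e
    have he₂ := Path.size_snd e
    have hb := hm.bindTree t e.fst (by omega)
    obtain ⟨k₁, hk₁, e₁⟩ := h₁ hs.1 e.fst hm (by omega)
    obtain ⟨k₂, hk₂, e₂⟩ := h₂ hs.2 e.snd hb (by omega)
    refine Fn.intro rfl ?_
    have hf : e.fst.tm.enc = Data.node 3 [e.tm.enc] := rfl
    have hg : e.snd.tm.enc = Data.node 4 [e.tm.enc] := rfl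
    simp only [hf, hg, Data.node, Data.ofNat, Data.ofList] at e₁ e₂
    simp [Code.bindTreeBody, Code.bindTree, Code.node, Code.nat, Code.lst, ev, Code.hd, Code.tl,
      Tm.enc, Data.node, Data.ofNat, Data.ofList, Data.size, e₁, e₂, PMap.bindTree]
    rw [Nat.mul_add, Nat.mul_add]
    omega
  | unit => exact hs.elim
  | fst _ => exact hs.elim
  | snd _ => exact hs.elim

theorem fn_nones (l : List Data) {X : ℕ} (hX : (Data.ofList l).size + 2 ≤ X) :
    Fn prog 11 (.ofList l) (.ofList (l.map fun _ => .nil)) (20 * X * (l.length + 1)) := by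
  induction l with
  | nil =>
    refine Fn.intro rfl ?_
    simp [Code.nonesBody, ev, Data.ofList, Data.size] at hX ⊢
    omega
  | cons a l ih =>
    simp [Data.ofList, Data.size] at hX
    obtain ⟨k, hk, e⟩ := ih (by omega)
    refine Fn.intro rfl ?_
    simp [Code.nonesBody, Code.nones, ev, Data.ofList, Data.size, e]
    rw [Nat.mul_add _ (l.length + 1)]
    omega

/-! ### Encodings of expressions and of the arguments of the main functions -/

/-- Terms and expressions use the same tags `0` to `4`, so a translated term is an output without
any conversion. -/
theorem Tm.enc_nrc {g : Bool} {K : Ctx} {T : Ty} (t : Tm K T) : (t.nrc g).enc = t.enc := by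
  induction t <;> simp_all [Tm.nrc, Nrc.enc, Tm.enc]

/-- The encoding of a side. -/
def encBit : Bool → Data
  | false => .ofNat 0
  | true => .ofNat 1

/-- The encoding of a list of sides. -/
def encBits (l : List Bool) : Data := .ofList (l.map encBit)

theorem size_encBits_le (l : List Bool) : (encBits l).size ≤ 4 * l.length + 1 := by
  induction l with
  | nil => simp [encBits, Data.ofList, Data.size]
  | cons b l ih =>
    simp only [encBits, List.map_cons, Data.ofList, Data.size, List.length_cons] at ih ⊢
    have : (encBit b).size ≤ 3 := by cases b <;> simp [encBit, Data.ofNat, Data.size]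
    omega

/-- The argument of the main functions. -/
def callArg (mode m τ δ d : Data) : Data := .cons mode (.cons m (.cons τ (.cons δ d)))

/-! ### Evaluation of codes with costs

Sizes and the costs of auxiliary calls are at most `W`; the cost is split into a number of units
of size `W + 1` and the cost of recursive calls. -/

/-- The code evaluates to `b` at a cost of at most `n` units and `r`. -/
def Ev (W : ℕ) (vs : List Data) (e : Code) (b : Data) (n r : ℕ) : Prop :=
  (∀ a ∈ vs, a.size ≤ W) → ∃ k ≤ n * (W + 1) + r, ev prog vs e = some (b, k)

namespace Ev

variable {W : ℕ} {vs : List Data} {e e₁ e₂ e₃ : Code} {a b c : Data} {n n₁ n₂ n₃ r r₁ r₂ r₃ : ℕ}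

theorem mono (h : Ev W vs e b n r) (hn : n ≤ n₁) (hr : r ≤ r₁) : Ev W vs e b n₁ r₁ := by
  intro hvs
  obtain ⟨k, hk, h⟩ := h hvs
  exact ⟨k, hk.trans (Nat.add_le_add (Nat.mul_le_mul_right _ hn) hr), h⟩

theorem var {i : ℕ} (h : vs[i]? = some a) : Ev W vs (.var i) a 1 0 := by
  intro hvs
  have := hvs a (List.mem_of_getElem? h)
  exact ⟨a.size + 1, by omega, by simp [ev, h]⟩

theorem nil : Ev W vs .nil .nil 1 0 := fun _ => ⟨1, by omega, rfl⟩

theorem cons (h₁ : Ev W vs e₁ a n₁ r₁) (h₂ : Ev W vs e₂ b n₂ r₂) :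
    Ev W vs (.cons e₁ e₂) (.cons a b) (n₁ + n₂ + 1) (r₁ + r₂) := by
  intro hvs
  obtain ⟨k₁, hk₁, h₁⟩ := h₁ hvs
  obtain ⟨k₂, hk₂, h₂⟩ := h₂ hvs
  refine ⟨k₁ + k₂ + 1, ?_, by simp [ev, h₁, h₂]⟩
  simp only [Nat.add_mul]
  omega

theorem case_nil (h : Ev W vs e .nil n r) (h₁ : Ev W vs e₁ c n₁ r₁) :
    Ev W vs (.case e e₁ e₂) c (n + n₁ + 1) (r + r₁) := by
  intro hvs
  obtain ⟨k, hk, h⟩ := h hvs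
  obtain ⟨k₁, hk₁, h₁⟩ := h₁ hvs
  refine ⟨k + k₁ + 1, ?_, by simp [ev, h, h₁]⟩
  simp only [Nat.add_mul]
  omega

theorem case_cons (h : Ev W vs e (.cons a b) n r) (hs : (Data.cons a b).size ≤ W)
    (h₂ : Ev W (a :: b :: vs) e₂ c n₂ r₂) :
    Ev W vs (.case e e₁ e₂) c (n + n₂ + 1) (r + r₂) := by
  intro hvs
  obtain ⟨k, hk, h⟩ := h hvs
  simp only [Data.size] at hs
  obtain ⟨k₂, hk₂, h₂⟩ := h₂ (by
    simp only [List.mem_cons]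
    rintro x (rfl | rfl | hx)
    · omega
    · omega
    · exact hvs x hx)
  refine ⟨k + k₂ + 1, ?_, by simp [ev, h, h₂]⟩
  simp only [Nat.add_mul]
  omega

theorem of_mem (h : (∀ x ∈ vs, x.size ≤ W) → Ev W vs e b n r) : Ev W vs e b n r :=
  fun hvs => h hvs hvs

theorem case_var {i : ℕ} (h : vs[i]? = some (.cons a b)) (h₂ : Ev W (a :: b :: vs) e₂ c n₂ r₂) :
    Ev W vs (.case (.var i) e₁ e₂) c (n₂ + 2) r₂ :=
  of_mem fun hvs => ((var h).case_cons (hvs _ (List.mem_of_getElem? h)) h₂).mono (by omega)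
    (by omega)

theorem call {f C : ℕ} (h : Ev W vs e a n r) (hf : Fn prog f a b C) :
    Ev W vs (.call f e) b (n + 1) (r + C) := by
  intro hvs
  obtain ⟨k, hk, h⟩ := h hvs
  obtain ⟨k', hk', h'⟩ := hf
  refine ⟨k + k' + 1, ?_, by simp [ev, h, h']⟩
  simp only [Nat.add_mul]
  omega

/-- A call of an auxiliary function. -/
theorem call_aux {f : ℕ} (h : Ev W vs e a n r) {C : ℕ} (hf : Fn prog f a b C) (hC : C ≤ W) :
    Ev W vs (.call f e) b (n + 2) r := by
  intro hvs
  obtain ⟨k, hk, h⟩ := h.call hf hvs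
  refine ⟨k, hk.trans ?_, h⟩
  simp only [Nat.add_mul]
  omega

theorem hd (h : Ev W vs e (.cons a b) n r) (hs : (Data.cons a b).size ≤ W) :
    Ev W vs (Code.hd e) a (n + 2) r :=
  (h.case_cons hs (var rfl)).mono (by omega) (by omega)

theorem tl (h : Ev W vs e (.cons a b) n r) (hs : (Data.cons a b).size ≤ W) :
    Ev W vs (Code.tl e) b (n + 2) r :=
  (h.case_cons hs (var rfl)).mono (by omega) (by omega)

theorem nat (k : ℕ) : Ev W vs (Code.nat k) (.ofNat k) (2 * k + 1) 0 := by
  induction k with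
  | zero => exact nil
  | succ k ih => exact (nil.cons ih).mono (by omega) (by omega)

theorem node_nil (k : ℕ) : Ev W vs (Code.node k []) (.node k []) (2 * k + 3) 0 :=
  ((nat k).cons nil).mono (by omega) (by omega)

theorem node_one (k : ℕ) (h : Ev W vs e a n r) :
    Ev W vs (Code.node k [e]) (.node k [a]) (n + 2 * k + 4) r :=
  ((nat k).cons (h.cons nil)).mono (by omega) (by omega)

theorem node_two (k : ℕ) (h₁ : Ev W vs e₁ a n₁ r₁) (h₂ : Ev W vs e₂ b n₂ r₂) :
    Ev W vs (Code.node k [e₁, e₂]) (.node k [a, b]) (n₁ + n₂ + 2 * k + 5) (r₁ + r₂) :=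
  ((nat k).cons (h₁.cons (h₂.cons nil))).mono (by omega) (by omega)

theorem pos_zero {g : Bool} {K : Ctx} {T : Ty} :
    Ev W vs (Code.pos 0) (Nrc.var (g := g) (.zero (Γ := K) (T := T))).enc 5 0 :=
  (node_one 0 (nat 0)).mono (by omega) (by omega)

theorem pos_one {g : Bool} {K : Ctx} {S T : Ty} :
    Ev W vs (Code.pos 1) (Nrc.var (g := g) (.succ (S := S) (.zero (Γ := K) (T := T)))).enc 10 0 :=
  (node_one 0 (nat 1)).mono (by omega) (by omega)

section Nrc

variable {g : Bool} {K : Ctx} {S T : Ty}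

theorem sing {E : Nrc g K T} (h : Ev W vs e E.enc n r) :
    Ev W vs (Code.sing e) (Nrc.sing E).enc (n + 14) r := node_one 5 h

theorem tt : Ev W vs Code.tt (Nrc.tt (g := g) (K := K)).enc 20 0 :=
  (node_one 5 (node_nil 1)).mono (by omega) (by omega)

theorem diff {E F : Nrc g K (.set T)} (h₁ : Ev W vs e₁ E.enc n₁ r₁) (h₂ : Ev W vs e₂ F.enc n₂ r₂) :
    Ev W vs (Code.node 9 [e₁, e₂]) (Nrc.diff E F).enc (n₁ + n₂ + 23) (r₁ + r₂) :=
  node_two 9 h₁ h₂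

theorem neg {E : Nrc g K (.set .unit)} (h : Ev W vs e E.enc n r) :
    Ev W vs (Code.neg e) E.neg.enc (n + 43) r :=
  (diff tt h).mono (by omega) (by omega)

theorem union {E F : Nrc g K (.set T)} (h₁ : Ev W vs e₁ E.enc n₁ r₁)
    (h₂ : Ev W vs e₂ F.enc n₂ r₂) :
    Ev W vs (Code.union e₁ e₂) (Nrc.union E F).enc (n₁ + n₂ + 21) (r₁ + r₂) :=
  node_two 8 h₁ h₂

theorem big {E : Nrc g K (.set S)} {F : Nrc g (S :: K) (.set T)} (h₁ : Ev W vs e₁ E.enc n₁ r₁)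
    (h₂ : Ev W vs e₂ F.enc n₂ r₂) :
    Ev W vs (Code.big e₁ e₂) (Nrc.bigUnion E F).enc (n₁ + n₂ + 17) (r₁ + r₂) :=
  node_two 6 h₁ h₂

theorem conj {E F : Nrc g K (.set .unit)} (h₁ : Ev W vs e₁ E.enc n₁ r₁)
    (h₂ : Ev W vs e₂ F.enc n₂ r₂) :
    Ev W vs (Code.conj e₁ e₂) (Nrc.conj E F).enc (n₁ + n₂ + 150) (r₁ + r₂) :=
  (neg (union (neg h₁) (neg h₂))).mono (by omega) (by omega)

theorem inhab {E : Nrc g K (.set T)} (h : Ev W vs e E.enc n r) :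
    Ev W vs (Code.inhab e) E.inhab.enc (n + 37) r :=
  (big h tt).mono (by omega) (by omega)

theorem neq {E F : Nrc g K T} (h₁ : Ev W vs e₁ E.enc n₁ r₁) (h₂ : Ev W vs e₂ F.enc n₂ r₂) :
    Ev W vs (Code.neq e₁ e₂) (Nrc.neq E F).enc (n₁ + n₂ + 88) (r₁ + r₂) :=
  (inhab (diff (sing h₁) (sing h₂))).mono (by omega) (by omega)

theorem isMem {E : Nrc g K T} {F : Nrc g K (.set T)} (h₁ : Ev W vs e₁ E.enc n₁ r₁)
    (h₂ : Ev W vs e₂ F.enc n₂ r₂) :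
    Ev W vs (Code.isMem e₁ e₂) (Nrc.isMem E F).enc (n₁ + n₂ + 117) (r₁ + r₂) :=
  (neg (inhab (diff (sing h₁) h₂))).mono (by omega) (by omega)

theorem guardAnd {E F : Nrc g K (.set .unit)} (h₁ : Ev W vs e₁ E.enc n₁ r₁)
    (h₂ : Ev W vs e₂ F.enc n₂ r₂) :
    Ev W vs (Code.guardAnd e₁ e₂) (Nrc.guardAnd E F).enc (n₁ + n₂ + 107) (r₁ + r₂) :=
  (neg (union h₁ (neg h₂))).mono (by omega) (by omega)

theorem filter {E : Nrc g K (.set T)} {F : Nrc g (T :: K) (.set .unit)}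
    (h₁ : Ev W vs e₁ E.enc n₁ r₁) (h₂ : Ev W vs e₂ F.enc n₂ r₂) :
    Ev W vs (Code.filter e₁ e₂) (Nrc.filter E F).enc (n₁ + n₂ + 58) (r₁ + r₂) :=
  (big h₁ (big h₂ (sing pos_one))).mono (by omega) (by omega)

theorem letIn {E : Nrc g K S} {F : Nrc g (S :: K) (.set T)} (h₁ : Ev W vs e₁ E.enc n₁ r₁)
    (h₂ : Ev W vs e₂ F.enc n₂ r₂) :
    Ev W vs (Code.letIn e₁ e₂) (Nrc.letIn E F).enc (n₁ + n₂ + 31) (r₁ + r₂) :=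
  (big (sing h₁) h₂).mono (by omega) (by omega)

theorem product {E : Nrc g K (.set S)} {F : Nrc g (S :: K) (.set T)}
    (h₁ : Ev W vs e₁ E.enc n₁ r₁) (h₂ : Ev W vs e₂ F.enc n₂ r₂) :
    Ev W vs (Code.big e₁ (Code.big e₂ (Code.sing (Code.node 2 [Code.pos 1, Code.pos 0]))))
      (Nrc.product E F).enc (n₁ + n₂ + 80) (r₁ + r₂) :=
  (big h₁ (big h₂ (sing (E := .pair (.var (.succ .zero)) (.var .zero))
    (node_two 2 pos_one pos_zero)))).mono (by omega) (by omega)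

end Nrc

/-- The first argument of a rule. -/
theorem arg₀ {j : ℕ} {l : List Data} (h : vs[17 + j]? = some (.ofList (a :: l))) :
    Ev W vs (Code.arg₀ j) a 3 0 := case_var h (var rfl)

theorem arg₁ {j : ℕ} {l : List Data} (h : vs[17 + j]? = some (.ofList (a :: b :: l))) :
    Ev W vs (Code.arg₁ j) b 5 0 :=
  of_mem fun hvs => by
    have := hvs _ (List.mem_of_getElem? h)
    refine hd (b := .ofList l) (case_var h (var (a := .ofList (b :: l)) rfl)) ?_
    simp only [Data.ofList, Data.size] at this ⊢
    omega

theorem arg₂ {j : ℕ} {l : List Data} (h : vs[17 + j]? = some (.ofList (a :: b :: c :: l))) :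
    Ev W vs (Code.arg₂ j) c 7 0 :=
  of_mem fun hvs => by
    have := hvs _ (List.mem_of_getElem? h)
    refine hd (b := .ofList l) (tl (a := b) (b := .ofList (c :: l))
      (case_var h (var (a := .ofList (b :: c :: l)) rfl)) ?_) ?_
    all_goals
      simp only [Data.ofList, Data.size] at this ⊢
      omega

theorem extract {em eM eτ eδ ed : Code} {mo M τ δ d : Data} {n₁ n₂ n₃ n₄ n₅ r₁ r₂ r₃ r₄ r₅ c : ℕ}
    (h₁ : Ev W vs em mo n₁ r₁) (h₂ : Ev W vs eM M n₂ r₂) (h₃ : Ev W vs eτ τ n₃ r₃)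
    (h₄ : Ev W vs eδ δ n₄ r₄) (h₅ : Ev W vs ed d n₅ r₅)
    (hf : Fn prog 1 (callArg mo M τ δ d) b c) :
    Ev W vs (Code.extract em eM eτ eδ ed) b (n₁ + n₂ + n₃ + n₄ + n₅ + 5)
      (r₁ + r₂ + r₃ + r₄ + r₅ + c) :=
  ((h₁.cons (h₂.cons (h₃.cons (h₄.cons h₅)))).call hf).mono (by omega) (by omega)

theorem define {eM eτ eδ ed : Code} {M τ δ d : Data} {n₂ n₃ n₄ n₅ r₂ r₃ r₄ r₅ c : ℕ}
    (h₂ : Ev W vs eM M n₂ r₂) (h₃ : Ev W vs eτ τ n₃ r₃)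
    (h₄ : Ev W vs eδ δ n₄ r₄) (h₅ : Ev W vs ed d n₅ r₅)
    (hf : Fn prog 2 (callArg (.ofNat 0) M τ δ d) b c) :
    Ev W vs (Code.define eM eτ eδ ed) b (n₂ + n₃ + n₄ + n₅ + 6)
      (r₂ + r₃ + r₄ + r₅ + c) :=
  ((nil.cons (h₂.cons (h₃.cons (h₄.cons h₅)))).call hf).mono (by omega) (by omega)

/-- Each unit of the tag costs one `case`, which puts two values in front; the position `i` of the
argument moves along by two. -/
theorem dispatch {hs : List ℕ} {k h i : ℕ} {C : ℕ} (hk : hs[k]? = some h)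
    (hi : vs[i]? = some a) (he : Ev W vs e (.ofNat k) n r) (hW : (Data.ofNat k).size ≤ W)
    (hf : Fn prog h a b C) : Ev W vs (Code.dispatch hs e i) b (n + 2 * k + 3) (r + C) := by
  induction k generalizing hs vs e i n r with
  | zero =>
    cases hs with
    | nil => simp at hk
    | cons h' hs =>
      simp only [List.getElem?_cons_zero, Option.some.injEq] at hk
      subst hk
      exact (case_nil he ((var hi).call hf)).mono (by omega) (by omega)
  | succ k ih =>
    cases hs with
    | nil => simp at hk
    | cons h' hs =>
      simp only [List.getElem?_cons_succ] at hk
      have := Data.size_ofNat k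
      have := Data.size_ofNat (k + 1)
      refine (case_cons (a := .nil) (b := .ofNat k) he hW
        (ih hk (vs := .nil :: .ofNat k :: vs) (i := i + 2) (by simpa using hi) (var rfl)
          (by omega))).mono ?_ ?_ <;> omega

end Ev

/-- The variables of a handler after the decomposition of its argument. -/
def unpacked (mo M τ δ rtag args ctx Θ Δ gtag T t v : Data) : List Data :=
  let g := Data.ofList [T, t, v]
  let G := Data.cons gtag g
  let concl := Data.ofList [ctx, Θ, Δ, G]
  let rule := Data.cons rtag args
  let d := Data.cons concl rule
  [v, .nil, t, .ofList [v], T, .ofList [t, v], gtag, g, G, .nil, Δ, .ofList [G], Θ,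
    .ofList [Δ, G], ctx, .ofList [Θ, Δ, G], rtag, args, concl, rule, δ, d, τ, .cons δ d, M,
    .cons τ (.cons δ d), mo, .cons M (.cons τ (.cons δ d)), callArg mo M τ δ d]

/-- There are 14 nested cases on variables, at two units each. -/
theorem Ev.unpack {W : ℕ} {mo M τ δ rtag args ctx Θ Δ gtag T t v b : Data} {body : Code} {n r : ℕ}
    (h : Ev W (unpacked mo M τ δ rtag args ctx Θ Δ gtag T t v) body b n r) :
    Ev W [callArg mo M τ δ (.cons (.ofList [ctx, Θ, Δ, .cons gtag (.ofList [T, t, v])])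
      (.cons rtag args))] (Code.unpack body) b (n + 28) r :=
  .case_var rfl (.case_var rfl (.case_var rfl (.case_var rfl (.case_var rfl (.case_var rfl
    (.case_var rfl (.case_var rfl (.case_var rfl (.case_var rfl (.case_var rfl (.case_var rfl
      (.case_var rfl (.case_var rfl h)))))))))))))

theorem Fn.of_ev {W h : ℕ} {a b : Data} {n r : ℕ} {body : Code} (hb : prog[h]? = some body)
    (ha : a.size ≤ W) (hE : Ev W [a] body b n r) : Fn prog h a b (n * (W + 1) + r) :=
  Fn.intro hb (hE (by simpa using ha))

/-- A call of a function that branches on the rule. -/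
theorem fn_dispatch {W f k h : ℕ} {hs : List ℕ} {mo M τ δ concl args b : Data} {C : ℕ}
    (hb : prog[f]? = some (Code.dispatchBody hs)) (hk : hs[k]? = some h)
    (ha : (callArg mo M τ δ (.cons concl (.cons (.ofNat k) args))).size ≤ W)
    (hf : Fn prog h (callArg mo M τ δ (.cons concl (.cons (.ofNat k) args))) b C) :
    Fn prog f (callArg mo M τ δ (.cons concl (.cons (.ofNat k) args))) b
      ((2 * k + 20) * (W + 1) + C) := by
  refine .of_ev hb ha ?_
  simp only [callArg, Data.size] at ha
  refine (Ev.dispatch (r := 0) hk rfl ?_ (by omega) hf).mono (n := 16 + 2 * k + 3) (by omega)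
    (by omega)
  refine (Ev.hd (b := args) (Ev.tl (a := concl) (Ev.tl (a := δ) (Ev.tl (a := τ)
    (Ev.tl (a := M) (Ev.tl (a := mo) (Ev.var rfl) ?_) ?_) ?_) ?_) ?_) ?_).mono
      (by omega) (by omega)
  all_goals simp only [Data.size]; omega

/-! ### Sizes of the data in a run -/

/-- The size of the derivation is at most `N`, and so is the number of variables; the paths of
the partial map leave room for their growth along the derivation. -/
def Fits {K Γ : Ctx} (N : ℕ) (m : PMap K Γ) (n : ℕ) : Prop :=
  ∃ c, 2 * N + 5 ≤ c ∧ m.Bdd c ∧ c + 16 * n ≤ 18 * N + 5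

/-- A bound for the sizes of partial maps and derivations. -/
def sizeBound (N : ℕ) : ℕ := N * (18 * N + 7) + 2 * (18 * N + 5) + 10

/-- A bound for the costs of auxiliary calls. -/
def costBound (Y : ℕ) : ℕ := 10000 * Y * Y

theorem Fits.le {K Γ : Ctx} {N n : ℕ} {m : PMap K Γ} (h : Fits N m n) : n ≤ N := by
  obtain ⟨c, hc, -, h⟩ := h
  omega

/-- Passing to a premise shrinks the derivation by at least one node, which releases 16 units of
room. No rule needs more: pair expansion takes 12, a double weakening 4, and a capture 2, because `2
* N + 5 ≤ c` already pays for the captured paths. -/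
theorem Fits.of_bdd {K K' Γ Γ' : Ctx} {N n n' : ℕ} {m : PMap K Γ} {m' : PMap K' Γ'}
    (h : Fits N m n) (hn : n' + 1 ≤ n)
    (hm : ∀ c, 2 * N + 5 ≤ c → m.Bdd c → m'.Bdd (c + 16)) : Fits N m' n' := by
  obtain ⟨c, hc, hb, h⟩ := h
  exact ⟨c + 16, by omega, hm c hc hb, by omega⟩

theorem Fits.of_lt {K Γ : Ctx} {N n n' : ℕ} {m : PMap K Γ} (h : Fits N m n) (hn : n' + 1 ≤ n) :
    Fits N m n' :=
  h.of_bdd hn fun _ _ hb => hb.mono (by omega)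

theorem Fits.cons_none {K Γ : Ctx} {N n n' : ℕ} {m : PMap K Γ} {T : Ty} (h : Fits N m n)
    (hn : n' + 1 ≤ n) : Fits N (m.cons (none : Option (Path K T))) n' :=
  h.of_bdd hn fun _ _ hb => (hb.mono (by omega)).cons_none

theorem Fits.cons_zero {K Γ : Ctx} {N n n' : ℕ} {T : Ty} {m : PMap (T :: K) Γ} (h : Fits N m n)
    (hn : n' + 1 ≤ n) : Fits N (m.cons (some (.var .zero))) n' :=
  h.of_bdd hn fun _ _ hb => (hb.mono (by omega)).cons_some
    (by rw [Path.tm, Tm.size_enc_var, Var.idx]; omega)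

theorem Fits.wk {K Γ : Ctx} {N n n' : ℕ} {T : Ty} {m : PMap K Γ} (h : Fits N m n)
    (hn : n' + 1 ≤ n) : Fits N (m.wk T) n' :=
  h.of_bdd hn fun _ _ hb => hb.wk.mono (by omega)

theorem Fits.wk_wk_cons {K Γ : Ctx} {N n n' : ℕ} {S T : Ty} {m : PMap K Γ} (h : Fits N m n)
    (hn : n' + 1 ≤ n) : Fits N (((m.wk S).wk T).cons (some (.var .zero))) n' :=
  h.of_bdd hn fun _ _ hb => (hb.wk.wk.mono (by omega)).cons_some
    (by rw [Path.tm, Tm.size_enc_var, Var.idx]; omega)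

theorem Fits.merge {K Γ : Ctx} {N n n' : ℕ} {m : PMap K Γ} (h : Fits N m n)
    (hn : n' + 1 ≤ n) {T : Ty} (x y : Var Γ T) : Fits N (m.merge x y) n' :=
  h.of_bdd hn fun _ _ hb => (hb.mono (by omega)).merge x y

theorem Fits.eta {K Γ : Ctx} {N n n' : ℕ} {m : PMap K Γ} (h : Fits N m n)
    (hn : n' + 1 ≤ n) {S T : Ty} (x : Var Γ (.prod S T)) : Fits N (m.eta x) n' :=
  h.of_bdd hn fun _ _ hb => (hb.eta x).mono (by omega)

theorem Fits.capture {K Γ : Ctx} {N n n' : ℕ} {m : PMap K Γ} (h : Fits N m n)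
    (hn : n' + 1 ≤ n) {T : Ty} {s : Tm Γ T} (hs : s.enc.size ≤ N) : Fits N (m.capture s) n' :=
  h.of_bdd hn fun _ _ hb => (hb.capture s (by omega)).mono (by omega)

/-- The encoding contains the end sequent together with the types of all its variables. So the size
of a derivation also bounds the number of variables and the parts of the sequent. -/
theorem Deriv.le_size_enc {Γ : Ctx} {Θ : List (Mem Γ)} {Δ : List (Fm Γ)} {G : Goal Γ}
    (d : Deriv Γ Θ Δ G) :
    Γ.length + (Data.ofList (Θ.map Mem.enc)).size + (Data.ofList (Δ.map Fm.enc)).size +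
      G.enc.size + d.encRule.size + 5 ≤ d.enc.size := by
  have h : d.enc = .cons (encSequent Γ Θ Δ G) d.encRule := rfl
  have h' := Data.length_lt_size_ofList (List.map Ty.enc Γ)
  rw [h]
  simp only [encSequent, Ctx.enc, Data.ofList, Data.size, List.length_map] at h' ⊢
  omega

theorem size_le_sizeBound (N : ℕ) : 36 * N + 20 ≤ sizeBound N := by
  unfold sizeBound
  have := Nat.zero_le (N * (18 * N + 7))
  omega

theorem Fits.size_map_le {K Γ : Ctx} {N n : ℕ} {m : PMap K Γ} (h : Fits N m n)
    (hΓ : Γ.length ≤ n) : m.enc.size + 2 * (18 * N + 5) + 9 ≤ sizeBound N := by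
  have hn := h.le
  obtain ⟨c, hc, hb, h⟩ := h
  have := hb.size_le
  have : Γ.length * (c + 2) ≤ N * (18 * N + 7) := Nat.mul_le_mul (by omega) (by omega)
  unfold sizeBound
  omega

theorem size_callArg_le {K Γ : Ctx} {N : ℕ} {m : PMap K Γ} {Θ : List (Mem Γ)} {Δ : List (Fm Γ)}
    {G : Goal Γ} {d : Deriv Γ Θ Δ G} {τ δ : List Bool} (h : Fits N m d.enc.size)
    (hτ : τ.length = Θ.length) (hδ : δ.length = Δ.length) {k : ℕ} (hk : k ≤ 2) :
    (callArg (.ofNat k) m.enc (encBits τ) (encBits δ) d.enc).size ≤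
      costBound (sizeBound N) := by
  have h₁ := d.le_size_enc
  have h₂ := h.size_map_le (by omega)
  have h₃ := size_encBits_le τ
  have h₄ := size_encBits_le δ
  have h₅ := Data.size_ofNat k
  have h₆ := Data.length_lt_size_ofList (Θ.map Mem.enc)
  have h₇ := Data.length_lt_size_ofList (Δ.map Fm.enc)
  have h₈ := h.le
  rw [List.length_map] at h₆ h₇
  simp only [callArg, Data.size]
  have : sizeBound N ≤ costBound (sizeBound N) := by
    unfold costBound
    have : 1 ≤ sizeBound N := by have := size_le_sizeBound N; omega
    nlinarith
  omega

/-! ### Evaluation of auxiliary calls -/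

theorem le_costBound {C Y i : ℕ} (hi : i ≤ Y) (hC : C ≤ 1000 * Y * i) : C ≤ costBound Y := by
  refine hC.trans ?_
  unfold costBound
  have := Nat.mul_le_mul_left (1000 * Y) hi
  nlinarith

namespace Ev

variable {Y : ℕ} {vs : List Data} {e e₁ e₂ e₃ : Code} {n n₁ n₂ n₃ r r₁ r₂ r₃ : ℕ}

theorem nth {l : List Data} {i : ℕ} {a : Data} (h : l[i]? = some a)
    (hs : (Data.ofList l).size ≤ Y) (h₁ : Ev (costBound Y) vs e₁ (.ofList l) n₁ r₁)
    (h₂ : Ev (costBound Y) vs e₂ (.ofNat i) n₂ r₂) :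
    Ev (costBound Y) vs (Code.nth e₁ e₂) a (n₁ + n₂ + 3) (r₁ + r₂) := by
  have hi := (List.getElem?_eq_some_iff.1 h).1
  have hl := Data.length_lt_size_ofList l
  have := Data.size_ofNat i
  refine ((h₁.cons h₂).call_aux (fn_nth h (X := 10 * Y) (by omega)) ?_).mono (by omega) le_rfl
  exact le_costBound (i := i + 1) (by omega) (by nlinarith)

theorem setNth {l : List Data} {i : ℕ} {a : Data} (h : i < l.length)
    (hs : (Data.ofList l).size ≤ Y) (ha : a.size ≤ Y)
    (h₁ : Ev (costBound Y) vs e₁ (.ofList l) n₁ r₁)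
    (h₂ : Ev (costBound Y) vs e₂ (.ofNat i) n₂ r₂) (h₃ : Ev (costBound Y) vs e₃ a n₃ r₃) :
    Ev (costBound Y) vs (Code.setNth e₁ e₂ e₃) (.ofList (l.set i a)) (n₁ + n₂ + n₃ + 4)
      (r₁ + r₂ + r₃) := by
  have hl := Data.length_lt_size_ofList l
  have := Data.size_ofNat i
  refine ((h₁.cons (h₂.cons h₃)).call_aux (fn_setNth h (X := 10 * Y) (by omega)) ?_).mono
    (by omega) (by omega)
  exact le_costBound (i := i + 1) (by omega) (by nlinarith)

theorem dupNth {l₁ l₂ : List Data} {i : ℕ} {a : Data} (hi : l₁.length = i)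
    (hs : (Data.ofList (l₁ ++ a :: l₂)).size ≤ Y)
    (h₁ : Ev (costBound Y) vs e₁ (.ofList (l₁ ++ a :: l₂)) n₁ r₁)
    (h₂ : Ev (costBound Y) vs e₂ (.ofNat i) n₂ r₂) :
    Ev (costBound Y) vs (Code.dupNth e₁ e₂) (.ofList (l₁ ++ a :: a :: l₂)) (n₁ + n₂ + 3)
      (r₁ + r₂) := by
  subst hi
  have hl := Data.length_lt_size_ofList (l₁ ++ a :: l₂)
  simp only [List.length_append, List.length_cons] at hl
  have := Data.size_ofNat l₁.length
  refine ((h₁.cons h₂).call_aux (fn_dupNth l₁ l₂ a (X := 10 * Y) (by omega)) ?_).mono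
    (by omega) le_rfl
  exact le_costBound (i := l₁.length + 1) (by omega) (by nlinarith)

theorem removeNth {l₁ l₂ : List Data} {i : ℕ} {a : Data} (hi : l₁.length = i)
    (hs : (Data.ofList (l₁ ++ a :: l₂)).size ≤ Y)
    (h₁ : Ev (costBound Y) vs e₁ (.ofList (l₁ ++ a :: l₂)) n₁ r₁)
    (h₂ : Ev (costBound Y) vs e₂ (.ofNat i) n₂ r₂) :
    Ev (costBound Y) vs (Code.removeNth e₁ e₂) (.ofList (l₁ ++ l₂)) (n₁ + n₂ + 3)
      (r₁ + r₂) := by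
  subst hi
  have hl := Data.length_lt_size_ofList (l₁ ++ a :: l₂)
  simp only [List.length_append, List.length_cons] at hl
  have := Data.size_ofNat l₁.length
  refine ((h₁.cons h₂).call_aux (fn_removeNth l₁ l₂ a (X := 10 * Y) (by omega)) ?_).mono
    (by omega) le_rfl
  exact le_costBound (i := l₁.length + 1) (by omega) (by nlinarith)

theorem wkMap {K Γ : Ctx} {S : Ty} {m : PMap K Γ} (hm : m.enc.size + 1 ≤ Y)
    (h : Ev (costBound Y) vs e m.enc n r) :
    Ev (costBound Y) vs (Code.wkMap e) (m.wk S).enc (n + 2) r :=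
  h.call_aux (fn_wkMap m (X := Y) hm) (le_costBound (i := m.enc.size) (by omega) (by nlinarith))

theorem tr {g : Bool} {K Γ : Ctx} {m : PMap K Γ} {T : Ty} {t : Tm Γ T} {t' : Tm K T}
    (ht : t.tr m = some t') (hm : m.enc.size + 1 ≤ Y) (hs : t.enc.size + 1 ≤ Y)
    (h₁ : Ev (costBound Y) vs e₁ m.enc n₁ r₁) (h₂ : Ev (costBound Y) vs e₂ t.enc n₂ r₂) :
    Ev (costBound Y) vs (Code.tr e₁ e₂) (t'.nrc g).enc (n₁ + n₂ + 3) (r₁ + r₂) := by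
  rw [Tm.enc_nrc]
  refine ((h₁.cons h₂).call_aux (fn_tr ht (X := 2 * Y) (by omega)) ?_).mono (by omega) le_rfl
  exact le_costBound (i := t.enc.size) (by omega) (by nlinarith)

theorem bindTree {K Γ : Ctx} {m : PMap K Γ} {T : Ty} {s : Tm Γ T} (hs : s.IsTree)
    (p : Path K T) {c : ℕ} (hm : m.Bdd c) (hp : p.tm.enc.size + 2 * s.enc.size ≤ c)
    (hY : Γ.length * (c + 2) + 2 * c + 10 ≤ Y) (h₁ : Ev (costBound Y) vs e₁ m.enc n₁ r₁)
    (h₂ : Ev (costBound Y) vs e₂ s.enc n₂ r₂) (h₃ : Ev (costBound Y) vs e₃ p.tm.enc n₃ r₃) :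
    Ev (costBound Y) vs (Code.bindTree e₁ e₂ e₃) (m.bindTree s p).enc (n₁ + n₂ + n₃ + 4)
      (r₁ + r₂ + r₃) := by
  refine ((h₁.cons (h₂.cons h₃)).call_aux (fn_bindTree hs p hm hp hY) ?_).mono
    (by omega) (by omega)
  exact le_costBound (i := s.enc.size) (by omega) (by nlinarith)

/-- The side of a formula. -/
theorem nth_bits {l₁ l₂ : List Bool} {b : Bool} {i : ℕ} (hi : l₁.length = i)
    (hs : (encBits (l₁ ++ b :: l₂)).size ≤ Y)
    (h₁ : Ev (costBound Y) vs e₁ (encBits (l₁ ++ b :: l₂)) n₁ r₁)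
    (h₂ : Ev (costBound Y) vs e₂ (.ofNat i) n₂ r₂) :
    Ev (costBound Y) vs (Code.nth e₁ e₂) (encBit b) (n₁ + n₂ + 3) (r₁ + r₂) :=
  nth (l := (l₁ ++ b :: l₂).map encBit) (by subst hi; simp) hs h₁ h₂

/-- The duplication of the side of a formula. -/
theorem dup_bits {l₁ l₂ : List Bool} {b : Bool} {i : ℕ} (hi : l₁.length = i)
    (hs : (encBits (l₁ ++ b :: l₂)).size ≤ Y)
    (h₁ : Ev (costBound Y) vs e₁ (encBits (l₁ ++ b :: l₂)) n₁ r₁)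
    (h₂ : Ev (costBound Y) vs e₂ (.ofNat i) n₂ r₂) :
    Ev (costBound Y) vs (Code.dupNth e₁ e₂) (encBits (l₁ ++ b :: b :: l₂)) (n₁ + n₂ + 3)
      (r₁ + r₂) := by
  simp only [encBits, List.map_append, List.map_cons] at hs h₁ ⊢
  exact dupNth (by simpa using hi) hs h₁ h₂

/-- The removal of the side of a formula. -/
theorem remove_bits {l₁ l₂ : List Bool} {b : Bool} {i : ℕ} (hi : l₁.length = i)
    (hs : (encBits (l₁ ++ b :: l₂)).size ≤ Y)
    (h₁ : Ev (costBound Y) vs e₁ (encBits (l₁ ++ b :: l₂)) n₁ r₁)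
    (h₂ : Ev (costBound Y) vs e₂ (.ofNat i) n₂ r₂) :
    Ev (costBound Y) vs (Code.removeNth e₁ e₂) (encBits (l₁ ++ l₂)) (n₁ + n₂ + 3)
      (r₁ + r₂) := by
  simp only [encBits, List.map_append, List.map_cons] at hs h₁ ⊢
  exact removeNth (by simpa using hi) hs h₁ h₂

/-- The side `true` is encoded as the number one, whose head and tail are both `nil`. -/
theorem case_true {N : ℕ} {c : Data}
    (h : Ev (costBound (sizeBound N)) vs e (encBit true) n r)
    (h₂ : Ev (costBound (sizeBound N)) (.nil :: .nil :: vs) e₂ c n₂ r₂) :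
    Ev (costBound (sizeBound N)) vs (.case e e₁ e₂) c (n + n₂ + 1) (r + r₂) := by
  have := size_le_sizeBound N
  refine case_cons h ?_ h₂
  exact le_costBound (i := 1) (by omega) (by simp only [Data.size, Data.ofNat]; omega)

/-- The value of a variable under the partial map. -/
theorem nth_none {K Γ : Ctx} {m : PMap K Γ} {T : Ty} {x : Var Γ T} (hx : m.get x = none)
    (hm : m.enc.size + 1 ≤ Y)
    (h₁ : Ev (costBound Y) vs e₁ m.enc n₁ r₁) (h₂ : Ev (costBound Y) vs e₂ x.enc n₂ r₂) :
    Ev (costBound Y) vs (Code.nth e₁ e₂) .nil (n₁ + n₂ + 3) (r₁ + r₂) := by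
  have h := m.getElem?_encList x
  rw [hx] at h
  exact nth h (Nat.le_of_succ_le hm) h₁ h₂

theorem nth_some {g : Bool} {K Γ : Ctx} {m : PMap K Γ} {T : Ty} {x : Var Γ T} {p : Path K T}
    (hx : m.get x = some p) (hm : m.enc.size + 1 ≤ Y)
    (h₁ : Ev (costBound Y) vs e₁ m.enc n₁ r₁) (h₂ : Ev (costBound Y) vs e₂ x.enc n₂ r₂) :
    Ev (costBound Y) vs (Code.nth e₁ e₂) (p.tm.nrc g).enc (n₁ + n₂ + 3) (r₁ + r₂) := by
  have h := m.getElem?_encList x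
  rw [hx] at h
  rw [Tm.enc_nrc]
  exact nth h (Nat.le_of_succ_le hm) h₁ h₂

theorem _root_.NestedRel.PMap.size_get_lt {K Γ : Ctx} {m : PMap K Γ} {T : Ty} {x : Var Γ T}
    {p : Path K T} (hx : m.get x = some p) : p.tm.enc.size < m.enc.size := by
  have h := m.getElem?_encList x
  rw [hx] at h
  exact Data.size_lt_of_mem (List.mem_of_getElem? h)

/-- Test whether a variable has a value. -/
theorem case_some {K Γ : Ctx} {m : PMap K Γ} {T : Ty} {x : Var Γ T} {p : Path K T} {c : Data}
    (hx : m.get x = some p) (hm : m.enc.size + 1 ≤ Y)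
    (h₁ : Ev (costBound Y) vs e₁ m.enc n₁ r₁) (h₂ : Ev (costBound Y) vs e₂ x.enc n₂ r₂)
    (h : ∀ a b, Ev (costBound Y) (a :: b :: vs) e₃ c n₃ r₃) :
    Ev (costBound Y) vs (.case (Code.nth e₁ e₂) e e₃) c (n₁ + n₂ + n₃ + 4) (r₁ + r₂ + r₃) := by
  obtain ⟨a, b, hab⟩ := Tm.enc_eq_cons p.tm
  have hs := PMap.size_get_lt hx
  have h' := nth_some (g := false) hx hm h₁ h₂
  rw [Tm.enc_nrc, hab] at h'
  refine (case_cons h' ?_ (h a b)).mono (by omega) le_rfl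
  rw [← hab]
  exact le_costBound (i := 1) (by omega) (by omega)

section entry

variable {j : ℕ} {K Γ : Ctx} {R : Ty} {s : Tm Γ R} {z : Tm Γ (.set R)} {Θ₁ Θ₂ : List (Mem Γ)}
  {l : List Data}

theorem entry (hΘ : vs[12 + j]? = some (.ofList ((Θ₁ ++ ⟨R, s, z⟩ :: Θ₂).map Mem.enc)))
    (ha : vs[17 + j]? = some (.ofList (.ofNat Θ₁.length :: l)))
    (hs : (Data.ofList ((Θ₁ ++ ⟨R, s, z⟩ :: Θ₂).map Mem.enc)).size ≤ Y) :
    Ev (costBound Y) vs (Code.nth (Code.mems j) (Code.arg₀ j))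
      (.ofList [R.enc, s.enc, z.enc]) 7 0 := by
  refine nth ?_ hs (var hΘ) (arg₀ ha)
  simp [Mem.enc]

theorem size_entry_le (hs : (Data.ofList ((Θ₁ ++ ⟨R, s, z⟩ :: Θ₂).map Mem.enc)).size ≤ Y) :
    (Data.ofList [R.enc, s.enc, z.enc]).size ≤ costBound Y ∧
      s.enc.size + z.enc.size + 6 ≤ Y := by
  have h := Data.size_lt_of_mem (a := Mem.enc ⟨R, s, z⟩)
    (l := (Θ₁ ++ ⟨R, s, z⟩ :: Θ₂).map Mem.enc) (by simp)
  have := Data.size_pos R.enc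
  have hY : Y ≤ costBound Y := le_costBound (i := 1) (by omega) (by omega)
  simp only [Mem.enc, Data.ofList, Data.size] at h ⊢
  omega

theorem entryElt (hΘ : vs[12 + j]? = some (.ofList ((Θ₁ ++ ⟨R, s, z⟩ :: Θ₂).map Mem.enc)))
    (ha : vs[17 + j]? = some (.ofList (.ofNat Θ₁.length :: l)))
    (hs : (Data.ofList ((Θ₁ ++ ⟨R, s, z⟩ :: Θ₂).map Mem.enc)).size ≤ Y) :
    Ev (costBound Y) vs (Code.entryElt j) s.enc 11 0 := by
  have h := (size_entry_le hs).1
  refine hd (b := .ofList [z.enc]) (tl (entry hΘ ha hs) h) ?_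
  simp only [Data.ofList, Data.size] at h ⊢
  omega

theorem entrySet (hΘ : vs[12 + j]? = some (.ofList ((Θ₁ ++ ⟨R, s, z⟩ :: Θ₂).map Mem.enc)))
    (ha : vs[17 + j]? = some (.ofList (.ofNat Θ₁.length :: l)))
    (hs : (Data.ofList ((Θ₁ ++ ⟨R, s, z⟩ :: Θ₂).map Mem.enc)).size ≤ Y) :
    Ev (costBound Y) vs (Code.entrySet j) z.enc 13 0 := by
  have h := (size_entry_le hs).1
  refine hd (b := .nil) (tl (a := s.enc) (b := .ofList [z.enc]) (tl (entry hΘ ha hs) h) ?_) ?_ <;>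
  · simp only [Data.ofList, Data.size] at h ⊢
    omega

theorem capture {N k : ℕ} {m : PMap K Γ} (hF : Fits N m k) (hΓ : Γ.length + 1 ≤ k)
    (hΘ : vs[12 + j]? = some (.ofList ((Θ₁ ++ ⟨R, s, z⟩ :: Θ₂).map Mem.enc)))
    (ha : vs[17 + j]? = some (.ofList (.ofNat Θ₁.length :: l)))
    (hM : vs[24 + j]? = some m.enc) (hst : s.IsTree)
    (hs : (Data.ofList ((Θ₁ ++ ⟨R, s, z⟩ :: Θ₂).map Mem.enc)).size ≤ N) :
    Ev (costBound (sizeBound N)) vs (Code.capture j) (m.capture s).enc 23 0 := by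
  have hm := hF.size_map_le (by omega)
  have hN := size_le_sizeBound N
  have hl := hF.le
  have hsN := (size_entry_le hs).2
  obtain ⟨c, hc, hb, hF⟩ := hF
  have : Γ.length * (c + 2 + 2) ≤ N * (18 * N + 7) := Nat.mul_le_mul (by omega) (by omega)
  refine (bindTree hst (.var .zero) hb.wk ?_ ?_ (wkMap (S := R) (by omega) (var hM))
    (entryElt hΘ ha (hs.trans (by omega))) (pos_zero (g := false) (K := K) (T := R))).mono
    (by omega) le_rfl
  · rw [Path.tm, Tm.size_enc_var, Var.idx]; omega
  · unfold sizeBound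
    omega

theorem captureNeq {g : Bool} {N k : ℕ} {m : PMap K Γ} (hF : Fits N m k) (hΓ : Γ.length + 1 ≤ k)
    (hΘ : vs[12 + j]? = some (.ofList ((Θ₁ ++ ⟨R, s, z⟩ :: Θ₂).map Mem.enc)))
    (ha : vs[17 + j]? = some (.ofList (.ofNat Θ₁.length :: l)))
    (hM : vs[24 + j]? = some m.enc) (hst : s.IsTree)
    (hs : (Data.ofList ((Θ₁ ++ ⟨R, s, z⟩ :: Θ₂).map Mem.enc)).size ≤ N)
    {e : Tm (R :: K) R} (he : s.tr (m.capture s) = some e) :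
    Ev (costBound (sizeBound N)) vs (Code.captureNeq j)
      (Nrc.neq (e.nrc g) (.var .zero)).enc 140 0 := by
  have hN := size_le_sizeBound N
  have hsN := (size_entry_le hs).2
  have hm := (hF.capture (n' := k - 1) (by omega) (s := s) (by omega)).size_map_le (by omega)
  exact (neq (tr he (by omega) (by omega) (capture hF hΓ hΘ ha hM hst hs)
    (entryElt hΘ ha (hs.trans (by omega)))) pos_zero).mono (by omega) le_rfl

end entry

end Ev

/-- A handler of a rule, called through the branching function `f`. -/
theorem fn_handler {W f k h : ℕ} {hs : List ℕ} {mo M τ δ ctx Θ Δ gtag T t v args b : Data}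
    {body : Code} {n r : ℕ} (hb : prog[f]? = some (Code.dispatchBody hs)) (hk : hs[k]? = some h)
    (hh : prog[h]? = some (Code.unpack body)) (hk' : k ≤ 17)
    (ha : (callArg mo M τ δ (.cons (.ofList [ctx, Θ, Δ, .cons gtag (.ofList [T, t, v])])
      (.cons (.ofNat k) args))).size ≤ W)
    (hE : Ev W (unpacked mo M τ δ (.ofNat k) args ctx Θ Δ gtag T t v) body b n r)
    (hn : n ≤ 900) :
    Fn prog f (callArg mo M τ δ (.cons (.ofList [ctx, Θ, Δ, .cons gtag (.ofList [T, t, v])])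
      (.cons (.ofNat k) args))) b (1000 * (W + 1) + r) := by
  refine (fn_dispatch hb hk ha (.of_ev hh ha hE.unpack)).mono ?_
  rw [← Nat.add_assoc, ← Nat.add_mul]
  -- Dispatch takes at most 54 units, decomposition 28 and the body 900, together less than the 1000
  -- of a step.
  exact Nat.add_le_add_right (Nat.mul_le_mul_right _ (by omega)) _

/-! ### Specification of the program -/

/-- The cost of a step, without recursive calls. -/
def stepCost (N : ℕ) : ℕ := 1000 * (costBound (sizeBound N) + 1)

/-- A step is paid for by the part of the derivation outside its premises, which has size at least
one. -/
theorem stepCost_le {N C n n' : ℕ} (h : n' + 1 ≤ n) (hC : C ≤ stepCost N * n') :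
    stepCost N + C ≤ stepCost N * n := by
  have := Nat.mul_le_mul_left (stepCost N) h
  rw [Nat.mul_add] at this
  omega

/-- Side conditions for the computation of a superset. -/
def Goal.SupOk {K Γ : Ctx} (m : PMap K Γ) (S : ∀ T, Var Γ T → Bool) : Goal Γ → Prop
  | .mem t v => t.All (Ok m S true) ∧ v.All (Ok m S false)
  | .sub t v => t.All (Ok m S true) ∧ v.All (Ok m S false)
  | .eq t v => t.All (Ok m S false) ∧ v.All (Ok m S true)

/-- Side conditions for the computation of an interpolant. -/
def Goal.ItpOk {K Γ : Ctx} (m : PMap K Γ) (S : ∀ T, Var Γ T → Bool) : Goal Γ → Prop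
  | .mem t v => t.All (Ok m S true) ∧ v.All (Ok m S true)
  | .sub t v => t.All (Ok m S true) ∧ v.All (Ok m S true)
  | .eq t v => t.All (Ok m S true) ∧ v.All (Ok m S true)

/-- The right-hand side avoids the variables in `Z`, except for the set of a membership. -/
def Goal.Avoid {Γ : Ctx} (Z : ∀ T, Var Γ T → Prop) : Goal Γ → Prop
  | .mem t _ => t.All (fun T x => ¬ Z T x)
  | .sub t v => t.All (fun T x => ¬ Z T x) ∧ v.All (fun T x => ¬ Z T x)
  | .eq t v => t.All (fun T x => ¬ Z T x) ∧ v.All (fun T x => ¬ Z T x)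

/-- Interpolation for right-hand sides whose two parts belong to different sides. -/
def MixedSpec (N : ℕ) (g : Bool) {Γ : Ctx} (Θ : List (Mem Γ)) (Δ : List (Fm Γ)) (d : Data) :
    Goal Γ → Prop
  | .mem _ _ => True
  | .sub (T := T) t v =>
    ∀ {K : Ctx} {m : PMap (T :: K) Γ} {τ δ : List Bool} {S : ∀ T, Var Γ T → Bool}
      {Z : ∀ T, Var Γ T → Prop}, TSeq.Inv ⟨m, τ, δ, Θ, Δ⟩ S Z → Fits N m d.size →
      (Goal.sub t v).Avoid Z → t.All (Ok m S false) → v.All (Ok m S true) →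
      ∃ E : Nrc g (T :: K) (.set .unit), InterpSub.{u} ⟨m, τ, δ, Θ, Δ⟩ t v E ∧
        Fn prog 1 (callArg (.ofNat 2) m.enc (encBits τ) (encBits δ) d) E.enc
          (stepCost N * d.size)
  | .eq (T := .ur) t v =>
    ∀ {K : Ctx} {m : PMap (.set .ur :: K) Γ} {τ δ : List Bool} {S : ∀ T, Var Γ T → Bool}
      {Z : ∀ T, Var Γ T → Prop}, TSeq.Inv ⟨m, τ, δ, Θ, Δ⟩ S Z → Fits N m d.size →
      (Goal.eq t v).Avoid Z → t.All (Ok m S false) → v.All (Ok m S true) →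
      ∃ E : Nrc g (.set .ur :: K) (.set .unit), InterpUr.{u} ⟨m, τ, δ, Θ, Δ⟩ t v E ∧
        Fn prog 1 (callArg (.ofNat 2) m.enc (encBits τ) (encBits δ) d) E.enc
          (stepCost N * d.size)
  | .eq _ _ => True

/-- Explicit definitions from equations between the two sides. -/
def DefineSpec (N : ℕ) (g : Bool) {Γ : Ctx} (Θ : List (Mem Γ)) (Δ : List (Fm Γ)) (d : Data) :
    Goal Γ → Prop
  | .eq (T := T) t v =>
    (T.bareUr = true → g = true) →
    ∀ {K : Ctx} {m : PMap K Γ} {τ δ : List Bool} {S : ∀ T, Var Γ T → Bool}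
      {Z : ∀ T, Var Γ T → Prop}, TSeq.Inv ⟨m, τ, δ, Θ, Δ⟩ S Z → Fits N m d.size →
      (Goal.eq t v).Avoid Z → t.All (Ok m S false) → v.All (Ok m S true) →
      ∃ E : Nrc g K T, Defines.{u} ⟨m, τ, δ, Θ, Δ⟩ v E ∧
        Fn prog 2 (callArg (.ofNat 0) m.enc (encBits τ) (encBits δ) d) E.enc
          (2 * (stepCost N * d.size))
  | _ => True

/-- The program extracts supersets, interpolants and definitions from a derivation. -/
structure Spec (N : ℕ) (g : Bool) {Γ : Ctx} {Θ : List (Mem Γ)} {Δ : List (Fm Γ)} {G : Goal Γ}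
    (d : Deriv Γ Θ Δ G) : Prop where
  sup : ∀ {K : Ctx} {m : PMap K Γ} {τ δ : List Bool} {S : ∀ T, Var Γ T → Bool}
    {Z : ∀ T, Var Γ T → Prop}, TSeq.Inv ⟨m, τ, δ, Θ, Δ⟩ S Z → Fits N m d.enc.size →
    G.Avoid Z → G.SupOk m S → ∃ E : Nrc g K (.set G.ty), Covers.{u} ⟨m, τ, δ, Θ, Δ⟩ G E ∧
      Fn prog 1 (callArg (.ofNat 0) m.enc (encBits τ) (encBits δ) d.enc) E.enc
        (stepCost N * d.enc.size)
  itp : ∀ {K : Ctx} {m : PMap K Γ} {τ δ : List Bool} {S : ∀ T, Var Γ T → Bool}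
    {Z : ∀ T, Var Γ T → Prop}, TSeq.Inv ⟨m, τ, δ, Θ, Δ⟩ S Z → Fits N m d.enc.size →
    G.Avoid Z → G.ItpOk m S → ∃ E : Nrc g K (.set .unit), Interp.{u} ⟨m, τ, δ, Θ, Δ⟩ G E ∧
      Fn prog 1 (callArg (.ofNat 1) m.enc (encBits τ) (encBits δ) d.enc) E.enc
        (stepCost N * d.enc.size)
  mixed : MixedSpec.{u} N g Θ Δ d.enc G
  define : DefineSpec.{u} N g Θ Δ d.enc G

/-- The run of a handler. -/
theorem fn_rule {N : ℕ} {K Γ : Ctx} {m : PMap K Γ} {Θ : List (Mem Γ)} {Δ : List (Fm Γ)}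
    {G : Goal Γ} {d : Deriv Γ Θ Δ G} {τ δ : List Bool} {S : ∀ T, Var Γ T → Bool}
    {Z : ∀ T, Var Γ T → Prop} (hI : TSeq.Inv ⟨m, τ, δ, Θ, Δ⟩ S Z) (hF : Fits N m d.enc.size)
    {mo : ℕ} (hmo : mo ≤ 2) {ctx Θ' Δ' gtag T t v args b : Data} {f k h : ℕ} {hs : List ℕ}
    {body : Code} {n r R : ℕ}
    (hd : d.enc = .cons (.ofList [ctx, Θ', Δ', .cons gtag (.ofList [T, t, v])])
      (.cons (.ofNat k) args))
    (hb : prog[f]? = some (Code.dispatchBody hs)) (hk : hs[k]? = some h)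
    (hh : prog[h]? = some (Code.unpack body)) (hk' : k ≤ 17)
    (hE : Ev (costBound (sizeBound N)) (unpacked (.ofNat mo) m.enc (encBits τ) (encBits δ)
      (.ofNat k) args ctx Θ' Δ' gtag T t v) body b n r) (hn : n ≤ 900) (hR : r ≤ R) :
    Fn prog f (callArg (.ofNat mo) m.enc (encBits τ) (encBits δ) d.enc) b (stepCost N + R) := by
  have ha := size_callArg_le hF hI.mem.length_eq hI.fm.length_eq hmo
  rw [hd] at ha ⊢
  exact (fn_handler hb hk hh hk' ha hE hn).mono (Nat.add_le_add_left hR _)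

/-! ### Specification: rules that only transform models, contradictions, the axiom -/

section rules

variable {N : ℕ} {g : Bool} {Γ : Ctx} {Θ Θ₁ Θ₂ : List (Mem Γ)} {Δ Δ₁ Δ₂ : List (Fm Γ)}
  {T : Ty} {t : Tm Γ T} {v : Tm Γ (.set T)}

/-- Rules with one premise, whose models extend those of the conclusion. -/
theorem Spec.of_step {Γ' : Ctx} {Θ' : List (Mem Γ')} {Δ' : List (Fm Γ')} {t' : Tm Γ' T}
    {v' : Tm Γ' (.set T)} {d : Deriv Γ Θ Δ (.mem t v)} {d' : Deriv Γ' Θ' Δ' (.mem t' v')}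
    (hd : d'.enc.size + 1 ≤ d.enc.size) (ih : Spec.{u} N g d')
    (h : ∀ {K : Ctx} {m : PMap K Γ} {τ δ : List Bool} {S : ∀ T, Var Γ T → Bool}
      {Z : ∀ T, Var Γ T → Prop}, TSeq.Inv ⟨m, τ, δ, Θ, Δ⟩ S Z → Fits N m d.enc.size →
      ∃ (m' : PMap K Γ') (τ' δ' : List Bool) (S' : ∀ T, Var Γ' T → Bool)
        (Z' : ∀ T, Var Γ' T → Prop), TSeq.Inv ⟨m', τ', δ', Θ', Δ'⟩ S' Z' ∧
        Fits N m' d'.enc.size ∧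
        (∀ P, Step.{u} P ⟨m, τ, δ, Θ, Δ⟩ t v ⟨m', τ', δ', Θ', Δ'⟩ t' v') ∧
        (∀ p, t.All (Ok m S p) → t'.All (Ok m' S' p)) ∧
        (∀ p, v.All (Ok m S p) → v'.All (Ok m' S' p)) ∧
        (t.All (fun T x => ¬ Z T x) → t'.All (fun T x => ¬ Z' T x)) ∧
        ∀ k ≤ 2, ∀ b C,
          Fn prog 1 (callArg (.ofNat k) m'.enc (encBits τ') (encBits δ') d'.enc) b C →
          Fn prog 1 (callArg (.ofNat k) m.enc (encBits τ) (encBits δ) d.enc) b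
            (stepCost N + C)) : Spec.{u} N g d where
  sup hI hF hZ hG := by
    obtain ⟨m', τ', δ', S', Z', hI', hF', hS, ht, hv, hZ', hC⟩ := h hI hF
    obtain ⟨E, hE, hf⟩ := ih.sup hI' hF' (hZ' hZ) ⟨ht _ hG.1, hv _ hG.2⟩
    exact ⟨E, .of_step (hS _) hE, (hC 0 (by omega) _ _ hf).mono (stepCost_le hd le_rfl)⟩
  itp hI hF hZ hG := by
    obtain ⟨m', τ', δ', S', Z', hI', hF', hS, ht, hv, hZ', hC⟩ := h hI hF
    obtain ⟨E, hE, hf⟩ := ih.itp hI' hF' (hZ' hZ) ⟨ht _ hG.1, hv _ hG.2⟩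
    exact ⟨E, .of_step (fun b => hS _) hE,
      (hC 1 (by omega) _ _ hf).mono (stepCost_le hd le_rfl)⟩
  mixed := trivial
  define := trivial

theorem TSeq.Inv.size_encBits {N : ℕ} {K : Ctx} {m : PMap K Γ} {τ δ : List Bool}
    {S : ∀ T, Var Γ T → Bool} {Z : ∀ T, Var Γ T → Prop} {G : Goal Γ}
    (hI : TSeq.Inv ⟨m, τ, δ, Θ, Δ⟩ S Z) {d : Deriv Γ Θ Δ G} (hF : Fits N m d.enc.size) :
    (encBits τ).size ≤ sizeBound N ∧ (encBits δ).size ≤ sizeBound N := by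
  have h₁ := d.le_size_enc
  have h₂ := hF.le
  have h₃ := size_encBits_le τ
  have h₄ := size_encBits_le δ
  have h₅ := size_le_sizeBound N
  have h₆ := Data.length_lt_size_ofList (Θ.map Mem.enc)
  have h₇ := Data.length_lt_size_ofList (Δ.map Fm.enc)
  have h₈ := hI.mem.length_eq
  have h₉ := hI.fm.length_eq
  rw [List.length_map] at h₆ h₇
  simp only at h₈ h₉
  omega

theorem Spec.contr {φ : Fm Γ} {d : Deriv Γ Θ (Δ₁ ++ φ :: φ :: Δ₂) (.mem t v)}
    (ih : Spec.{u} N g d) : Spec.{u} N g (.contr Δ₁ Δ₂ φ d) := by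
  have hd : d.enc.size + 1 ≤ (Deriv.contr Δ₁ Δ₂ φ d).enc.size := by
    simp only [Deriv.enc, Deriv.encRule, Data.node, Data.ofList, Data.size]; omega
  refine .of_step hd ih ?_
  intro K m τ δ S Z hI hF
  obtain ⟨δ₁, p, δ₂, rfl, hl⟩ := exists_middle hI.fm
  refine ⟨m, τ, δ₁ ++ p :: p :: δ₂, S, Z, hI.contr hl, hF.of_lt hd, fun P => step_contr P hl,
    fun _ => id, fun _ => id, id, fun k hk b C hf => ?_⟩
  have hs := (hI.size_encBits hF).2
  exact fn_rule hI hF hk rfl rfl rfl rfl (by omega)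
    (.extract (.var rfl) (.var rfl) (.var rfl) (.dup_bits hl hs (.var rfl) (.arg₀ rfl))
      (.arg₁ rfl) hf) (by norm_num) (by omega)

theorem Spec.andL {φ ψ : Fm Γ} {d : Deriv Γ Θ (Δ₁ ++ φ :: ψ :: Δ₂) (.mem t v)}
    (ih : Spec.{u} N g d) : Spec.{u} N g (.andL Δ₁ Δ₂ φ ψ d) := by
  have hd : d.enc.size + 1 ≤ (Deriv.andL Δ₁ Δ₂ φ ψ d).enc.size := by
    simp only [Deriv.enc, Deriv.encRule, Data.node, Data.ofList, Data.size]; omega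
  refine .of_step hd ih ?_
  intro K m τ δ S Z hI hF
  obtain ⟨δ₁, p, δ₂, rfl, hl⟩ := exists_middle hI.fm
  refine ⟨m, τ, δ₁ ++ p :: p :: δ₂, S, Z, hI.and hl, hF.of_lt hd, fun P => step_and P hl,
    fun _ => id, fun _ => id, id, fun k hk b C hf => ?_⟩
  have hs := (hI.size_encBits hF).2
  exact fn_rule hI hF hk rfl rfl rfl rfl (by omega)
    (.extract (.var rfl) (.var rfl) (.var rfl) (.dup_bits hl hs (.var rfl) (.arg₀ rfl))
      (.arg₁ rfl) hf) (by norm_num) (by omega)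

theorem Spec.exL {R : Ty} {z : Tm Γ (.set R)} {φ : Fm (R :: Γ)}
    {d : Deriv (R :: Γ) (⟨R, .var .zero, z.wk R⟩ :: Θ.map (Mem.wk R))
        (Δ₁.map (Fm.wk R) ++ φ :: Δ₂.map (Fm.wk R)) (.mem (t.wk R) (v.wk R))}
    (ih : Spec.{u} N g d) : Spec.{u} N g (.exL Δ₁ Δ₂ z φ d) := by
  have hd : d.enc.size + 1 ≤ (Deriv.exL Δ₁ Δ₂ z φ d).enc.size := by
    simp only [Deriv.enc, Deriv.encRule, Data.node, Data.ofList, Data.size]; omega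
  refine .of_step hd ih ?_
  intro K m τ δ S Z hI hF
  obtain ⟨δ₁, p, δ₂, rfl, hl⟩ := exists_middle hI.fm
  refine ⟨_, _, _, _, _, hI.ex hl, hF.cons_none hd, fun P => step_ex P hl,
    fun _ h => Tm.ok_wk h _ _ _, fun _ h => Tm.ok_wk h _ _ _,
    fun h => (Tm.all_ren _ _ _).2 h, fun k hk b C hf => ?_⟩
  have hs := (hI.size_encBits hF).2
  exact fn_rule hI hF hk rfl rfl rfl rfl (by omega)
    (.extract (.var rfl) (.cons .nil (.var rfl))
      (.cons (.nth_bits (l₁ := δ₁) (l₂ := δ₂) hl hs (.var rfl) (.arg₀ rfl)) (.var rfl))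
      (.var rfl) (.arg₁ rfl) hf) (by norm_num) (by omega)

theorem Spec.betaFst {R₁ R₂ : Ty} {t₁ : Tm Γ R₁} {t₂ : Tm Γ R₂} {Θ : List (Mem (R₁ :: Γ))}
    {Δ : List (Fm (R₁ :: Γ))} {t : Tm (R₁ :: Γ) T} {v : Tm (R₁ :: Γ) (.set T)}
    {d : Deriv Γ (Θ.map (Mem.sub (.inst t₁))) (Δ.map (Fm.sub (.inst t₁)))
      (.mem (t.sub (.inst t₁)) (v.sub (.inst t₁)))}
    (ih : Spec.{u} N g d) : Spec.{u} N g (.betaFst t₁ t₂ Θ Δ t v d) := by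
  have hd : d.enc.size + 1 ≤ (Deriv.betaFst t₁ t₂ Θ Δ t v d).enc.size := by
    simp only [Deriv.enc, Deriv.encRule, Data.node, Data.ofList, Data.size]; omega
  refine .of_step hd ih ?_
  intro K m τ δ S Z hI hF
  have hsub : ∀ P : ∀ T, Var Γ T → Prop, (Tm.fst (.pair t₁ t₂)).All P → t₁.All P :=
    fun P h => h.1
  refine ⟨m, τ, δ, S, Z, hI.beta hsub id id, hF.of_lt hd, fun P => step_beta P fun _ _ => rfl,
    fun _ => Tm.all_sub_of_sub (inst_all_of_beta hsub),
    fun _ => Tm.all_sub_of_sub (inst_all_of_beta hsub),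
    Tm.all_sub_of_sub (inst_all_of_beta hsub), fun k hk b C hf => ?_⟩
  exact fn_rule hI hF hk rfl rfl rfl rfl (by omega)
    (.extract (.var rfl) (.var rfl) (.var rfl) (.var rfl) (.arg₀ rfl) hf) (by norm_num)
    (by omega)

theorem Spec.betaSnd {R₁ R₂ : Ty} {t₁ : Tm Γ R₁} {t₂ : Tm Γ R₂} {Θ : List (Mem (R₂ :: Γ))}
    {Δ : List (Fm (R₂ :: Γ))} {t : Tm (R₂ :: Γ) T} {v : Tm (R₂ :: Γ) (.set T)}
    {d : Deriv Γ (Θ.map (Mem.sub (.inst t₂))) (Δ.map (Fm.sub (.inst t₂)))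
      (.mem (t.sub (.inst t₂)) (v.sub (.inst t₂)))}
    (ih : Spec.{u} N g d) : Spec.{u} N g (.betaSnd t₁ t₂ Θ Δ t v d) := by
  have hd : d.enc.size + 1 ≤ (Deriv.betaSnd t₁ t₂ Θ Δ t v d).enc.size := by
    simp only [Deriv.enc, Deriv.encRule, Data.node, Data.ofList, Data.size]; omega
  refine .of_step hd ih ?_
  intro K m τ δ S Z hI hF
  have hsub : ∀ P : ∀ T, Var Γ T → Prop, (Tm.snd (.pair t₁ t₂)).All P → t₂.All P :=
    fun P h => h.2
  refine ⟨m, τ, δ, S, Z, hI.beta hsub id id, hF.of_lt hd, fun P => step_beta P fun _ _ => rfl,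
    fun _ => Tm.all_sub_of_sub (inst_all_of_beta hsub),
    fun _ => Tm.all_sub_of_sub (inst_all_of_beta hsub),
    Tm.all_sub_of_sub (inst_all_of_beta hsub), fun k hk b C hf => ?_⟩
  exact fn_rule hI hF hk rfl rfl rfl rfl (by omega)
    (.extract (.var rfl) (.var rfl) (.var rfl) (.var rfl) (.arg₀ rfl) hf) (by norm_num)
    (by omega)

theorem Spec.eta {R₁ R₂ : Ty} {x : Var Γ (.prod R₁ R₂)}
    {d : Deriv (R₁ :: R₂ :: Γ) (Θ.map (Mem.sub (.eta x))) (Δ.map (Fm.sub (.eta x)))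
      (.mem (t.sub (.eta x)) (v.sub (.eta x)))}
    (ih : Spec.{u} N g d) : Spec.{u} N g (Deriv.eta (t := t) (v := v) x d) := by
  have hd : d.enc.size + 1 ≤ (Deriv.eta (t := t) (v := v) x d).enc.size := by
    simp only [Deriv.enc, Deriv.encRule, Data.node, Data.ofList, Data.size]; omega
  refine .of_step hd ih ?_
  intro K m τ δ S Z hI hF
  refine ⟨_, _, _, _, _, hI.eta x, hF.eta hd x, fun P => step_eta P x,
    fun _ h => (Tm.all_sub _ _ _).2 (h.mono fun T y hy => ok_eta x T y hy),
    fun _ h => (Tm.all_sub _ _ _).2 (h.mono fun T y hy => ok_eta x T y hy),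
    fun h => (Tm.all_sub _ _ _).2 (h.mono (eta_all_not x)), fun k hk b C hf => ?_⟩
  have hm := hF.size_map_le (by have := (Deriv.eta (t := t) (v := v) x d).le_size_enc; omega)
  cases hx : m.get x with
  | none =>
    simp only [PMap.eta, hx] at hf
    exact fn_rule hI hF hk rfl rfl rfl rfl (by omega)
      (.case_nil (.nth_none hx (by omega) (.var rfl) (.arg₀ rfl))
        (.extract (.var rfl) (.cons .nil (.cons .nil (.var rfl))) (.var rfl)
          (.var rfl) (.arg₁ rfl) hf)) (by norm_num) (by omega)
  | some e =>
    simp only [PMap.eta, hx] at hf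
    have hn {vs : List Data} {i₁ i₂ : Code} {n₁ n₂ r₁ r₂ : ℕ}
      (h₁ : Ev (costBound (sizeBound N)) vs i₁ m.enc n₁ r₁)
      (h₂ : Ev (costBound (sizeBound N)) vs i₂ x.enc n₂ r₂) :=
      Ev.nth_some (g := g) hx (Y := sizeBound N) (by omega) h₁ h₂
    simp only [Tm.enc_nrc] at hn
    exact fn_rule hI hF hk rfl rfl rfl rfl (by omega)
      (.case_some hx (by omega) (.var rfl) (.arg₀ rfl) fun _ _ =>
        (.extract (.var rfl) (.cons (.node_one 3 (hn (.var rfl) (.arg₀ rfl)))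
          (.cons (.node_one 4 (hn (.var rfl) (.arg₀ rfl))) (.var rfl))) (.var rfl)
          (.var rfl) (.arg₁ rfl) hf)) (by norm_num) (by omega)

/-- Common to the rules for `⊥` and for `s ≠ s`, which run the same handler under two different
tags. -/
theorem Spec.of_false {φ : Fm Γ} (hφ : ∀ (U : Type u) (ρ : Env U Γ), ¬ φ.holds ρ)
    {d : Deriv Γ Θ (Δ₁ ++ φ :: Δ₂) (.mem t v)}
    (hd : ∃ k ≤ 17, [12, 13, 14, 15, 16, 17, 18, 19, 20, 12, 21, 22, 23, 24, 20, 25, 25, 26][k]? =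
      some 20 ∧ d.encRule = .node k [.ofNat Δ₁.length]) : Spec.{u} N g d := by
  obtain ⟨k, hk', hk, hd⟩ := hd
  have hd' : d.enc = .cons (.ofList [Ctx.enc Γ, .ofList (Θ.map Mem.enc),
      .ofList ((Δ₁ ++ φ :: Δ₂).map Fm.enc), .cons (.ofNat 0) (.ofList [T.enc, t.enc, v.enc])])
      (.cons (.ofNat k) (.ofList [.ofNat Δ₁.length])) := by
    rw [Deriv.enc, hd]; rfl
  refine ⟨?_, ?_, trivial, trivial⟩
  · intro K m τ δ S Z hI hF _ _
    obtain ⟨δ₁, p, δ₂, rfl, hl⟩ := exists_middle hI.fm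
    refine ⟨.emp T, covers_of_false hl hφ, ?_⟩
    refine (fn_rule (R := 0) hI hF (by omega) hd' rfl hk rfl hk'
      (.case_nil (.var rfl) (.node_one 7 (.var rfl))) (by norm_num) (by omega)).mono ?_
    exact stepCost_le (Nat.succ_le_of_lt (Data.size_pos _)) (Nat.zero_le _)
  · intro K m τ δ S Z hI hF _ _
    obtain ⟨δ₁, p, δ₂, rfl, hl⟩ := exists_middle hI.fm
    have hs := (hI.size_encBits hF).2
    cases p with
    | false =>
      refine ⟨.emp .unit, interp_of_false_left hl hφ, ?_⟩
      refine (fn_rule (R := 0) hI hF (by omega) hd' rfl hk rfl hk'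
        (.case_var rfl (.case_nil (.nth_bits hl hs (.var rfl) (.arg₀ rfl))
          (.node_one 7 (.node_nil 1)))) (by norm_num) (by omega)).mono ?_
      exact stepCost_le (Nat.succ_le_of_lt (Data.size_pos _)) (Nat.zero_le _)
    | true =>
      refine ⟨.tt, interp_of_false_right hl hφ, ?_⟩
      refine (fn_rule (R := 0) hI hF (by omega) hd' rfl hk rfl hk'
        (.case_var rfl (.case_true (.nth_bits hl hs (.var rfl) (.arg₀ rfl)) .tt))
          (by norm_num) (by omega)).mono ?_
      exact stepCost_le (Nat.succ_le_of_lt (Data.size_pos _)) (Nat.zero_le _)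

theorem Spec.botL : Spec.{u} N g (Deriv.botL (Θ := Θ) Δ₁ Δ₂ (t := t) (v := v)) :=
  .of_false (φ := .bot) (fun _ _ h => by simp [Fm.holds] at h) ⟨8, by omega, rfl, rfl⟩

theorem Spec.neL {s : Tm Γ .ur} :
    Spec.{u} N g (Deriv.neL (Θ := Θ) Δ₁ Δ₂ s (t := t) (v := v)) :=
  .of_false (φ := .ne s s) (fun _ _ h => by simp [Fm.holds] at h) ⟨14, by omega, rfl, rfl⟩

/-- For a superset: if the membership is on the side `false`, its element is shared with the
right-hand side and is the only candidate; if it is on the side `true`, the set is shared and serves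
itself. For an interpolant, a membership of the side `false` has only common variables and is its
own interpolant. -/
theorem Spec.memUr {t : Tm Γ .ur} {v : Tm Γ (.set .ur)} :
    Spec.{u} N g (Deriv.memUr Θ₁ Θ₂ (Δ := Δ) (t := t) (v := v)) := by
  refine ⟨?_, ?_, trivial, trivial⟩
  · intro K m τ δ S Z hI hF _ hG
    obtain ⟨τ₁, q, τ₂, rfl, hl⟩ := exists_middle hI.mem
    have hs := (hI.size_encBits hF).1
    have hsz := (Deriv.memUr Θ₁ Θ₂ (Δ := Δ) (t := t) (v := v)).le_size_enc
    have hm := hF.size_map_le (by omega)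
    have hN := size_le_sizeBound N
    have hle := hF.le
    have hgs : t.enc.size + v.enc.size ≤ (Goal.mem t v).enc.size := by
      simp only [Goal.enc, Data.node, Data.ofList, Data.size]; omega
    have hA := ((forall₂_middle hl).1 hI.mem).2.1
    cases q with
    | false =>
      obtain ⟨t', ht⟩ := Tm.exists_tr (Tm.isSome_of_ok (by simp) hG.1 hA.elt)
      refine ⟨_, covers_of_elt ht, ?_⟩
      refine (fn_rule (R := 0) hI hF (by omega) rfl rfl rfl rfl (by omega)
        (.case_nil (.var rfl) (.case_nil (.nth_bits hl hs (.var rfl) (.arg₀ rfl))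
          (.sing (.tr ht (by omega) (by omega) (.var rfl) (.var rfl))))) (by norm_num)
          (by omega)).mono ?_
      exact stepCost_le (Nat.succ_le_of_lt (Data.size_pos _)) (Nat.zero_le _)
    | true =>
      obtain ⟨v', hv⟩ := Tm.exists_tr (Tm.isSome_of_ok (by simp) hG.2 hA.set)
      refine ⟨_, covers_of_right (.memUr Θ₁ Θ₂) hv, ?_⟩
      refine (fn_rule (R := 0) hI hF (by omega) rfl rfl rfl rfl (by omega)
        (.case_nil (.var rfl) (.case_true (.nth_bits hl hs (.var rfl) (.arg₀ rfl))
          (.tr hv (by omega) (by omega) (.var rfl) (.var rfl)))) (by norm_num)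
          (by omega)).mono ?_
      exact stepCost_le (Nat.succ_le_of_lt (Data.size_pos _)) (Nat.zero_le _)
  · intro K m τ δ S Z hI hF _ hG
    obtain ⟨τ₁, q, τ₂, rfl, hl⟩ := exists_middle hI.mem
    have hs := (hI.size_encBits hF).1
    have hsz := (Deriv.memUr Θ₁ Θ₂ (Δ := Δ) (t := t) (v := v)).le_size_enc
    have hm := hF.size_map_le (by omega)
    have hN := size_le_sizeBound N
    have hle := hF.le
    have hgs : t.enc.size + v.enc.size ≤ (Goal.mem t v).enc.size := by
      simp only [Goal.enc, Data.node, Data.ofList, Data.size]; omega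
    have hA := ((forall₂_middle hl).1 hI.mem).2.1
    cases q with
    | false =>
      obtain ⟨t', ht⟩ := Tm.exists_tr (Tm.isSome_of_ok (by simp) hG.1 hA.elt)
      obtain ⟨v', hv⟩ := Tm.exists_tr (Tm.isSome_of_ok (by simp) hG.2 hA.set)
      refine ⟨_, interp_memUr_false hl ht hv, ?_⟩
      refine (fn_rule (R := 0) hI hF (by omega) rfl rfl rfl rfl (by omega)
        (.case_var rfl (.case_nil (.nth_bits hl hs (.var rfl) (.arg₀ rfl))
          (.isMem (.tr ht (by omega) (by omega) (.var rfl) (.var rfl))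
            (.tr hv (by omega) (by omega) (.var rfl) (.var rfl))))) (by norm_num)
          (by omega)).mono ?_
      exact stepCost_le (Nat.succ_le_of_lt (Data.size_pos _)) (Nat.zero_le _)
    | true =>
      refine ⟨_, interp_memUr_true hl, ?_⟩
      refine (fn_rule (R := 0) hI hF (by omega) rfl rfl rfl rfl (by omega)
        (.case_var rfl (.case_true (.nth_bits hl hs (.var rfl) (.arg₀ rfl)) .tt)) (by norm_num)
          (by omega)).mono ?_
      exact stepCost_le (Nat.succ_le_of_lt (Data.size_pos _)) (Nat.zero_le _)

end rules

theorem stepCost_le_add {N n n₁ n₂ : ℕ} (h : n₁ + n₂ + 1 ≤ n) :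
    stepCost N + (stepCost N * n₁ + stepCost N * n₂) ≤ stepCost N * n :=
  stepCost_le h (Nat.mul_add _ _ _).ge

theorem Tm.All.imp_ok {K K' Γ : Ctx} {m : PMap K Γ} {m' : PMap K' Γ} {S : ∀ T, Var Γ T → Bool}
    {p : Bool} {T : Ty} {t : Tm Γ T} (h : t.All (Ok m S p))
    (hm : ∀ T (x : Var Γ T), (m.get x).isSome → (m'.get x).isSome) : t.All (Ok m' S p) :=
  h.mono fun _ _ h => h.imp_left (hm _ _)

theorem PMap.isSome_wk {K Γ : Ctx} {m : PMap K Γ} {R : Ty} (T : Ty) (x : Var Γ T)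
    (h : (m.get x).isSome) : ((m.wk R).get x).isSome := by simpa using h

/-- The sizes of the components of a call. -/
structure CallSizes {K Γ : Ctx} (N : ℕ) (m : PMap K Γ) (τ δ : List Bool) (Θ : List (Mem Γ))
    (Δ : List (Fm Γ)) (G : Goal Γ) (n : ℕ) : Prop where
  map : m.enc.size + 1 ≤ sizeBound N
  memBits : (encBits τ).size ≤ sizeBound N
  fmBits : (encBits δ).size ≤ sizeBound N
  mems : (Data.ofList (Θ.map Mem.enc)).size ≤ N
  fms : (Data.ofList (Δ.map Fm.enc)).size ≤ N
  goal : G.enc.size ≤ N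
  ctx : Γ.length + 1 ≤ n
  le : N + 1 ≤ sizeBound N

/-! ### Specification: disjunction, universal quantification, membership, substitution -/

section rules

variable {N : ℕ} {g : Bool} {K Γ : Ctx} {Θ Θ₁ Θ₂ : List (Mem Γ)} {Δ Δ₁ Δ₂ : List (Fm Γ)}
  {T : Ty} {t : Tm Γ T} {v : Tm Γ (.set T)} {m : PMap K Γ} {τ δ : List Bool}
  {S : ∀ T, Var Γ T → Bool} {Z : ∀ T, Var Γ T → Prop}

theorem Fits.callSizes {G : Goal Γ} {d : Deriv Γ Θ Δ G} (hF : Fits N m d.enc.size)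
    (hI : TSeq.Inv ⟨m, τ, δ, Θ, Δ⟩ S Z) : CallSizes N m τ δ Θ Δ G d.enc.size := by
  have h₁ := d.le_size_enc
  have h₂ := hF.le
  have h₃ := hF.size_map_le (by omega)
  have h₄ := size_le_sizeBound N
  exact ⟨by omega, (hI.size_encBits hF).1, (hI.size_encBits hF).2, by omega, by omega, by omega,
    by omega, by omega⟩

theorem Spec.orL {φ ψ : Fm Γ} {d₁ : Deriv Γ Θ (Δ₁ ++ φ :: Δ₂) (.mem t v)}
    {d₂ : Deriv Γ Θ (Δ₁ ++ ψ :: Δ₂) (.mem t v)} (ih₁ : Spec.{u} N g d₁) (ih₂ : Spec.{u} N g d₂) :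
    Spec.{u} N g (.orL Δ₁ Δ₂ φ ψ d₁ d₂) := by
  have hd : d₁.enc.size + d₂.enc.size + 1 ≤ (Deriv.orL Δ₁ Δ₂ φ ψ d₁ d₂).enc.size := by
    simp only [Deriv.enc, Deriv.encRule, Data.node, Data.ofList, Data.size]; omega
  refine ⟨?_, ?_, trivial, trivial⟩
  · intro K m τ δ S Z hI hF hZ hG
    obtain ⟨δ₁, p, δ₂, rfl, hl⟩ := exists_middle hI.fm
    obtain ⟨E, hE, hf⟩ := ih₁.sup (hI.or hl).1 (hF.of_lt (by omega)) hZ hG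
    obtain ⟨F, hF', hf'⟩ := ih₂.sup (hI.or hl).2 (hF.of_lt (by omega)) hZ hG
    refine ⟨.union E F, hE.or hl hF', (fn_rule hI hF (by omega) rfl rfl rfl rfl (by omega)
      (.case_nil (.var rfl) (.union
        (.extract (.var rfl) (.var rfl) (.var rfl) (.var rfl) (.arg₁ rfl) hf)
        (.extract (.var rfl) (.var rfl) (.var rfl) (.var rfl) (.arg₂ rfl) hf')))
        (by norm_num) ?_).mono (stepCost_le_add hd)⟩
    omega
  · intro K m τ δ S Z hI hF hZ hG
    obtain ⟨δ₁, p, δ₂, rfl, hl⟩ := exists_middle hI.fm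
    obtain ⟨E, hE, hf⟩ := ih₁.itp (hI.or hl).1 (hF.of_lt (by omega)) hZ hG
    obtain ⟨F, hF', hf'⟩ := ih₂.itp (hI.or hl).2 (hF.of_lt (by omega)) hZ hG
    have hs := (hF.callSizes hI).fmBits
    cases p with
    | false =>
      refine ⟨.union E F, hE.or_false hl hF', (fn_rule hI hF (by omega) rfl rfl rfl rfl (by omega)
        (.case_var rfl (.case_nil (.nth_bits hl hs (.var rfl) (.arg₀ rfl)) (.union
          (.extract (.var rfl) (.var rfl) (.var rfl) (.var rfl) (.arg₁ rfl) hf)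
          (.extract (.var rfl) (.var rfl) (.var rfl) (.var rfl) (.arg₂ rfl) hf'))))
          (by norm_num) ?_).mono (stepCost_le_add hd)⟩
      omega
    | true =>
      refine ⟨.conj E F, hE.or_true hl hF', (fn_rule hI hF (by omega) rfl rfl rfl rfl (by omega)
        (.case_var rfl (.case_true (.nth_bits hl hs (.var rfl) (.arg₀ rfl)) (.conj
          (.extract (.var rfl) (.var rfl) (.var rfl) (.var rfl) (.arg₁ rfl) hf)
          (.extract (.var rfl) (.var rfl) (.var rfl) (.var rfl) (.arg₂ rfl) hf'))))
          (by norm_num) ?_).mono (stepCost_le_add hd)⟩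
      omega

/-- If membership and formula share their side, the instance stays there. Otherwise the bound occurs
on both sides, hence is expressible, and capturing the element makes the instance legal on the side
of the formula. -/
theorem Spec.allL {R : Ty} {s : Tm Γ R} {z : Tm Γ (.set R)} {φ : Fm (R :: Γ)}
    {d : Deriv Γ (Θ₁ ++ ⟨R, s, z⟩ :: Θ₂) (Δ₁ ++ φ.sub (.inst s) :: Δ₂) (.mem t v)}
    (ih : Spec.{u} N g d) : Spec.{u} N g (.allL Θ₁ Θ₂ Δ₁ Δ₂ s z φ d) := by
  have hd : d.enc.size + 1 ≤ (Deriv.allL Θ₁ Θ₂ Δ₁ Δ₂ s z φ d).enc.size := by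
    simp only [Deriv.enc, Deriv.encRule, Data.node, Data.ofList, Data.size]; omega
  refine ⟨?_, ?_, trivial, trivial⟩
  · intro K m τ δ S Z hI hF hZ hG
    obtain ⟨δ₁, p, δ₂, rfl, hl⟩ := exists_middle hI.fm
    obtain ⟨τ₁, q, τ₂, rfl, hl'⟩ := exists_middle hI.mem
    have hA := ((forall₂_middle hl').1 hI.mem).2.1
    have hφ := ((forall₂_middle hl).1 hI.fm).2.1
    have hs := hF.callSizes hI
    have hsz := (Ev.size_entry_le hs.mems).2
    by_cases hpq : q = p
    · subst hpq
      obtain ⟨E, hE, hf⟩ := ih.sup (hI.all hl hl' hA.elt) (hF.of_lt hd) hZ hG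
      refine ⟨E, .of_step (step_all _ hl hl' fun h => h) hE, ?_⟩
      cases q with
      | false =>
        refine (fn_rule hI hF (by omega) rfl rfl rfl rfl (by omega)
          (.case_nil (.nth_bits hl' hs.memBits (.var rfl) (.arg₀ rfl))
            (.case_nil (.nth_bits hl hs.fmBits (.var rfl) (.arg₁ rfl))
              (.extract (.var rfl) (.var rfl) (.var rfl) (.var rfl) (.arg₂ rfl) hf)))
          (by norm_num) ?_).mono (stepCost_le hd le_rfl)
        omega
      | true =>
        refine (fn_rule hI hF (by omega) rfl rfl rfl rfl (by omega)
          (.case_true (.nth_bits hl' hs.memBits (.var rfl) (.arg₀ rfl))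
            (.case_true (.nth_bits hl hs.fmBits (.var rfl) (.arg₁ rfl))
              (.extract (.var rfl) (.var rfl) (.var rfl) (.var rfl) (.arg₂ rfl) hf)))
          (by norm_num) ?_).mono (stepCost_le hd le_rfl)
        omega
    · have hst := hI.isTree hl hl'
      have hall := PMap.all_bindTree (m.wk R) s (.var .zero) hst
      obtain ⟨z', hz'⟩ : ∃ z', z.tr m = some z' :=
        Tm.exists_tr (Tm.isSome_of_ok hpq hA.set hφ.ok.1)
      obtain ⟨E, hE, hf⟩ := ih.sup ((hI.mono (PMap.isSome_capture s)).all hl hl'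
        (hall.mono fun _ _ => .inl)) (hF.capture hd (by omega)) hZ
        ⟨hG.1.imp_ok (PMap.isSome_capture s), hG.2.imp_ok (PMap.isSome_capture s)⟩
      refine ⟨_, hE.all hl hl' hz', ?_⟩
      have hle := hs.le
      cases q with
      | false =>
        cases p with
        | false => exact absurd rfl hpq
        | true =>
          refine (fn_rule hI hF (by omega) rfl rfl rfl rfl (by omega)
            (.case_nil (.nth_bits hl' hs.memBits (.var rfl) (.arg₀ rfl))
              (.case_true (.nth_bits hl hs.fmBits (.var rfl) (.arg₁ rfl))
                (.case_nil (.var rfl) (.big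
                  (.tr hz' hs.map (by omega) (.var rfl)
                    (.entrySet rfl rfl (hs.mems.trans (by omega))))
                  (.extract (.var rfl) (.capture hF hs.ctx rfl rfl rfl hst hs.mems) (.var rfl)
                    (.var rfl) (.arg₂ rfl) hf)))))
            (by norm_num) ?_).mono (stepCost_le hd le_rfl)
          omega
      | true =>
        cases p with
        | true => exact absurd rfl hpq
        | false =>
          refine (fn_rule hI hF (by omega) rfl rfl rfl rfl (by omega)
            (.case_true (.nth_bits hl' hs.memBits (.var rfl) (.arg₀ rfl))
              (.case_nil (.nth_bits hl hs.fmBits (.var rfl) (.arg₁ rfl))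
                (.case_nil (.var rfl) (.big
                  (.tr hz' hs.map (by omega) (.var rfl)
                    (.entrySet rfl rfl (hs.mems.trans (by omega))))
                  (.extract (.var rfl) (.capture hF hs.ctx rfl rfl rfl hst hs.mems) (.var rfl)
                    (.var rfl) (.arg₂ rfl) hf)))))
            (by norm_num) ?_).mono (stepCost_le hd le_rfl)
          omega
  · intro K m τ δ S Z hI hF hZ hG
    obtain ⟨δ₁, p, δ₂, rfl, hl⟩ := exists_middle hI.fm
    obtain ⟨τ₁, q, τ₂, rfl, hl'⟩ := exists_middle hI.mem
    have hA := ((forall₂_middle hl').1 hI.mem).2.1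
    have hφ := ((forall₂_middle hl).1 hI.fm).2.1
    have hs := hF.callSizes hI
    have hsz := (Ev.size_entry_le hs.mems).2
    by_cases hpq : q = p
    · subst hpq
      obtain ⟨E, hE, hf⟩ := ih.itp (hI.all hl hl' hA.elt) (hF.of_lt hd) hZ hG
      refine ⟨E, .of_step (fun b => step_all _ hl hl' fun h => h) hE, ?_⟩
      cases q with
      | false =>
        refine (fn_rule hI hF (by omega) rfl rfl rfl rfl (by omega)
          (.case_nil (.nth_bits hl' hs.memBits (.var rfl) (.arg₀ rfl))
            (.case_nil (.nth_bits hl hs.fmBits (.var rfl) (.arg₁ rfl))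
              (.extract (.var rfl) (.var rfl) (.var rfl) (.var rfl) (.arg₂ rfl) hf)))
          (by norm_num) ?_).mono (stepCost_le hd le_rfl)
        omega
      | true =>
        refine (fn_rule hI hF (by omega) rfl rfl rfl rfl (by omega)
          (.case_true (.nth_bits hl' hs.memBits (.var rfl) (.arg₀ rfl))
            (.case_true (.nth_bits hl hs.fmBits (.var rfl) (.arg₁ rfl))
              (.extract (.var rfl) (.var rfl) (.var rfl) (.var rfl) (.arg₂ rfl) hf)))
          (by norm_num) ?_).mono (stepCost_le hd le_rfl)
        omega
    · have hst := hI.isTree hl hl'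
      have hall := PMap.all_bindTree (m.wk R) s (.var .zero) hst
      obtain ⟨z', hz'⟩ : ∃ z', z.tr m = some z' :=
        Tm.exists_tr (Tm.isSome_of_ok hpq hA.set hφ.ok.1)
      obtain ⟨e, he⟩ := Tm.exists_tr (m := m.capture s) hall
      obtain ⟨E, hE, hf⟩ := ih.itp ((hI.mono (PMap.isSome_capture s)).all hl hl'
        (hall.mono fun _ _ => .inl)) (hF.capture hd (by omega)) hZ
        ⟨hG.1.imp_ok (PMap.isSome_capture s), hG.2.imp_ok (PMap.isSome_capture s)⟩
      have hle := hs.le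
      cases q with
      | false =>
        cases p with
        | false => exact absurd rfl hpq
        | true =>
          refine ⟨_, hE.all_true hl hl' hI hG.1 hG.2 hz' he, ?_⟩
          refine (fn_rule hI hF (by omega) rfl rfl rfl rfl (by omega)
            (.case_nil (.nth_bits hl' hs.memBits (.var rfl) (.arg₀ rfl))
              (.case_true (.nth_bits hl hs.fmBits (.var rfl) (.arg₁ rfl))
                (.case_var rfl (.big
                  (.tr hz' hs.map (by omega) (.var rfl)
                    (.entrySet rfl rfl (hs.mems.trans (by omega))))
                  (.guardAnd (.captureNeq hF hs.ctx rfl rfl rfl hst hs.mems he)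
                    (.extract (.var rfl) (.capture hF hs.ctx rfl rfl rfl hst hs.mems) (.var rfl)
                      (.var rfl) (.arg₂ rfl) hf))))))
            (by norm_num) ?_).mono (stepCost_le hd le_rfl)
          omega
      | true =>
        cases p with
        | true => exact absurd rfl hpq
        | false =>
          refine ⟨_, hE.all_false hl hl' hI hz' he, ?_⟩
          refine (fn_rule hI hF (by omega) rfl rfl rfl rfl (by omega)
            (.case_true (.nth_bits hl' hs.memBits (.var rfl) (.arg₀ rfl))
              (.case_nil (.nth_bits hl hs.fmBits (.var rfl) (.arg₁ rfl))
                (.case_var rfl (.neg (.big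
                  (.tr hz' hs.map (by omega) (.var rfl)
                    (.entrySet rfl rfl (hs.mems.trans (by omega))))
                  (.neg (.union (.captureNeq hF hs.ctx rfl rfl rfl hst hs.mems he)
                    (.extract (.var rfl) (.capture hF hs.ctx rfl rfl rfl hst hs.mems) (.var rfl)
                      (.var rfl) (.arg₂ rfl) hf))))))))
            (by norm_num) ?_).mono (stepCost_le hd le_rfl)
          omega

/-- The side of `s ∈ v` decides. For a superset, either `s = t` is an equation across the sides,
which goes to the premise, or `v` is common and serves itself. For an interpolant, an `s` of the
side `false` must first be made common, or, at Ur type, both terms are compared with `v`. -/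
theorem Spec.memR {s t : Tm Γ T} {d : Deriv Γ (Θ₁ ++ ⟨T, s, v⟩ :: Θ₂) Δ (.eq s t)}
    (ih : Spec.{u} N g d) : Spec.{u} N g (.memR Θ₁ Θ₂ d) := by
  have hd : d.enc.size + 1 ≤ (Deriv.memR Θ₁ Θ₂ d).enc.size := by
    simp only [Deriv.enc, Deriv.encRule, Data.node, Data.ofList, Data.size]; omega
  refine ⟨?_, ?_, trivial, trivial⟩
  · intro K m τ δ S Z hI hF hZ hG
    obtain ⟨τ₁, q, τ₂, rfl, hl⟩ := exists_middle hI.mem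
    have hA := ((forall₂_middle hl).1 hI.mem).2.1
    have hs := hF.callSizes hI
    have hsz := (Ev.size_entry_le hs.mems).2
    have hle := hs.le
    cases q with
    | false =>
      obtain ⟨E, hE, hf⟩ := ih.sup hI (hF.of_lt hd) ⟨hA.elt_not, hZ⟩ ⟨hA.elt, hG.1⟩
      refine ⟨E, hE.memR, (fn_rule hI hF (by omega) rfl rfl rfl rfl (by omega)
        (.case_nil (.var rfl) (.case_nil (.nth_bits hl hs.memBits (.var rfl) (.arg₀ rfl))
          (.extract (.var rfl) (.var rfl) (.var rfl) (.var rfl) (.arg₁ rfl) hf)))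
        (by norm_num) ?_).mono (stepCost_le hd le_rfl)⟩
      omega
    | true =>
      obtain ⟨v', hv⟩ := Tm.exists_tr (Tm.isSome_of_ok (by simp) hG.2 hA.set)
      refine ⟨_, covers_of_right (.memR Θ₁ Θ₂ d) hv,
        (fn_rule (R := 0) hI hF (by omega) rfl rfl rfl rfl (by omega)
        (.case_nil (.var rfl) (.case_true (.nth_bits hl hs.memBits (.var rfl) (.arg₀ rfl))
          (.tr hv hs.map (by omega) (.var rfl) (.var rfl))))
        (by norm_num) ?_).mono (stepCost_le hd (Nat.zero_le _))⟩
      omega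
  · intro K m τ δ S Z hI hF hZ hG
    obtain ⟨τ₁, q, τ₂, rfl, hl⟩ := exists_middle hI.mem
    have hA := ((forall₂_middle hl).1 hI.mem).2.1
    have hs := hF.callSizes hI
    have hsz := (Ev.size_entry_le hs.mems).2
    have hle := hs.le
    cases q with
    | true =>
      obtain ⟨E, hE, hf⟩ := ih.itp hI (hF.of_lt hd) ⟨hA.elt_not, hZ⟩ ⟨hA.elt, hG.1⟩
      refine ⟨E, hE.memR_true hl, (fn_rule hI hF (by omega) rfl rfl rfl rfl (by omega)
        (.case_var rfl (.case_true (.nth_bits hl hs.memBits (.var rfl) (.arg₀ rfl))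
          (.extract (.var rfl) (.var rfl) (.var rfl) (.var rfl) (.arg₁ rfl) hf)))
        (by norm_num) ?_).mono (stepCost_le hd le_rfl)⟩
      omega
    | false =>
      obtain ⟨v', hv⟩ := Tm.exists_tr (Tm.isSome_of_ok (by simp) hG.2 hA.set)
      by_cases hT : T = .ur
      · subst hT
        obtain ⟨E, hE, hf⟩ := ih.mixed (hI.wk (R := .set .ur)) (hF.wk hd) ⟨hA.elt_not, hZ⟩
          (hA.elt.imp_ok PMap.isSome_wk) (hG.1.imp_ok PMap.isSome_wk)
        refine ⟨_, Interp.memR_ur hl hv hE, (fn_rule hI hF (by omega) rfl rfl rfl rfl (by omega)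
          (.case_var rfl (.case_nil (.nth_bits hl hs.memBits (.var rfl) (.arg₀ rfl))
            (.case_nil (.case_var (a := .ofNat 0) (b := .nil) rfl (.var rfl))
              (.letIn (.tr hv hs.map (by omega) (.var rfl) (.var rfl))
                (.extract (.nat 2) (.wkMap hs.map (.var rfl)) (.var rfl) (.var rfl) (.arg₁ rfl)
                  hf)))))
          (by norm_num) ?_).mono (stepCost_le hd le_rfl)⟩
        omega
      -- A marked variable has type `Set(Ur)`, so at any other type the element is a tuple of
      -- variables.
      · have hst : s.IsTree := by
          refine hA.shape.resolve_right fun h => ?_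
          dsimp only at h
          cases v with
          | var x => exact hT (Ty.set.inj (hI.ty _ _ h))
          | _ => exact h
        have hall := PMap.all_bindTree (m.wk T) s (.var .zero) hst
        obtain ⟨e, he⟩ := Tm.exists_tr (m := m.capture s) hall
        obtain ⟨E, hE, hf⟩ := ih.itp (hI.mono (PMap.isSome_capture s))
          (hF.capture hd (by omega)) ⟨hA.elt_not, hZ⟩
          ⟨hall.mono fun _ _ => .inl, hG.1.imp_ok (PMap.isSome_capture s)⟩
        refine ⟨_, hE.memR_false hl hI hG.1 hv he, ?_⟩
        -- The program recognizes a type other than Ur by its positive tag.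
        have hT' : ∃ k a, T.enc = .cons (.ofNat (k + 1)) a := by
          cases T with
          | ur => exact absurd rfl hT
          | _ => exact ⟨_, _, rfl⟩
        obtain ⟨k, a, hk⟩ := hT'
        have hTs : T.enc.size ≤ costBound (sizeBound N) := by
          have : T.enc.size ≤ (Goal.mem t v).enc.size := by
            simp only [Goal.enc, Data.node, Data.ofList, Data.size]; omega
          have := hs.goal
          exact le_costBound (i := 1) (by omega) (by omega)
        have hTs' : (Data.ofNat (k + 1)).size ≤ costBound (sizeBound N) := by
          rw [hk] at hTs
          simp only [Data.size] at hTs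
          omega
        refine (fn_rule hI hF (by omega) rfl rfl rfl rfl (by omega)
          (.case_var rfl (.case_nil (.nth_bits hl hs.memBits (.var rfl) (.arg₀ rfl))
            (.case_cons (a := .nil) (b := .ofNat k)
              (.hd (b := a) (.var (congrArg some hk)) (hk ▸ hTs)) hTs'
              (.big (.tr hv hs.map (by omega) (.var rfl) (.var rfl))
                (.guardAnd (.captureNeq hF hs.ctx rfl rfl rfl hst hs.mems he)
                  (.extract (.var rfl) (.capture hF hs.ctx rfl rfl rfl hst hs.mems) (.var rfl)
                    (.var rfl) (.arg₁ rfl) hf))))))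
          (by norm_num) ?_).mono (stepCost_le hd le_rfl)
        omega

theorem Ev.eqVars {j : ℕ} {vs : List Data} {x y : Var Γ .ur} {l : List Data}
    (hΔ : vs[10 + j]? = some (.ofList ((Δ₁ ++ .eq (.var x) (.var y) :: Δ₂).map Fm.enc)))
    (ha : vs[17 + j]? = some (.ofList (.ofNat Δ₁.length :: l)))
    (hs : (Data.ofList ((Δ₁ ++ .eq (.var x) (.var y) :: Δ₂).map Fm.enc)).size ≤ sizeBound N) :
    Ev (costBound (sizeBound N)) vs
      (Code.hd (Code.tl (Code.hd (Code.tl (Code.nth (Code.fms j) (Code.arg₀ j)))))) x.enc 15 0 ∧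
    Ev (costBound (sizeBound N)) vs
      (Code.hd (Code.tl (Code.hd (Code.tl (Code.tl (Code.nth (Code.fms j) (Code.arg₀ j)))))))
      y.enc 17 0 := by
  have hm := Data.size_lt_of_mem (a := Fm.enc (.eq (.var x) (.var y)))
    (l := (Δ₁ ++ .eq (.var x) (.var y) :: Δ₂).map Fm.enc) (by simp)
  have hY : sizeBound N ≤ costBound (sizeBound N) := by
    have := size_le_sizeBound N
    exact le_costBound (i := 1) (by omega) (by omega)
  have hn : Ev (costBound (sizeBound N)) vs (Code.nth (Code.fms j) (Code.arg₀ j))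
      (Fm.enc (.eq (.var x) (.var y))) 7 0 := by
    refine Ev.nth (n₁ := 1) (n₂ := 3) (r₁ := 0) (r₂ := 0) (i := Δ₁.length) ?_ hs (.var hΔ)
      (.arg₀ ha)
    simp
  simp only [Fm.enc, Tm.enc, Data.node, Data.ofList, Data.size] at hm hn
  constructor
  · refine ((((hn.tl ?_).hd ?_).tl ?_).hd ?_) <;> (simp only [Data.size]; omega)
  · refine ((((hn.tl ?_).tl ?_).hd ?_).tl ?_).hd ?_ <;> (simp only [Data.size]; omega)

theorem Ev.set_map {Y : ℕ} {vs : List Data} {e₁ e₂ e₃ : Code} {n₁ n₂ n₃ r₁ r₂ r₃ : ℕ}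
    {y : Var Γ T} {p : Path K T} (hm : m.enc.size + 1 ≤ Y) (hp : p.tm.enc.size ≤ Y)
    (h₁ : Ev (costBound Y) vs e₁ m.enc n₁ r₁) (h₂ : Ev (costBound Y) vs e₂ y.enc n₂ r₂)
    (h₃ : Ev (costBound Y) vs e₃ (p.tm.nrc false).enc n₃ r₃) :
    Ev (costBound Y) vs (Code.setNth e₁ e₂ e₃) (m.set y p).enc (n₁ + n₂ + n₃ + 4)
      (r₁ + r₂ + r₃) := by
  rw [Tm.enc_nrc] at h₃
  rw [PMap.enc, PMap.encList_set]
  exact Ev.setNth (by rw [PMap.length_encList]; exact y.idx_lt) (Nat.le_of_succ_le hm) hp h₁ h₂ h₃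

theorem PMap.merge_of_none {x y : Var Γ T} (hx : m.get x = none) : m.merge x y = m := by
  simp [PMap.merge, hx]

theorem PMap.merge_of_some_none {x y : Var Γ T} {e : Path K T} (hx : m.get x = some e)
    (hy : m.get y = none) : m.merge x y = m.set y e := by
  simp [PMap.merge, hx, hy]

theorem PMap.merge_of_some_some {x y : Var Γ T} {e e' : Path K T} (hx : m.get x = some e)
    (hy : m.get y = some e') : m.merge x y = m := by
  simp [PMap.merge, hx, hy]

theorem Spec.eqSubst {x y : Var Γ .ur} {d : Deriv Γ (Θ.map (Mem.sub (.replace x y)))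
      (Δ₁.map (Fm.sub (.replace x y)) ++ Δ₂.map (Fm.sub (.replace x y)))
      (.mem (t.sub (.replace x y)) (v.sub (.replace x y)))} (ih : Spec.{u} N g d) :
    Spec.{u} N g (Deriv.eqSubst (t := t) (v := v) Δ₁ Δ₂ x y d) := by
  have hd : d.enc.size + 1 ≤ (Deriv.eqSubst (t := t) (v := v) Δ₁ Δ₂ x y d).enc.size := by
    simp only [Deriv.enc, Deriv.encRule, Data.node, Data.ofList, Data.size]; omega
  refine ⟨?_, ?_, trivial, trivial⟩
  · intro K m τ δ S Z hI hF hZ hG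
    obtain ⟨δ₁, p, δ₂, rfl, hl⟩ := exists_middle hI.fm
    have hφ := ((forall₂_middle hl).1 hI.fm).2.1
    have hs := hF.callSizes hI
    have hle := hs.le
    have hΔ := hs.fms.trans (show N ≤ sizeBound N by omega)
    obtain ⟨E, hE, hf⟩ := ih.sup (hI.eqSubst hl) (hF.merge hd x y)
      ((Tm.all_sub _ _ _).2 (hZ.mono (replace_all_not hI.ty x y)))
      ⟨(Tm.all_sub _ _ _).2 (hG.1.mono (ok_replace hφ.ok.1 hφ.ok.2)),
        (Tm.all_sub _ _ _).2 (hG.2.mono (ok_replace hφ.ok.1 hφ.ok.2))⟩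
    -- Supersets refer to models of both sides, in which the equation holds; no test is needed.
    refine ⟨E, .of_step (step_eqSubst_same _ trivial hl) hE, ?_⟩
    cases hx : m.get x with
    | none =>
      rw [PMap.merge_of_none hx] at hf
      refine (fn_rule hI hF (by omega) rfl rfl rfl rfl (by omega)
        (.case_nil (.nth_none hx hs.map (.var rfl) (Ev.eqVars rfl rfl hΔ).1)
          (.extract (.var rfl) (.var rfl) (.var rfl)
            (.remove_bits hl hs.fmBits (.var rfl) (.arg₀ rfl)) (.arg₁ rfl) hf))
        (by norm_num) ?_).mono (stepCost_le hd le_rfl)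
      omega
    | some e =>
      have he := PMap.size_get_lt hx
      have hm := hs.map
      cases hy : m.get y with
      | none =>
        rw [PMap.merge_of_some_none hx hy] at hf
        refine (fn_rule hI hF (by omega) rfl rfl rfl rfl (by omega)
          (.case_some hx hs.map (.var rfl) (Ev.eqVars rfl rfl hΔ).1 fun _ _ =>
            .case_nil (.nth_none hy hs.map (.var rfl) (Ev.eqVars rfl rfl hΔ).2)
            (.extract (.var rfl) (.set_map hs.map (by omega) (.var rfl) (Ev.eqVars rfl rfl hΔ).2
              (.nth_some hx hs.map (.var rfl) (Ev.eqVars rfl rfl hΔ).1)) (.var rfl)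
              (.remove_bits hl hs.fmBits (.var rfl) (.arg₀ rfl)) (.arg₁ rfl) hf))
          (by norm_num) ?_).mono (stepCost_le hd le_rfl)
        omega
      | some e' =>
        rw [PMap.merge_of_some_some hx hy] at hf
        refine (fn_rule hI hF (by omega) rfl rfl rfl rfl (by omega)
          (.case_some hx hs.map (.var rfl) (Ev.eqVars rfl rfl hΔ).1 fun _ _ =>
            .case_some hy hs.map (.var rfl) (Ev.eqVars rfl rfl hΔ).2 fun _ _ =>
            .case_nil (.var rfl) (.extract (.var rfl) (.var rfl) (.var rfl)
              (.remove_bits hl hs.fmBits (.var rfl) (.arg₀ rfl)) (.arg₁ rfl) hf))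
          (by norm_num) ?_).mono (stepCost_le hd le_rfl)
        omega
  · intro K m τ δ S Z hI hF hZ hG
    obtain ⟨δ₁, p, δ₂, rfl, hl⟩ := exists_middle hI.fm
    have hφ := ((forall₂_middle hl).1 hI.fm).2.1
    have hs := hF.callSizes hI
    have hle := hs.le
    have hΔ := hs.fms.trans (show N ≤ sizeBound N by omega)
    obtain ⟨E, hE, hf⟩ := ih.itp (hI.eqSubst hl) (hF.merge hd x y)
      ((Tm.all_sub _ _ _).2 (hZ.mono (replace_all_not hI.ty x y)))
      ⟨(Tm.all_sub _ _ _).2 (hG.1.mono (ok_replace hφ.ok.1 hφ.ok.2)),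
        (Tm.all_sub _ _ _).2 (hG.2.mono (ok_replace hφ.ok.1 hφ.ok.2))⟩
    cases hx : m.get x with
    | none =>
      refine ⟨E, hE.eqSubst hl hI hG.1 hG.2 (fun e e' h => by simp [hx] at h), ?_⟩
      rw [PMap.merge_of_none hx] at hf
      refine (fn_rule hI hF (by omega) rfl rfl rfl rfl (by omega)
        (.case_nil (.nth_none hx hs.map (.var rfl) (Ev.eqVars rfl rfl hΔ).1)
          (.extract (.var rfl) (.var rfl) (.var rfl)
            (.remove_bits hl hs.fmBits (.var rfl) (.arg₀ rfl)) (.arg₁ rfl) hf))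
        (by norm_num) ?_).mono (stepCost_le hd le_rfl)
      omega
    | some e =>
      have he := PMap.size_get_lt hx
      have hm := hs.map
      cases hy : m.get y with
      | none =>
        refine ⟨E, hE.eqSubst hl hI hG.1 hG.2 (fun e e' _ h => by simp [hy] at h), ?_⟩
        rw [PMap.merge_of_some_none hx hy] at hf
        refine (fn_rule hI hF (by omega) rfl rfl rfl rfl (by omega)
          (.case_some hx hs.map (.var rfl) (Ev.eqVars rfl rfl hΔ).1 fun _ _ =>
            .case_nil (.nth_none hy hs.map (.var rfl) (Ev.eqVars rfl rfl hΔ).2)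
            (.extract (.var rfl) (.set_map hs.map (by omega) (.var rfl) (Ev.eqVars rfl rfl hΔ).2
              (.nth_some hx hs.map (.var rfl) (Ev.eqVars rfl rfl hΔ).1)) (.var rfl)
              (.remove_bits hl hs.fmBits (.var rfl) (.arg₀ rfl)) (.arg₁ rfl) hf))
          (by norm_num) ?_).mono (stepCost_le hd le_rfl)
        omega
      | some e' =>
        cases p with
        | false =>
          refine ⟨_, hE.eqSubst_false hl hI hG.1 hG.2 hx hy, ?_⟩
          rw [PMap.merge_of_some_some hx hy] at hf
          refine (fn_rule hI hF (by omega) rfl rfl rfl rfl (by omega)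
            (.case_some hx hs.map (.var rfl) (Ev.eqVars rfl rfl hΔ).1 fun _ _ =>
              .case_some hy hs.map (.var rfl) (Ev.eqVars rfl rfl hΔ).2 fun _ _ =>
              .case_var rfl (.case_nil (.nth_bits hl hs.fmBits (.var rfl) (.arg₀ rfl))
                (.guardAnd (.neq (.nth_some hx hs.map (.var rfl) (Ev.eqVars rfl rfl hΔ).1)
                  (.nth_some hy hs.map (.var rfl) (Ev.eqVars rfl rfl hΔ).2))
                  (.extract (.var rfl) (.var rfl) (.var rfl)
                    (.remove_bits hl hs.fmBits (.var rfl) (.arg₀ rfl)) (.arg₁ rfl) hf))))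
            (by norm_num) ?_).mono (stepCost_le hd le_rfl)
          omega
        | true =>
          refine ⟨_, hE.eqSubst_true hl hI hx hy, ?_⟩
          rw [PMap.merge_of_some_some hx hy] at hf
          refine (fn_rule hI hF (by omega) rfl rfl rfl rfl (by omega)
            (.case_some hx hs.map (.var rfl) (Ev.eqVars rfl rfl hΔ).1 fun _ _ =>
              .case_some hy hs.map (.var rfl) (Ev.eqVars rfl rfl hΔ).2 fun _ _ =>
              .case_var rfl (.case_true (.nth_bits hl hs.fmBits (.var rfl) (.arg₀ rfl))
                (.union (.neq (.nth_some hx hs.map (.var rfl) (Ev.eqVars rfl rfl hΔ).1)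
                  (.nth_some hy hs.map (.var rfl) (Ev.eqVars rfl rfl hΔ).2))
                  (.extract (.var rfl) (.var rfl) (.var rfl)
                    (.remove_bits hl hs.fmBits (.var rfl) (.arg₀ rfl)) (.arg₁ rfl) hf))))
            (by norm_num) ?_).mono (stepCost_le hd le_rfl)
          omega

end rules

/-! ### Specification: right rules for equations and inclusions -/

section rules

variable {N : ℕ} {g : Bool} {K Γ : Ctx} {Θ : List (Mem Γ)} {Δ : List (Fm Γ)}
  {T : Ty} {m : PMap K Γ} {τ δ : List Bool} {S : ∀ T, Var Γ T → Bool} {Z : ∀ T, Var Γ T → Prop}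

theorem stepCost_le_two {N C n n' : ℕ} (h : n' + 1 ≤ n) (hC : C ≤ 2 * (stepCost N * n')) :
    stepCost N + C ≤ 2 * (stepCost N * n) := by
  have := stepCost_le (N := N) h le_rfl
  omega

/-- The premises are used crosswise: the superset comes from `v ⊆ t` and the filter from `t ⊆ v`.
Each is visited only once, so even as a superset of an equation the singleton of the exact
definition can be afforded. -/
theorem Spec.eqSet {t v : Tm Γ (.set T)} {d₁ : Deriv Γ Θ Δ (.sub t v)}
    {d₂ : Deriv Γ Θ Δ (.sub v t)} (ih₁ : Spec.{u} N g d₁) (ih₂ : Spec.{u} N g d₂) :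
    Spec.{u} N g (.eqSet d₁ d₂) := by
  have hd : d₁.enc.size + d₂.enc.size + 1 ≤ (Deriv.eqSet d₁ d₂).enc.size := by
    simp only [Deriv.enc, Deriv.encRule, Data.node, Data.ofList, Data.size]; omega
  refine ⟨?_, ?_, trivial, ?_⟩
  · intro K m τ δ S Z hI hF hZ hG
    have hs := hF.callSizes hI
    obtain ⟨E, hE, hf⟩ := ih₂.sup hI (hF.of_lt (by omega)) ⟨hZ.2, hZ.1⟩ ⟨hG.2, hG.1⟩
    obtain ⟨F, hF', hf'⟩ := ih₁.mixed (hI.wk (R := T)) (hF.wk (by omega)) hZ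
      (hG.1.imp_ok PMap.isSome_wk) (hG.2.imp_ok PMap.isSome_wk)
    refine ⟨_, (defines_set (.eqSet d₁ d₂) hE hF').covers,
      (fn_rule hI hF (by omega) rfl rfl rfl rfl (by omega)
      (.case_nil (.var rfl) (.sing (.filter
        (.extract .nil (.var rfl) (.var rfl) (.var rfl) (.arg₁ rfl) hf)
        (.extract (.nat 2) (.wkMap hs.map (.var rfl)) (.var rfl) (.var rfl) (.arg₀ rfl) hf'))))
        (by norm_num) ?_).mono (stepCost_le_add hd)⟩
    omega
  · intro K m τ δ S Z hI hF hZ hG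
    obtain ⟨E, hE, hf⟩ := ih₁.itp hI (hF.of_lt (by omega)) hZ hG
    obtain ⟨F, hF', hf'⟩ := ih₂.itp hI (hF.of_lt (by omega)) ⟨hZ.2, hZ.1⟩ ⟨hG.2, hG.1⟩
    refine ⟨_, hE.conj_set hF', (fn_rule hI hF (by omega) rfl rfl rfl rfl (by omega)
      (.case_var rfl (.conj
        (.extract (.var rfl) (.var rfl) (.var rfl) (.var rfl) (.arg₀ rfl) hf)
        (.extract (.var rfl) (.var rfl) (.var rfl) (.var rfl) (.arg₁ rfl) hf')))
        (by norm_num) ?_).mono (stepCost_le_add hd)⟩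
    omega
  · intro _ K m τ δ S Z hI hF hZ ht hv
    have hs := hF.callSizes hI
    obtain ⟨E, hE, hf⟩ := ih₂.sup hI (hF.of_lt (by omega)) ⟨hZ.2, hZ.1⟩ ⟨hv, ht⟩
    obtain ⟨F, hF', hf'⟩ := ih₁.mixed (hI.wk (R := T)) (hF.wk (by omega)) hZ
      (ht.imp_ok PMap.isSome_wk) (hv.imp_ok PMap.isSome_wk)
    refine ⟨_, defines_set (.eqSet d₁ d₂) hE hF',
      (fn_rule hI hF (by omega) rfl rfl rfl rfl (by omega)
      (.filter
        (.extract .nil (.var rfl) (.var rfl) (.var rfl) (.arg₁ rfl) hf)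
        (.extract (.nat 2) (.wkMap hs.map (.var rfl)) (.var rfl) (.var rfl) (.arg₀ rfl) hf'))
        (by norm_num) ?_).mono ((stepCost_le_add hd).trans (by omega))⟩
    omega

theorem Spec.eqProd {T₁ T₂ : Ty} {t v : Tm Γ (.prod T₁ T₂)} {d₁ : Deriv Γ Θ Δ (.eq t.fst v.fst)}
    {d₂ : Deriv Γ Θ Δ (.eq t.snd v.snd)} (ih₁ : Spec.{u} N g d₁) (ih₂ : Spec.{u} N g d₂) :
    Spec.{u} N g (.eqProd d₁ d₂) := by
  have hd : d₁.enc.size + d₂.enc.size + 1 ≤ (Deriv.eqProd d₁ d₂).enc.size := by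
    simp only [Deriv.enc, Deriv.encRule, Data.node, Data.ofList, Data.size]; omega
  refine ⟨?_, ?_, trivial, ?_⟩
  · intro K m τ δ S Z hI hF hZ hG
    have hs := hF.callSizes hI
    obtain ⟨E, hE, hf⟩ := ih₁.sup hI (hF.of_lt (by omega)) hZ hG
    obtain ⟨F, hF', hf'⟩ := ih₂.sup (hI.wk (R := T₁)) (hF.wk (by omega)) hZ
      ⟨hG.1.imp_ok PMap.isSome_wk, hG.2.imp_ok PMap.isSome_wk⟩
    refine ⟨_, hE.prod hF',
      (fn_rule hI hF (by omega) rfl rfl rfl rfl (by omega)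
      (.case_nil (.var rfl) (.product
        (.extract (.var rfl) (.var rfl) (.var rfl) (.var rfl) (.arg₀ rfl) hf)
        (.extract (.var rfl) (.wkMap hs.map (.var rfl)) (.var rfl) (.var rfl) (.arg₁ rfl) hf')))
        (by norm_num) ?_).mono (stepCost_le_add hd)⟩
    omega
  · intro K m τ δ S Z hI hF hZ hG
    obtain ⟨E, hE, hf⟩ := ih₁.itp hI (hF.of_lt (by omega)) hZ hG
    obtain ⟨F, hF', hf'⟩ := ih₂.itp hI (hF.of_lt (by omega)) hZ hG
    refine ⟨_, hE.conj_prod hF', (fn_rule hI hF (by omega) rfl rfl rfl rfl (by omega)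
      (.case_var rfl (.conj
        (.extract (.var rfl) (.var rfl) (.var rfl) (.var rfl) (.arg₀ rfl) hf)
        (.extract (.var rfl) (.var rfl) (.var rfl) (.var rfl) (.arg₁ rfl) hf')))
        (by norm_num) ?_).mono (stepCost_le_add hd)⟩
    omega
  · intro hg K m τ δ S Z hI hF hZ ht hv
    simp only [Ty.bareUr, Bool.or_eq_true] at hg
    obtain ⟨E, hE, hf⟩ := ih₁.define (fun h => hg (.inl h)) hI (hF.of_lt (by omega)) hZ ht hv
    obtain ⟨F, hF', hf'⟩ := ih₂.define (fun h => hg (.inr h)) hI (hF.of_lt (by omega)) hZ ht hv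
    refine ⟨_, hE.prod hF', (fn_rule hI hF (by omega) rfl rfl rfl rfl (by omega)
      (.node_two 2 (.define (.var rfl) (.var rfl) (.var rfl) (.arg₀ rfl) hf)
        (.define (.var rfl) (.var rfl) (.var rfl) (.arg₁ rfl) hf'))
        (by norm_num) le_rfl).mono (stepCost_le_two hd ?_)⟩
    rw [Nat.mul_add]
    omega

theorem dispatch_cost_le {W k n : ℕ} (hk : k ≤ 17) (hn : n ≤ 900) :
    (2 * k + 20) * (W + 1) + (n * (W + 1) + 0) ≤ 1000 * (W + 1) := by
  have h := Nat.mul_le_mul_right (W + 1) (show 2 * k + 20 + n ≤ 1000 by omega)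
  rw [Nat.add_mul] at h
  omega

/-- The run of a handler that does not depend on its argument. -/
theorem fn_leaf {G : Goal Γ} {d : Deriv Γ Θ Δ G} (hI : TSeq.Inv ⟨m, τ, δ, Θ, Δ⟩ S Z)
    (hF : Fits N m d.enc.size) {mo : ℕ} (hmo : mo ≤ 2) {concl args b : Data} {f k h n : ℕ}
    {hs : List ℕ} {body : Code} (hd : d.enc = .cons concl (.cons (.ofNat k) args))
    (hb : prog[f]? = some (Code.dispatchBody hs)) (hk : hs[k]? = some h)
    (hh : prog[h]? = some body) (hk' : k ≤ 17)
    (hE : ∀ vs, Ev (costBound (sizeBound N)) vs body b n 0) (hn : n ≤ 900) :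
    Fn prog f (callArg (.ofNat mo) m.enc (encBits τ) (encBits δ) d.enc) b
      (stepCost N * d.enc.size) := by
  have hpos : 0 + 1 ≤ d.enc.size := Data.size_pos _
  have ha := size_callArg_le hF hI.mem.length_eq hI.fm.length_eq hmo
  have hle := stepCost_le (N := N) (C := 0) hpos (Nat.zero_le _)
  rw [Nat.add_zero] at hle
  refine Fn.mono ?_ hle
  rw [hd] at ha ⊢
  refine (fn_dispatch hb hk ha (.of_ev hh ha (hE _))).mono ?_
  exact dispatch_cost_le hk' hn

theorem Spec.eqUnit {t v : Tm Γ .unit} : Spec.{u} N g (Deriv.eqUnit (Θ := Θ) (Δ := Δ)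
    (t := t) (v := v)) := by
  refine ⟨?_, ?_, trivial, ?_⟩
  · intro K m τ δ S Z hI hF _ _
    exact ⟨_, covers_unit, fn_leaf hI hF (by omega) rfl rfl rfl rfl (by omega) (fun _ => .tt)
      (by norm_num)⟩
  · intro K m τ δ S Z hI hF _ _
    exact ⟨_, interp_unit, fn_leaf hI hF (by omega) rfl rfl rfl rfl (by omega) (fun _ => .tt)
      (by norm_num)⟩
  · intro _ K m τ δ S Z hI hF _ _ _
    exact ⟨_, defines_unit, (fn_leaf hI hF (by omega) rfl rfl rfl rfl (by omega)
      (fun _ => .node_nil 1) (by norm_num)).mono (by omega)⟩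

theorem memOk_fresh_set {t : Tm Γ .ur} {p b : Bool} {o : Option (Path K (.set .ur))}
    (ht : t.All (Ok m S p)) (hZ : t.All (fun T x => ¬ Z T x))
    (ho : o.isSome ∨ b = p) :
    MemOk (m.cons o) (vcons b S) (vcons True Z) p ⟨.ur, t.wk (.set .ur), .var .zero⟩ :=
  ⟨Tm.ok_wk ht _ _ _, (Tm.all_ren _ _ _).2 hZ, ho, .inr trivial⟩

theorem memOk_fresh_elt {t : Tm Γ (.set T)} {p b : Bool} {o : Option (Path K T)}
    (ht : t.All (Ok m S p)) (ho : o.isSome ∨ b = p) :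
    MemOk (m.cons o) (vcons b S) (vcons False Z) p ⟨T, .var .zero, t.wk T⟩ :=
  ⟨ho, id, Tm.ok_wk ht _ _ _, .inl trivial⟩

/-- The fresh set variable is marked: its membership may have an arbitrary term as element, and the
variable itself occurs in no formula and in no element. It joins the side of `t`, or becomes common
when the terms are separated. -/
theorem Spec.eqUr {t v : Tm Γ .ur} {d : Deriv (.set .ur :: Γ)
      (⟨.ur, t.wk _, .var .zero⟩ :: Θ.map (Mem.wk _)) (Δ.map (Fm.wk _))
      (.mem (v.wk _) (.var .zero))} (ih : Spec.{u} N g d) : Spec.{u} N g (.eqUr d) := by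
  have hd : d.enc.size + 1 ≤ (Deriv.eqUr d).enc.size := by
    simp only [Deriv.enc, Deriv.encRule, Data.node, Data.ofList, Data.size]; omega
  refine ⟨?_, ?_, ?_, ?_⟩
  · intro K m τ δ S Z hI hF hZ hG
    obtain ⟨E, hE, hf⟩ := ih.sup
      (hI.fresh none false True (fun _ => rfl) (memOk_fresh_set hG.1 hZ.1 (.inr rfl)))
      (hF.cons_none hd) ((Tm.all_ren _ _ _).2 hZ.2) ⟨Tm.ok_wk hG.2 _ _ _, .inr rfl⟩
    refine ⟨E, hE.ur, (fn_rule hI hF (by omega) rfl rfl rfl rfl (by omega)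
      (.case_nil (.var rfl) (.extract .nil (.cons .nil (.var rfl)) (.cons .nil (.var rfl))
        (.var rfl) (.arg₀ rfl) hf)) (by norm_num) ?_).mono (stepCost_le hd le_rfl)⟩
    omega
  · intro K m τ δ S Z hI hF hZ hG
    obtain ⟨E, hE, hf⟩ := ih.itp
      (hI.fresh none true True (fun _ => rfl) (memOk_fresh_set hG.1 hZ.1 (.inr rfl)))
      (hF.cons_none hd) ((Tm.all_ren _ _ _).2 hZ.2) ⟨Tm.ok_wk hG.2 _ _ _, .inr rfl⟩
    refine ⟨E, hE.ur, (fn_rule hI hF (by omega) rfl rfl rfl rfl (by omega)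
      (.case_var rfl (.case_nil (.var rfl)
        (.extract (.nat 1) (.cons .nil (.var rfl)) (.cons (.nat 1) (.var rfl))
          (.var rfl) (.arg₀ rfl) hf))) (by norm_num) ?_).mono (stepCost_le hd le_rfl)⟩
    omega
  · intro K m τ δ S Z hI hF hZ ht hv
    obtain ⟨E, hE, hf⟩ := ih.itp
      (hI.fresh (some (.var .zero)) false True (fun _ => rfl)
        (memOk_fresh_set ht hZ.1 (.inr rfl)))
      (hF.cons_zero hd) ((Tm.all_ren _ _ _).2 hZ.2) ⟨Tm.ok_wk hv _ _ _, .inl rfl⟩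
    refine ⟨E, .of_interp hE, (fn_rule hI hF (by omega) rfl rfl rfl rfl (by omega)
      (.case_var rfl (.case_var rfl
        (.extract (.nat 1)
          (.cons (.pos_zero (g := g) (K := K) (T := .set .ur)) (.var rfl)) (.cons .nil (.var rfl))
          (.var rfl) (.arg₀ rfl) hf))) (by norm_num) ?_).mono (stepCost_le hd le_rfl)⟩
    omega
  · intro hg K m τ δ S Z hI hF hZ ht hv
    have hs := hF.callSizes hI
    have hs' := (hF.wk (T := .ur) (n' := d.enc.size) hd).size_map_le
      (by have := d.le_size_enc; simp only [List.length_cons] at this; omega)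
    obtain ⟨E, hE, hf⟩ := ih.sup
      (hI.fresh none false True (fun _ => rfl) (memOk_fresh_set ht hZ.1 (.inr rfl)))
      (hF.cons_none hd) ((Tm.all_ren _ _ _).2 hZ.2) ⟨Tm.ok_wk hv _ _ _, .inr rfl⟩
    -- Second use of the same premise, hence the factor 2 in the cost of definitions. Both uses are
    -- extractions, so the factor does not multiply along the derivation.
    obtain ⟨F, hF', hf'⟩ := ih.itp
      ((hI.wk (R := .ur)).wk (R := .set .ur) |>.fresh (some (.var .zero)) false True
        (fun _ => rfl) (memOk_fresh_set ((ht.imp_ok PMap.isSome_wk).imp_ok PMap.isSome_wk) hZ.1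
          (.inr rfl)))
      (hF.wk_wk_cons hd) ((Tm.all_ren _ _ _).2 hZ.2)
      ⟨Tm.ok_wk ((hv.imp_ok PMap.isSome_wk).imp_ok PMap.isSome_wk) _ _ _, .inl rfl⟩
    refine ⟨_, defines_ur (hg rfl) (.eqUr d) hE.ur (.of_interp hF'),
      (fn_rule hI hF (by omega) rfl rfl rfl rfl (by omega)
      (.node_two 10 (.node_nil 0) (.filter
        (.extract .nil (.cons .nil (.var rfl)) (.cons .nil (.var rfl)) (.var rfl) (.arg₀ rfl) hf)
        (.letIn (.sing .pos_zero) (.extract (.nat 1)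
          (.cons (.pos_zero (g := g) (K := .ur :: K) (T := .set .ur))
            (.wkMap (by omega) (.wkMap hs.map (.var rfl))))
          (.cons .nil (.var rfl)) (.var rfl) (.arg₀ rfl) hf'))))
        (by norm_num) le_rfl).mono (stepCost_le_two hd ?_)⟩
    omega

theorem Spec.subR {t v : Tm Γ (.set T)} {d : Deriv (T :: Γ)
      (⟨T, .var .zero, t.wk T⟩ :: Θ.map (Mem.wk T)) (Δ.map (Fm.wk T))
      (.mem (.var .zero) (v.wk T))} (ih : Spec.{u} N g d) : Spec.{u} N g (.subR d) := by
  have hd : d.enc.size + 1 ≤ (Deriv.subR d).enc.size := by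
    simp only [Deriv.enc, Deriv.encRule, Data.node, Data.ofList, Data.size]; omega
  refine ⟨?_, ?_, ?_, trivial⟩
  · intro K m τ δ S Z hI hF hZ hG
    obtain ⟨E, hE, hf⟩ := ih.sup
      (hI.fresh none true False False.elim (memOk_fresh_elt hG.1 (.inr rfl)))
      (hF.cons_none hd) id ⟨.inr rfl, Tm.ok_wk hG.2 _ _ _⟩
    refine ⟨E, hE.sub, (fn_rule hI hF (by omega) rfl rfl rfl rfl (by omega)
      (.case_nil (.var rfl) (.extract .nil (.cons .nil (.var rfl)) (.cons (.nat 1) (.var rfl))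
        (.var rfl) (.arg₀ rfl) hf)) (by norm_num) ?_).mono (stepCost_le hd le_rfl)⟩
    omega
  · intro K m τ δ S Z hI hF hZ hG
    obtain ⟨E, hE, hf⟩ := ih.itp
      (hI.fresh none true False False.elim (memOk_fresh_elt hG.1 (.inr rfl)))
      (hF.cons_none hd) id ⟨.inr rfl, Tm.ok_wk hG.2 _ _ _⟩
    refine ⟨E, hE.sub, (fn_rule hI hF (by omega) rfl rfl rfl rfl (by omega)
      (.case_var rfl (.case_nil (.var rfl)
        (.extract (.nat 1) (.cons .nil (.var rfl)) (.cons (.nat 1) (.var rfl))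
          (.var rfl) (.arg₀ rfl) hf))) (by norm_num) ?_).mono (stepCost_le hd le_rfl)⟩
    omega
  · intro K m τ δ S Z hI hF hZ ht hv
    obtain ⟨E, hE, hf⟩ := ih.itp
      (hI.fresh (some (.var .zero)) false False False.elim (memOk_fresh_elt ht (.inr rfl)))
      (hF.cons_zero hd) id ⟨.inl rfl, Tm.ok_wk hv _ _ _⟩
    refine ⟨E, .of_interp hE, (fn_rule hI hF (by omega) rfl rfl rfl rfl (by omega)
      (.case_var rfl (.case_var rfl
        (.extract (.nat 1)
          (.cons (.pos_zero (g := g) (K := K) (T := T)) (.var rfl)) (.cons .nil (.var rfl))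
          (.var rfl) (.arg₀ rfl) hf))) (by norm_num) ?_).mono (stepCost_le hd le_rfl)⟩
    omega

end rules

/-- The contexts `K`, the partial maps and the sides are quantified inside `Spec`, since they change
from conclusion to premise. -/
theorem Deriv.spec (N : ℕ) (g : Bool) {Γ : Ctx} {Θ : List (Mem Γ)} {Δ : List (Fm Γ)}
    {G : Goal Γ} (d : Deriv Γ Θ Δ G) : Spec.{u} N g d := by
  induction d with
  | contr _ _ _ _ ih => exact ih.contr
  | memUr => exact .memUr
  | eqSet _ _ ih₁ ih₂ => exact ih₁.eqSet ih₂
  | eqProd _ _ ih₁ ih₂ => exact ih₁.eqProd ih₂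
  | eqUnit => exact .eqUnit
  | eqUr _ ih => exact ih.eqUr
  | subR _ ih => exact ih.subR
  | memR _ _ _ ih => exact ih.memR
  | botL => exact .botL
  | andL _ _ _ _ _ ih => exact ih.andL
  | orL _ _ _ _ _ _ ih₁ ih₂ => exact ih₁.orL ih₂
  | allL _ _ _ _ _ _ _ _ ih => exact ih.allL
  | exL _ _ _ _ _ ih => exact ih.exL
  | eqSubst _ _ _ _ _ ih => exact ih.eqSubst
  | neL => exact .neL
  | betaFst _ _ _ _ _ _ _ ih => exact ih.betaFst
  | betaSnd _ _ _ _ _ _ _ ih => exact ih.betaSnd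
  | eta _ _ ih => exact ih.eta

/-! ### Change of the set of Ur-elements -/

section map

variable {U V : Type u} (f : U → V)

/-- The action of a map of Ur-elements on objects. -/
def Ty.map : (T : Ty) → T.den U → T.den V
  | .ur => f
  | .unit => id
  | .prod S T => fun a => (S.map a.1, T.map a.2)
  | .set T => fun s => T.map '' Ty.asSet s

def Env.map {Γ : Ctx} (ρ : Env U Γ) : Env V Γ := fun T x => T.map f (ρ T x)

theorem Env.map_cons {Γ : Ctx} (ρ : Env U Γ) {S : Ty} (a : S.den U) :
    (ρ.cons a).map f = (ρ.map f).cons (S.map f a) := by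
  funext T x
  cases x <;> rfl

theorem Tm.eval_map {Γ : Ctx} (ρ : Env U Γ) {T : Ty} (t : Tm Γ T) :
    t.eval (ρ.map f) = T.map f (t.eval ρ) := by
  induction t with
  | var x => rfl
  | unit => rfl
  | pair t s h₁ h₂ => simp [Tm.eval, Ty.map, h₁, h₂]
  | fst t ih => simp [Tm.eval, Ty.map, ih]
  | snd t ih => simp [Tm.eval, Ty.map, ih]

variable {f}

theorem Ty.map_injective (hf : Function.Injective f) (T : Ty) : Function.Injective (T.map f) := by
  induction T with
  | ur => exact hf
  | unit => exact Function.injective_id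
  | prod S T h₁ h₂ => exact h₁.prodMap h₂
  | set T ih => exact ih.image_injective

theorem Fm.holds_map (hf : Function.Injective f) {Γ : Ctx} (ρ : Env U Γ) (φ : Fm Γ) :
    φ.holds (ρ.map f) ↔ φ.holds ρ := by
  induction φ with
  | eq t s => simp only [Fm.holds, Tm.eval_map, (Ty.map_injective hf _).eq_iff]
  | ne t s => simp only [Fm.holds, Tm.eval_map, ne_eq, (Ty.map_injective hf _).eq_iff]
  | top => rfl
  | bot => rfl
  | or φ ψ h₁ h₂ => simp only [Fm.holds, h₁, h₂]
  | and φ ψ h₁ h₂ => simp only [Fm.holds, h₁, h₂]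
  | all t φ ih =>
    simp only [Fm.holds, Tm.eval_map, ← ih, Env.map_cons]
    exact Set.forall_mem_image
  | ex t φ ih =>
    simp only [Fm.holds, Tm.eval_map, ← ih, Env.map_cons]
    exact Set.exists_mem_image

/-- Expressions without `Get` commute with injective maps of Ur-elements. -/
theorem Nrc.eval_map (hf : Function.Injective f) {g : Bool} (hg : g = false) (c₀ : g = true → U)
    (c₁ : g = true → V) {Γ : Ctx} (ρ : Env U Γ) {T : Ty} (E : Nrc g Γ T) :
    E.eval c₁ (ρ.map f) = T.map f (E.eval c₀ ρ) := by
  induction E with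
  | var x => rfl
  | unit => rfl
  | pair e₁ e₂ h₁ h₂ => simp only [Nrc.eval, Ty.map, h₁, h₂]
  | fst e ih => simp only [Nrc.eval, Ty.map, ih]
  | snd e ih => simp only [Nrc.eval, Ty.map, ih]
  | sing e ih =>
    simp only [Nrc.eval, ih]
    exact Set.image_singleton.symm
  | bigUnion e₁ e₂ h₁ h₂ =>
    simp only [Nrc.eval, h₁]
    refine Set.ext fun b => ⟨?_, ?_⟩
    · rintro ⟨_, ⟨a, ha, rfl⟩, hb⟩
      rw [← Env.map_cons, h₂] at hb
      obtain ⟨b, hb, rfl⟩ := hb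
      exact ⟨b, ⟨a, ha, hb⟩, rfl⟩
    · rintro ⟨b, ⟨a, ha, hb⟩, rfl⟩
      refine ⟨_, ⟨a, ha, rfl⟩, ?_⟩
      rw [← Env.map_cons, h₂]
      exact ⟨b, hb, rfl⟩
  | emp T => exact (Set.image_empty _).symm
  | union e₁ e₂ h₁ h₂ =>
    simp only [Nrc.eval, h₁, h₂]
    exact (Set.image_union _ _ _).symm
  | diff e₁ e₂ h₁ h₂ =>
    simp only [Nrc.eval, h₁, h₂]
    -- Among the operations other than `Get`, difference is the one that needs injectivity.
    exact (Set.image_sdiff (Ty.map_injective hf _) _ _).symm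
  | get h e ih => exact absurd (h.symm.trans hg) (by simp)

end map

/-! ### The initial call -/

/-- The empty partial map. -/
def PMap.nones (K : Ctx) : (Γ : Ctx) → PMap K Γ
  | [] => .nil
  | _ :: Γ => .cons none (PMap.nones K Γ)

theorem PMap.get_nones {K Γ : Ctx} {T : Ty} (x : Var Γ T) : (PMap.nones K Γ).get x = none := by
  induction x with
  | zero => rfl
  | succ x ih => exact ih

theorem PMap.encList_nones (K Γ : Ctx) :
    (PMap.nones K Γ).encList = (Γ.map Ty.enc).map fun _ => .nil := by
  induction Γ with
  | nil => rfl
  | cons T Γ ih => simp [PMap.nones, PMap.encList, ih, encOpt]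

/-- Case distinction on the two parts of a context. -/
def Var.appendCases {C : Ty → Sort*} {Δ : Ctx} : {Γ : Ctx} → (∀ T, Var Γ T → C T) →
    (∀ T, Var Δ T → C T) → ∀ T, Var (Γ ++ Δ) T → C T
  | [], _, b, T, x => b T x
  | _ :: _, a, _, _, .zero => a _ .zero
  | _ :: _, a, b, T, .succ x => Var.appendCases (fun T x => a T (.succ x)) b T x

@[simp] theorem Var.appendCases_inl {C : Ty → Sort*} {Γ Δ : Ctx} (a : ∀ T, Var Γ T → C T)
    (b : ∀ T, Var Δ T → C T) {T : Ty} (x : Var Γ T) : Var.appendCases a b T x.inl = a T x := by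
  induction x with
  | zero => rfl
  | succ x ih => exact ih _

@[simp] theorem Var.appendCases_inr {C : Ty → Sort*} {Γ Δ : Ctx} (a : ∀ T, Var Γ T → C T)
    (b : ∀ T, Var Δ T → C T) {T : Ty} (x : Var Δ T) :
    Var.appendCases a b T (Var.inr Γ x) = b T x := by
  induction Γ with
  | nil => rfl
  | cons S Γ ih => exact ih _

/-- The variable `o_in` is common to both sides, the others are not. -/
def rootMap (A : Ty) (Δ : Ctx) : PMap [A] (A :: (Δ ++ Δ)) :=
  .cons (some (.var .zero)) (PMap.nones _ _)

def rootSide (A : Ty) (Δ : Ctx) : ∀ T, Var (A :: (Δ ++ Δ)) T → Bool :=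
  vcons false (Var.appendCases (fun _ _ => false) (fun _ _ => true))

theorem ok_left {A : Ty} {Δ : Ctx} (T : Ty) (x : Var (A :: Δ) T) :
    Ok (rootMap A Δ) (rootSide A Δ) false T (Ren.left A Δ T x) := by
  cases x with
  | zero => exact .inl rfl
  | succ x => exact .inr (Var.appendCases_inl (C := fun _ => Bool) _ _ x)

theorem ok_right {A : Ty} {Δ : Ctx} (T : Ty) (x : Var (A :: Δ) T) :
    Ok (rootMap A Δ) (rootSide A Δ) true T (Ren.right A Δ T x) := by
  cases x with
  | zero => exact .inl rfl
  | succ x => exact .inr (Var.appendCases_inr (C := fun _ => Bool) _ _ x)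

/-- The binding in which both copies of the variables have the same values. -/
def Env.double {U : Type u} {A : Ty} {Δ : Ctx} (ρ : Env U (A :: Δ)) : Env U (A :: (Δ ++ Δ)) :=
  Env.cons (ρ A .zero) (Var.appendCases (fun T x => ρ T (.succ x)) (fun T x => ρ T (.succ x)))

theorem Env.double_left {U : Type u} {A : Ty} {Δ : Ctx} (ρ : Env U (A :: Δ)) :
    (fun T x => ρ.double T (Ren.left A Δ T x)) = ρ := by
  funext T x
  cases x with
  | zero => rfl
  | succ x => exact Var.appendCases_inl (C := fun T => T.den U) _ _ x

theorem Env.double_right {U : Type u} {A : Ty} {Δ : Ctx} (ρ : Env U (A :: Δ)) :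
    (fun T x => ρ.double T (Ren.right A Δ T x)) = ρ := by
  funext T x
  cases x with
  | zero => rfl
  | succ x => exact Var.appendCases_inr (C := fun T => T.den U) _ _ x

theorem rootMap_bdd (A : Ty) (Δ : Ctx) {b : ℕ} (hb : 5 ≤ b) : (rootMap A Δ).Bdd b := by
  refine PMap.Bdd.cons_some ?_ hb
  intro T x e he
  rw [PMap.get_nones] at he
  cases he

/-- The run of the program on a derivation whose context is `A :: Γ`. -/
theorem fn_main {N : ℕ} {A : Ty} {Γ : Ctx} {a₀ a₁ a₂ a₃ b : Data} {Θ Δ G R : Data} {C : ℕ}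
    {input d : Data} (hd : d = .cons (.ofList [Ctx.enc (A :: Γ), Θ, Δ, G]) R)
    (hin : input = .ofList [a₀, a₁, a₂, a₃, d]) (hN : input.size ≤ N)
    (hf : Fn prog 2 (callArg (.ofNat 0)
      (PMap.cons (some (.var .zero)) (PMap.nones [A] Γ)).enc (encBits []) (encBits [false, true]) d)
      b C) : Fn prog 0 input b (stepCost N + C) := by
  have hY := size_le_sizeBound N
  unfold stepCost
  generalize hW : costBound (sizeBound N) = W
  have hW' : N ≤ W := by
    rw [← hW]
    exact le_costBound (i := 1) (by omega) (by omega)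
  subst hd hin
  have hs : (Data.ofList (Γ.map Ty.enc)).size + 10 ≤ N := by
    simp only [Data.ofList, Data.size, Ctx.enc, List.map_cons] at hN
    omega
  have hlen := Data.length_lt_size_ofList (Γ.map Ty.enc)
  have hn : Ev W [Data.ofList [a₀, a₁, a₂, a₃, .cons (.ofList [Ctx.enc (A :: Γ), Θ, Δ, G]) R]]
      (Code.hd (Code.tl (Code.tl (Code.tl (Code.tl (.var 0))))))
      (.cons (.ofList [Ctx.enc (A :: Γ), Θ, Δ, G]) R) 11 0 := by
    refine Ev.hd (b := .nil) (Ev.tl (a := a₃) (Ev.tl (a := a₂) (Ev.tl (a := a₁) (Ev.tl (a := a₀)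
      (.var rfl) ?_) ?_) ?_) ?_) ?_
    all_goals
      simp only [Data.ofList, Data.size] at hN ⊢
      omega
  have hm := (Ev.hd (b := .ofList [Θ, Δ, G]) (Ev.hd (b := R) hn (by
    simp only [Data.ofList, Data.size] at hN ⊢
    omega)) (by
    simp only [Data.ofList, Data.size] at hN ⊢
    omega)).tl (a := A.enc) (b := .ofList (Γ.map Ty.enc)) (by
    simp only [Data.ofList, Data.size, Ctx.enc, List.map_cons] at hN ⊢
    omega)
  have hnones := hm.call_aux (fn_nones _ (X := sizeBound N) (by omega)) (by
    rw [← hW]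
    exact le_costBound (i := (Γ.map Ty.enc).length + 1) (by omega) (by gcongr; norm_num))
  rw [← PMap.encList_nones [A]] at hnones
  refine (Fn.of_ev rfl (hN.trans hW') (.define
    (.cons (.pos_zero (g := false) (K := []) (T := A)) hnones) .nil
    (.cons (.nat 0) (.cons (.nat 1) .nil)) hn hf)).mono ?_
  have := Nat.mul_le_mul_right (W + 1) (show 100 ≤ 1000 by norm_num)
  omega

/-- A bound for the running time, as a polynomial. -/
noncomputable def timeBound : Polynomial ℕ :=
  let Y : Polynomial ℕ := .X * (18 * .X + 7) + 2 * (18 * .X + 5) + 10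
  let c := 1000 * (10000 * Y * Y + 1)
  c + 2 * (c * .X) + .X + 2

theorem eval_timeBound (N : ℕ) :
    timeBound.eval N = stepCost N + 2 * (stepCost N * N) + N + 2 := by
  simp [timeBound, stepCost, costBound, sizeBound]

/-- Extraction of a definition from a proof, over nonempty sets of Ur-elements. -/
theorem exists_definition {A B : Ty} {As : Ctx} {Sig : Fm (A :: B :: As)}
    (d : ImplicitDefProof Sig) : ∃ E : Nrc B.bareUr [A] B,
      prog.ReturnsWithin d.enc E.enc (timeBound.eval d.enc.size) ∧
      ∀ (U : Type u) [Nonempty U] (c₀ : B.bareUr = true → U) (ρ : Env U (A :: B :: As)),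
        Sig.holds ρ → E.eval c₀ (Env.cons (ρ A .zero) (Env.empty U)) = ρ B (.succ .zero) := by
  have hsize : (Deriv.enc d).size ≤ d.enc.size := by
    simp only [ImplicitDefProof.enc, Data.ofList, Data.size]
    omega
  generalize hN : d.enc.size = N at hsize ⊢
  have hI : TSeq.Inv ⟨rootMap A (B :: As), [], [false, true], [],
      [Sig.ren (Ren.left A (B :: As)), Sig.ren (Ren.right A (B :: As))]⟩
      (rootSide A (B :: As)) (fun _ _ => False) :=
    ⟨.nil, .cons ⟨(Fm.all_ren _ _ _).2 (.trivial ok_left _), .trivial (fun _ _ => id) _⟩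
      (.cons ⟨(Fm.all_ren _ _ _).2 (.trivial ok_right _), .trivial (fun _ _ => id) _⟩ .nil),
      fun _ _ => False.elim⟩
  -- `Get` is available exactly if `B` has a bare Ur-element, so the side condition is the identity.
  -- The initial bound `2 * N + 5` for the paths plus 16 times the size of the derivation stays
  -- within `18 * N + 5`.
  obtain ⟨E, hE, hf⟩ := (Deriv.spec.{u} N B.bareUr d).define id hI
    ⟨2 * N + 5, le_rfl, rootMap_bdd _ _ (by omega), by omega⟩ ⟨id, id⟩ (ok_left _ _) (ok_right _ _)
  refine ⟨E, ?_, ?_⟩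
  · obtain ⟨k, hk, hr⟩ := fn_main rfl rfl hN.le hf
    obtain ⟨body, hb, hr⟩ := run_of_fn hr
    refine ⟨_, ?_, .call hb (.var rfl) hr⟩
    rw [eval_timeBound, hN]
    have := Nat.mul_le_mul_left (stepCost N) hsize
    omega
  · intro U _ c₀ ρ hρ
    -- Both copies of the variables take the same values; then both copies of `Sig` hold, and the
    -- defined `o_out'` has the value of `o_out`.
    have := hE U c₀ (Env.cons (ρ A .zero) (Env.empty U)) ρ.double
      ⟨?_, .nil, .cons ?_ (.cons ?_ .nil)⟩
    · rw [this]
      exact congrFun (congrFun ρ.double_right B) (.succ .zero)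
    · intro T x e he
      cases x with
      | zero => cases he; rfl
      | succ x => cases (PMap.get_nones x).symm.trans he
    · rw [Fm.holds_ren, Env.double_left]
      exact fun _ => hρ
    · rw [Fm.holds_ren, Env.double_right]
      exact fun _ => hρ

end NestedRel

theorem theorem4p1 :
    ∃ (P : Program) (p : Polynomial ℕ),
      ∀ (A B : Ty) (As : Ctx) (Sig : Fm (A :: B :: As)) (d : ImplicitDefProof Sig),
        ∃ E : Nrc B.bareUr [A] B,
          P.ReturnsWithin d.enc E.enc (p.eval d.enc.size) ∧
          ∀ (U : Type*) (c₀ : B.bareUr = true → U) (ρ : Env U (A :: B :: As)),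
            Sig.holds ρ →
              E.eval c₀ (Env.cons (ρ A .zero) (Env.empty U)) = ρ B (.succ .zero) := by
  refine ⟨prog, timeBound, fun A B As Sig d => ?_⟩
  obtain ⟨E, hE, h⟩ := exists_definition d
  refine ⟨E, hE, fun U c₀ ρ hρ => ?_⟩
  cases isEmpty_or_nonempty U with
  | inr _ => exact h U c₀ ρ hρ
  | inl hU =>
    -- If `Get` were available, `c₀` would provide an Ur-element.
    have hg : B.bareUr = false := by
      by_contra hB
      exact hU.false (c₀ (by simpa using hB))
    -- Without `Get`, the values of expressions and the truth of formulas are compatible with the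
    -- embedding of the empty set of Ur-elements into the nonempty `Option U`, where the definition
    -- is already known to be correct.
    have hf := Option.some_injective U
    refine Ty.map_injective hf B ?_
    rw [← Nrc.eval_map hf hg c₀ (fun hB => some (c₀ hB)), Env.map_cons]
    have he : (Env.empty U).map some = Env.empty (Option U) := by
      funext T x
      cases x
    rw [he]
    exact h (Option U) _ (ρ.map some) ((Fm.holds_map hf ρ Sig).2 hρ)
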